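/- **Data.** Let $R$ be a commutative integral domain and let $(a_{ij})_{i,j\in I}$ be a symmetrizable generalized Cartan matrix with symmetrizer $(d_i)_{i\in I}$, $d_i\in\mathbb Z_{>0}$, $d_ia_{ij}=d_ja_{ji}$. Let $\Gamma$ be an oriented quiver with vertex set $I$ in which $i\ne j$ are joined by an edge if and only if $a_{ij}\neq0$. We require that there is then exactly one edge (a multiple edge counts as one edge, and its orientation is arbitrary) and $a_{ij}a_{ji}<4$, or that $a_{ij}=a_{ji}=-2$ and there are two edges $i\to j$ and $j\to i$ (affine type $A_1$). Fix a ghost shift $\sigma_\epsilon\in\mathbb R\setminus\{0\}$ for every edge $\epsilon$. For $\epsilon:i\rightsquigarrow j$, call $i$ the *owner* and $j$ the *partner* of $\epsilon$ if $\sigma_\epsilon>0$, and $j$ the owner and $i$ the partner if $\sigma_\epsilon<0$. Fix a charge $\kappa_1<\dots<\kappa_\ell$ in $\mathbb R$, residues $\rho_1,\dots,\rho_\ell\in I$, and $\beta=\sum_i\beta_i\alpha_i$ with $\beta_i\in\mathbb Z_{\ge0}$ and $\sum_i\beta_i=n$, such that each $i$ with $\beta_i\neq0$ owns only finitely many edges.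 Let $I^\beta\subset I^n$ be the set of residue sequences in which every $i$ occurs $\beta_i$ times. Fix polynomials $Q_{ij}(u,v)\in R[u,v]$ with $Q_{ij}(u,v)=Q_{ji}(v,u)$ and $Q_{ii}=0$ such that for $i\ne j$ the polynomial $Q_{ij}$ is nonzero and homogeneous of degree $-2d_ia_{ij}$, where $\deg u=2d_i$ and $\deg v=2d_j$. **Diagrams.** A diagram with residues $\mathbf i\in I^\beta$ consists of $n$ solid strings in $\mathbb R\times[0,1]$, each a graph over $[0,1]$ (the height), the $k$-th of residue $i_k$; of a ghost of the $k$-th solid string, shifted to the right by $|\sigma_\epsilon|$, for every edge $\epsilon$ with owner $i_k$; and of $\ell$ vertical red strings at $\kappa_1,\dots,\kappa_\ell$ with residues $\rho_1,\dots,\rho_\ell$. Strings meet only in transversal crossings of two strings, away from the end points. Solid strings may carry dots, away from crossings; their ghosts carry ghost dots at the same heights. Diagrams are taken up to isotopy. A *loading* is a point $\mathbf x\in\mathbb R^n$ such that for all $\mathbf i\in I^\beta$ the end points (of solid, ghost and red strings) given by solid strings of residues $i_k$ at $x_k$ are pairwise distinct. Let $X$ be a finite non-empty set of loadings. **The algebra.**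 $W_\beta(X)$ is the $R$-algebra spanned by the diagrams whose bottom and top positions are in $X$ and whose residues are in $I^\beta$, where $ED$ is the diagram $E$ on top of $D$ if positions and residues match, and $0$ otherwise, modulo the following relations. They are applied inside arbitrary diagrams, and simultaneously in neighbourhoods of the solid strings and of their ghosts; $y_r$ denotes a dot on the solid string $r$. * Dots pass through all crossings, except that, for a crossing $\psi$ of two solid strings of the same residue, with $y_L,y_R$ the dots on the left and right string, $y_L\psi-\psi y_R=1=\psi y_L-y_R\psi$. * Two strings that cross twice in succession can be pulled apart, with the following exceptions. A double crossing of two solid strings of the same residue is $0$. If the ghost of a solid $i$-string $r$ for an edge $\epsilon$ crosses a solid $j$-string $s$ twice, where $j$ is the partner of $\epsilon$, the result is $Q_{ij}(y_r,y_s)$ times the diagram with the strings pulled apart. If a red $i$-string crosses a solid $i$-string $s$ twice, it is $y_s$ times the diagram with the strings pulled apart. * A string $M$ can be pulled across the crossing of two strings $A,B$, except in the following cases. Let $r,s$ be solid strings of the same residue $i$ that cross, $r$ on the left at the bottom, and let $M$ be between $A$ and $B$ at the bottom and at the top. Then (diagram with $M$ to the left of the crossing) $-$ (diagram with $M$ to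 the right of the crossing) is equal to $$\frac{Q_{ij}(y_r,y_u)-Q_{ij}(y_s,y_u)}{y_r-y_s}$$ times the diagram without crossings, if $A,B$ are the ghosts of $r,s$ for an edge $\epsilon$ and $M$ is a solid string $u$ whose residue $j$ is the partner of $\epsilon$, and also if $A,B$ are $r,s$ and $M$ is the ghost of a solid $j$-string $u$ for an edge with partner $i$. It is equal to the diagram without crossings if $A,B$ are $r,s$ and $M$ is a red $i$-string. The degree of a diagram is the sum of $2d_i$ for every dot on a solid $i$-string, $-2d_i$ for every crossing of two solid $i$-strings, $-d_ia_{ij}$ for every crossing of the ghost of a solid $i$-string for an edge $\epsilon$ with a solid $j$-string, $j$ the partner of $\epsilon$, and $d_i$ for every crossing of a solid and a red $i$-string. Let $W_\beta(X)_\delta$ be the span of the diagrams of degree $\delta\in\mathbb Z$. Let $R[\beta]^{S_\beta}=\bigotimes_{i:\beta_i\ne0}R[y_1,\dots,y_{\beta_i}]^{S_{\beta_i}}$, where the variables of the factor for $i$ have degree $2d_i$. For $f\in R[\beta]^{S_\beta}$ let $f\cdot1\in W_\beta(X)$ be the sum, over all $\mathbf x\in X$ and $\mathbf i\in I^\beta$,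 of the diagrams with vertical strings at $\mathbf x$ of residues $\mathbf i$, with dots according to $f$, where the variables of the factor for $i$ are the dots on the solid $i$-strings. **Proposition.** $W_\beta(X)=\bigoplus_\delta W_\beta(X)_\delta$ is a graded algebra, and $f\mapsto f\cdot1$ is an isomorphism of graded $R$-algebras from $R[\beta]^{S_\beta}$ onto the center $Z(W_\beta(X))$. Moreover, $W_\beta(X)$ is a free module of finite rank over its center. -/

import Mathlib

noncomputable section

namespace WKLRW

/-- A symmetrizable quiver: a symmetrizable generalized Cartan matrix `a` with symmetrizer `d`,
and an orientation `Arrow` of its edges.  All edges between two vertices that are joined by a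
multiple edge count as one edge.  We require `a i j * a j i < 4`, in which case there is exactly
one edge between `i` and `j` if `a i j ≠ 0`, except that a subquiver of affine type `A₁`
is also allowed, for which there are two edges, one in each direction. -/
structure SymQuiver (I : Type*) where
  a : I → I → ℤ
  d : I → ℕ
  a_self : ∀ i, a i i = 2
  a_nonpos : ∀ i j, i ≠ j → a i j ≤ 0
  a_zero : ∀ i j, a i j = 0 → a j i = 0
  d_pos : ∀ i, 0 < d i
  symm : ∀ i j, (d i : ℤ) * a i j = d j * a j i
  Arrow : I → I → Prop
  arrow_iff : ∀ i j, (Arrow i j ∨ Arrow j i) ↔ (i ≠ j ∧ a i j ≠ 0)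
  arrow_unique : ∀ i j, i ≠ j →
    (a i j * a j i < 4 ∧ ¬ (Arrow i j ∧ Arrow j i)) ∨
    (a i j = -2 ∧ a j i = -2 ∧ (Arrow i j ∧ Arrow j i))

/-- The edges of the quiver: `ε : i ⇝ j` is the pair `(i, j)`. -/
def SymQuiver.Edge {I : Type*} (Γ : SymQuiver I) : Type _ := {p : I × I // Γ.Arrow p.1 p.2}

/-- The edge `ε : i ⇝ j` with ghost shift `s ≠ 0` produces ghosts of the solid `i`-strings if
`s > 0`, and of the solid `j`-strings if `s < 0`.  This is the residue of these ghosts. -/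
def SymQuiver.owner {I : Type*} (Γ : SymQuiver I) (σ : Γ.Edge → ℝ) (ε : Γ.Edge) : I :=
  open Classical in if 0 < σ ε then ε.1.1 else ε.1.2

/-- The other end of the edge `ε`. -/
def SymQuiver.partner {I : Type*} (Γ : SymQuiver I) (σ : Γ.Edge → ℝ) (ε : Γ.Edge) : I :=
  open Classical in if 0 < σ ε then ε.1.2 else ε.1.1

/-- The data on which a weighted KLRW algebra depends (apart from the positioning). -/
structure Datum (R I : Type*) [CommRing R] where
  /-- the quiver -/
  Γ : SymQuiver I
  /-- the ghost shift -/
  σ : Γ.Edge → ℝ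
  σ_ne_zero : ∀ ε, σ ε ≠ 0
  /-- the number of red strings, their positions (the charge) and their residues -/
  ℓ : ℕ
  κ : Fin ℓ → ℝ
  κ_strictMono : StrictMono κ
  ρ : Fin ℓ → I
  /-- the number of solid strings -/
  n : ℕ
  /-- the element `β = ∑ i, β i • α i` of the positive root lattice, of height `n` -/
  β : I →₀ ℕ
  height : β.degree = n
  /-- a diagram consists of finitely many strings -/
  finite_ghosts : ∀ i, β i ≠ 0 → {ε | Γ.owner σ ε = i}.Finite
  /-- the polynomials `Q i j (u, v)` -/
  Q : I → I → MvPolynomial (Fin 2) R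
  Q_self : ∀ i, Q i i = 0
  Q_ne_zero : ∀ i j, i ≠ j → Q i j ≠ 0
  Q_homogeneous : ∀ i j, i ≠ j →
    (Q i j).IsWeightedHomogeneous ![2 * (Γ.d i : ℤ), 2 * (Γ.d j : ℤ)] (-(2 * (Γ.d i * Γ.a i j)))
  Q_symm : ∀ i j, Q j i = MvPolynomial.rename (Equiv.swap 0 1) (Q i j)

/-- `Q(y_r, y_u)`. -/
def evalQ {R : Type*} [CommRing R] {n : ℕ} (Q : MvPolynomial (Fin 2) R) (r u : Fin n) :
    MvPolynomial (Fin n) R :=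
  MvPolynomial.aeval ![MvPolynomial.X r, MvPolynomial.X u] Q

/-- The polynomial `(Q(y_r, y_u) - Q(y_s, y_u)) / (y_s - y_r)`; see `sub_mul_diffQ`. -/
def diffQ {R : Type*} [CommRing R] {n : ℕ} (Q : MvPolynomial (Fin 2) R) (r u s : Fin n) :
    MvPolynomial (Fin n) R :=
  - ∑ m ∈ Q.support, MvPolynomial.C (Q.coeff m) * MvPolynomial.X u ^ m 1 *
      ∑ p ∈ Finset.range (m 0), MvPolynomial.X s ^ p * MvPolynomial.X r ^ (m 0 - 1 - p)

theorem sub_mul_diffQ {R : Type*} [CommRing R] {n : ℕ} (Q : MvPolynomial (Fin 2) R)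
    (r u s : Fin n) :
    (MvPolynomial.X s - MvPolynomial.X r) * diffQ Q r u s = evalQ Q r u - evalQ Q s u := by
  have key : ∀ t : Fin n, evalQ Q t u = ∑ m ∈ Q.support,
      MvPolynomial.C (Q.coeff m) * MvPolynomial.X u ^ m 1 * MvPolynomial.X t ^ m 0 := by
    intro t
    rw [evalQ, MvPolynomial.aeval_def, MvPolynomial.eval₂_eq']
    refine Finset.sum_congr rfl fun m _ => ?_
    simp [Fin.prod_univ_two, MvPolynomial.algebraMap_eq]
    ring
  rw [key, key, diffQ, mul_neg, Finset.mul_sum, ← Finset.sum_sub_distrib,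
    ← Finset.sum_neg_distrib]
  refine Finset.sum_congr rfl fun m _ => ?_
  have h := (Commute.all (MvPolynomial.X s : MvPolynomial (Fin n) R)
    (MvPolynomial.X r)).mul_geom_sum₂ (m 0)
  linear_combination -(MvPolynomial.C (Q.coeff m) * MvPolynomial.X u ^ m 1) * h

namespace Datum

variable {R I : Type*} [CommRing R] (D : Datum R I)

/-- The strings of a diagram: the solid strings, the ghost of the `k`-th solid string for the
edge `ε`, and the red strings. -/
inductive Str (D : Datum R I) : Type _
  | solid (k : Fin D.n) : Str D
  | ghost (k : Fin D.n) (ε : D.Γ.Edge) : Str D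
  | red (m : Fin D.ℓ) : Str D

/-- The strings that are present if the solid strings have residues `i`. -/
def Present (i : Fin D.n → I) : D.Str → Prop
  | .solid _ => True
  | .ghost k ε => D.Γ.owner D.σ ε = i k
  | .red _ => True

/-- The horizontal coordinates of all strings, given those `x` of the solid strings.  Ghosts
are shifted to the right by the absolute value of the ghost shift. -/
def loc (x : Fin D.n → ℝ) : D.Str → ℝ
  | .solid k => x k
  | .ghost k ε => x k + |D.σ ε|
  | .red m => D.κ m

/-- The strings are at pairwise distinct positions. -/
def Generic (i : Fin D.n → I) (x : Fin D.n → ℝ) : Prop :=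
  Set.InjOn (D.loc x) {S | D.Present i S}

/-- The set `I^β` of residue sequences. -/
def ResSeq : Type _ := {i : Fin D.n → I // ∑ k, Finsupp.single (i k) 1 = D.β}

theorem ResSeq.card_fiber {D : Datum R I} (i : D.ResSeq) (b : I) :
    open Classical in (Finset.univ.filter fun k => i.1 k = b).card = D.β b := by
  classical
  conv_rhs => rw [← i.2]
  rw [Finsupp.finsetSum_apply, Finset.card_filter]
  refine Finset.sum_congr rfl fun k _ => ?_
  rw [Finsupp.single_apply]

instance : Finite D.ResSeq := by
  have h : ∀ (i : D.ResSeq) (k : Fin D.n), i.1 k ∈ D.β.support := by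
    classical
    intro i k
    rw [Finsupp.mem_support_iff, ← i.card_fiber]
    exact Finset.card_ne_zero.2 ⟨k, by simp⟩
  refine Finite.of_injective
    (fun (i : D.ResSeq) (k : Fin D.n) => (⟨i.1 k, h i k⟩ : D.β.support)) ?_
  intro i j hij
  apply Subtype.ext
  funext k
  exact congrArg Subtype.val (congrFun hij k)

instance : Fintype D.ResSeq := Fintype.ofFinite _

/-- A loading: a solid positioning for which, for every residue sequence, the end points of all
strings are pairwise distinct. -/
def Loading : Type _ := {x : Fin D.n → ℝ // ∀ i : D.ResSeq, D.Generic i.1 x}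

/-- A generic horizontal slice of a diagram (without dots): the positions and residues of the
solid strings. -/
@[ext]
structure Slice (D : Datum R I) where
  pos : Fin D.n → ℝ
  res : D.ResSeq
  generic : D.Generic res.1 pos

/-- The slice of the idempotent diagram with positions `x` and residues `i`. -/
def Loading.slice {D : Datum R I} (x : D.Loading) (i : D.ResSeq) : D.Slice := ⟨x.1, i, x.2 i⟩

/-- When the solid strings move along straight lines from `x` to `x'`, then the string `S`
crosses `T` from left to right. -/
def Passes (x x' : Fin D.n → ℝ) (S T : D.Str) : Prop :=
  D.loc x S < D.loc x T ∧ D.loc x' T < D.loc x' S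

/-- An elementary piece of a diagram without dots, read from bottom to top: the `k`-th solid
string at the bottom moves along a straight line to the position `top.pos (w k)`, ghosts move
in parallel, red strings are vertical.  It contains at most one crossing, in the
bilocal sense: all crossings in it are forced to occur simultaneously, because the coincidence of
one of the crossing pairs of strings is the same condition on the positions of the solid strings
as the coincidence of any other one.  (In particular, three strings never meet.) -/
@[ext]
structure Move (D : Datum R I) where
  bot : D.Slice
  top : D.Slice
  w : Equiv.Perm (Fin D.n)
  res_comp : ∀ k, top.res.1 (w k) = bot.res.1 k
  elementary : ∀ S T S' T' : D.Str,
    D.Present bot.res.1 S → D.Present bot.res.1 T →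
    D.Present bot.res.1 S' → D.Present bot.res.1 T' →
    D.Passes bot.pos (fun k => top.pos (w k)) S T →
    D.Passes bot.pos (fun k => top.pos (w k)) S' T' →
    ∀ z : Fin D.n → ℝ, D.loc z S = D.loc z T ↔ D.loc z S' = D.loc z T'

namespace Move

variable {D}

/-- The final positions of the solid strings, which are numbered as at the bottom. -/
def endPos (m : D.Move) : Fin D.n → ℝ := fun k => m.top.pos (m.w k)

/-- The solid strings `r` and `s` have the same residue and cross, with `r` on the left at the
bottom. -/
def SolidCross (m : D.Move) (r s : Fin D.n) : Prop :=
  m.bot.res.1 r = m.bot.res.1 s ∧ D.Passes m.bot.pos m.endPos (.solid r) (.solid s)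

/-- The ghost of the string `k` for the edge `ε` crosses the solid string `s`, and `ε`
joins the residues of these strings. -/
def GhostCross (m : D.Move) (k : Fin D.n) (ε : D.Γ.Edge) (s : Fin D.n) : Prop :=
  D.Γ.owner D.σ ε = m.bot.res.1 k ∧ D.Γ.partner D.σ ε = m.bot.res.1 s ∧
  (D.Passes m.bot.pos m.endPos (.ghost k ε) (.solid s) ∨
    D.Passes m.bot.pos m.endPos (.solid s) (.ghost k ε))

/-- The solid string `k` crosses the red string `c` of the same residue. -/
def RedCross (m : D.Move) (k : Fin D.n) (c : Fin D.ℓ) : Prop :=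
  D.ρ c = m.bot.res.1 k ∧
  (D.Passes m.bot.pos m.endPos (.solid k) (.red c) ∨
    D.Passes m.bot.pos m.endPos (.red c) (.solid k))

open Classical in
/-- The degree: the sum of the contributions `-2 d_i`, `-⟨α_i, α_j⟩ = - d_i a_{ij}` and
`⟨α_i, α_i⟩ / 2 = d_i` of the crossings of the three kinds above; all others have degree zero. -/
def degree (m : D.Move) : ℤ :=
  (∑ r, ∑ s, if m.SolidCross r s then -(2 * (D.Γ.d (m.bot.res.1 r) : ℤ)) else 0) +
  (∑ k, ∑ s, ∑ᶠ ε, if m.GhostCross k ε s then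
      -((D.Γ.d (m.bot.res.1 k) : ℤ) * D.Γ.a (m.bot.res.1 k) (m.bot.res.1 s)) else 0) +
  (∑ k, ∑ c, if m.RedCross k c then (D.Γ.d (m.bot.res.1 k) : ℤ) else 0)

end Move

/-- The generators: idempotent diagrams, a dot on the `k`-th solid string (and on its ghosts),
and elementary pieces of diagrams without dots. -/
inductive Gen (D : Datum R I) : Type _
  | idem (s : D.Slice) : Gen D
  | dot (s : D.Slice) (k : Fin D.n) : Gen D
  | move (m : D.Move) : Gen D

/-- The degree of a generator; a dot on an `i`-string has degree `2 d_i`. -/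
def Gen.degree {D : Datum R I} : D.Gen → ℤ
  | .idem _ => 0
  | .dot s k => 2 * (D.Γ.d (s.res.1 k) : ℤ)
  | .move m => m.degree

/-- Formal linear combinations of vertical compositions of generators; in a product `E * D`
the diagram `E` is on top of `D`. -/
abbrev Free : Type _ := FreeAlgebra R D.Gen

/-- The idempotent diagram. -/
def idem (s : D.Slice) : D.Free := FreeAlgebra.ι R (Gen.idem s)

/-- The dot `y_k`. -/
def dot (s : D.Slice) (k : Fin D.n) : D.Free := FreeAlgebra.ι R (Gen.dot s k)

/-- An elementary piece without dots. -/
def mv (m : D.Move) : D.Free := FreeAlgebra.ι R (Gen.move m)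

/-- `f(y_1, …, y_n)` times the idempotent diagram. -/
def poly (s : D.Slice) (f : MvPolynomial (Fin D.n) R) : D.Free :=
  ∑ m ∈ f.support, f.coeff m • ((List.ofFn fun k => D.dot s k ^ m k).prod * D.idem s)

/-- `b` can be put on top of `a`. -/
def Follows (b a : D.Move) : Prop := b.bot = a.top

/-- A path of three elementary pieces, `a` at the bottom, `b`, and `c` at the top. -/
structure Path3 (D : Datum R I) where
  a : D.Move
  b : D.Move
  c : D.Move
  hab : D.Follows b a
  hbc : D.Follows c b

namespace Path3

variable {D}

/-- The positions of the solid strings in the four slices, numbered as at the bottom. -/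
def x0 (p : D.Path3) : Fin D.n → ℝ := p.a.bot.pos
def x1 (p : D.Path3) : Fin D.n → ℝ := fun k => p.a.top.pos (p.a.w k)
def x2 (p : D.Path3) : Fin D.n → ℝ := fun k => p.b.top.pos ((p.b.w * p.a.w) k)
def x3 (p : D.Path3) : Fin D.n → ℝ := fun k => p.c.top.pos ((p.c.w * p.b.w * p.a.w) k)

/-- The composite diagram. -/
def diagram (p : D.Path3) : D.Free := D.mv p.c * D.mv p.b * D.mv p.a

/-- The two paths start and end at the same slices and join the same end points. -/
def SameEnds (p q : D.Path3) : Prop :=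
  p.a.bot = q.a.bot ∧ p.c.top = q.c.top ∧ p.c.w * p.b.w * p.a.w = q.c.w * q.b.w * q.a.w

end Path3

/-- Two strings that are in the same order in `x` and in `z` are also in this order in `y`. -/
def Between (i : Fin D.n → I) (x y z : Fin D.n → ℝ) : Prop :=
  ∀ S T : D.Str, D.Present i S → D.Present i T →
    D.loc x S < D.loc x T → D.loc z S < D.loc z T → D.loc y S < D.loc y T

/-- No two strings cross twice. -/
def Path3.Reduced {D : Datum R I} (p : D.Path3) : Prop :=
  D.Between p.a.bot.res.1 p.x0 p.x1 p.x3 ∧ D.Between p.a.bot.res.1 p.x0 p.x2 p.x3 ∧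
  D.Between p.a.bot.res.1 p.x0 p.x1 p.x2

/-- The exceptional triples of strings `A`, `M`, `B` in the Reidemeister III relation, where
`A` and `B` are the solid strings `r` and `s` of the same residue, or ghosts of them; with the
polynomial that is the coefficient of the error term. -/
inductive Exceptional (i : Fin D.n → I) :
    Fin D.n → Fin D.n → D.Str → D.Str → D.Str → MvPolynomial (Fin D.n) R → Prop
  | ghostSolidGhost (r u s : Fin D.n) (ε : D.Γ.Edge) (hrs : i r = i s)
      (ho : D.Γ.owner D.σ ε = i r) (hp : D.Γ.partner D.σ ε = i u) :
      Exceptional i r s (.ghost r ε) (.solid u) (.ghost s ε) (-diffQ (D.Q (i r) (i u)) r u s)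
  | solidGhostSolid (r u s : Fin D.n) (ε : D.Γ.Edge) (hrs : i r = i s)
      (ho : D.Γ.owner D.σ ε = i u) (hp : D.Γ.partner D.σ ε = i r) :
      Exceptional i r s (.solid r) (.ghost u ε) (.solid s) (-diffQ (D.Q (i r) (i u)) r u s)
  | solidRedSolid (r s : Fin D.n) (c : Fin D.ℓ) (hrs : i r = i s) (hc : D.ρ c = i r) :
      Exceptional i r s (.solid r) (.red c) (.solid s) 1

/-- The strings are in the order `A`, `M`, `B` in `x`, and in the order `B`, `M`, `A` in `x'`. -/
def Reversed (x x' : Fin D.n → ℝ) (A M B : D.Str) : Prop :=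
  D.loc x A < D.loc x M ∧ D.loc x M < D.loc x B ∧
  D.loc x' B < D.loc x' M ∧ D.loc x' M < D.loc x' A

/-- The defining relations. -/
inductive Rel : D.Free → D.Free → Prop
  /- composition of diagrams: the product is zero if the slices do not match -/
  | idem_mul_self (s : D.Slice) : Rel (D.idem s * D.idem s) (D.idem s)
  | idem_mul_of_ne (s t : D.Slice) (h : s ≠ t) : Rel (D.idem s * D.idem t) 0
  | idem_dot (s : D.Slice) (k : Fin D.n) : Rel (D.idem s * D.dot s k) (D.dot s k)
  | dot_idem (s : D.Slice) (k : Fin D.n) : Rel (D.dot s k * D.idem s) (D.dot s k)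
  | idem_move (m : D.Move) : Rel (D.idem m.top * D.mv m) (D.mv m)
  | move_idem (m : D.Move) : Rel (D.mv m * D.idem m.bot) (D.mv m)
  /- isotopy: vertical strings, and dots on different strings change their heights -/
  | move_refl (m : D.Move) (h : m.bot = m.top) (hw : m.w = 1) : Rel (D.mv m) (D.idem m.bot)
  | dot_comm (s : D.Slice) (k l : Fin D.n) : Rel (D.dot s k * D.dot s l) (D.dot s l * D.dot s k)
  /- dots pass through all crossings but those of solid strings of the same residue
     (this includes the isotopies that move dots past distant crossings) -/
  | dot_slide (m : D.Move) (k : Fin D.n)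
      (h : ∀ s, ¬ m.SolidCross k s ∧ ¬ m.SolidCross s k) :
      Rel (D.dot m.top (m.w k) * D.mv m) (D.mv m * D.dot m.bot k)
  /- dots and crossings of solid strings of the same residue; in `m₀` the strings do not cross -/
  | dot_cross_left (m m₀ : D.Move) (r s : Fin D.n) (h : m.SolidCross r s)
      (hbot : m₀.bot = m.bot) (htop : m₀.top = m.top) (hw : m₀.w = m.w * Equiv.swap r s) :
      Rel (D.mv m * D.dot m.bot r - D.dot m.top (m.w r) * D.mv m) (D.mv m₀)
  | dot_cross_right (m m₀ : D.Move) (r s : Fin D.n) (h : m.SolidCross r s)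
      (hbot : m₀.bot = m.bot) (htop : m₀.top = m.top) (hw : m₀.w = m.w * Equiv.swap r s) :
      Rel (D.dot m.top (m.w s) * D.mv m - D.mv m * D.dot m.bot s) (D.mv m₀)
  /- Reidemeister II: `m'` undoes `m` -/
  | double_solid (m m' : D.Move) (hbot : m'.bot = m.top) (htop : m'.top = m.bot)
      (hw : m'.w = m.w⁻¹) (r s : Fin D.n) (h : m.SolidCross r s) :
      Rel (D.mv m' * D.mv m) 0
  | double_ghost (m m' : D.Move) (hbot : m'.bot = m.top) (htop : m'.top = m.bot)
      (hw : m'.w = m.w⁻¹) (k : Fin D.n) (ε : D.Γ.Edge) (s : Fin D.n) (h : m.GhostCross k ε s) :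
      Rel (D.mv m' * D.mv m) (D.poly m.bot (evalQ (D.Q (m.bot.res.1 k) (m.bot.res.1 s)) k s))
  | double_red (m m' : D.Move) (hbot : m'.bot = m.top) (htop : m'.top = m.bot)
      (hw : m'.w = m.w⁻¹) (k : Fin D.n) (c : Fin D.ℓ) (h : m.RedCross k c) :
      Rel (D.mv m' * D.mv m) (D.dot m.bot k)
  | double_other (m m' : D.Move) (hbot : m'.bot = m.top) (htop : m'.top = m.bot)
      (hw : m'.w = m.w⁻¹) (hs : ∀ r s, ¬ m.SolidCross r s) (hg : ∀ k ε s, ¬ m.GhostCross k ε s)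
      (hr : ∀ k c, ¬ m.RedCross k c) :
      Rel (D.mv m' * D.mv m) (D.idem m.bot)
  /- Isotopy and Reidemeister III outside of the exceptional cases: up to three crossings may
     occur in a different order.  As the pieces need not contain a crossing, this includes
     straightening of strings and the isotopies that change the heights of two distant crossings. -/
  | braid (p q : D.Path3) (h : p.SameEnds q) (hp : p.Reduced) (hq : q.Reduced)
      (hex : ∀ r s A M B f, D.Exceptional p.a.bot.res.1 r s A M B f →
        ¬ D.Reversed p.x0 p.x3 A M B) :
      Rel p.diagram q.diagram
  /- The exceptional cases of Reidemeister III: in `p` the string `M` passes to the left of the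
     crossing of `A` and `B`, in `q` it passes to the right, in `m₀` no strings cross. -/
  | braid_exceptional (p q : D.Path3) (h : p.SameEnds q) (hp : p.Reduced) (hq : q.Reduced)
      (r s : Fin D.n) (A M B : D.Str) (f : MvPolynomial (Fin D.n) R)
      (hex : D.Exceptional p.a.bot.res.1 r s A M B f) (hrev : D.Reversed p.x0 p.x3 A M B)
      (hleft : D.loc p.x1 M < D.loc p.x1 A) (hright : D.loc q.x1 B < D.loc q.x1 M)
      (m₀ : D.Move) (hbot : m₀.bot = p.a.bot) (htop : m₀.top = p.c.top)
      (hw : m₀.w = p.c.w * p.b.w * p.a.w * Equiv.swap r s) :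
      Rel p.diagram (q.diagram + D.mv m₀ * D.poly p.a.bot f)

/-- The algebra of all diagrams, between arbitrary slices, modulo the relations. -/
abbrev Big : Type _ := RingQuot D.Rel

/-- The class of a linear combination of diagrams. -/
def cls : D.Free →ₐ[R] D.Big := RingQuot.mkAlgHom R D.Rel

/-- The sum of the idempotent diagrams with positions in `X` and residues in `I^β`. -/
def unit (X : Finset D.Loading) : D.Big := ∑ x ∈ X, ∑ i : D.ResSeq, D.cls (D.idem (x.slice i))

theorem unit_idem (X : Finset D.Loading) : IsIdempotentElem (D.unit X) := by
  classical
  have h1 : ∀ s, D.cls (D.idem s) * D.cls (D.idem s) = D.cls (D.idem s) := fun s => by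
    rw [← map_mul]; exact RingQuot.mkAlgHom_rel R (Rel.idem_mul_self s)
  have h2 : ∀ s t, s ≠ t → D.cls (D.idem s) * D.cls (D.idem t) = 0 := fun s t h => by
    rw [← map_mul, ← map_zero D.cls]; exact RingQuot.mkAlgHom_rel R (Rel.idem_mul_of_ne s t h)
  have hinj : ∀ (x y : D.Loading) (i j : D.ResSeq), x.slice i = y.slice j → x = y ∧ i = j := by
    intro x y i j h
    exact ⟨Subtype.ext (congrArg Slice.pos h), congrArg Slice.res h⟩
  have hu : D.unit X =
      ∑ z ∈ X ×ˢ (Finset.univ : Finset D.ResSeq), D.cls (D.idem (z.1.slice z.2)) :=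
    (Finset.sum_product X Finset.univ fun z => D.cls (D.idem (z.1.slice z.2))).symm
  rw [IsIdempotentElem, hu, Finset.sum_mul_sum]
  refine Finset.sum_congr rfl fun z hz => ?_
  rw [Finset.sum_eq_single z]
  · exact h1 _
  · intro z' _ hne
    refine h2 _ _ fun h => hne ?_
    obtain ⟨a, b⟩ := hinj _ _ _ _ h
    exact (Prod.ext a b).symm
  · exact fun h => absurd hz h

/-- The weighted KLRW algebra `W_β(X)`: the linear combinations of diagrams whose
bottom and top are idempotent diagrams with positions in `X`, modulo the relations. -/
def W (X : Finset D.Loading) : Type _ := (D.unit_idem X).Corner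

variable (X : Finset D.Loading)

instance : Ring (D.W X) := inferInstanceAs (Ring (D.unit_idem X).Corner)

/-- The inclusion into the algebra of all diagrams. -/
def W.val {D : Datum R I} {X : Finset D.Loading} (v : D.W X) : D.Big := Subtype.val v

/-- The part `1_X * b * 1_X` of `b` with bottom and top in `X`. -/
def toW (b : D.Big) : D.W X := ⟨D.unit X * b * D.unit X, ⟨b, rfl⟩⟩

instance : Algebra R (D.W X) where
  smul c v := ⟨c • v.val, by
    obtain ⟨b, hb⟩ := v.2
    exact ⟨c • b, by
      change _ = c • v.1
      rw [← hb]; simp only [mul_smul_comm, smul_mul_assoc]⟩⟩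
  algebraMap :=
    { toFun c := D.toW X (algebraMap R D.Big c)
      map_one' := Subtype.ext <| by
        change D.unit X * algebraMap R D.Big 1 * D.unit X = D.unit X
        rw [map_one, mul_one, (D.unit_idem X).eq]
      map_mul' a b := Subtype.ext <| by
        change D.unit X * algebraMap R D.Big (a * b) * D.unit X =
          (D.unit X * algebraMap R D.Big a * D.unit X) *
            (D.unit X * algebraMap R D.Big b * D.unit X)
        simp only [Algebra.algebraMap_eq_smul_one, mul_smul_comm, smul_mul_assoc, mul_one,
          (D.unit_idem X).eq, smul_smul]
        rw [mul_comm]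
      map_zero' := Subtype.ext <| by
        change D.unit X * algebraMap R D.Big 0 * D.unit X = 0
        rw [map_zero, mul_zero, zero_mul]
      map_add' a b := Subtype.ext <| by
        change D.unit X * algebraMap R D.Big (a + b) * D.unit X =
          D.unit X * algebraMap R D.Big a * D.unit X + D.unit X * algebraMap R D.Big b * D.unit X
        rw [map_add, mul_add, add_mul] }
  commutes' c v := Subtype.ext <| by
    change (D.unit X * algebraMap R D.Big c * D.unit X) * v.1 =
      v.1 * (D.unit X * algebraMap R D.Big c * D.unit X)
    obtain ⟨h1, h2⟩ := (Subsemigroup.mem_corner_iff (D.unit_idem X)).mp v.2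
    simp only [Algebra.algebraMap_eq_smul_one, mul_smul_comm, smul_mul_assoc, mul_one,
      (D.unit_idem X).eq, h1, h2]
  smul_def' c v := Subtype.ext <| by
    change c • v.1 = (D.unit X * algebraMap R D.Big c * D.unit X) * v.1
    obtain ⟨h1, h2⟩ := (Subsemigroup.mem_corner_iff (D.unit_idem X)).mp v.2
    simp only [Algebra.algebraMap_eq_smul_one, mul_smul_comm, smul_mul_assoc, mul_one,
      (D.unit_idem X).eq, h1]

/-- The linear combinations of diagrams of degree `δ`, in the algebra of all diagrams. -/
def bigDeg (δ : ℤ) : Submodule R D.Big :=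
  Submodule.span R {b | ∃ l : List D.Gen, (l.map Gen.degree).sum = δ ∧
    b = D.cls (l.map (FreeAlgebra.ι R)).prod}

/-- The homogeneous component of degree `δ` of `W_β(X)`. -/
def deg (δ : ℤ) : Submodule R (D.W X) where
  carrier := {v | v.val ∈ D.bigDeg δ}
  add_mem' h h' := (D.bigDeg δ).add_mem h h'
  zero_mem' := (D.bigDeg δ).zero_mem
  smul_mem' c _ h := (D.bigDeg δ).smul_mem c h

/-- `R[β]^{S_β}`, the tensor product of the rings of symmetric polynomials in `β i` variables,
for all residues `i` with `β i ≠ 0`. -/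
abbrev SymTensor : Type _ :=
  PiTensorProduct R fun b : D.β.support => MvPolynomial.symmetricSubalgebra (Fin (D.β b)) R

/-- The component of degree `δ` of `R[β]^{S_β}`, where the variables of the factor for the
residue `i` have degree `2 d_i`. -/
def symDeg (δ : ℤ) : Submodule R D.SymTensor :=
  Submodule.span R {t | ∃ (f : (b : D.β.support) → MvPolynomial.symmetricSubalgebra (Fin (D.β b)) R)
    (m : D.β.support → ℕ), (∀ b, (f b).1.IsHomogeneous (m b)) ∧
    ∑ b : D.β.support, 2 * (D.Γ.d b.1 : ℤ) * m b = δ ∧ t = PiTensorProduct.tprod R f}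

/-- The strings of residue `b`, enumerated in increasing order. -/
def enum (i : D.ResSeq) (b : I) : Fin (D.β b) → Fin D.n :=
  open Classical in (Finset.univ.filter fun k => i.1 k = b).orderEmbOfFin (i.card_fiber b)

/-- For a residue sequence `i`, the homomorphism that puts the variables of the factor
for the residue `b` on the strings of residue `b`. -/
def toPoly (i : D.ResSeq) : D.SymTensor →ₐ[R] MvPolynomial (Fin D.n) R :=
  PiTensorProduct.liftAlgHom
    ((MultilinearMap.mkPiAlgebra R D.β.support (MvPolynomial (Fin D.n) R)).compLinearMap
      fun b => ((MvPolynomial.rename (D.enum i b)).comp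
        (MvPolynomial.symmetricSubalgebra (Fin (D.β b)) R).val).toLinearMap)
    (by simp) (by intro f g; simp [Finset.prod_mul_distrib])

/-- `f · 1`: the sum over all positions in `X` and all residue sequences of the idempotent diagrams
with dots on them according to `f`. -/
def polyOne (f : D.SymTensor) : D.W X :=
  D.toW X (∑ x ∈ X, ∑ i : D.ResSeq, D.cls (D.poly (x.slice i) (D.toPoly i f)))

end Datum

end WKLRW

end

set_option linter.unusedSectionVars false

noncomputable section

namespace WKLRW

open Filter Topology

/-! ### Arrangements of the hyperplanes `z_a - z_b = c` -/

/-! A diagram is read as a walk of the point `z` of `ℝⁿ` formed by the positions of the solid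
strings. Two strings meet on a wall `z_a - z_b = c` (with `z_none = 0` for a red string), so a
crossing is the passage through a wall. A diagram without dots is a gallery in an affine arrangement
together with a renumbering of the strings, and it is reduced if no wall is crossed twice.

Spanning. Move the end of a straight line that starts at `x` inside the chamber of `y`. For a
generic motion the last walls on the line change only when two or three of them are crossed at once.
Hence the possible last walls of reduced galleries are connected by flips of at most three walls
(`connected_flips`). Such flips are covered by the Reidemeister relations, whose error terms have
fewer crossings. As in Matsumoto's theorem, reduced galleries with the same ends therefore agree up
to fewer crossings (`Gal.sub_mem_fil`). Dots slide through crossings and double crossings become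
dots, again up to fewer crossings. So one reduced diagram `Conn.diag` for every residue-preserving
bijection of the strings, multiplied by polynomials in the dots at the bottom, spans all diagrams
between two slices (`exists_lc`).

Independence. Diagrams act on rational functions in the dots. Dots multiply, a crossing of equal
residues is a divided difference, the ghost of an edge passing its partner to the right multiplies
by `Q` and to the left by `1`, a solid string passing a red one of its residue to the right
multiplies by its dot and to the left by `1`, and finally the strings are renumbered. The relations
hold by `repFree_rel`. The operator of `Conn.diag` is a combination of permutations with a non-zero
coefficient at its own permutation and all others at shorter ones. Permutations are linearly
independent by Dedekind, so the spanning set is a basis and the action is faithful (`lc_injective`,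
`eq_of_rep_eq`).

Center. A central element commutes with the dots, hence is a polynomial on every idempotent
(`exists_eq_pB`). Commuting with `Conn.diag` means that this polynomial is transported along the
bijection (`eq_rename_of_mul_diag`), so a single symmetric polynomial occurs everywhere. Conversely,
only residue-preserving bijections occur in the operators, and they all transport a symmetric
polynomial in the same way (`pB_mul_diag`).

Freeness. Polynomials are free over those that are symmetric in each colour, with the monomials of
bounded exponents as a basis. These span by repeated division with remainder, and they are
independent because their number is the order of the group, which is the degree of the field of
rational functions over its fixed field (`colMon_unique`). Combined with the basis of diagrams this
gives `centerBasis`.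

Grading. All relations are homogeneous, so the degree is recorded by a homomorphism `grad` into a
group algebra of `ℤ`, and homogeneous components are read off as coefficients. -/

/-- The oriented hyperplane `z_a - z_b = c`, where `z_none = 0`. -/
abbrev Wall (n : ℕ) : Type := Option (Fin n) × Option (Fin n) × ℝ

/-- The coordinates of a point, extended by zero. -/
def ext {n : ℕ} (z : Fin n → ℝ) (o : Option (Fin n)) : ℝ := o.elim 0 z

@[simp] theorem ext_none {n : ℕ} (z : Fin n → ℝ) : ext z none = 0 := rfl
@[simp] theorem ext_some {n : ℕ} (z : Fin n → ℝ) (k : Fin n) : ext z (some k) = z k := rfl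

namespace Wall

variable {n : ℕ}

/-- The affine functional that vanishes on the wall. -/
def L (H : Wall n) (z : Fin n → ℝ) : ℝ := ext z H.1 - ext z H.2.1 - H.2.2

/-- The linear part of the functional `L`. -/
def lin (H : Wall n) (z : Fin n → ℝ) : ℝ := ext z H.1 - ext z H.2.1

/-- The wall with the opposite orientation. -/
def opp (H : Wall n) : Wall n := (H.2.1, H.1, -H.2.2)

@[simp] theorem opp_opp (H : Wall n) : H.opp.opp = H := by simp [opp]

@[simp] theorem L_opp (H : Wall n) (z : Fin n → ℝ) : L H.opp z = - L H z := by
  simp only [L, opp]; ring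

theorem L_add_smul (H : Wall n) (z v : Fin n → ℝ) (t : ℝ) :
    L H (z + t • v) = L H z + t * lin H v := by
  obtain ⟨a, b, c⟩ := H
  cases a <;> cases b <;> simp [L, lin] <;> ring

theorem lin_sub (H : Wall n) (z w : Fin n → ℝ) : lin H (z - w) = L H z - L H w := by
  obtain ⟨a, b, c⟩ := H
  cases a <;> cases b <;> simp [L, lin] <;> ring

theorem lin_neg (H : Wall n) (z : Fin n → ℝ) : lin H (-z) = - lin H z := by
  obtain ⟨a, b, c⟩ := H
  cases a <;> cases b <;> simp [lin]; ring

theorem L_line (H : Wall n) (x y : Fin n → ℝ) (t : ℝ) :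
    L H (x + t • (y - x)) = L H x + t * (L H y - L H x) := by
  rw [L_add_smul, lin_sub]

theorem continuous_L (H : Wall n) : Continuous (L H) := by
  obtain ⟨a, b, c⟩ := H
  change Continuous fun z => ext z a - ext z b - c
  cases a <;> cases b <;> simp only [ext_none, ext_some] <;> fun_prop

/-- A function on vertices defines a point. -/
def ofVertices (v : Option (Fin n) → ℝ) : Fin n → ℝ := fun k => v (some k) - v none

/-- Treating `none` as a vertex with a value of its own puts walls of red strings on the same
footing as the others: subtracting `v none` does not change differences of values. -/
theorem L_ofVertices (H : Wall n) (v : Option (Fin n) → ℝ) :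
    L H (ofVertices v) = v H.1 - v H.2.1 - H.2.2 := by
  obtain ⟨a, b, c⟩ := H
  cases a <;> cases b <;> simp [L, ofVertices]

/-- A wall is determined, up to orientation, by its set of points. -/
theorem eq_or_eq_opp {H K : Wall n} (hH : H.1 ≠ H.2.1) (hK : K.1 ≠ K.2.1)
    (h : ∀ z, L H z = 0 ↔ L K z = 0) : H = K ∨ H = K.opp := by
  classical
  obtain ⟨a, b, c⟩ := H
  obtain ⟨a', b', c'⟩ := K
  simp only [opp, Prod.mk.injEq] at hH hK ⊢
  have h' : ∀ v : Option (Fin n) → ℝ, v a - v b - c = 0 ↔ v a' - v b' - c' = 0 := fun v => by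
    simpa [L_ofVertices] using h (ofVertices v)
  -- Except for `h6` in the case `a' = b`, these are points of the first wall, with different values
  -- on and off its vertices. Evaluating the second functional there forces the vertices and the
  -- constants to agree up to orientation.
  have h1 := h' (fun o => if o = a then c else 0)
  have h2 := h' (fun o => if o = a then c + 1 else if o = b then 1 else 0)
  have h3 := h' (fun o => if o = b then -c else 0)
  have h4 := h' (fun o => if o = a then c else if o = b then 0 else 1)
  have h6 := h' (fun o => if o = a then c else if o = a' then c' + 1 else 0)
  have h5 := h' (fun o => if o = a then c + 2 else if o = b then 2 else 1)
  by_cases e1 : a' = a <;> by_cases e2 : b' = b <;> by_cases e3 : a' = b <;>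
    by_cases e4 : b' = a <;> simp_all <;> grind

end Wall

open Wall

/-! ### Separating walls -/

variable {n : ℕ} (A : Finset (Wall n))

/-- A set of walls that is closed under reversing the orientation. -/
structure IsArr : Prop where
  opp_mem : ∀ H ∈ A, H.opp ∈ A
  ne : ∀ H ∈ A, H.1 ≠ H.2.1

/-- A point on no wall. -/
def OffWalls (x : Fin n → ℝ) : Prop := ∀ H ∈ A, L H x ≠ 0

open Classical in
/-- The walls that are crossed from the negative to the positive side on the way from
`x` to `y`. -/
def sep (x y : Fin n → ℝ) : Finset (Wall n) := A.filter fun H => L H x < 0 ∧ 0 < L H y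

variable {A}

theorem mem_sep {x y : Fin n → ℝ} {H : Wall n} :
    H ∈ sep A x y ↔ H ∈ A ∧ L H x < 0 ∧ 0 < L H y := by
  classical
  simp [sep]

theorem OffWalls.pos_iff {x : Fin n → ℝ} (hx : OffWalls A x) {H : Wall n} (hH : H ∈ A) :
    0 < L H x ↔ ¬ L H x < 0 := by
  have := hx H hH
  constructor
  · intro h; linarith
  · intro h; exact lt_of_le_of_ne (not_lt.1 h) (Ne.symm this)

theorem opp_mem_sep (hA : IsArr A) {x y : Fin n → ℝ} {H : Wall n} :
    H.opp ∈ sep A x y ↔ H ∈ sep A y x := by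
  simp only [mem_sep, L_opp, Left.neg_neg_iff, Left.neg_pos_iff]
  constructor
  · rintro ⟨h, h1, h2⟩; exact ⟨by simpa using hA.opp_mem _ h, h2, h1⟩
  · rintro ⟨h, h1, h2⟩; exact ⟨hA.opp_mem _ h, h2, h1⟩

/-- Every hyperplane is present with both orientations, and if it separates two points, exactly one
of them is counted. Going back counts the other one. -/
theorem card_sep_comm (hA : IsArr A) (x y : Fin n → ℝ) : (sep A x y).card = (sep A y x).card := by
  refine Finset.card_bij (fun H _ => H.opp) ?_ ?_ ?_
  · intro H hH; rw [opp_mem_sep hA]; exact hH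
  · intro H _ K _ h; simpa using congrArg opp h
  · intro H hH; exact ⟨H.opp, by rw [opp_mem_sep hA]; exact hH, by simp⟩

theorem sep_self (x : Fin n → ℝ) : sep A x x = ∅ := by
  ext H; simp only [mem_sep, Finset.notMem_empty, iff_false]; rintro ⟨-, h1, h2⟩; linarith

theorem sep_subset_union {x y z : Fin n → ℝ} (hy : OffWalls A y) :
    sep A x z ⊆ sep A x y ∪ sep A y z := by
  intro H hH
  obtain ⟨h, h1, h2⟩ := mem_sep.1 hH
  rw [Finset.mem_union, mem_sep, mem_sep]
  rcases lt_or_gt_of_ne (hy H h) with h3 | h3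
  · exact Or.inr ⟨h, h3, h2⟩
  · exact Or.inl ⟨h, h1, h3⟩

theorem disjoint_sep (x y z : Fin n → ℝ) : Disjoint (sep A x y) (sep A y z) := by
  rw [Finset.disjoint_left]
  intro H h1 h2
  have := (mem_sep.1 h1).2.2
  have := (mem_sep.1 h2).2.1
  linarith

/-- The sets of separating walls add up if no wall is crossed twice. -/
def Red (A : Finset (Wall n)) (x y z : Fin n → ℝ) : Prop :=
  sep A x y ⊆ sep A x z ∧ sep A y z ⊆ sep A x z

theorem Red.eq {x y z : Fin n → ℝ} (h : Red A x y z) (hy : OffWalls A y) :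
    sep A x z = sep A x y ∪ sep A y z :=
  (sep_subset_union hy).antisymm (Finset.union_subset h.1 h.2)

theorem Red.card {x y z : Fin n → ℝ} (h : Red A x y z) (hy : OffWalls A y) :
    (sep A x z).card = (sep A x y).card + (sep A y z).card := by
  rw [h.eq hy, Finset.card_union_of_disjoint (disjoint_sep x y z)]

theorem card_sep_triangle {x y z : Fin n → ℝ} (hy : OffWalls A y) :
    (sep A x z).card ≤ (sep A x y).card + (sep A y z).card :=
  (Finset.card_le_card (sep_subset_union hy)).trans (Finset.card_union_le _ _)

/-- The walls crossed on the two legs are disjoint sets that cover the walls between the ends, so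
additivity of the distances forces equality. In this form reducedness is accessible to arithmetic.
-/
theorem red_iff {x y z : Fin n → ℝ} (hy : OffWalls A y) :
    Red A x y z ↔ (sep A x z).card = (sep A x y).card + (sep A y z).card := by
  refine ⟨fun h => h.card hy, fun h => ?_⟩
  rw [← Finset.card_union_of_disjoint (disjoint_sep x y z)] at h
  have := Finset.eq_of_subset_of_card_le (sep_subset_union hy) h.ge
  exact ⟨this ▸ Finset.subset_union_left, this ▸ Finset.subset_union_right⟩

/-- If `x` and `z` are on the same side of a wall that is crossed between them, then this wall is
crossed twice. -/
theorem not_red_iff (hA : IsArr A) {x y z : Fin n → ℝ} (hx : OffWalls A x) (hz : OffWalls A z) :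
    ¬ Red A x y z ↔ ∃ H ∈ sep A x y, H.opp ∈ sep A y z := by
  constructor
  · intro h
    rw [Red, not_and_or, Finset.not_subset, Finset.not_subset] at h
    rcases h with ⟨H, h1, h2⟩ | ⟨H, h1, h2⟩
    · refine ⟨H, h1, ?_⟩
      rw [opp_mem_sep hA, mem_sep]
      rw [mem_sep] at h1 h2
      refine ⟨h1.1, ?_, h1.2.2⟩
      by_contra h3
      exact h2 ⟨h1.1, h1.2.1, (hz.pos_iff h1.1).2 h3⟩
    · refine ⟨H.opp, ?_, by simpa using h1⟩
      rw [opp_mem_sep hA, mem_sep]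
      rw [mem_sep] at h1 h2
      refine ⟨h1.1, h1.2.1, ?_⟩
      rw [hx.pos_iff h1.1]
      exact fun h3 => h2 ⟨h1.1, h3, h1.2.2⟩
  · rintro ⟨H, h1, h2⟩ h
    have h3 := (mem_sep.1 (h.1 h1)).2.2
    have h4 := (mem_sep.1 (h.2 h2)).2.2
    rw [L_opp] at h4
    linarith

/-- The last wall can be removed. -/
theorem sep_erase (hA : IsArr A) {x y k : Fin n → ℝ} (hy : OffWalls A y) (hk : OffWalls A k)
    {K : Wall n} (h : sep A k y = {K}) (hK : K ∈ sep A x y) :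
    Red A x k y ∧ sep A x k = (sep A x y).erase K := by
  have h0 : Red A x k y := by
    refine ⟨?_, by rw [h]; simpa using hK⟩
    intro H hH
    rw [mem_sep] at hH ⊢
    refine ⟨hH.1, hH.2.1, (hy.pos_iff hH.1).2 fun h1 => ?_⟩
    -- If `H` were crossed back between `k` and `y`, then `H.opp = K`. But `K` has `x` on its
    -- negative side, and so does `H`.
    have h2 : H.opp ∈ sep A k y := by
      rw [opp_mem_sep hA, mem_sep]; exact ⟨hH.1, h1, hH.2.2⟩
    rw [h, Finset.mem_singleton] at h2
    rw [← h2, mem_sep, L_opp] at hK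
    linarith [hK.2.1, hH.2.1]
  refine ⟨h0, ?_⟩
  rw [h0.eq hk, h]
  have : K ∉ sep A x k := fun h1 => by
    have := disjoint_sep (A := A) x k y
    rw [Finset.disjoint_left] at this
    exact this h1 (by simp [h])
  ext H
  simp only [Finset.mem_erase, Finset.mem_union, Finset.mem_singleton]
  constructor
  · intro h1; exact ⟨fun h2 => this (h2 ▸ h1), Or.inl h1⟩
  · rintro ⟨h1, h2 | h2⟩
    · exact h2
    · exact absurd h2 h1

/-- Two points that are in the same chamber. -/
def Same (A : Finset (Wall n)) (x y : Fin n → ℝ) : Prop := ∀ H ∈ A, 0 < L H x * L H y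

theorem Same.gen {x y : Fin n → ℝ} (h : Same A x y) : OffWalls A x := fun H hH h0 => by
  have := h H hH; rw [h0] at this; simp at this

theorem same_self {x : Fin n → ℝ} (h : OffWalls A x) : Same A x x := fun H hH =>
  mul_self_pos.2 (h H hH)

theorem Same.sep_eq {x y z : Fin n → ℝ} (h : Same A x y) : sep A z x = sep A z y := by
  ext H
  rw [mem_sep, mem_sep]
  refine and_congr_right fun hH => and_congr_right fun _ => ?_
  exact pos_iff_pos_of_mul_pos (h H hH)

theorem same_of_sep_eq_empty (hA : IsArr A) {x y : Fin n → ℝ} (hx : OffWalls A x) (hy : OffWalls A y)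
    (h : sep A x y = ∅) : Same A x y := by
  intro H hH
  rcases lt_or_gt_of_ne (hx H hH) with h1 | h1 <;> rcases lt_or_gt_of_ne (hy H hH) with h2 | h2
  · exact mul_pos_of_neg_of_neg h1 h2
  · have : H ∈ sep A x y := mem_sep.2 ⟨hH, h1, h2⟩
    simp [h] at this
  · have : H.opp ∈ sep A x y := (opp_mem_sep hA).2 (mem_sep.2 ⟨hH, h2, h1⟩)
    simp [h] at this
  · exact mul_pos h1 h2

end WKLRW

end

/-! ### Local pictures where walls are crossed simultaneously -/

noncomputable section

namespace WKLRW

open Filter Topology Wall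

variable {n : ℕ} {A : Finset (Wall n)}

/-- Finitely many affine functions that are not identically zero have a common non-zero in every
non-empty open set. -/
theorem exists_avoid {ι : Type*} (s : Finset ι) (f : ι → (Fin n → ℝ) → ℝ)
    (haff : ∀ j ∈ s, ∀ x y (t : ℝ), f j (x + t • (y - x)) = f j x + t * (f j y - f j x))
    (hne : ∀ j ∈ s, ∃ z, f j z ≠ 0) {U : Set (Fin n → ℝ)} (hU : IsOpen U) (hU' : U.Nonempty) :
    ∃ y ∈ U, ∀ j ∈ s, f j y ≠ 0 := by
  classical
  induction s using Finset.induction_on with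
  | empty => exact ⟨hU'.some, hU'.some_mem, by simp⟩
  | insert i s hi ih =>
    obtain ⟨y, hy, hys⟩ := ih (fun j hj => haff j (by simp [hj])) fun j hj => hne j (by simp [hj])
    obtain ⟨z, hz⟩ := hne i (by simp)
    by_cases h0 : f i y = 0
    swap
    · refine ⟨y, hy, fun j hj => ?_⟩
      rcases Finset.mem_insert.1 hj with rfl | hj
      · exact h0
      · exact hys j hj
    -- The point `y` fails only for `f i`. On the line to `z` the value of `f i` is `t * f i z`,
    -- while the open conditions persist for small `t`.
    have e1 : ∀ᶠ t : ℝ in 𝓝[>] 0, y + t • (z - y) ∈ U := by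
      have hc : Continuous fun t : ℝ => y + t • (z - y) := by fun_prop
      have := hc.continuousAt (x := 0) |>.eventually_mem (hU.mem_nhds (by simpa using hy))
      exact this.filter_mono nhdsWithin_le_nhds
    have e2 : ∀ᶠ t : ℝ in 𝓝[>] 0, ∀ j ∈ s, f j (y + t • (z - y)) ≠ 0 := by
      rw [Filter.eventually_all_finset]
      intro j hj
      have hc : Continuous fun t : ℝ => f j y + t * (f j z - f j y) := by fun_prop
      have := (hc.continuousAt (x := 0)).eventually_ne (y := 0) (by simpa using hys j hj)
      refine (this.filter_mono nhdsWithin_le_nhds).mono fun t ht => ?_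
      rwa [haff j (by simp [hj])]
    obtain ⟨t, ⟨h1, h2⟩, h3⟩ := ((e1.and e2).and self_mem_nhdsWithin).exists
    refine ⟨_, h1, fun j hj => ?_⟩
    rcases Finset.mem_insert.1 hj with rfl | hj
    · rw [haff _ (by simp), h0]
      simpa using ⟨ne_of_gt h3, hz⟩
    · exact h2 j hj

/-- The point `z` is close to the intersection of the walls `F`, in direction `v` from it, and on
the same side as `y` of all other walls. -/
structure Loc (A F : Finset (Wall n)) (y v z : Fin n → ℝ) : Prop where
  out : ∀ H ∈ A, H ∉ F → H.opp ∉ F → 0 < L H z * L H y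
  pos : ∀ H ∈ F, 0 < L H z ↔ 0 < lin H v
  neg : ∀ H ∈ F, L H z < 0 ↔ lin H v < 0

/-- On the walls through `z` the functional at `z + t • v` is `t` times its linear part at `v`; on
all other walls the sign persists by continuity. -/
theorem eventually_loc {F : Finset (Wall n)} {y z v : Fin n → ℝ} (hF : ∀ H ∈ F, L H z = 0)
    (hout : ∀ H ∈ A, H ∉ F → H.opp ∉ F → 0 < L H z * L H y) :
    ∀ᶠ t : ℝ in 𝓝[>] 0, Loc A F y v (z + t • v) := by
  have h1 : ∀ᶠ t : ℝ in 𝓝[>] 0, ∀ H ∈ A, H ∉ F → H.opp ∉ F →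
      0 < L H (z + t • v) * L H y := by
    rw [Filter.eventually_all_finset]
    intro H hH
    by_cases h1 : H ∈ F
    · simp [h1]
    by_cases h2 : H.opp ∈ F
    · simp [h2]
    have hc : Continuous fun t : ℝ => L H (z + t • v) * L H y := by
      have := continuous_L H
      fun_prop
    have := hc.continuousAt (x := 0) |>.eventually_const_lt (u := 0)
      (by simpa using hout H hH h1 h2)
    exact (this.filter_mono nhdsWithin_le_nhds).mono fun t ht _ _ => ht
  filter_upwards [h1, self_mem_nhdsWithin] with t ht ht0
  have ht0 : 0 < t := ht0
  refine ⟨ht, fun H hH => ?_, fun H hH => ?_⟩ <;> rw [L_add_smul, hF H hH, zero_add]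
  · exact mul_pos_iff_of_pos_left ht0
  · exact ⟨fun h => neg_of_mul_neg_right h ht0.le, fun h => mul_neg_of_pos_of_neg ht0 h⟩

theorem Loc.gen {F : Finset (Wall n)} {y v z : Fin n → ℝ} (h : Loc A F y v z)
    (hF : ∀ H ∈ F, lin H v ≠ 0) : OffWalls A z := by
  have key : ∀ H ∈ F, L H z ≠ 0 := fun H hH h0 => by
    rcases lt_or_gt_of_ne (hF H hH) with h1 | h1
    · have := (h.neg H hH).2 h1; linarith
    · have := (h.pos H hH).2 h1; linarith
  intro H hH h0
  by_cases h1 : H ∈ F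
  · exact key H h1 h0
  by_cases h2 : H.opp ∈ F
  · exact key _ h2 (by simp [h0])
  · have := h.out H hH h1 h2
    rw [h0] at this; simp at this

-- Off `F` both points are on the side of `y`, so only walls of `F` separate them. `F` may contain
-- just one orientation of a wall; `hno` ensures that none of these walls is crossed against it.
open Classical in
theorem Loc.sep {F : Finset (Wall n)} {y v z v' z' : Fin n → ℝ} (hFA : F ⊆ A)
    (h : Loc A F y v z) (h' : Loc A F y v' z')
    (hno : ∀ H ∈ F, ¬ (0 < lin H v ∧ lin H v' < 0)) :
    sep A z z' = F.filter fun H => lin H v < 0 ∧ 0 < lin H v' := by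
  ext H
  rw [mem_sep, Finset.mem_filter]
  constructor
  · rintro ⟨hH, h1, h2⟩
    by_cases h3 : H ∈ F
    · exact ⟨h3, (h.neg H h3).1 h1, (h'.pos H h3).1 h2⟩
    by_cases h4 : H.opp ∈ F
    · refine absurd ⟨?_, ?_⟩ (hno _ h4)
      · exact (h.pos _ h4).1 (by simpa using h1)
      · exact (h'.neg _ h4).1 (by simpa using h2)
    · have h5 := h.out H hH h3 h4
      have h6 := h'.out H hH h3 h4
      have := neg_of_mul_pos_right h5 h1.le
      have := pos_of_mul_pos_right h6 h2.le
      linarith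
  · rintro ⟨h1, h2, h3⟩
    exact ⟨hFA h1, (h.neg H h1).2 h2, (h'.pos H h1).2 h3⟩

/-- There are paths to `y` that cross two or three walls, the last of which is `K` and `K'`,
respectively. -/
inductive Flip (A : Finset (Wall n)) (x y : Fin n → ℝ) (K K' : Wall n) : Prop
  | two (z k k' : Fin n → ℝ) (hz : OffWalls A z) (hk : OffWalls A k) (hk' : OffWalls A k')
      (hxy : sep A z y ⊆ sep A x y) (hzy : (sep A z y).card = 2)
      (h1 : sep A z k = {K'}) (h2 : sep A k y = {K})
      (h1' : sep A z k' = {K}) (h2' : sep A k' y = {K'})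
  | three (K₃ : Wall n) (z u k u' k' : Fin n → ℝ) (hz : OffWalls A z) (hu : OffWalls A u) (hk : OffWalls A k)
      (hu' : OffWalls A u') (hk' : OffWalls A k')
      (hxy : sep A z y ⊆ sep A x y) (hzy : (sep A z y).card = 3)
      (h1 : sep A z u = {K'}) (h2 : sep A u k = {K₃}) (h3 : sep A k y = {K})
      (h1' : sep A z u' = {K}) (h2' : sep A u' k' = {K₃}) (h3' : sep A k' y = {K'})

/-- `K` is the last wall on some way to `y`. -/
def LastWall (A : Finset (Wall n)) (y : Fin n → ℝ) (K : Wall n) : Prop :=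
  ∃ k, OffWalls A k ∧ sep A k y = {K}

/-- The ratio whose order is the order in which walls are crossed on straight lines from `x`. -/
def rho (x : Fin n → ℝ) (H : Wall n) (z : Fin n → ℝ) : ℝ := L H z / L H x

open Classical in
/-- The walls that are crossed last on the straight line from `x` to `z`. -/
def lastSet (A : Finset (Wall n)) (x y z : Fin n → ℝ) : Finset (Wall n) :=
  (sep A x y).filter fun H => ∀ G ∈ sep A x y, rho x G z ≤ rho x H z

theorem mem_lastSet {x y z : Fin n → ℝ} {H : Wall n} : H ∈ lastSet A x y z ↔
    H ∈ sep A x y ∧ ∀ G ∈ sep A x y, rho x G z ≤ rho x H z := by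
  simp [lastSet]

/-- A wall with negative ratio is met on the line from `x` to `z` at the time `1 / (1 - rho x H z)`,
which increases with the ratio. At the time `T` of the largest ratio `r` the point is on all walls
of `lastSet` and has passed the other separating walls. Walls that do not separate have positive
ratio and are not met. -/
theorem exists_crossing (hA : IsArr A) {x y z : Fin n → ℝ} (hx : OffWalls A x) (hzy : Same A z y)
    {K : Wall n} (hK : K ∈ lastSet A x y z) :
    ∃ p, (∀ H ∈ lastSet A x y z, L H p = 0) ∧
      ∀ H ∈ A, H ∉ lastSet A x y z → H.opp ∉ lastSet A x y z → 0 < L H p * L H y := by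
  have hz := hzy.gen
  have hsep : sep A x y = sep A x z := (hzy.sep_eq).symm
  have neg : ∀ H ∈ sep A x y, rho x H z < 0 := by
    intro H hH
    rw [hsep, mem_sep] at hH
    exact div_neg_of_pos_of_neg hH.2.2 hH.2.1
  obtain ⟨hK1, hK2⟩ := mem_lastSet.1 hK
  set r := rho x K z with hr
  have hr0 := neg K hK1
  have hT : 0 < 1 - r := by linarith
  set T := (1 - r)⁻¹ with hTdef
  have hT0 : 0 < T := inv_pos.2 hT
  have hT1 : T < 1 := inv_lt_one_of_one_lt₀ (by linarith)
  have hTr : T * (1 - r) = 1 := inv_mul_cancel₀ hT.ne'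
  have hL : ∀ H ∈ A, L H (x + T • (z - x)) = L H x * (T * (rho x H z - r)) := by
    intro H hH
    have : L H z = L H x * rho x H z := by rw [rho, mul_div_cancel₀ _ (hx H hH)]
    rw [L_line, this]
    linear_combination (-L H x) * hTr
  have hlt : ∀ H ∈ sep A x y, H ∉ lastSet A x y z → 0 < L H (x + T • (z - x)) := by
    intro H hH h1
    rw [hL H (mem_sep.1 hH).1]
    have h2 : rho x H z < r := by
      by_contra h3
      exact h1 (mem_lastSet.2 ⟨hH, fun G hG => (hK2 G hG).trans (not_lt.1 h3)⟩)
    exact mul_pos_of_neg_of_neg (mem_sep.1 hH).2.1 (mul_neg_of_pos_of_neg hT0 (by linarith))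
  refine ⟨x + T • (z - x), fun H hH => ?_, fun H hH h1 h2 => ?_⟩
  · obtain ⟨h1, h2⟩ := mem_lastSet.1 hH
    have : rho x H z = r := le_antisymm (hK2 H h1) (h2 K hK1)
    rw [hL H (mem_sep.1 h1).1, this]; ring
  · by_cases h3 : H ∈ sep A x y
    · exact mul_pos (hlt H h3 h1) (mem_sep.1 h3).2.2
    by_cases h4 : H.opp ∈ sep A x y
    · have := mul_pos (hlt _ h4 h2) (mem_sep.1 h4).2.2
      simpa using this
    · have h5 : 0 < rho x H z := by
        have h6 := hsep ▸ h3
        have h7 := hsep ▸ h4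
        rw [opp_mem_sep hA] at h7
        rw [mem_sep] at h6 h7
        rcases lt_or_gt_of_ne (hx H hH) with h8 | h8 <;>
          rcases lt_or_gt_of_ne (hz H hH) with h9 | h9
        · exact div_pos_of_neg_of_neg h9 h8
        · exact absurd ⟨hH, h8, h9⟩ h6
        · exact absurd ⟨hH, h9, h8⟩ h7
        · exact div_pos h9 h8
      rw [hL H hH]
      have h6 : 0 < L H x * L H y := by
        have h7 : 0 < L H x * L H z := by
          rw [rho] at h5
          rcases div_pos_iff.1 h5 with h | h
          · exact mul_pos h.2 h.1
          · exact mul_pos_of_neg_of_neg h.2 h.1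
        have h8 := hzy H hH
        rcases mul_pos_iff.1 h7 with h | h <;> rcases mul_pos_iff.1 h8 with h' | h' <;>
          first | (exact mul_pos h.1 h'.2) | (exact mul_pos_of_neg_of_neg h.1 h'.2) | linarith
      have h7 : 0 < T * (rho x H z - r) := mul_pos hT0 (by linarith)
      calc 0 < (L H x * L H y) * (T * (rho x H z - r)) := mul_pos h6 h7
        _ = _ := by ring

/-- Only signs enter into `Loc`, so `y` need not be close to `p`: it is in the chamber of `z`, and
on a wall through `p` the linear part at `z - p` is the value at `z`. -/
theorem loc_self {F : Finset (Wall n)} {y z p : Fin n → ℝ} (hy : OffWalls A y) (hzy : Same A z y)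
    (hFA : F ⊆ A) (hpF : ∀ H ∈ F, L H p = 0) : Loc A F y (z - p) y := by
  have key : ∀ H ∈ F, lin H (z - p) = L H z := fun H hH => by rw [lin_sub, hpF H hH, sub_zero]
  refine ⟨fun H hH _ _ => same_self hy H hH, fun H hH => ?_, fun H hH => ?_⟩
  · rw [key H hH]; exact (pos_iff_pos_of_mul_pos (hzy H (hFA hH))).symm
  · rw [key H hH]; exact (neg_iff_neg_of_mul_pos (hzy H (hFA hH))).symm

/-- The point of the line just before the last crossing is separated from `y` by `K` alone. -/
theorem lastWall_of_lastSet_eq (hA : IsArr A) {x y z : Fin n → ℝ} (hx : OffWalls A x) (hy : OffWalls A y)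
    (hzy : Same A z y) {K : Wall n} (hK : lastSet A x y z = {K}) : LastWall A y K := by
  classical
  have hKm : K ∈ lastSet A x y z := by simp [hK]
  obtain ⟨p, hp1, hp2⟩ := exists_crossing hA hx hzy hKm
  have hKA := (mem_sep.1 (mem_lastSet.1 hKm).1).1
  have hKz : 0 < L K z :=
    (pos_iff_pos_of_mul_pos (hzy K hKA)).2 (mem_sep.1 (mem_lastSet.1 hKm).1).2.2
  rw [hK] at hp1 hp2
  have hFA : ({K} : Finset (Wall n)) ⊆ A := by simpa using hKA
  have hlin : lin K (z - p) = L K z := by rw [lin_sub, hp1 K (by simp), sub_zero]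
  obtain ⟨t, ht⟩ := (eventually_loc (v := -(z - p)) hp1 hp2).exists
  refine ⟨_, ht.gen ?_, ?_⟩
  · intro H hH
    rw [Finset.mem_singleton] at hH
    subst hH
    rw [lin_neg, hlin]
    linarith
  · rw [Loc.sep hFA ht (loc_self hy hzy hFA hp1)]
    · ext H
      simp only [Finset.mem_filter, Finset.mem_singleton]
      constructor
      · exact fun h => h.1
      · rintro rfl
        refine ⟨rfl, ?_, ?_⟩
        · rw [lin_neg, hlin]; linarith
        · rw [hlin]; exact hKz
    · intro H hH
      rw [Finset.mem_singleton] at hH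
      subst hH
      rw [lin_neg, hlin]
      rintro ⟨h1, h2⟩; linarith

/-- Walls that are crossed simultaneously can be crossed in two orders. -/
theorem flip_of_lastSet (hA : IsArr A) {x y z : Fin n → ℝ} (hx : OffWalls A x) (hy : OffWalls A y)
    (hzy : Same A z y) (hcard : (lastSet A x y z).card ≤ 3) {K K' : Wall n} (hne : K ≠ K')
    (hK : K ∈ lastSet A x y z) (hK' : K' ∈ lastSet A x y z) (hl : LastWall A y K)
    (hl' : LastWall A y K') : Flip A x y K K' := by
  classical
  obtain ⟨p, hp1, hp2⟩ := exists_crossing hA hx hzy hK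
  set F := lastSet A x y z with hF
  have hFs : F ⊆ sep A x y := fun H hH => (mem_lastSet.1 hH).1
  have hFA : F ⊆ A := fun H hH => (mem_sep.1 (hFs hH)).1
  have hFy : ∀ H ∈ F, 0 < L H y := fun H hH => (mem_sep.1 (hFs hH)).2.2
  obtain ⟨k, hk, hky⟩ := hl
  obtain ⟨k', hk', hky'⟩ := hl'
  -- Only `K` lies between `k` and `y`, and `y` is on the positive side of `F`. So the direction `k
  -- - p` is negative on `K` and positive on the rest of `F`.
  have sgn : ∀ {k : Fin n → ℝ} {K : Wall n}, OffWalls A k → sep A k y = {K} → K ∈ F →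
      lin K (k - p) < 0 ∧ ∀ H ∈ F, H ≠ K → 0 < lin H (k - p) := by
    intro k K hk hky hK
    have : ∀ H ∈ F, lin H (k - p) = L H k := fun H hH => by rw [lin_sub, hp1 H hH, sub_zero]
    constructor
    · rw [this K hK]
      exact (mem_sep.1 (hky ▸ Finset.mem_singleton_self K : K ∈ sep A k y)).2.1
    · intro H hH h1
      rw [this H hH, hk.pos_iff (hFA hH)]
      intro h2
      have : H ∈ sep A k y := mem_sep.2 ⟨hFA hH, h2, hFy H hH⟩
      rw [hky, Finset.mem_singleton] at this
      exact h1 this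
  obtain ⟨s1, s2⟩ := sgn hk hky hK
  obtain ⟨s1', s2'⟩ := sgn hk' hky' hK'
  have hw : ∀ H ∈ F, 0 < lin H (z - p) := fun H hH => by
    rw [lin_sub, hp1 H hH, sub_zero]
    exact (pos_iff_pos_of_mul_pos (hzy H (hFA hH))).2 (hFy H hH)
  -- Five points around `p`. The direction `-(z - p)` is negative on all of `F`, the directions of
  -- `k` and `k'` are negative on a single wall, and their opposites are positive on a single wall.
  -- They supply the intermediate chambers of both paths to `y`.
  obtain ⟨t, ⟨⟨⟨tz, tk⟩, tk'⟩, tu⟩, tu'⟩ := ((((eventually_loc (v := -(z - p)) hp1 hp2).and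
    (eventually_loc (v := k - p) hp1 hp2)).and (eventually_loc (v := k' - p) hp1 hp2)).and
    (eventually_loc (v := -(k' - p)) hp1 hp2)).and
    (eventually_loc (v := -(k - p)) hp1 hp2) |>.exists
  have ty := loc_self hy hzy hFA hp1
  have nz : ∀ H ∈ F, lin H (k - p) ≠ 0 := fun H hH => by
    by_cases h : H = K
    · subst h; exact s1.ne
    · exact (s2 H hH h).ne'
  have nz' : ∀ H ∈ F, lin H (k' - p) ≠ 0 := fun H hH => by
    by_cases h : H = K'
    · subst h; exact s1'.ne
    · exact (s2' H hH h).ne'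
  have gz := tz.gen fun H hH => by rw [lin_neg]; exact (neg_lt_zero.2 (hw H hH)).ne
  have gk := tk.gen nz
  have gk' := tk'.gen nz'
  have gu := tu.gen fun H hH => by rw [lin_neg]; exact neg_ne_zero.2 (nz' H hH)
  have gu' := tu'.gen fun H hH => by rw [lin_neg]; exact neg_ne_zero.2 (nz H hH)
  have hzy' : sep A (p + t • -(z - p)) y = F := by
    rw [Loc.sep hFA tz ty fun H hH => by rw [lin_neg]; rintro ⟨h1, h2⟩; linarith [hw H hH]]
    refine Finset.filter_true_of_mem fun H hH => ?_
    rw [lin_neg]; exact ⟨neg_lt_zero.2 (hw H hH), hw H hH⟩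
  have hky1 : sep A (p + t • (k - p)) y = {K} := by
    rw [Loc.sep hFA tk ty fun H hH h => by linarith [hw H hH]]
    ext H
    simp only [Finset.mem_filter, Finset.mem_singleton]
    constructor
    · rintro ⟨h1, h2, -⟩
      by_contra h3
      linarith [s2 H h1 h3]
    · rintro rfl
      exact ⟨hK, s1, hw _ hK⟩
  have hky1' : sep A (p + t • (k' - p)) y = {K'} := by
    rw [Loc.sep hFA tk' ty fun H hH h => by linarith [hw H hH]]
    ext H
    simp only [Finset.mem_filter, Finset.mem_singleton]
    constructor
    · rintro ⟨h1, h2, -⟩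
      by_contra h3
      linarith [s2' H h1 h3]
    · rintro rfl
      exact ⟨hK', s1', hw _ hK'⟩
  have from_z : ∀ {v w : Fin n → ℝ}, Loc A F y v w →
      sep A (p + t • -(z - p)) w = F.filter fun H => 0 < lin H v := by
    intro v w h
    rw [Loc.sep hFA tz h fun H hH => by rw [lin_neg]; rintro ⟨h1, h2⟩; linarith [hw H hH]]
    refine Finset.filter_congr fun H hH => ?_
    rw [lin_neg]
    exact ⟨fun h => h.2, fun h => ⟨neg_lt_zero.2 (hw H hH), h⟩⟩
  have hpair : ({K, K'} : Finset (Wall n)) ⊆ F := by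
    intro H; simp only [Finset.mem_insert, Finset.mem_singleton]; rintro (rfl | rfl) <;> assumption
  have h2c : 2 ≤ F.card := (Finset.card_pair hne) ▸ Finset.card_le_card hpair
  rcases (by omega : F.card = 2 ∨ F.card = 3) with hc | hc
  · have hFe : F = {K, K'} := (Finset.eq_of_subset_of_card_le hpair
      (by rw [hc, Finset.card_pair hne])).symm
    refine Flip.two _ _ _ gz gk gk' (hzy' ▸ hFs) (by rw [hzy', hc]) ?_ hky1 ?_ hky1'
    · rw [from_z tk]
      ext H
      rw [Finset.mem_filter, Finset.mem_singleton]
      constructor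
      · rintro ⟨h1, h2⟩
        rw [hFe] at h1
        rcases Finset.mem_insert.1 h1 with rfl | h1
        · linarith
        · exact Finset.mem_singleton.1 h1
      · rintro rfl; exact ⟨hK', s2 _ hK' hne.symm⟩
    · rw [from_z tk']
      ext H
      rw [Finset.mem_filter, Finset.mem_singleton]
      constructor
      · rintro ⟨h1, h2⟩
        rw [hFe] at h1
        rcases Finset.mem_insert.1 h1 with h1 | h1
        · exact h1
        · rw [Finset.mem_singleton.1 h1] at h2; linarith
      · rintro rfl; exact ⟨hK, s2' _ hK hne⟩
  -- With three walls, one path runs through the opposite of `k'` and then `k`, the other one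
  -- through the opposite of `k` and then `k'`. The third wall is crossed in the middle of both.
  · obtain ⟨K₃, hK3⟩ : ∃ K₃, F \ {K, K'} = {K₃} := by
      rw [← Finset.card_eq_one, Finset.card_sdiff_of_subset hpair, hc, Finset.card_pair hne]
    have h3m : K₃ ∈ F ∧ K₃ ≠ K ∧ K₃ ≠ K' := by
      have : K₃ ∈ F \ {K, K'} := by simp [hK3]
      simpa using this
    have hcase : ∀ H ∈ F, H = K ∨ H = K' ∨ H = K₃ := by
      intro H hH
      by_contra h
      push Not at h
      have : H ∈ F \ {K, K'} := by simp [hH, h.1, h.2.1]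
      rw [hK3, Finset.mem_singleton] at this
      exact h.2.2 this
    have a3 := s2 K₃ h3m.1 h3m.2.1
    have a3' := s2' K₃ h3m.1 h3m.2.2
    have a2 := s2 K' hK' hne.symm
    have a2' := s2' K hK hne
    refine Flip.three K₃ _ _ _ _ _ gz gu gk gu' gk' (hzy' ▸ hFs) (by rw [hzy', hc])
      ?_ ?_ hky1 ?_ ?_ hky1'
    · rw [from_z tu]
      ext H
      rw [Finset.mem_filter, Finset.mem_singleton, lin_neg]
      constructor
      · rintro ⟨h1, h2⟩
        rcases hcase H h1 with rfl | rfl | rfl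
        · linarith
        · rfl
        · linarith
      · rintro rfl; exact ⟨hK', by linarith⟩
    · rw [Loc.sep hFA tu tk fun H hH => ?_]
      · ext H
        rw [Finset.mem_filter, Finset.mem_singleton, lin_neg]
        constructor
        · rintro ⟨h1, h2, h3⟩
          rcases hcase H h1 with rfl | rfl | rfl
          · linarith
          · linarith
          · rfl
        · rintro rfl; exact ⟨h3m.1, by linarith, a3⟩
      · rw [lin_neg]
        rintro ⟨h2, h3⟩
        rcases hcase H hH with rfl | rfl | rfl <;> linarith
    · rw [from_z tu']
      ext H
      rw [Finset.mem_filter, Finset.mem_singleton, lin_neg]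
      constructor
      · rintro ⟨h1, h2⟩
        rcases hcase H h1 with rfl | rfl | rfl
        · rfl
        · linarith
        · linarith
      · rintro rfl; exact ⟨hK, by linarith⟩
    · rw [Loc.sep hFA tu' tk' fun H hH => ?_]
      · ext H
        rw [Finset.mem_filter, Finset.mem_singleton, lin_neg]
        constructor
        · rintro ⟨h1, h2, h3⟩
          rcases hcase H h1 with rfl | rfl | rfl
          · linarith
          · linarith
          · rfl
        · rintro rfl; exact ⟨h3m.1, by linarith, a3'⟩
      · rw [lin_neg]
        rintro ⟨h2, h3⟩
        rcases hcase H hH with rfl | rfl | rfl <;> linarith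

end WKLRW

end

/-! ### Moving the end of a line: last walls are connected by flips -/

noncomputable section

namespace WKLRW

open Filter Topology Wall

variable {n : ℕ} {A : Finset (Wall n)}

theorem rho_line (x : Fin n → ℝ) (H : Wall n) (u v : Fin n → ℝ) (t : ℝ) :
    rho x H (u + t • (v - u)) = rho x H u + t * (rho x H v - rho x H u) := by
  simp only [rho, L_line]; ring

theorem continuous_rho (x : Fin n → ℝ) (H : Wall n) : Continuous (rho x H) :=
  (continuous_L H).div_const _

theorem isOpen_same (y : Fin n → ℝ) : IsOpen {z | Same A z y} := by
  have : {z | Same A z y} = ⋂ H ∈ A, {z | 0 < L H z * L H y} := by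
    ext z; simp [Same]
  rw [this]
  exact isOpen_biInter_finset fun H _ =>
    isOpen_lt continuous_const ((continuous_L H).mul continuous_const)

theorem isOpen_rho_lt (x : Fin n → ℝ) (s : Finset (Wall n × Wall n)) :
    IsOpen {z | ∀ p ∈ s, rho x p.1 z < rho x p.2 z} := by
  have : {z | ∀ p ∈ s, rho x p.1 z < rho x p.2 z} =
      ⋂ p ∈ s, {z | rho x p.1 z < rho x p.2 z} := by
    ext z; simp
  rw [this]
  exact isOpen_biInter_finset fun p _ => isOpen_lt (continuous_rho x _) (continuous_rho x _)

/-- If the ratios agreed everywhere, both walls would have the same points, hence be equal up to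
orientation; and of two opposite walls only one separates in the given direction. -/
theorem exists_rho_ne (hA : IsArr A) {x y : Fin n → ℝ} {H K : Wall n} (hH : H ∈ sep A x y)
    (hK : K ∈ sep A x y) (hne : H ≠ K) : ∃ z, rho x H z - rho x K z ≠ 0 := by
  by_contra h
  push Not at h
  obtain ⟨h1, h2, h3⟩ := mem_sep.1 hH
  obtain ⟨h1', h2', h3'⟩ := mem_sep.1 hK
  have h0 : ∀ z, L H z = 0 ↔ L K z = 0 := by
    intro z
    have := sub_eq_zero.1 (h z)
    rw [rho, rho] at this
    constructor
    · intro h5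
      rw [h5, zero_div, eq_comm, div_eq_zero_iff] at this
      exact this.resolve_right h2'.ne
    · intro h5
      rw [h5, zero_div, div_eq_zero_iff] at this
      exact this.resolve_right h2.ne
  rcases eq_or_eq_opp (hA.ne H h1) (hA.ne K h1') h0 with h4 | h4
  · exact hne h4
  · rw [h4, L_opp] at h2
    have := (mem_sep.1 hH).2.2
    rw [h4, L_opp] at this
    linarith

open Classical in
/-- The pairs of different walls that separate two points. -/
def sepPairs (A : Finset (Wall n)) (x y : Fin n → ℝ) : Finset (Wall n × Wall n) :=
  (sep A x y ×ˢ sep A x y).filter fun p => p.1 ≠ p.2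

theorem mem_sepPairs {x y : Fin n → ℝ} {p : Wall n × Wall n} :
    p ∈ sepPairs A x y ↔ p.1 ∈ sep A x y ∧ p.2 ∈ sep A x y ∧ p.1 ≠ p.2 := by
  simp [sepPairs, and_assoc]

theorem exists_generic_mem (hA : IsArr A) (x y : Fin n → ℝ) {U : Set (Fin n → ℝ)} (hU : IsOpen U)
    (hU' : U.Nonempty) :
    ∃ z ∈ U, ∀ H ∈ sep A x y, ∀ K ∈ sep A x y, H ≠ K → rho x H z ≠ rho x K z := by
  obtain ⟨z, hz, h⟩ := exists_avoid (sepPairs A x y) (fun p z => rho x p.1 z - rho x p.2 z)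
    (fun p _ u v t => by simp only [rho_line]; ring)
    (fun p hp => by
      obtain ⟨h1, h2, h3⟩ := mem_sepPairs.1 hp
      exact exists_rho_ne hA h1 h2 h3) hU hU'
  exact ⟨z, hz, fun H hH K hK hne => sub_ne_zero.1 (h (H, K) (mem_sepPairs.2 ⟨hH, hK, hne⟩))⟩

/-- Perturb `z` within the chamber of `y` so that all ratios become different and those below the
maximum stay below it. Then a single wall is last, and it was among the last walls before. -/
theorem exists_lastWall (hA : IsArr A) {x y z : Fin n → ℝ} (hx : OffWalls A x) (hy : OffWalls A y)
    (hzy : Same A z y) (hne : (sep A x y).Nonempty) :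
    ∃ K ∈ lastSet A x y z, LastWall A y K := by
  classical
  obtain ⟨M, hM, hMmax⟩ := Finset.exists_max_image _ (fun H => rho x H z) hne
  have hMl : M ∈ lastSet A x y z := mem_lastSet.2 ⟨hM, hMmax⟩
  let s := (sep A x y ×ˢ lastSet A x y z).filter fun p => p.1 ∉ lastSet A x y z
  have hs : ∀ p ∈ s, rho x p.1 z < rho x p.2 z := by
    intro p hp
    simp only [s, Finset.mem_filter, Finset.mem_product] at hp
    obtain ⟨⟨h1, h2⟩, h3⟩ := hp
    by_contra h4
    exact h3 (mem_lastSet.2 ⟨h1, fun G hG => ((mem_lastSet.1 h2).2 G hG).trans (not_lt.1 h4)⟩)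
  obtain ⟨z', ⟨h1, h2⟩, h3⟩ := exists_generic_mem hA x y
    ((isOpen_same (A := A) y).inter (isOpen_rho_lt x s)) ⟨z, hzy, hs⟩
  obtain ⟨K, hK, hKmax⟩ := Finset.exists_max_image _ (fun H => rho x H z') hne
  have hKl : K ∈ lastSet A x y z := by
    by_contra h4
    have := h2 (K, M) (by simp [s, hK, hMl, h4])
    linarith [hKmax M hM]
  refine ⟨K, hKl, lastWall_of_lastSet_eq hA hx hy h1 (x := x) ?_⟩
  ext H
  rw [mem_lastSet, Finset.mem_singleton]
  constructor
  · rintro ⟨h4, h5⟩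
    by_contra h6
    exact h3 H h4 K hK h6 (le_antisymm (hKmax H h4) (h5 K hK))
  · rintro rfl
    exact ⟨hK, hKmax⟩

theorem exists_last_step (hA : IsArr A) {x y : Fin n → ℝ} (hx : OffWalls A x) (hy : OffWalls A y)
    (hne : (sep A x y).Nonempty) : ∃ K ∈ sep A x y, LastWall A y K := by
  obtain ⟨K, hK, h⟩ := exists_lastWall hA hx hy (same_self hy) hne
  exact ⟨K, (mem_lastSet.1 hK).1, h⟩

/-- The wall meets the vertex `w`. -/
def Touches (H : Wall n) (w : Option (Fin n)) : Prop := H.1 = w ∨ H.2.1 = w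

/-- A vertex of the first edge is not a vertex of the other two edges. -/
def Leaf (H K G : Wall n) : Prop := ∃ w, Touches H w ∧ ¬ Touches K w ∧ ¬ Touches G w

open Classical in
theorem lin_indicator (H : Wall n) (w : Option (Fin n)) :
    lin H (ofVertices fun o => if o = w then 1 else 0) =
      (if H.1 = w then 1 else 0) - if H.2.1 = w then 1 else 0 := by
  have h := L_ofVertices H fun o => if o = w then 1 else 0
  have : L H (ofVertices fun o => if o = w then (1 : ℝ) else 0) =
      lin H (ofVertices fun o => if o = w then 1 else 0) - H.2.2 := rfl
  linarith

/-- Moving only the vertex that `H` does not share changes the first summand and neither of the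
others. -/
theorem Leaf.exists_ne {H K G : Wall n} (h : Leaf H K G) (hH : H.1 ≠ H.2.1) {a : ℝ} (ha : a ≠ 0)
    (b c : ℝ) : ∃ z, a * L H z + b * L K z + c * L G z ≠ 0 := by
  classical
  obtain ⟨w, h1, h2, h3⟩ := h
  simp only [Touches, not_or] at h1 h2 h3
  by_contra h4
  push Not at h4
  have e1 := h4 0
  have e2 := h4 (0 + (1 : ℝ) • ofVertices fun o => if o = w then 1 else 0)
  simp only [L_add_smul, lin_indicator] at e2
  rw [if_neg h2.1, if_neg h2.2, if_neg h3.1, if_neg h3.2] at e2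
  have e3 : a * ((if H.1 = w then 1 else 0) - if H.2.1 = w then 1 else 0) = 0 := by linarith
  rcases mul_eq_zero.1 e3 with e3 | e3
  · exact ha e3
  · rcases h1 with h1 | h1
    · rw [if_pos h1, if_neg (fun h => hH (h1.trans h.symm))] at e3; norm_num at e3
    · rw [if_pos h1, if_neg (fun h => hH (h.trans h1.symm))] at e3; norm_num at e3

/-- Among four edges there are three that do not form a triangle. -/
theorem exists_leaf {V : Type*} {a b c d a' b' c' d' : V} (ha : a ≠ a') (hb : b ≠ b') 
    (hd : d ≠ d') (hab : ¬(a = b ∧ a' = b') ∧ ¬(a = b' ∧ a' = b))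
    (had : ¬(a = d ∧ a' = d') ∧ ¬(a = d' ∧ a' = d))
    (hbc : ¬(b = c ∧ b' = c') ∧ ¬(b = c' ∧ b' = c)) (hbd : ¬(b = d ∧ b' = d') ∧ ¬(b = d' ∧ b' = d))
    (hcd : ¬(c = d ∧ c' = d') ∧ ¬(c = d' ∧ c' = d))
    (h1 : ∀ w, (a = w ∨ a' = w) → (b = w ∨ b' = w) ∨ (c = w ∨ c' = w))
    (h2 : ∀ w, (b = w ∨ b' = w) → (a = w ∨ a' = w) ∨ (c = w ∨ c' = w))
    (h3 : ∀ w, (c = w ∨ c' = w) → (a = w ∨ a' = w) ∨ (b = w ∨ b' = w))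
    (h4 : ∀ w, (a = w ∨ a' = w) → (b = w ∨ b' = w) ∨ (d = w ∨ d' = w))
    (h5 : ∀ w, (b = w ∨ b' = w) → (a = w ∨ a' = w) ∨ (d = w ∨ d' = w)) : False := by
  -- The conditions are used at the end points only. They force `a` and `b` to share one vertex and
  -- both `c` and `d` to join the two free ends, so `c` and `d` would be the same edge.
  have e1 := h1 a (Or.inl rfl)
  have e2 := h1 a' (Or.inr rfl)
  have e3 := h2 b (Or.inl rfl)
  have e4 := h2 b' (Or.inr rfl)
  have e5 := h3 c (Or.inl rfl)
  have e6 := h3 c' (Or.inr rfl)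
  have e7 := h4 a (Or.inl rfl)
  have e8 := h4 a' (Or.inr rfl)
  have e9 := h5 b (Or.inl rfl)
  have e10 := h5 b' (Or.inr rfl)
  clear h1 h2 h3 h4 h5
  grind

/-- Walls with the same two vertices are parallel, so a common crossing on the line makes them
equal. With reversed vertices they would be opposite, and then they cannot both have `x` on the
negative side. -/
theorem edges_ne {x y z : Fin n → ℝ} (hzy : Same A z y) {H K : Wall n}
    (hne : H ≠ K) (hH : H ∈ lastSet A x y z) (hK : K ∈ lastSet A x y z) :
    ¬(H.1 = K.1 ∧ H.2.1 = K.2.1) ∧ ¬(H.1 = K.2.1 ∧ H.2.1 = K.1) := by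
  obtain ⟨h1, h2⟩ := mem_lastSet.1 hH
  obtain ⟨h1', h2'⟩ := mem_lastSet.1 hK
  obtain ⟨e0, e1, e2⟩ := mem_sep.1 (hzy.sep_eq (z := x) ▸ h1)
  obtain ⟨e0', e1', e2'⟩ := mem_sep.1 (hzy.sep_eq (z := x) ▸ h1')
  have hr : rho x H z = rho x K z := le_antisymm (h2' H h1) (h2 K h1')
  have hneg : rho x H z < 0 := div_neg_of_pos_of_neg e2 e1
  have f1 : L H z = rho x H z * L H x := by rw [rho, div_mul_cancel₀ _ e1.ne]
  have f2 : L K z = rho x H z * L K x := by rw [hr, rho, div_mul_cancel₀ _ e1'.ne]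
  obtain ⟨a, b, c⟩ := H
  obtain ⟨a', b', c'⟩ := K
  generalize rho x (a, b, c) z = r at *
  simp only [L] at e1 e1' f1 f2
  constructor
  · rintro ⟨g1, g2⟩
    simp only at g1 g2
    subst g1 g2
    have : (c' - c) * (1 - r) = 0 := by linarith
    rcases mul_eq_zero.1 this with h | h
    · exact hne (by rw [sub_eq_zero.1 h])
    · linarith
  · rintro ⟨g1, g2⟩
    simp only at g1 g2
    subst g1 g2
    have : (c' + c) * (1 - r) = 0 := by linarith
    rcases mul_eq_zero.1 this with h | h
    · linarith
    · linarith

/-- Four simultaneous walls would be four different edges, three of which do not form a triangle by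
`exists_leaf`. Such a triple has a leaf, and its coincidence is excluded. -/
theorem card_lastSet_le (hA : IsArr A) {x y z : Fin n → ℝ} (hzy : Same A z y)
    (h : ∀ H ∈ sep A x y, ∀ K ∈ sep A x y, ∀ G ∈ sep A x y, K ≠ G → Leaf H K G →
      ¬ (rho x H z = rho x K z ∧ rho x H z = rho x G z)) : (lastSet A x y z).card ≤ 3 := by
  classical
  by_contra hc
  push Not at hc
  obtain ⟨d, hd⟩ := Finset.card_pos.1 (by omega : 0 < (lastSet A x y z).card)
  have hc' : 2 < ((lastSet A x y z).erase d).card := by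
    rw [Finset.card_erase_of_mem hd]; omega
  obtain ⟨a, b, c, ha, hb, hc, hab, hac, hbc⟩ := Finset.two_lt_card_iff.1 hc'
  obtain ⟨had, ha⟩ := Finset.mem_erase.1 ha
  obtain ⟨hbd, hb⟩ := Finset.mem_erase.1 hb
  obtain ⟨hcd, hc⟩ := Finset.mem_erase.1 hc
  have hs : ∀ H ∈ lastSet A x y z, H ∈ sep A x y := fun H hH => (mem_lastSet.1 hH).1
  have heq : ∀ H ∈ lastSet A x y z, ∀ K ∈ lastSet A x y z, rho x H z = rho x K z :=
    fun H hH K hK => le_antisymm ((mem_lastSet.1 hK).2 H (hs H hH))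
      ((mem_lastSet.1 hH).2 K (hs K hK))
  have hn : ∀ H ∈ lastSet A x y z, H.1 ≠ H.2.1 := fun H hH => hA.ne H (mem_sep.1 (hs H hH)).1
  have hl : ∀ H ∈ lastSet A x y z, ∀ K ∈ lastSet A x y z, ∀ G ∈ lastSet A x y z, K ≠ G →
      ∀ w, Touches H w → Touches K w ∨ Touches G w := by
    intro H hH K hK G hG hKG w hw
    by_contra h5
    push Not at h5
    exact h H (hs H hH) K (hs K hK) G (hs G hG) hKG ⟨w, hw, h5.1, h5.2⟩
      ⟨heq H hH K hK, heq H hH G hG⟩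
  exact exists_leaf (hn a ha) (hn b hb) (hn d hd) (edges_ne hzy hab ha hb)
    (edges_ne hzy had ha hd) (edges_ne hzy hbc hb hc)
    (edges_ne hzy hbd hb hd) (edges_ne hzy hcd hc hd) (hl a ha b hb c hc hbc) (hl b hb a ha c hc hac)
    (hl c hc a ha b hb hab) (hl a ha b hb d hd hbd) (hl b hb a ha d hd had)

/-- A chamber has points from which a given wall is the closest one. -/
theorem exists_near_wall (hA : IsArr A) {x y : Fin n → ℝ} (hy : OffWalls A y)
    {K : Wall n} (hK : K ∈ sep A x y) (hl : LastWall A y K) :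
    ∃ z, Same A z y ∧ ∀ H ∈ sep A x y, H ≠ K → rho x H z < rho x K z := by
  obtain ⟨k, hk, hky⟩ := hl
  have hKk : K ∈ sep A k y := by simp [hky]
  obtain ⟨hKA, k1, k2⟩ := mem_sep.1 hKk
  have kx := (mem_sep.1 hK).2.1
  -- The segment from `k` to `y` meets `K` at the time `T`. No other wall separates its ends, so
  -- there `p` is on the side of `y`.
  set T := L K k / (L K k - L K y) with hT
  have hT0 : 0 < T := div_pos_of_neg_of_neg k1 (by linarith)
  have hT1 : T < 1 := by rw [hT, div_lt_one_of_neg (by linarith)]; linarith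
  set p := k + T • (y - k) with hp
  have hpK : L K p = 0 := by
    rw [hp, L_line, hT]
    have : L K k - L K y ≠ 0 := by linarith
    field_simp; ring
  have hpos : ∀ H ∈ A, H ≠ K → H.opp ≠ K → 0 < L H p * L H y := by
    intro H hH h1 h2
    have h3 : H ∉ sep A k y := by rw [hky]; simpa using h1
    have h4 : H.opp ∉ sep A k y := by rw [hky]; simpa using h2
    rw [opp_mem_sep hA] at h4
    rw [mem_sep] at h3 h4
    rw [hp, L_line]
    have e : L H k + T * (L H y - L H k) = (1 - T) * L H k + T * L H y := by ring
    rw [e]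
    rcases lt_or_gt_of_ne (hk H hH) with h5 | h5 <;> rcases lt_or_gt_of_ne (hy H hH) with h6 | h6
    · exact mul_pos_of_neg_of_neg (by nlinarith) h6
    · exact absurd ⟨hH, h5, h6⟩ h3
    · exact absurd ⟨hH, h6, h5⟩ h4
    · exact mul_pos (by nlinarith) h6
  have hFA : ({K} : Finset (Wall n)) ⊆ A := by simpa using hKA
  have ev1 := eventually_loc (A := A) (F := {K}) (y := y) (z := p) (v := y - p)
    (by simpa using hpK) (by simpa using hpos)
  -- At `p` the ratio of `K` is zero and those of the other separating walls are negative. The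
  -- strict inequality survives a small step towards `y`.
  have ev2 : ∀ᶠ t : ℝ in 𝓝[>] 0, ∀ H ∈ sep A x y, H ≠ K →
      rho x H (p + t • (y - p)) < rho x K (p + t • (y - p)) := by
    rw [Filter.eventually_all_finset]
    intro H hH
    by_cases h1 : H = K
    · simp [h1]
    have hc : ∀ G, Continuous fun t : ℝ => rho x G (p + t • (y - p)) := fun G =>
      (continuous_rho x G).comp (by fun_prop)
    have h2 : rho x H (p + (0 : ℝ) • (y - p)) < rho x K (p + (0 : ℝ) • (y - p)) := by
      simp only [zero_smul, add_zero]
      rw [rho, rho, hpK, zero_div]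
      obtain ⟨g1, g2, g3⟩ := mem_sep.1 hH
      refine div_neg_of_pos_of_neg (pos_of_mul_pos_left (hpos H g1 h1 fun h => ?_) g3.le) g2
      rw [← h, L_opp] at kx
      linarith
    have := ((hc H).continuousAt (x := 0)).eventually_lt ((hc K).continuousAt (x := 0)) h2
    exact (this.filter_mono nhdsWithin_le_nhds).mono fun t ht _ => ht
  obtain ⟨t, h1, h2⟩ := (ev1.and ev2).exists
  refine ⟨_, fun H hH => ?_, h2⟩
  have e : lin K (y - p) = L K y := by rw [lin_sub, hpK, sub_zero]
  have hK0 : 0 < L K (p + t • (y - p)) := (h1.pos K (by simp)).2 (by rw [e]; exact k2)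
  by_cases h3 : H = K
  · rw [h3]; exact mul_pos hK0 k2
  by_cases h4 : H.opp = K
  · have := mul_pos hK0 k2
    rw [← h4] at this
    simpa using this
  · exact h1.out H hH (by simpa using h3) (by simpa using h4)

theorem Same.line {x y z : Fin n → ℝ} (hx : Same A x z) (hy : Same A y z) {t : ℝ}
    (ht : t ∈ Set.Icc (0 : ℝ) 1) : Same A (x + t • (y - x)) z := by
  intro H hH
  have h1 := hx H hH
  have h2 := hy H hH
  rw [L_line]
  have e : (L H x + t * (L H y - L H x)) * L H z =
      (1 - t) * (L H x * L H z) + t * (L H y * L H z) := by ring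
  rw [e]
  rcases eq_or_lt_of_le ht.1 with h | h
  · rw [← h]; simpa using h1
  · have := mul_pos h h2
    have := mul_nonneg (sub_nonneg.2 ht.2) h1.le
    linarith

/-- The last walls on the ways from `x` to `y` are connected by flips. -/
theorem connected_flips (hA : IsArr A) {x y : Fin n → ℝ} (hx : OffWalls A x) (hy : OffWalls A y)
    {K K' : Wall n} (hK : K ∈ sep A x y) (hK' : K' ∈ sep A x y) (hl : LastWall A y K)
    (hl' : LastWall A y K') : Relation.ReflTransGen (Flip A x y) K K' := by
  classical
  set S := sep A x y with hS
  have openU : ∀ K : Wall n, IsOpen ({z | Same A z y} ∩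
      {z | ∀ p ∈ (S.erase K).image fun H => (H, K), rho x p.1 z < rho x p.2 z}) :=
    fun K => (isOpen_same y).inter (isOpen_rho_lt x _)
  have neU : ∀ K ∈ S, LastWall A y K → ({z | Same A z y} ∩
      {z | ∀ p ∈ (S.erase K).image fun H => (H, K), rho x p.1 z < rho x p.2 z}).Nonempty := by
    intro K hK hl
    obtain ⟨z, h1, h2⟩ := exists_near_wall hA hy hK hl
    refine ⟨z, h1, fun p hp => ?_⟩
    simp only [Finset.mem_image, Finset.mem_erase] at hp
    obtain ⟨H, ⟨h3, h4⟩, rfl⟩ := hp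
    exact h2 H h4 h3
  obtain ⟨q, ⟨hq1, hq2⟩, hq3⟩ := exists_generic_mem hA x y (openU K') (neU K' hK' hl')
  -- Along the segment from `p` to `q` both differences of ratios are affine in the time. If they
  -- vanish together before the time `1`, eliminating the time gives `f = 0` at `p`. The leaf of `H`
  -- and the different ratios at `q` show that `f` is not identically zero, so `p` can be chosen to
  -- exclude this.
  let f : Wall n × Wall n × Wall n → (Fin n → ℝ) → ℝ := fun p z =>
    (rho x p.1 q - rho x p.2.2 q) * (rho x p.1 z - rho x p.2.1 z) -
      (rho x p.1 q - rho x p.2.1 q) * (rho x p.1 z - rho x p.2.2 z)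
  obtain ⟨p, ⟨hp1, hp2⟩, hp3⟩ := exists_avoid
    ((S ×ˢ S ×ˢ S).filter fun p => Leaf p.1 p.2.1 p.2.2 ∧ p.2.1 ≠ p.2.2) f
    (fun p _ u v t => by simp only [f, rho_line]; ring)
    (fun p hp => by
      obtain ⟨H, K, G⟩ := p
      simp only [Finset.mem_filter, Finset.mem_product] at hp
      obtain ⟨⟨hH, hK, hG⟩, hleaf, hKG⟩ := hp
      have hHA := mem_sep.1 hH
      have ha : (rho x K q - rho x G q) / L H x ≠ 0 :=
        div_ne_zero (sub_ne_zero.2 (hq3 K hK G hG hKG)) hHA.2.1.ne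
      obtain ⟨z, hz⟩ := hleaf.exists_ne (hA.ne H hHA.1) ha
        (-(rho x H q - rho x G q) / L K x) ((rho x H q - rho x K q) / L G x)
      refine ⟨z, fun h => hz (Eq.trans ?_ h)⟩
      simp only [f]
      generalize rho x H q = r1, rho x K q = r2, rho x G q = r3
      simp only [rho]
      ring) (openU K) (neU K hK hl)
  have uniq : ∀ (K : Wall n) z, K ∈ S →
      (∀ p ∈ (S.erase K).image fun H => (H, K), rho x p.1 z < rho x p.2 z) →
      lastSet A x y z = {K} := by
    intro K z hK h
    have h' : ∀ H ∈ S, H ≠ K → rho x H z < rho x K z := fun H hH hne =>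
      h (H, K) (Finset.mem_image_of_mem _ (Finset.mem_erase.2 ⟨hne, hH⟩))
    ext H
    rw [mem_lastSet, Finset.mem_singleton]
    constructor
    · rintro ⟨h1, h2⟩
      by_contra h3
      linarith [h2 K hK, h' H h1 h3]
    · rintro rfl
      refine ⟨hK, fun G hG => ?_⟩
      by_cases h4 : G = H
      · rw [h4]
      · exact (h' G hG h4).le
  let c : ℝ → Fin n → ℝ := fun t => p + t • (q - p)
  have hc : ∀ t ∈ Set.Icc (0 : ℝ) 1, Same A (c t) y := fun t ht => Same.line hp1 hq1 ht
  have hcard : ∀ t ∈ Set.Icc (0 : ℝ) 1, (lastSet A x y (c t)).card ≤ 3 := by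
    intro t ht
    by_cases ht1 : t = 1
    · have : c t = q := by simp [c, ht1]
      rw [this, uniq K' q hK' hq2]; simp
    refine card_lastSet_le hA (hc t ht) fun H hH K hK G hG hKG hleaf ⟨e1, e2⟩ => ?_
    simp only [c, rho_line] at e1 e2
    have h0 := hp3 (H, K, G) (by simp [hS, hH, hK, hG, hleaf, hKG])
    refine h0 ?_
    have : (1 - t) * f (H, K, G) p = 0 := by
      simp only [f]
      linear_combination (rho x H q - rho x G q) * e1 - (rho x H q - rho x K q) * e2
    exact (mul_eq_zero.1 this).resolve_left (fun h => ht1 (by linarith))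
  -- `P` joins times whose last walls are connected by flips. It holds locally, because near a given
  -- time the set of last walls can only shrink, and within one such set any two last walls differ
  -- by a single flip. The interval is connected.
  let P : ℝ → ℝ → Prop := fun t t' => ∀ K₁ ∈ lastSet A x y (c t), LastWall A y K₁ →
    ∀ K₂ ∈ lastSet A x y (c t'), LastWall A y K₂ → Relation.ReflTransGen (Flip A x y) K₁ K₂
  have hflip : ∀ t ∈ Set.Icc (0 : ℝ) 1, P t t := by
    intro t ht K₁ h1 l1 K₂ h2 l2
    by_cases hne : K₁ = K₂
    · rw [hne]
    · exact .single (flip_of_lastSet hA hx hy (hc t ht) (hcard t ht) hne h1 h2 l1 l2)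
  have hloc : ∀ t, ∀ᶠ t' in 𝓝 t, lastSet A x y (c t') ⊆ lastSet A x y (c t) := by
    intro t
    have : ∀ᶠ t' in 𝓝 t, ∀ H ∈ S, H ∉ lastSet A x y (c t) → H ∉ lastSet A x y (c t') := by
      rw [Filter.eventually_all_finset]
      intro H hH
      by_cases h1 : H ∈ lastSet A x y (c t)
      · simp [h1]
      have h2 : ∃ G ∈ S, rho x H (c t) < rho x G (c t) := by
        by_contra h3
        push Not at h3
        exact h1 (mem_lastSet.2 ⟨hH, h3⟩)
      obtain ⟨G, hG, h2⟩ := h2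
      have hcc : ∀ G, Continuous fun t : ℝ => rho x G (c t) := fun G =>
        (continuous_rho x G).comp (by fun_prop)
      filter_upwards [((hcc H).continuousAt (x := t)).eventually_lt ((hcc G).continuousAt) h2]
        with t' h4 _ h5
      linarith [(mem_lastSet.1 h5).2 G hG]
    filter_upwards [this] with t' h H hH
    by_contra h1
    exact h H (mem_lastSet.1 hH).1 h1 hH
  have key : P 0 1 := by
    refine isPreconnected_Icc.induction₂' (s := Set.Icc (0 : ℝ) 1) P ?_ ?_
      (by simp) (by simp)
    · intro t ht
      filter_upwards [(hloc t).filter_mono nhdsWithin_le_nhds] with t' h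
      exact ⟨fun K₁ h1 l1 K₂ h2 l2 => hflip t ht K₁ h1 l1 K₂ (h h2) l2,
        fun K₁ h1 l1 K₂ h2 l2 => hflip t ht K₁ (h h1) l1 K₂ h2 l2⟩
    · intro t u v ht hu hv htu huv K₁ h1 l1 K₂ h2 l2
      obtain ⟨K₃, h3, l3⟩ := exists_lastWall hA hx hy (hc u hu) ⟨K, hK⟩
      exact (htu K₁ h1 l1 K₃ h3 l3).trans (huv K₃ h3 l3 K₂ h2 l2)
  have e0 : c 0 = p := by simp [c]
  have e1 : c 1 = q := by simp [c]
  refine key K ?_ hl K' ?_ hl'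
  · rw [e0, uniq K p hK hp2]; simp
  · rw [e1, uniq K' q hK' hq2]; simp

end WKLRW

end

noncomputable section

namespace WKLRW

namespace Datum

open Wall

variable {R I : Type*} [CommRing R] {D : Datum R I}

/-! ### The walls of a residue sequence -/

namespace Str

/-- The solid string that a string follows; none for a red string. -/
def base : D.Str → Option (Fin D.n)
  | .solid k => some k
  | .ghost k _ => some k
  | .red _ => none

/-- The displacement of a string from the solid string that it follows. -/
def off : D.Str → ℝ
  | .solid _ => 0
  | .ghost _ ε => |D.σ ε|
  | .red m => D.κ m

theorem loc_eq (z : Fin D.n → ℝ) (S : D.Str) : D.loc z S = ext z S.base + S.off := by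
  cases S <;> simp [loc, base, off]

/-- The wall on which two strings meet; the first one is on the left on its negative side. -/
def wall (S T : D.Str) : Wall D.n := (S.base, T.base, T.off - S.off)

theorem L_wall (S T : D.Str) (z : Fin D.n → ℝ) : L (wall S T) z = D.loc z S - D.loc z T := by
  rw [loc_eq, loc_eq, L, wall]; ring

theorem base_ne_of_passes {x y : Fin D.n → ℝ} {S T : D.Str} (h : D.Passes x y S T) :
    S.base ≠ T.base := by
  intro h1
  obtain ⟨h2, h3⟩ := h
  rw [loc_eq, loc_eq, h1] at h2 h3
  linarith

/-- Renumbering the solid strings. -/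
def perm (w : Equiv.Perm (Fin D.n)) : D.Str → D.Str
  | .solid k => .solid (w k)
  | .ghost k ε => .ghost (w k) ε
  | .red m => .red m

theorem perm_symm_perm (w : Equiv.Perm (Fin D.n)) (S : D.Str) : (S.perm w.symm).perm w = S := by
  cases S <;> simp [perm]

theorem base_perm (w : Equiv.Perm (Fin D.n)) (S : D.Str) : (S.perm w).base = S.base.map w := by
  cases S <;> rfl

theorem off_perm (w : Equiv.Perm (Fin D.n)) (S : D.Str) : (S.perm w).off = S.off := by
  cases S <;> rfl

theorem loc_perm (w : Equiv.Perm (Fin D.n)) (S : D.Str) (z : Fin D.n → ℝ) :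
    D.loc z (S.perm w) = D.loc (z ∘ w) S := by
  cases S <;> rfl

theorem present_perm {w : Equiv.Perm (Fin D.n)} {i i' : Fin D.n → I} (h : ∀ k, i' (w k) = i k)
    (S : D.Str) : D.Present i' (S.perm w) ↔ D.Present i S := by
  cases S <;> simp [perm, Present, h]

end Str

open Str

theorem ResSeq.β_ne_zero (i : D.ResSeq) (k : Fin D.n) : D.β (i.1 k) ≠ 0 := by
  classical
  rw [← i.card_fiber]
  exact Finset.card_ne_zero.2 ⟨k, by simp⟩

theorem finite_present (i : D.ResSeq) : {S | D.Present i.1 S}.Finite := by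
  refine ((Set.finite_range (Str.solid (D := D))).union ((Set.finite_iUnion fun k =>
    ((D.finite_ghosts (i.1 k) (i.β_ne_zero k)).image (Str.ghost (D := D) k))).union
    (Set.finite_range (Str.red (D := D))))).subset ?_
  rintro (k | ⟨k, ε⟩ | m) hS
  · exact Or.inl ⟨k, rfl⟩
  · exact Or.inr (Or.inl (Set.mem_iUnion.2 ⟨k, ε, hS, rfl⟩))
  · exact Or.inr (Or.inr ⟨m, rfl⟩)

theorem finite_walls (i : D.ResSeq) : {H : Wall D.n | ∃ S T, D.Present i.1 S ∧ D.Present i.1 T ∧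
    S.base ≠ T.base ∧ H = wall S T}.Finite := by
  refine (((finite_present i).prod (finite_present i)).image fun p => wall p.1 p.2).subset ?_
  rintro _ ⟨S, T, hS, hT, -, rfl⟩
  exact ⟨(S, T), ⟨hS, hT⟩, rfl⟩

/-- The walls on which two strings of a diagram meet. -/
def walls (i : D.ResSeq) : Finset (Wall D.n) := (finite_walls i).toFinset

theorem mem_walls {i : D.ResSeq} {H : Wall D.n} : H ∈ walls i ↔
    ∃ S T, D.Present i.1 S ∧ D.Present i.1 T ∧ S.base ≠ T.base ∧ H = wall S T := by
  rw [walls, Set.Finite.mem_toFinset]; rfl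

theorem isArr_walls (i : D.ResSeq) : IsArr (walls i) where
  opp_mem H hH := by
    obtain ⟨S, T, hS, hT, hne, rfl⟩ := mem_walls.1 hH
    exact mem_walls.2 ⟨T, S, hT, hS, hne.symm, by simp [opp, wall]⟩
  ne H hH := by
    obtain ⟨S, T, hS, hT, hne, rfl⟩ := mem_walls.1 hH
    exact hne

/-- The walls that are crossed on the way from `x` to `y`. -/
abbrev sp (i : D.ResSeq) (x y : Fin D.n → ℝ) : Finset (Wall D.n) := sep (walls i) x y

theorem wall_mem_sp {i : D.ResSeq} {S T : D.Str} (hS : D.Present i.1 S) (hT : D.Present i.1 T)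
    {x y : Fin D.n → ℝ} : wall S T ∈ sp i x y ↔ D.Passes x y S T := by
  rw [mem_sep, L_wall, L_wall, Passes]
  constructor
  · rintro ⟨-, h1, h2⟩
    exact ⟨sub_neg.1 h1, sub_pos.1 h2⟩
  · intro h
    exact ⟨mem_walls.2 ⟨S, T, hS, hT, base_ne_of_passes h, rfl⟩, sub_neg.2 h.1, sub_pos.2 h.2⟩

theorem exists_of_mem_sp {i : D.ResSeq} {x y : Fin D.n → ℝ} {H : Wall D.n} (h : H ∈ sp i x y) :
    ∃ S T, D.Present i.1 S ∧ D.Present i.1 T ∧ D.Passes x y S T ∧ H = wall S T := by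
  obtain ⟨S, T, hS, hT, -, rfl⟩ := mem_walls.1 (mem_sep.1 h).1
  exact ⟨S, T, hS, hT, (wall_mem_sp hS hT).1 h, rfl⟩

theorem Generic.gen {i : D.ResSeq} {x : Fin D.n → ℝ} (h : D.Generic i.1 x) : OffWalls (walls i) x := by
  intro H hH h0
  obtain ⟨S, T, hS, hT, hne, rfl⟩ := mem_walls.1 hH
  rw [L_wall, sub_eq_zero] at h0
  exact hne (congrArg base (h hS hT h0))

/-- Strings that follow the same solid string keep their distance, so their positions are distinct
once they are distinct for one point. All other pairs have a wall. -/
theorem Generic.of_gen {i : D.ResSeq} {x x' : Fin D.n → ℝ} (h : D.Generic i.1 x)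
    (hx : OffWalls (walls i) x') : D.Generic i.1 x' := by
  intro S hS T hT hST
  by_cases hb : S.base = T.base
  · refine h hS hT ?_
    rw [loc_eq, loc_eq, hb] at hST ⊢
    linarith
  · exact absurd (by rw [L_wall, hST, sub_self]) (hx _ (mem_walls.2 ⟨S, T, hS, hT, hb, rfl⟩))

/-- This translates `Move.elementary`: the coincidence of two strings is the zero set of their wall,
and this set determines the wall up to orientation, which is fixed by the direction of the passage.
-/
theorem card_sp_le_one_iff {i : D.ResSeq} {x y : Fin D.n → ℝ} : (sp i x y).card ≤ 1 ↔
    ∀ S T S' T' : D.Str, D.Present i.1 S → D.Present i.1 T → D.Present i.1 S' → D.Present i.1 T' →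
      D.Passes x y S T → D.Passes x y S' T' →
      ∀ z : Fin D.n → ℝ, D.loc z S = D.loc z T ↔ D.loc z S' = D.loc z T' := by
  have e : ∀ (S T : D.Str) z, D.loc z S = D.loc z T ↔ L (wall S T) z = 0 := fun S T z => by
    rw [L_wall, sub_eq_zero]
  rw [Finset.card_le_one]
  constructor
  · intro h S T S' T' hS hT hS' hT' h1 h2 z
    rw [e, e, h _ ((wall_mem_sp hS hT).2 h1) _ ((wall_mem_sp hS' hT').2 h2)]
  · intro h H hH K hK
    obtain ⟨S, T, hS, hT, h1, rfl⟩ := exists_of_mem_sp hH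
    obtain ⟨S', T', hS', hT', h2, rfl⟩ := exists_of_mem_sp hK
    refine (eq_or_eq_opp (base_ne_of_passes h1) (base_ne_of_passes h2) fun z => ?_).resolve_right ?_
    · rw [← e, ← e]; exact h S T S' T' hS hT hS' hT' h1 h2 z
    · intro h3
      have h4 := (mem_sep.1 hK).2.1
      have h5 := (mem_sep.1 hH).2.1
      rw [h3, L_opp] at h5
      linarith

theorem walls_perm {i i' : D.ResSeq} {w : Equiv.Perm (Fin D.n)} (h : ∀ k, i'.1 (w k) = i.1 k)
    (H : Wall D.n) : (H.1.map w, H.2.1.map w, H.2.2) ∈ walls i' ↔ H ∈ walls i := by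
  have inj : Function.Injective (Option.map w) := Option.map_injective w.injective
  rw [mem_walls, mem_walls]
  constructor
  · rintro ⟨S, T, hS, hT, hne, h1⟩
    obtain ⟨a, b, c⟩ := H
    simp only [wall, Prod.mk.injEq] at h1
    have hb : ∀ S : D.Str, S.base = (S.perm w.symm).base.map w := fun S => by
      rw [← base_perm, perm_symm_perm]
    refine ⟨S.perm w.symm, T.perm w.symm, ?_, ?_, ?_, ?_⟩
    · rwa [← present_perm h, perm_symm_perm]
    · rwa [← present_perm h, perm_symm_perm]
    · intro h2; exact hne (by rw [hb S, hb T, h2])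
    · rw [wall, off_perm, off_perm, h1.2.2, ← inj (h1.1.trans (hb S)), ← inj (h1.2.1.trans (hb T))]
  · rintro ⟨S, T, hS, hT, hne, rfl⟩
    refine ⟨S.perm w, T.perm w, (present_perm h S).2 hS, (present_perm h T).2 hT, ?_, ?_⟩
    · rw [base_perm, base_perm]; exact fun h => hne (inj h)
    · simp [wall, base_perm, off_perm]

theorem ext_comp (w : Equiv.Perm (Fin D.n)) (z : Fin D.n → ℝ) (a : Option (Fin D.n)) :
    ext z (a.map w) = ext (z ∘ w) a := by
  cases a <;> rfl

/-- Each piece of a diagram has its own numbering of the strings. This allows all pieces to be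
described in the numbering at the bottom of the diagram. -/
theorem card_sp_perm {i i' : D.ResSeq} {w : Equiv.Perm (Fin D.n)} (h : ∀ k, i'.1 (w k) = i.1 k)
    (x y : Fin D.n → ℝ) : (sp i' x y).card = (sp i (x ∘ w) (y ∘ w)).card := by
  symm
  have e : ∀ (H : Wall D.n) z, L (H.1.map w, H.2.1.map w, H.2.2) z = L H (z ∘ w) := fun H z => by
    simp only [L, ext_comp]
  refine Finset.card_bij (fun H _ => (H.1.map w, H.2.1.map w, H.2.2)) ?_ ?_ ?_
  · intro H hH
    rw [mem_sep] at hH ⊢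
    rwa [walls_perm h, e, e]
  · rintro ⟨a, b, c⟩ _ ⟨a', b', c'⟩ _ h
    simp only [Prod.mk.injEq] at h ⊢
    have inj := Option.map_injective w.injective
    exact ⟨inj h.1, inj h.2.1, h.2.2⟩
  · intro H hH
    have hH' : ((H.1.map w.symm).map w, (H.2.1.map w.symm).map w, H.2.2) = H := by
      simp [Option.map_map]
    refine ⟨(H.1.map w.symm, H.2.1.map w.symm, H.2.2), ?_, hH'⟩
    rw [mem_sep] at hH ⊢
    rw [← walls_perm h, ← e, ← e, hH']
    exact hH

theorem generic_perm {i i' : D.ResSeq} {w : Equiv.Perm (Fin D.n)} (h : ∀ k, i'.1 (w k) = i.1 k)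
    {x : Fin D.n → ℝ} (hx : D.Generic i'.1 x) : D.Generic i.1 (x ∘ w) := by
  intro S hS T hT hST
  rw [← loc_perm, ← loc_perm] at hST
  have := hx ((present_perm h S).2 hS) ((present_perm h T).2 hT) hST
  rw [← perm_symm_perm w.symm S, ← perm_symm_perm w.symm T]
  simp only [Equiv.symm_symm]
  rw [this]

theorem lt_or_lt {i : D.ResSeq} {x : Fin D.n → ℝ} (hx : D.Generic i.1 x) {S T : D.Str}
    (hS : D.Present i.1 S) (hT : D.Present i.1 T) (hne : S ≠ T) :
    D.loc x S < D.loc x T ∨ D.loc x T < D.loc x S :=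
  lt_or_gt_of_ne fun h => hne (hx hS hT h)

/-- Both conditions say that no pair of strings crosses twice: `Between` speaks of the pairs that do
not cross from `x` to `z`, and `Red` of those that do. -/
theorem between_iff_red {i : D.ResSeq} {x y z : Fin D.n → ℝ} (hx : D.Generic i.1 x)
    (hy : D.Generic i.1 y) (hz : D.Generic i.1 z) :
    D.Between i.1 x y z ↔ Red (walls i) x y z := by
  constructor
  · intro h
    constructor
    · intro H hH
      obtain ⟨S, T, hS, hT, h1, rfl⟩ := exists_of_mem_sp hH
      refine (wall_mem_sp hS hT).2 ⟨h1.1, ?_⟩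
      refine (lt_or_lt hz hS hT (fun e => base_ne_of_passes h1 (e ▸ rfl))).resolve_left fun h2 => ?_
      exact lt_asymm h1.2 (h S T hS hT h1.1 h2)
    · intro H hH
      obtain ⟨S, T, hS, hT, h1, rfl⟩ := exists_of_mem_sp hH
      refine (wall_mem_sp hS hT).2 ⟨?_, h1.2⟩
      refine (lt_or_lt hx hS hT
        (fun e => base_ne_of_passes h1 (e ▸ rfl))).resolve_right fun h2 => ?_
      exact lt_asymm h1.1 (h T S hT hS h2 h1.2)
  · intro h S T hS hT h1 h2
    refine (lt_or_lt hy hS hT (fun e => ?_)).resolve_right fun h3 => ?_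
    · rw [e] at h1; exact lt_irrefl _ h1
    · have := (wall_mem_sp hS hT).1 (h.1 ((wall_mem_sp hS hT).2 ⟨h1, h3⟩))
      exact lt_asymm h2 this.2

theorem exists_passes_not_red {i : D.ResSeq} {x y z : Fin D.n → ℝ} (hx : D.Generic i.1 x)
    (hz : D.Generic i.1 z) (h : ¬ Red (walls i) x y z) :
    ∃ H ∈ sp i x y, H.opp ∈ sp i y z :=
  (not_red_iff (isArr_walls i) hx.gen hz.gen).1 h

/-- Without displacement, no strings cross. -/
theorem not_passes_self (x : Fin D.n → ℝ) (S T : D.Str) : ¬ D.Passes x x S T := by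
  rintro ⟨h1, h2⟩; exact lt_asymm h1 h2

/-! ### Letters: the crossings of non-zero degree -/

/-- The crossings that contribute to the degree. -/
inductive Letter (D : Datum R I) : Type _
  | solid (r s : Fin D.n) : Letter D
  | ghostRight (k : Fin D.n) (ε : D.Γ.Edge) (s : Fin D.n) : Letter D
  | ghostLeft (k : Fin D.n) (ε : D.Γ.Edge) (s : Fin D.n) : Letter D
  | redRight (k : Fin D.n) (c : Fin D.ℓ) : Letter D
  | redLeft (k : Fin D.n) (c : Fin D.ℓ) : Letter D

namespace Letter

/-- The string that is on the left at the bottom. -/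
def fst : D.Letter → D.Str
  | .solid r _ => .solid r
  | .ghostRight k ε _ => .ghost k ε
  | .ghostLeft _ _ s => .solid s
  | .redRight k _ => .solid k
  | .redLeft _ c => .red c

/-- The string that is on the right at the bottom. -/
def snd : D.Letter → D.Str
  | .solid _ s => .solid s
  | .ghostRight _ _ s => .solid s
  | .ghostLeft k ε _ => .ghost k ε
  | .redRight _ c => .red c
  | .redLeft k _ => .solid k

/-- The condition on the residues. -/
def Sig (i : Fin D.n → I) : D.Letter → Prop
  | .solid r s => i r = i s
  | .ghostRight k ε s => D.Γ.owner D.σ ε = i k ∧ D.Γ.partner D.σ ε = i s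
  | .ghostLeft k ε s => D.Γ.owner D.σ ε = i k ∧ D.Γ.partner D.σ ε = i s
  | .redRight k c => D.ρ c = i k
  | .redLeft k c => D.ρ c = i k

theorem Sig.present_fst {i : Fin D.n → I} {l : D.Letter} (h : l.Sig i) : D.Present i l.fst := by
  cases l <;> first | trivial | exact h.1

theorem Sig.present_snd {i : Fin D.n → I} {l : D.Letter} (h : l.Sig i) : D.Present i l.snd := by
  cases l <;> first | trivial | exact h.1

end Letter

/-- The crossing occurs on the way from `x` to `y`. -/
def Has (i : Fin D.n → I) (x y : Fin D.n → ℝ) (l : D.Letter) : Prop :=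
  l.Sig i ∧ D.Passes x y l.fst l.snd

theorem Has.mem_sp {i : D.ResSeq} {x y : Fin D.n → ℝ} {l : D.Letter} (h : Has i.1 x y l) :
    wall l.fst l.snd ∈ sp i x y := (wall_mem_sp h.1.present_fst h.1.present_snd).2 h.2

theorem has_iff_mem_sp {i : D.ResSeq} {x y : Fin D.n → ℝ} {l : D.Letter} (h : l.Sig i.1) :
    Has i.1 x y l ↔ wall l.fst l.snd ∈ sp i x y := by
  rw [wall_mem_sp h.present_fst h.present_snd, Has, and_iff_right h]

theorem owner_ne_partner (ε : D.Γ.Edge) : D.Γ.owner D.σ ε ≠ D.Γ.partner D.σ ε := by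
  have := ((D.Γ.arrow_iff ε.1.1 ε.1.2).1 (Or.inl ε.2)).1
  unfold SymQuiver.owner SymQuiver.partner
  split_ifs
  · exact this
  · exact this.symm

/-- A letter is determined by its wall. -/
theorem Letter.eq_of_wall_eq {i : Fin D.n → I} {x : Fin D.n → ℝ} (hx : D.Generic i x)
    {l l' : D.Letter} (hl : l.Sig i) (hl' : l'.Sig i) (h : wall l.fst l.snd = wall l'.fst l'.snd) :
    l = l' := by
  have pos : ∀ ε, 0 < |D.σ ε| := fun ε => abs_pos.2 (D.σ_ne_zero ε)
  -- The wall only sees the absolute value of the shift. Two edges with the same owner and equal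
  -- absolute values would have coinciding ghosts, against genericity. The two directions in which a
  -- ghost passes are told apart by the sign of the offset.
  have gh : ∀ k ε ε', D.Γ.owner D.σ ε = i k → D.Γ.owner D.σ ε' = i k → |D.σ ε| = |D.σ ε'| →
      ε = ε' := by
    intro k ε ε' h1 h2 h3
    have := @hx (.ghost k ε) h1 (.ghost k ε') h2 (by simp [loc, h3])
    cases this; rfl
  have inj := D.κ_strictMono.injective
  cases l <;> cases l' <;>
    simp only [wall, Letter.fst, Letter.snd, base, off, Prod.mk.injEq, Option.some.injEq,
      reduceCtorEq, false_and, and_false, zero_sub, sub_zero, neg_inj] at h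
  · rw [h.1, h.2.1]
  · linarith [pos ‹_›, h.2.2]
  · linarith [pos ‹_›, h.2.2]
  · linarith [pos ‹_›, h.2.2]
  · obtain ⟨rfl, rfl, h⟩ := h
    rw [gh _ _ _ hl.1 hl'.1 h]
  · rename_i ε _ _ ε' _; linarith [pos ε, pos ε', h.2.2]
  · linarith [pos ‹_›, h.2.2]
  · rename_i ε _ _ ε' _; linarith [pos ε, pos ε', h.2.2]
  · obtain ⟨rfl, rfl, h⟩ := h
    rw [gh _ _ _ hl.1 hl'.1 h]
  · rw [h.1, inj h.2.2]
  · rw [h.2.1, inj h.2.2]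

theorem has_unique {i : D.ResSeq} {x y : Fin D.n → ℝ} (hx : D.Generic i.1 x)
    (h : (sp i x y).card ≤ 1) {l l' : D.Letter} (hl : Has i.1 x y l) (hl' : Has i.1 x y l') :
    l = l' :=
  Letter.eq_of_wall_eq hx hl.1 hl'.1 (Finset.card_le_one.1 h _ hl.mem_sp _ hl'.mem_sp)

end Datum

end WKLRW

end

noncomputable section

namespace WKLRW

open MvPolynomial

/-! ### Rational functions -/

section Frac

variable (R : Type*) [CommRing R] (n : ℕ)

/-- The field of rational functions. -/
abbrev Rat : Type _ := FractionRing (MvPolynomial (Fin n) R)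

variable {R n}

/-- A polynomial as a rational function. -/
abbrev toRat : MvPolynomial (Fin n) R →ₐ[R] Rat R n := Algebra.algHom R _ _

theorem toRat_injective : Function.Injective (toRat : MvPolynomial (Fin n) R →ₐ[R] Rat R n) :=
  IsFractionRing.injective _ _

theorem toRat_inj {f g : MvPolynomial (Fin n) R} : toRat f = toRat g ↔ f = g :=
  toRat_injective.eq_iff

variable [IsDomain R]

/-- The action of permutations on rational functions. -/
def permRat (w : Equiv.Perm (Fin n)) : Rat R n →ₐ[R] Rat R n :=
  IsFractionRing.liftAlgHom (A := MvPolynomial (Fin n) R)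
    (g := toRat.comp (rename w : MvPolynomial (Fin n) R →ₐ[R] MvPolynomial (Fin n) R))
    (toRat_injective.comp (rename_injective w w.injective))

@[simp] theorem permRat_toRat (w : Equiv.Perm (Fin n)) (f : MvPolynomial (Fin n) R) :
    permRat w (toRat f) = toRat (rename w f) :=
  IsFractionRing.lift_algebraMap (A := MvPolynomial (Fin n) R) (K := Rat R n)
    (g := (toRat.comp (rename w : MvPolynomial (Fin n) R →ₐ[R] MvPolynomial (Fin n) R)).toRingHom)
    (toRat_injective.comp (rename_injective w w.injective)) f

theorem Rat.exists_div (z : Rat R n) : ∃ f g : MvPolynomial (Fin n) R, g ≠ 0 ∧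
    z = toRat f / toRat g := by
  obtain ⟨f, g, hg, rfl⟩ := IsFractionRing.div_surjective (A := MvPolynomial (Fin n) R) z
  exact ⟨f, g, nonZeroDivisors.ne_zero hg, rfl⟩

theorem algHom_ext_rat {φ ψ : Rat R n →ₐ[R] Rat R n} (h : ∀ f, φ (toRat f) = ψ (toRat f)) :
    φ = ψ := by
  refine AlgHom.ext fun z => ?_
  obtain ⟨f, g, -, rfl⟩ := Rat.exists_div (R := R) (n := n) z
  rw [map_div₀, map_div₀, h, h]

theorem permRat_mul (v w : Equiv.Perm (Fin n)) :
    (permRat (v * w) : Rat R n →ₐ[R] Rat R n) = (permRat v).comp (permRat w) := by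
  refine algHom_ext_rat fun f => ?_
  simp [rename_rename, Equiv.Perm.coe_mul]

theorem permRat_mul_apply (v w : Equiv.Perm (Fin n)) (z : Rat R n) :
    permRat (v * w) z = permRat v (permRat w z) := by
  rw [permRat_mul]; rfl

@[simp] theorem permRat_one : (permRat 1 : Rat R n →ₐ[R] Rat R n) = AlgHom.id R _ := by
  refine algHom_ext_rat fun f => ?_
  simp [rename_id]

/-- The dot as a rational function. -/
def yy (k : Fin n) : Rat R n := toRat (X k)

@[simp] theorem permRat_yy (w : Equiv.Perm (Fin n)) (k : Fin n) :
    permRat w (yy k : Rat R n) = yy (w k) := by simp [yy]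

theorem yy_inj {r s : Fin n} : (yy r : Rat R n) = yy s ↔ r = s := by
  rw [yy, yy, toRat_inj, X_inj]

theorem yy_sub_ne_zero {r s : Fin n} (h : r ≠ s) : (yy r - yy s : Rat R n) ≠ 0 :=
  sub_ne_zero.2 fun h' => h (yy_inj.1 h')

/-- Multiplication as a linear map. -/
abbrev mulL (z : Rat R n) : Module.End R (Rat R n) := LinearMap.mulLeft R z

/-- Permutations as linear maps. -/
abbrev permL (w : Equiv.Perm (Fin n)) : Module.End R (Rat R n) := (permRat w).toLinearMap

/-- The divided difference. -/
def ddiff (r s : Fin n) : Module.End R (Rat R n) :=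
  mulL ((yy r - yy s)⁻¹) * (1 - permL (Equiv.swap r s))

theorem ddiff_apply (r s : Fin n) (z : Rat R n) :
    ddiff r s z = (z - permRat (Equiv.swap r s) z) / (yy r - yy s) := by
  simp [ddiff, div_eq_inv_mul]

theorem permRat_swap_ddiff (r s : Fin n) (z : Rat R n) :
    permRat (Equiv.swap r s) (ddiff r s z) = ddiff r s z := by
  rw [ddiff_apply, map_div₀, map_sub, map_sub, permRat_yy, permRat_yy, Equiv.swap_apply_left,
    Equiv.swap_apply_right, ← permRat_mul_apply, Equiv.swap_mul_self, permRat_one, AlgHom.id_apply,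
    ← neg_sub (yy r), ← neg_sub z, neg_div_neg_eq]

theorem ddiff_ddiff_swap (r s : Fin n) (z : Rat R n) : ddiff s r (ddiff r s z) = 0 := by
  rw [ddiff_apply s r, Equiv.swap_comm, permRat_swap_ddiff, sub_self, zero_div]

theorem ddiff_mul (r s : Fin n) (a z : Rat R n) : ddiff r s (a * z) =
    a * ddiff r s z + ddiff r s a * permRat (Equiv.swap r s) z := by
  simp only [ddiff_apply, map_mul]
  ring

/-- The second term of the twisted Leibniz rule contains the divided difference of `a`, which
vanishes. -/
theorem commute_ddiff_mulL {r s : Fin n} {a : Rat R n}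
    (h : permRat (Equiv.swap r s) a = a) : Commute (ddiff r s) (mulL a) := by
  refine LinearMap.ext fun z => ?_
  simp only [Module.End.mul_apply, LinearMap.mulLeft_apply]
  rw [ddiff_mul, ddiff_apply r s a, h, sub_self, zero_div, zero_mul, add_zero]

theorem ddiff_yy_left {r s : Fin n} (h : r ≠ s) : ddiff r s (yy r : Rat R n) = 1 := by
  rw [ddiff_apply, permRat_yy, Equiv.swap_apply_left, div_self (yy_sub_ne_zero h)]

theorem ddiff_yy_right {r s : Fin n} (h : r ≠ s) : ddiff r s (yy s : Rat R n) = -1 := by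
  rw [ddiff_apply, permRat_yy, Equiv.swap_apply_right, ← neg_sub, neg_div,
    div_self (yy_sub_ne_zero h)]

theorem permRat_ddiff (w : Equiv.Perm (Fin n)) (r s : Fin n) (z : Rat R n) :
    permRat w (ddiff r s z) = ddiff (w r) (w s) (permRat w z) := by
  rw [ddiff_apply, ddiff_apply, map_div₀, map_sub, map_sub, permRat_yy, permRat_yy,
    ← permRat_mul_apply, ← permRat_mul_apply, Equiv.swap_apply_apply]
  simp [mul_assoc]

theorem commute_ddiff {r s t u : Fin n} (h1 : r ≠ t) (h2 : r ≠ u) (h3 : s ≠ t) (h4 : s ≠ u) :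
    Commute (ddiff r s : Module.End R (Rat R n)) (ddiff t u) := by
  refine LinearMap.ext fun z => ?_
  simp only [Module.End.mul_apply]
  have e := permRat_ddiff (R := R) (Equiv.swap r s) t u z
  rw [Equiv.swap_apply_of_ne_of_ne h1.symm h3.symm,
    Equiv.swap_apply_of_ne_of_ne h2.symm h4.symm] at e
  rw [ddiff_apply r s, e, ddiff_apply r s z, ← map_sub, div_eq_mul_inv, div_eq_mul_inv, mul_comm,
    mul_comm (_ - _) (_ : Rat R n)⁻¹]
  have := commute_ddiff_mulL (R := R) (r := t) (s := u) (a := (yy r - yy s)⁻¹) (by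
    rw [map_inv₀, map_sub, permRat_yy, permRat_yy, Equiv.swap_apply_of_ne_of_ne h1 h2,
      Equiv.swap_apply_of_ne_of_ne h3 h4])
  exact (LinearMap.congr_fun this _).symm

/-- The braid relation for divided differences. -/
theorem ddiff_braid {a b c : Fin n} (hab : a ≠ b) (hac : a ≠ c) (hbc : b ≠ c) :
    (ddiff b c * (ddiff a c * ddiff a b) : Module.End R (Rat R n)) =
      ddiff a b * (ddiff a c * ddiff b c) := by
  refine LinearMap.ext fun z => ?_
  simp only [Module.End.mul_apply]
  have n1 := yy_sub_ne_zero (R := R) hab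
  have n2 := yy_sub_ne_zero (R := R) hac
  have n3 := yy_sub_ne_zero (R := R) hbc
  have s1 := Equiv.swap_apply_of_ne_of_ne hac.symm hbc.symm
  have s2 := Equiv.swap_apply_of_ne_of_ne hab.symm hbc
  have s3 := Equiv.swap_apply_of_ne_of_ne hab hac
  -- Products of transpositions are brought to normal forms, so that both sides are combinations of
  -- the same six conjugates of `z`.
  have p1 : Equiv.swap b c * Equiv.swap a c = Equiv.swap a b * Equiv.swap b c :=
    Equiv.ext fun x => by simp only [Equiv.Perm.mul_apply, Equiv.swap_apply_def]; grind
  have p2 : Equiv.swap a c * Equiv.swap a b = Equiv.swap a b * Equiv.swap b c :=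
    Equiv.ext fun x => by simp only [Equiv.Perm.mul_apply, Equiv.swap_apply_def]; grind
  have p3 : Equiv.swap b c * Equiv.swap a b = Equiv.swap a b * Equiv.swap a c :=
    Equiv.ext fun x => by simp only [Equiv.Perm.mul_apply, Equiv.swap_apply_def]; grind
  have p4 : Equiv.swap a c * Equiv.swap b c = Equiv.swap a b * Equiv.swap a c :=
    Equiv.ext fun x => by simp only [Equiv.Perm.mul_apply, Equiv.swap_apply_def]; grind
  have p5 : Equiv.swap b c * (Equiv.swap a b * Equiv.swap b c) = Equiv.swap a c :=
    Equiv.ext fun x => by simp only [Equiv.Perm.mul_apply, Equiv.swap_apply_def]; grind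
  have p6 : Equiv.swap a b * (Equiv.swap a b * Equiv.swap a c) = Equiv.swap a c :=
    Equiv.ext fun x => by simp only [Equiv.Perm.mul_apply, Equiv.swap_apply_def]; grind
  simp only [ddiff_apply, map_div₀, map_sub, permRat_yy, Equiv.swap_apply_left,
    Equiv.swap_apply_right, s1, s2, s3, ← permRat_mul_apply, p1, p2, p3, p4, p5, p6]
  generalize permRat (Equiv.swap a b) z = z1, permRat (Equiv.swap a c) z = z2,
    permRat (Equiv.swap b c) z = z3, permRat (Equiv.swap a b * Equiv.swap b c) z = z4,
    permRat (Equiv.swap a b * Equiv.swap a c) z = z5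
  -- The differences of dots are expressed through two of them; after clearing denominators a
  -- polynomial identity remains.
  have e1 : (yy b - yy a : Rat R n) = -(yy a - yy b) := (neg_sub _ _).symm
  have e3 : (yy c - yy b : Rat R n) = -(yy b - yy c) := (neg_sub _ _).symm
  have e4 : (yy a - yy c : Rat R n) = (yy a - yy b) + (yy b - yy c) := by ring
  rw [e1, e3]
  rw [e4] at n2 ⊢
  generalize (yy a - yy b : Rat R n) = u at *
  generalize (yy b - yy c : Rat R n) = v at *
  field_simp
  ring

end Frac

end WKLRW

end

noncomputable section

namespace WKLRW

namespace Datum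

open Wall Str MvPolynomial

variable {R I : Type*} [CommRing R] {D : Datum R I}

/-! ### Interchanging the ends of two strings -/

/-- If the strings `r`, `s` of the same residue cross, then no strings cross when their
ends are interchanged, provided that there is no other crossing, or that there is one further string
that crosses both. -/
theorem sp_swap_eq_empty {i : D.ResSeq} {x y : Fin D.n → ℝ} {r s : Fin D.n}
    (hy : OffWalls (walls i) y) (hrs : i.1 r = i.1 s) (hx : x r < x s)
    (hy' : y s < y r)
    (ha : ∀ c, (some r, some s, c) ∈ sp i x y → c = 0)
    (hb : ∀ t c, t ≠ some s → (some r, t, c) ∈ sp i x y → ext x t + c < x s ∧ y s < ext y t + c)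
    (hc : ∀ t c, t ≠ some r → (t, some s, c) ∈ sp i x y → x r < ext x t - c ∧ ext y t - c < y r)
    (hd : ∀ H ∈ sp i x y, H.1 = some r ∨ H.2.1 = some s) :
    sp i x (y ∘ Equiv.swap r s) = ∅ := by
  rw [Finset.eq_empty_iff_forall_notMem]
  intro H hH
  have hw : ∀ k, i.1 (Equiv.swap r s k) = i.1 k := by
    intro k
    by_cases h1 : k = r
    · rw [h1, Equiv.swap_apply_left, hrs]
    by_cases h2 : k = s
    · rw [h2, Equiv.swap_apply_right, hrs]
    · rw [Equiv.swap_apply_of_ne_of_ne h1 h2]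
  -- The walls are stable under the transposition, as `r` and `s` have the same residue. If `H` is
  -- crossed on the way to the interchanged ends, then `H` or its image is crossed on the way to
  -- `y`; each case contradicts one of the hypotheses.
  have hmem : ∀ H, (H.1.map (Equiv.swap r s), H.2.1.map (Equiv.swap r s), H.2.2) ∈ walls i ↔
      H ∈ walls i := walls_perm hw
  have ex : ∀ z (a : Option (Fin D.n)), a ≠ some r → a ≠ some s →
      ext (z ∘ Equiv.swap r s) a = ext z a ∧ a.map (Equiv.swap r s) = a := by
    intro z a h1 h2
    cases a with
    | none => exact ⟨rfl, rfl⟩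
    | some k =>
      have e := Equiv.swap_apply_of_ne_of_ne (a := r) (b := s) (x := k)
        (fun h => h1 (by rw [h])) (fun h => h2 (by rw [h]))
      simp [e]
  obtain ⟨a, b, c⟩ := H
  have hne' := (isArr_walls i).ne _ (mem_sep.1 hH).1
  obtain ⟨hA, h1, h2⟩ := mem_sep.1 hH
  have hA' := (hmem _).2 hA
  have oy := hy _ hA
  have oy' := hy _ hA'
  have hmk : ∀ {a b c}, (a, b, c) ∈ walls i → ext x a - ext x b - c < 0 →
      0 < ext y a - ext y b - c → (a, b, c) ∈ sp i x y := fun h1 h2 h3 => mem_sep.2 ⟨h1, h2, h3⟩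
  simp only [L] at h1 h2 oy oy' hne'
  have er : ext (y ∘ Equiv.swap r s) (some r) = y s := by simp
  have es : ext (y ∘ Equiv.swap r s) (some s) = y r := by simp
  by_cases ar : a = some r
  · subst ar
    by_cases bs : b = some s
    · subst bs
      rw [er, es] at h2
      simp only [ext_some] at h1 oy oy' h2
      have := hmk hA (by simp; linarith) (by simp; linarith)
      have := ha _ this
      linarith
    · obtain ⟨e1, e2⟩ := ex y b hne'.symm bs
      rw [er, e1] at h2
      simp only [ext_some] at h1 oy oy' h2
      have := hb _ _ bs (hmk hA (by simp; linarith) (by simp; linarith))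
      linarith
  by_cases as : a = some s
  · subst as
    by_cases br : b = some r
    · subst br
      rw [er, es] at h2
      simp only [ext_some, Option.map_some, Equiv.swap_apply_left, Equiv.swap_apply_right]
        at h1 oy oy' h2 hA'
      have := ha _ (hmk hA' (by simp; linarith) (by simp; linarith))
      linarith
    · obtain ⟨e1, e2⟩ := ex y b br hne'.symm
      rw [es, e1] at h2
      simp only [e2, ext_some, Option.map_some, Equiv.swap_apply_right] at h1 oy oy' h2 hA'
      have := hb _ _ hne'.symm (hmk hA' (by simp; linarith) (by simp; linarith))
      linarith
  by_cases br : b = some r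
  · subst br
    obtain ⟨e1, e2⟩ := ex y a ar as
    rw [er, e1] at h2
    simp only [e2, ext_some, Option.map_some, Equiv.swap_apply_left] at h1 oy oy' h2 hA'
    have := hc _ _ ar (hmk hA' (by simp; linarith) (by simp; linarith))
    linarith
  by_cases bs : b = some s
  · subst bs
    obtain ⟨e1, e2⟩ := ex y a ar as
    rw [es, e1] at h2
    simp only [ext_some] at h1 oy oy' h2
    have := hc _ _ ar (hmk hA (by simp; linarith) (by simp; linarith))
    linarith
  · rw [(ex y a ar as).1, (ex y b br bs).1] at h2
    rcases hd _ (hmk hA h1 h2) with h | h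
    · exact ar h
    · exact bs h

theorem ne_of_passes_solid {x y : Fin D.n → ℝ} {r s : Fin D.n}
    (h : D.Passes x y (.solid r) (.solid s)) : r ≠ s := by
  rintro rfl; exact lt_irrefl _ h.1

/-- For this reason the error term of a dot passing a crossing has no crossing: it acts by a mere
permutation and has degree zero. -/
theorem sp_swap_of_single {i : D.ResSeq} {x y : Fin D.n → ℝ} {r s : Fin D.n}
    (hy : OffWalls (walls i) y) (hcard : (sp i x y).card ≤ 1) (h : Has i.1 x y (.solid r s)) :
    sp i x (y ∘ Equiv.swap r s) = ∅ := by
  have hm : (some r, some s, (0 : ℝ)) ∈ sp i x y := by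
    have := h.mem_sp
    simpa only [wall, Letter.fst, Letter.snd, base, off, sub_zero] using this
  have key : ∀ H ∈ sp i x y, H = (some r, some s, 0) := fun H hH =>
    Finset.card_le_one.1 hcard _ hH _ hm
  refine sp_swap_eq_empty hy h.1 h.2.1 h.2.2 ?_ ?_ ?_ ?_
  · intro c hc; simpa using key _ hc
  · intro t c ht hc; have := key _ hc; simp only [Prod.mk.injEq] at this; exact absurd this.2.1 ht
  · intro t c ht hc; have := key _ hc; simp only [Prod.mk.injEq] at this; exact absurd this.1 ht
  · intro H hH; left; rw [key H hH]

/-- `A` and `B` follow the strings `r` and `s` of the same residue at the same distance, and `M` is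
another string between them. -/
structure Parallel (i : Fin D.n → I) (r s : Fin D.n) (A M B : D.Str) : Prop where
  res : i r = i s
  ne : r ≠ s
  baseA : A.base = some r
  baseB : B.base = some s
  baseMA : M.base ≠ some r
  baseMB : M.base ≠ some s
  off : A.off = B.off
  presA : D.Present i A
  presB : D.Present i B
  presM : D.Present i M

/-- The walls of the three pairs among `A`, `M`, `B` are different and crossed, so by the bound
there are no others, and `M` is between `A` and `B` at both ends. This applies to the error term of
the exceptional Reidemeister III relations. -/
theorem sp_swap_of_reversed {i : D.ResSeq} {x y : Fin D.n → ℝ} {r s : Fin D.n} {A M B : D.Str}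
    (hy : OffWalls (walls i) y) (hP : Parallel i.1 r s A M B) (hrev : D.Reversed x y A M B)
    (hcard : (sp i x y).card ≤ 3) : sp i x (y ∘ Equiv.swap r s) = ∅ := by
  classical
  obtain ⟨h1, h2, h3, h4⟩ := hrev
  have m1 : wall A M ∈ sp i x y := (wall_mem_sp hP.presA hP.presM).2 ⟨h1, h4⟩
  have m2 : wall M B ∈ sp i x y := (wall_mem_sp hP.presM hP.presB).2 ⟨h2, h3⟩
  have m3 : wall A B ∈ sp i x y :=
    (wall_mem_sp hP.presA hP.presB).2 ⟨h1.trans h2, h3.trans h4⟩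
  have hrs : (some r : Option (Fin D.n)) ≠ some s := by simpa using hP.ne
  have e1 : wall A M = (some r, M.base, M.off - A.off) := by rw [wall, hP.baseA]
  have e2 : wall M B = (M.base, some s, A.off - M.off) := by rw [wall, hP.baseB, hP.off]
  have e3 : wall A B = (some r, some s, 0) := by rw [wall, hP.baseA, hP.baseB, hP.off, sub_self]
  have hall : ∀ H ∈ sp i x y, H = wall A M ∨ H = wall M B ∨ H = wall A B := by
    intro H hH
    have hsub : ({wall A M, wall M B, wall A B} : Finset _) ⊆ sp i x y := by
      intro G; simp only [Finset.mem_insert, Finset.mem_singleton]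
      rintro (rfl | rfl | rfl) <;> assumption
    have hc : ({wall A M, wall M B, wall A B} : Finset (Wall D.n)).card = 3 := by
      refine Finset.card_eq_three.2 ⟨_, _, _, ?_, ?_, ?_, rfl⟩
      · rw [e1, e2]; intro h; exact hP.baseMA (congrArg Prod.fst h).symm
      · rw [e1, e3]; intro h; exact hP.baseMB (congrArg (fun H => H.2.1) h)
      · rw [e2, e3]; intro h; exact hP.baseMA (congrArg Prod.fst h)
    have := Finset.eq_of_subset_of_card_le hsub (by rw [hc]; exact hcard)
    rw [← this] at hH
    simpa using hH
  have lA : ∀ z, D.loc z A = z r + A.off := fun z => by rw [loc_eq, hP.baseA]; rfl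
  have lB : ∀ z, D.loc z B = z s + A.off := fun z => by rw [loc_eq, hP.baseB, hP.off]; rfl
  rw [lA, loc_eq] at h1 h4
  rw [lB, loc_eq] at h2 h3
  refine sp_swap_eq_empty hy hP.res (by linarith) (by linarith) ?_ ?_ ?_ ?_
  · intro c hc
    rcases hall _ hc with h | h | h
    · rw [e1] at h; exact absurd (congrArg (fun H => H.2.1) h).symm hP.baseMB
    · rw [e2] at h; exact absurd (congrArg Prod.fst h).symm hP.baseMA
    · rw [e3] at h; simpa using h
  · intro t c ht hc
    rcases hall _ hc with h | h | h
    · rw [e1] at h; simp only [Prod.mk.injEq] at h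
      rw [h.2.1, h.2.2]; constructor <;> linarith
    · rw [e2] at h; exact absurd (congrArg Prod.fst h).symm hP.baseMA
    · rw [e3] at h; exact absurd (congrArg (fun H => H.2.1) h) ht
  · intro t c ht hc
    rcases hall _ hc with h | h | h
    · rw [e1] at h; exact absurd (congrArg Prod.fst h) ht
    · rw [e2] at h; simp only [Prod.mk.injEq] at h
      rw [h.1, h.2.2]; constructor <;> linarith
    · rw [e3] at h; exact absurd (congrArg Prod.fst h) ht
  · intro H hH
    rcases hall _ hH with h | h | h <;> rw [h]
    · rw [e1]; exact Or.inl rfl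
    · rw [e2]; exact Or.inr rfl
    · rw [e3]; exact Or.inl rfl

/-- An edge joins different residues, so `M` follows neither `r` nor `s`. -/
theorem Exceptional.parallel {i : Fin D.n → I} {r s : Fin D.n} {A M B : D.Str}
    {f : MvPolynomial (Fin D.n) R} (h : D.Exceptional i r s A M B f) (hne : r ≠ s) :
    Parallel i r s A M B := by
  cases h with
  | ghostSolidGhost u s ε hrs ho hp =>
    refine ⟨hrs, hne, rfl, rfl, ?_, ?_, rfl, ho, ho.trans hrs, trivial⟩
    · intro h; cases h; exact owner_ne_partner ε (ho.trans hp.symm)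
    · intro h; cases h; exact owner_ne_partner ε (ho.trans (hrs.trans hp.symm))
  | solidGhostSolid u s ε hrs ho hp =>
    refine ⟨hrs, hne, rfl, rfl, ?_, ?_, rfl, trivial, trivial, ho⟩
    · intro h; cases h; exact owner_ne_partner ε (ho.trans hp.symm)
    · intro h; cases h; exact owner_ne_partner ε (ho.trans (hrs.symm.trans hp.symm))
  | solidRedSolid s c hrs hc =>
    exact ⟨hrs, hne, rfl, rfl, by simp [base], by simp [base], rfl, trivial, trivial, trivial⟩

theorem Exceptional.ne_of_reversed {i : Fin D.n → I} {r s : Fin D.n} {A M B : D.Str}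
    {f : MvPolynomial (Fin D.n) R} (h : D.Exceptional i r s A M B f) {x y : Fin D.n → ℝ}
    (hrev : D.Reversed x y A M B) : r ≠ s := by
  rintro rfl
  have h1 := hrev.1.trans hrev.2.1
  cases h <;> exact lt_irrefl _ h1

end Datum

end WKLRW

end

noncomputable section


namespace WKLRW

/-- Two words that differ by interchanging commuting letters have the same product. -/
theorem prod_eq_of_commute {α M : Type*} [Monoid M] (f : α → M) (P P' : α → α → Prop)
    (h : ∀ a b, P a b → P' b a → Commute (f a) (f b)) :
    ∀ {w w' : List α}, w.Perm w' → w.Pairwise P → w'.Pairwise P' →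
      (w.map f).prod = (w'.map f).prod
  | [], w', hw, _, _ => by rw [List.nil_perm.1 hw]
  | a :: u, w', hw, h1, h2 => by
    -- The letters before `a` in the second word come after it in the first one, so `a` commutes
    -- with them and can be moved to the front.
    obtain ⟨s, t, rfl⟩ := List.append_of_mem (hw.subset List.mem_cons_self)
    have hu : u.Perm (s ++ t) := (hw.trans List.perm_middle).cons_inv
    rw [List.pairwise_cons] at h1
    have h3 : ∀ b ∈ s, P' b a := fun b hb =>
      (List.pairwise_append.1 h2).2.2 b hb a List.mem_cons_self
    have hc : Commute (f a) (s.map f).prod := by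
      refine Commute.list_prod_right _ _ fun x hx => ?_
      obtain ⟨b, hb, rfl⟩ := List.mem_map.1 hx
      exact h a b (h1.1 b (hu.symm.subset (List.mem_append_left _ hb))) (h3 b hb)
    rw [List.map_cons, List.prod_cons, prod_eq_of_commute f P P' h hu h1.2
      (h2.sublist (List.Sublist.append (List.Sublist.refl s) (List.sublist_cons_self a t)))]
    simp only [List.map_append, List.map_cons, List.prod_append, List.prod_cons]
    rw [← mul_assoc, hc.eq, mul_assoc]

namespace Datum

open Wall Str MvPolynomial

variable {R I : Type*} [CommRing R] [IsDomain R] {D : Datum R I}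

/-! ### The operators of crossings on rational functions -/

/-- The operator of a crossing. -/
def opL (i : Fin D.n → I) : D.Letter → Module.End R (Rat R D.n)
  | .solid r s => ddiff r s
  | .ghostRight k _ s => mulL (toRat (evalQ (D.Q (i k) (i s)) k s))
  | .ghostLeft _ _ _ => mulL 1
  | .redRight k _ => mulL (yy k)
  | .redLeft _ _ => mulL 1

open Classical in
/-- The list of the at most one letter on the way from `x` to `y`. -/
def step (i : Fin D.n → I) (x y : Fin D.n → ℝ) : List D.Letter :=
  if h : ∃ l : D.Letter, Has i x y l then [h.choose] else []

/-- The operator of an elementary piece. -/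
def opS (i : Fin D.n → I) (x y : Fin D.n → ℝ) : Module.End R (Rat R D.n) :=
  ((step i x y).map (opL i)).prod

theorem step_of_not {i : Fin D.n → I} {x y : Fin D.n → ℝ} (h : ∀ l : D.Letter, ¬ Has i x y l) :
    step (D := D) i x y = [] := dif_neg fun ⟨l, hl⟩ => h l hl

theorem step_of_has {i : D.ResSeq} {x y : Fin D.n → ℝ} (hx : D.Generic i.1 x)
    (hc : (sp i x y).card ≤ 1) {l : D.Letter} (h : Has i.1 x y l) : step i.1 x y = [l] := by
  have h' : ∃ l : D.Letter, Has i.1 x y l := ⟨l, h⟩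
  rw [step, dif_pos h', has_unique hx hc h'.choose_spec h]

theorem opS_of_not {i : Fin D.n → I} {x y : Fin D.n → ℝ} (h : ∀ l : D.Letter, ¬ Has i x y l) :
    opS (D := D) i x y = 1 := by rw [opS, step_of_not h]; rfl

theorem opS_of_has {i : D.ResSeq} {x y : Fin D.n → ℝ} (hx : D.Generic i.1 x)
    (hc : (sp i x y).card ≤ 1) {l : D.Letter} (h : Has i.1 x y l) :
    opS i.1 x y = opL i.1 l := by rw [opS, step_of_has hx hc h]; simp

theorem opS_of_empty {i : D.ResSeq} {x y : Fin D.n → ℝ} (h : sp i x y = ∅) :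
    opS i.1 x y = 1 := opS_of_not fun l hl => by
  have := hl.mem_sp
  simp [h] at this

theorem mem_step {i : D.ResSeq} {x y : Fin D.n → ℝ} (hx : D.Generic i.1 x)
    (hc : (sp i x y).card ≤ 1) {l : D.Letter} : l ∈ step i.1 x y ↔ Has i.1 x y l := by
  by_cases h : ∃ l : D.Letter, Has i.1 x y l
  · obtain ⟨l', h'⟩ := h
    rw [step_of_has hx hc h', List.mem_singleton]
    exact ⟨fun h => h ▸ h', fun h => has_unique hx hc h h'⟩
  · push Not at h
    rw [step_of_not h]
    simpa using h l

theorem step_length (i : Fin D.n → I) (x y : Fin D.n → ℝ) :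
    step (D := D) i x y = [] ∨ ∃ l, step (D := D) i x y = [l] := by
  unfold step
  split_ifs
  · exact Or.inr ⟨_, rfl⟩
  · exact Or.inl rfl

/-- The positions of the solid strings in a reduced path of three elementary pieces. -/
structure TriPath (i : D.ResSeq) (x₀ x₁ x₂ x₃ : Fin D.n → ℝ) : Prop where
  g₀ : D.Generic i.1 x₀
  g₁ : D.Generic i.1 x₁
  g₂ : D.Generic i.1 x₂
  g₃ : D.Generic i.1 x₃
  c₁ : (sp i x₀ x₁).card ≤ 1
  c₂ : (sp i x₁ x₂).card ≤ 1
  c₃ : (sp i x₂ x₃).card ≤ 1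
  r₁ : Red (walls i) x₀ x₁ x₃
  r₂ : Red (walls i) x₀ x₂ x₃
  r₁₂ : Red (walls i) x₀ x₁ x₂

namespace TriPath

variable {i : D.ResSeq} {x₀ x₁ x₂ x₃ : Fin D.n → ℝ}

theorem has_two (p : TriPath i x₀ x₁ x₂ x₃) (l : D.Letter) :
    Has i.1 x₀ x₂ l ↔ Has i.1 x₀ x₁ l ∨ Has i.1 x₁ x₂ l := by
  by_cases h : l.Sig i.1
  · rw [has_iff_mem_sp h, has_iff_mem_sp h, has_iff_mem_sp h, sp, p.r₁₂.eq p.g₁.gen,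
      Finset.mem_union]
  · simp [Has, h]

theorem has_three (p : TriPath i x₀ x₁ x₂ x₃) (l : D.Letter) :
    Has i.1 x₀ x₃ l ↔ Has i.1 x₀ x₂ l ∨ Has i.1 x₂ x₃ l := by
  by_cases h : l.Sig i.1
  · rw [has_iff_mem_sp h, has_iff_mem_sp h, has_iff_mem_sp h, sp, p.r₂.eq p.g₂.gen,
      Finset.mem_union]
  · simp [Has, h]

theorem card_le (p : TriPath i x₀ x₁ x₂ x₃) : (sp i x₀ x₃).card ≤ 3 := by
  have h1 := p.r₂.card p.g₂.gen
  have h2 := p.r₁₂.card p.g₁.gen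
  have := p.c₁
  have := p.c₂
  have := p.c₃
  simp only [sp] at *
  omega

theorem not_has_two {y z w : Fin D.n → ℝ} {l : D.Letter} (h : Has i.1 y z l) :
    ¬ Has i.1 z w l := fun h' => lt_asymm h.2.2 h'.2.1

/-- The letters of the path, from top to bottom. -/
def word (i : D.ResSeq) (x₀ x₁ x₂ x₃ : Fin D.n → ℝ) : List D.Letter :=
  step i.1 x₂ x₃ ++ (step i.1 x₁ x₂ ++ step i.1 x₀ x₁)

/-- The operator of the path. -/
def ops (i : D.ResSeq) (x₀ x₁ x₂ x₃ : Fin D.n → ℝ) : Module.End R (Rat R D.n) :=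
  opS i.1 x₂ x₃ * (opS i.1 x₁ x₂ * opS i.1 x₀ x₁)

theorem ops_eq : ops i x₀ x₁ x₂ x₃ = ((word i x₀ x₁ x₂ x₃).map (opL i.1)).prod := by
  simp [ops, word, opS]

theorem mem_word (p : TriPath i x₀ x₁ x₂ x₃) (l : D.Letter) :
    l ∈ word i x₀ x₁ x₂ x₃ ↔ Has i.1 x₀ x₃ l := by
  rw [word, List.mem_append, List.mem_append, mem_step p.g₂ p.c₃, mem_step p.g₁ p.c₂,
    mem_step p.g₀ p.c₁, p.has_three, p.has_two]
  tauto

/-- A letter occurs before another one. -/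
def Before (i : D.ResSeq) (x₀ x₁ x₂ : Fin D.n → ℝ) (l l' : D.Letter) : Prop :=
  ∃ y, (y = x₁ ∨ y = x₂) ∧ Has i.1 x₀ y l ∧ ¬ Has i.1 x₀ y l'

/-- The slice on top of the lower of two pieces is the witness: the letter of the lower piece has
occurred there, and that of the upper piece has not, since it is about to cross in the same
direction. -/
theorem pairwise_word (p : TriPath i x₀ x₁ x₂ x₃) :
    (word i x₀ x₁ x₂ x₃).Pairwise fun l' l => Before i x₀ x₁ x₂ l l' := by
  have hs : ∀ x y (P : D.Letter → D.Letter → Prop), (step i.1 x y).Pairwise P := by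
    intro x y P
    rcases step_length (D := D) i.1 x y with h | ⟨l, h⟩ <;> rw [h] <;> simp
  rw [word, List.pairwise_append, List.pairwise_append]
  refine ⟨hs _ _ _, ⟨hs _ _ _, hs _ _ _, ?_⟩, ?_⟩
  · intro l' h' l h
    rw [mem_step p.g₁ p.c₂] at h'
    rw [mem_step p.g₀ p.c₁] at h
    exact ⟨x₁, Or.inl rfl, h, fun h2 => not_has_two h2 h'⟩
  · intro l' h' l h
    rw [mem_step p.g₂ p.c₃] at h'
    rw [List.mem_append, mem_step p.g₁ p.c₂, mem_step p.g₀ p.c₁, or_comm, ← p.has_two] at h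
    exact ⟨x₂, Or.inr rfl, h, fun h2 => not_has_two h2 h'⟩

theorem nodup_word (p : TriPath i x₀ x₁ x₂ x₃) : (word i x₀ x₁ x₂ x₃).Nodup := by
  refine p.pairwise_word.imp ?_
  rintro l' l ⟨y, -, h1, h2⟩ rfl
  exact h2 h1

theorem length_word : (word i x₀ x₁ x₂ x₃).length ≤ 3 := by
  have h : ∀ x y, (step (D := D) i.1 x y).length ≤ 1 := by
    intro x y
    rcases step_length (D := D) i.1 x y with h | ⟨l, h⟩ <;> rw [h] <;> simp
  have := h x₀ x₁
  have := h x₁ x₂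
  have := h x₂ x₃
  simp only [word, List.length_append]
  omega

/-- The order of three letters. -/
theorem exists_order (p : TriPath i x₀ x₁ x₂ x₃) {l₁ l₂ l₃ : D.Letter} (h₁ : Has i.1 x₀ x₃ l₁)
    (h₂ : Has i.1 x₀ x₃ l₂) (h₃ : Has i.1 x₀ x₃ l₃) (h₁₂ : l₁ ≠ l₂) (h₁₃ : l₁ ≠ l₃) (h₂₃ : l₂ ≠ l₃) :
    ∃ a b c, ops i x₀ x₁ x₂ x₃ = opL i.1 c * (opL i.1 b * opL i.1 a) ∧
      ((a = l₁ ∧ b = l₂ ∧ c = l₃) ∨ (a = l₁ ∧ b = l₃ ∧ c = l₂) ∨ (a = l₂ ∧ b = l₁ ∧ c = l₃) ∨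
        (a = l₂ ∧ b = l₃ ∧ c = l₁) ∨ (a = l₃ ∧ b = l₁ ∧ c = l₂) ∨ (a = l₃ ∧ b = l₂ ∧ c = l₁)) ∧
      (Has i.1 x₀ x₁ a ∧ ¬ Has i.1 x₀ x₁ b ∧ ¬ Has i.1 x₀ x₁ c) ∧
      (Has i.1 x₀ x₂ a ∧ Has i.1 x₀ x₂ b ∧ ¬ Has i.1 x₀ x₂ c) := by
  -- Three different letters occur in a word of at most three, so every piece carries exactly one of
  -- them.
  have hsub : [l₁, l₂, l₃].Subperm (word i x₀ x₁ x₂ x₃) := by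
    refine List.subperm_of_subset (by simp [h₁₂, h₁₃, h₂₃]) ?_
    intro l hl
    simp only [List.mem_cons, List.not_mem_nil, or_false] at hl
    rw [p.mem_word]
    rcases hl with rfl | rfl | rfl <;> assumption
  have hlen := hsub.length_le
  have hperm := hsub.perm_of_length_le (by simpa using length_word)
  have hnd := p.nodup_word
  have hops := ops_eq (i := i) (x₀ := x₀) (x₁ := x₁) (x₂ := x₂) (x₃ := x₃)
  rcases step_length (D := D) i.1 x₀ x₁ with e1 | ⟨a, e1⟩ <;>
    rcases step_length (D := D) i.1 x₁ x₂ with e2 | ⟨b, e2⟩ <;>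
    rcases step_length (D := D) i.1 x₂ x₃ with e3 | ⟨c, e3⟩ <;>
    simp only [word, e1, e2, e3] at hlen hnd hops hperm <;> simp at hlen
  have ha : Has i.1 x₀ x₁ a := by rw [← mem_step p.g₀ p.c₁, e1]; simp
  have hb : Has i.1 x₁ x₂ b := by rw [← mem_step p.g₁ p.c₂, e2]; simp
  have hc : Has i.1 x₂ x₃ c := by rw [← mem_step p.g₂ p.c₃, e3]; simp
  have hc' : ¬ Has i.1 x₀ x₂ c := fun h => not_has_two h hc
  refine ⟨a, b, c, by simpa using hops, ?_, ⟨ha, fun h => not_has_two h hb, fun h => hc' ?_⟩,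
    (p.has_two _).2 (Or.inl ha), (p.has_two _).2 (Or.inr hb), hc'⟩
  · have ma : a ∈ [l₁, l₂, l₃] := hperm.symm.subset (by simp)
    have mb : b ∈ [l₁, l₂, l₃] := hperm.symm.subset (by simp)
    have mc : c ∈ [l₁, l₂, l₃] := hperm.symm.subset (by simp)
    simp only [List.mem_cons, List.not_mem_nil, or_false] at ma mb mc
    simp at hnd
    grind
  · exact (p.has_two _).2 (Or.inl h)

theorem between₁ (p : TriPath i x₀ x₁ x₂ x₃) : D.Between i.1 x₀ x₁ x₃ :=
  (between_iff_red p.g₀ p.g₁ p.g₃).2 p.r₁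

theorem between₂ (p : TriPath i x₀ x₁ x₂ x₃) : D.Between i.1 x₀ x₂ x₃ :=
  (between_iff_red p.g₀ p.g₂ p.g₃).2 p.r₂

end TriPath

end Datum

end WKLRW

end

noncomputable section


namespace WKLRW

namespace Datum

open Wall Str MvPolynomial

variable {R I : Type*} [CommRing R] [IsDomain R] {D : Datum R I}

/-! ### Reidemeister III for the operators -/

theorem Has.has_iff {i : Fin D.n → I} {x y z : Fin D.n → ℝ} {l : D.Letter} (h : Has i x z l) :
    Has i x y l ↔ D.loc y l.snd < D.loc y l.fst :=
  ⟨fun h' => h'.2.2, fun h' => ⟨h.1, h.2.1, h'⟩⟩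

theorem Has.lt_of_not {i : D.ResSeq} {x y z : Fin D.n → ℝ} {l : D.Letter} (h : Has i.1 x z l)
    (hy : D.Generic i.1 y) (h' : ¬ Has i.1 x y l) : D.loc y l.fst < D.loc y l.snd := by
  refine (lt_or_lt hy h.1.present_fst h.1.present_snd ?_).resolve_right (mt h.has_iff.2 h')
  intro e
  exact base_ne_of_passes h.2 (by rw [e])

theorem rename_swap_evalQ {n : ℕ} (Q : MvPolynomial (Fin 2) R) (w : Equiv.Perm (Fin n))
    (r u : Fin n) : rename w (evalQ Q r u) = evalQ Q (w r) (w u) := by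
  rw [evalQ, evalQ, ← AlgHom.comp_apply]
  congr 1
  refine MvPolynomial.algHom_ext fun k => ?_
  fin_cases k <;> simp

theorem evalQ_symm (i j : I) (r u : Fin D.n) :
    evalQ (D.Q j i) u r = evalQ (D.Q i j) r u := by
  rw [D.Q_symm i j, evalQ, evalQ, MvPolynomial.aeval_rename]
  congr 1
  refine MvPolynomial.algHom_ext fun k => ?_
  fin_cases k <;> simp

theorem mulL_mul {n : ℕ} (f g : Rat R n) : mulL f * mulL g = mulL (f * g) :=
  LinearMap.ext fun z => (mul_assoc f g z).symm

theorem mulL_one {n : ℕ} : (mulL 1 : Module.End R (Rat R n)) = 1 :=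
  LinearMap.ext fun z => one_mul z

namespace TriPath

variable {i : D.ResSeq} {x₀ x₁ x₂ x₃ : Fin D.n → ℝ}

/-- A path with a known first letter, whose third letter cannot come second. -/
theorem ops_of_first (p : TriPath i x₀ x₁ x₂ x₃) {l₁ l₂ l₃ : D.Letter} (h₁ : Has i.1 x₀ x₃ l₁)
    (h₂ : Has i.1 x₀ x₃ l₂) (h₃ : Has i.1 x₀ x₃ l₃) (h₁₂ : l₁ ≠ l₂) (h₁₃ : l₁ ≠ l₃) (h₂₃ : l₂ ≠ l₃)
    (hf : Has i.1 x₀ x₁ l₁)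
    (hmid : ∀ y, D.loc y l₁.snd < D.loc y l₁.fst → D.loc y l₃.snd < D.loc y l₃.fst →
      D.loc y l₂.fst < D.loc y l₂.snd → False) :
    ops i x₀ x₁ x₂ x₃ = opL i.1 l₃ * (opL i.1 l₂ * opL i.1 l₁) := by
  obtain ⟨a, b, c, e, hc, ⟨a1, b1, c1⟩, a2, b2, c2⟩ := p.exists_order h₁ h₂ h₃ h₁₂ h₁₃ h₂₃
  rcases hc with ⟨rfl, rfl, rfl⟩ | ⟨rfl, rfl, rfl⟩ | ⟨rfl, rfl, rfl⟩ | ⟨rfl, rfl, rfl⟩ |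
    ⟨rfl, rfl, rfl⟩ | ⟨rfl, rfl, rfl⟩
  · exact e
  · exact (hmid x₂ (h₁.has_iff.1 a2) (h₃.has_iff.1 b2) (h₂.lt_of_not p.g₂ c2)).elim
  · exact absurd hf b1
  · exact absurd hf c1
  · exact absurd hf b1
  · exact absurd hf c1

/-- If the string `M` is on one side of two strings of the same residue, the crossings
with it can be made before or after the crossing of these two. -/
theorem ops_outer (p : TriPath i x₀ x₁ x₂ x₃) {r s : Fin D.n} {la lb : D.Letter} {f g : Rat R D.n}
    (h₀ : Has i.1 x₀ x₃ (.solid r s)) (ha : Has i.1 x₀ x₃ la) (hb : Has i.1 x₀ x₃ lb)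
    (hab : la ≠ lb) (hna : la ≠ .solid r s) (hnb : lb ≠ .solid r s)
    (ea : opL i.1 la = mulL f) (eb : opL i.1 lb = mulL g)
    (hsymm : permRat (Equiv.swap r s) (f * g) = f * g)
    (hm : ∀ y : Fin D.n → ℝ, D.loc y la.snd < D.loc y la.fst → D.loc y lb.fst < D.loc y lb.snd →
      y r < y s → False)
    (hm' : ∀ y : Fin D.n → ℝ, D.loc y lb.snd < D.loc y lb.fst → y s < y r →
      D.loc y la.fst < D.loc y la.snd → False) :
    ops i x₀ x₁ x₂ x₃ = ddiff r s * mulL (f * g) := by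
  have hcomm := commute_ddiff_mulL hsymm
  have e1 : mulL f * mulL g = mulL (f * g) := mulL_mul f g
  have e2 : mulL g * mulL f = mulL (f * g) := by
    rw [mul_comm f g]; exact mulL_mul g f
  -- In four of the six orders the two multiplications are adjacent, and their product commutes with
  -- the divided difference. The two orders with the crossing of `r` and `s` between them are
  -- geometrically impossible.
  obtain ⟨a, b, c, e, hc, ⟨a1, b1, c1⟩, a2, b2, c2⟩ := p.exists_order h₀ ha hb hna.symm hnb.symm hab
  rw [e]
  rcases hc with ⟨rfl, rfl, rfl⟩ | ⟨rfl, rfl, rfl⟩ | ⟨rfl, rfl, rfl⟩ | ⟨rfl, rfl, rfl⟩ |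
    ⟨rfl, rfl, rfl⟩ | ⟨rfl, rfl, rfl⟩
  · rw [ea, eb, ← mul_assoc, e2, hcomm.eq]; rfl
  · rw [ea, eb, ← mul_assoc, e1, hcomm.eq]; rfl
  · exact (hm x₁ (ha.has_iff.1 a1) (hb.lt_of_not p.g₁ c1) (h₀.lt_of_not p.g₁ b1)).elim
  · rw [ea, eb, e2]; rfl
  · exact (hm' x₂ (hb.has_iff.1 a2) (h₀.has_iff.1 b2) (ha.lt_of_not p.g₂ c2)).elim
  · rw [ea, eb, e1]; rfl

/-- The outer strings `a` and `c` cannot cross first, because `b` starts between them. This leaves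
two orders, which the braid relation of divided differences identifies. -/
theorem ops_solid (p : TriPath i x₀ x₁ x₂ x₃) {a b c : Fin D.n}
    (hab : Has i.1 x₀ x₃ (.solid a b)) (hbc : Has i.1 x₀ x₃ (.solid b c)) :
    ops i x₀ x₁ x₂ x₃ = ddiff b c * (ddiff a c * ddiff a b) := by
  have nab := ne_of_passes_solid hab.2
  have nbc := ne_of_passes_solid hbc.2
  obtain ⟨r1, u1, v1⟩ := hab
  obtain ⟨r2, u2, v2⟩ := hbc
  have hab : Has i.1 x₀ x₃ (.solid a b) := ⟨r1, u1, v1⟩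
  have hbc : Has i.1 x₀ x₃ (.solid b c) := ⟨r2, u2, v2⟩
  have hac : Has i.1 x₀ x₃ (.solid a c) := ⟨r1.trans r2, lt_trans u1 u2, lt_trans v2 v1⟩
  have nac := ne_of_passes_solid hac.2
  have d1 : (.solid a b : D.Letter) ≠ .solid a c := by simp [nbc]
  have d2 : (.solid a b : D.Letter) ≠ .solid b c := by simp [nab]
  have d3 : (.solid a c : D.Letter) ≠ .solid b c := by simp [nab]
  obtain ⟨l, _, _, -, hc, ⟨h1, n2, n3⟩, -⟩ := p.exists_order hab hac hbc d1 d2 d3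
  have hl : l = .solid a b ∨ l = .solid b c := by
    rcases hc with ⟨rfl, rfl, rfl⟩ | ⟨rfl, rfl, rfl⟩ | ⟨rfl, rfl, rfl⟩ | ⟨rfl, rfl, rfl⟩ |
      ⟨rfl, rfl, rfl⟩ | ⟨rfl, rfl, rfl⟩
    · exact Or.inl rfl
    · exact Or.inl rfl
    · have := hac.has_iff.1 h1
      have := hab.lt_of_not p.g₁ n2
      have := hbc.lt_of_not p.g₁ n3
      simp only [Letter.fst, Letter.snd, loc] at *
      linarith
    · have := hac.has_iff.1 h1
      have := hab.lt_of_not p.g₁ n3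
      have := hbc.lt_of_not p.g₁ n2
      simp only [Letter.fst, Letter.snd, loc] at *
      linarith
    · exact Or.inr rfl
    · exact Or.inr rfl
  rcases hl with rfl | rfl
  · refine p.ops_of_first hab hac hbc d1 d2 d3 h1 fun y => ?_
    simp only [Letter.fst, Letter.snd, loc]
    intros; linarith
  · rw [ddiff_braid nab nac nbc]
    refine p.ops_of_first hbc hac hab d3.symm d2.symm d1.symm h1 fun y => ?_
    simp only [Letter.fst, Letter.snd, loc]
    intros; linarith

/-- Both strings pass the red one in the same direction, and the product of their dots is symmetric.
The two lemmas that follow rest in the same way on a symmetric product of two values of `Q`. -/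
theorem ops_red (p : TriPath i x₀ x₁ x₂ x₃) {r s : Fin D.n} {c : Fin D.ℓ}
    (h₀ : Has i.1 x₀ x₃ (.solid r s)) (ha : Has i.1 x₀ x₃ (.redRight r c))
    (hb : Has i.1 x₀ x₃ (.redRight s c)) :
    ops i x₀ x₁ x₂ x₃ = ddiff r s * mulL (yy r * yy s) := by
  have hne := ne_of_passes_solid h₀.2
  refine p.ops_outer h₀ ha hb (by simp [hne]) (by simp) (by simp) rfl rfl ?_ ?_ ?_
  · simp [mul_comm]
  · intro y; simp only [Letter.fst, Letter.snd, loc]; intros; linarith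
  · intro y; simp only [Letter.fst, Letter.snd, loc]; intros; linarith

theorem ops_ghost_ghost (p : TriPath i x₀ x₁ x₂ x₃) {r s u : Fin D.n} {ε : D.Γ.Edge}
    (h₀ : Has i.1 x₀ x₃ (.solid r s)) (ha : Has i.1 x₀ x₃ (.ghostRight r ε u))
    (hb : Has i.1 x₀ x₃ (.ghostRight s ε u)) :
    ops i x₀ x₁ x₂ x₃ = ddiff r s * mulL (toRat (evalQ (D.Q (i.1 r) (i.1 u)) r u) *
      toRat (evalQ (D.Q (i.1 s) (i.1 u)) s u)) := by
  have hne := ne_of_passes_solid h₀.2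
  have hur : u ≠ r := by
    rintro rfl; exact owner_ne_partner ε (ha.1.1.trans ha.1.2.symm)
  have hus : u ≠ s := by
    rintro rfl; exact owner_ne_partner ε (hb.1.1.trans hb.1.2.symm)
  have hrs : i.1 r = i.1 s := h₀.1
  refine p.ops_outer h₀ ha hb (by simp [hne]) (by simp) (by simp) rfl rfl ?_ ?_ ?_
  · simp [rename_swap_evalQ, Equiv.swap_apply_of_ne_of_ne hur hus, hrs, mul_comm]
  · intro y; simp only [Letter.fst, Letter.snd, loc]; intros; linarith
  · intro y; simp only [Letter.fst, Letter.snd, loc]; intros; linarith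

theorem ops_solid_solid (p : TriPath i x₀ x₁ x₂ x₃) {r s u : Fin D.n} {ε : D.Γ.Edge}
    (h₀ : Has i.1 x₀ x₃ (.solid r s)) (ha : Has i.1 x₀ x₃ (.ghostRight u ε r))
    (hb : Has i.1 x₀ x₃ (.ghostRight u ε s)) :
    ops i x₀ x₁ x₂ x₃ = ddiff r s * mulL (toRat (evalQ (D.Q (i.1 u) (i.1 s)) u s) *
      toRat (evalQ (D.Q (i.1 u) (i.1 r)) u r)) := by
  have hne := ne_of_passes_solid h₀.2
  have hur : u ≠ r := by
    rintro rfl; exact owner_ne_partner ε (ha.1.1.trans ha.1.2.symm)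
  have hus : u ≠ s := by
    rintro rfl; exact owner_ne_partner ε (hb.1.1.trans hb.1.2.symm)
  have hrs : i.1 r = i.1 s := h₀.1
  refine p.ops_outer h₀ hb ha (by simp [hne.symm]) (by simp) (by simp) rfl rfl ?_ ?_ ?_
  · simp [rename_swap_evalQ, Equiv.swap_apply_of_ne_of_ne hur hus, hrs, mul_comm]
  · intro y; simp only [Letter.fst, Letter.snd, loc]; intros; linarith
  · intro y; simp only [Letter.fst, Letter.snd, loc]; intros; linarith

/-- If two strings are in different orders in two intermediate slices, they cross. -/
theorem reversed_of_between {y y' : Fin D.n → ℝ} (g₀ : D.Generic i.1 x₀) (g₃ : D.Generic i.1 x₃)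
    (hy : D.Between i.1 x₀ y x₃) (hy' : D.Between i.1 x₀ y' x₃) {S T : D.Str}
    (hS : D.Present i.1 S) (hT : D.Present i.1 T) (h : D.loc y S < D.loc y T)
    (h' : D.loc y' T < D.loc y' S) :
    (D.loc x₀ S < D.loc x₀ T ∧ D.loc x₃ T < D.loc x₃ S) ∨
      (D.loc x₀ T < D.loc x₀ S ∧ D.loc x₃ S < D.loc x₃ T) := by
  have hne : S ≠ T := by rintro rfl; exact lt_irrefl _ h
  rcases lt_or_lt g₀ hS hT hne with h1 | h1 <;> rcases lt_or_lt g₃ hS hT hne with h2 | h2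
  · exact absurd (hy' S T hS hT h1 h2) (lt_asymm h')
  · exact Or.inl ⟨h1, h2⟩
  · exact Or.inr ⟨h1, h2⟩
  · exact absurd (hy T S hT hS h1 h2) (lt_asymm h)

/-- If two letters whose operators do not commute occur in both orders, then the operator depends
only on the end points. -/
theorem exists_ops_eq {y y' : Fin D.n → ℝ} (g₀ : D.Generic i.1 x₀) (g₃ : D.Generic i.1 x₃)
    (gy : D.Generic i.1 y) (gy' : D.Generic i.1 y')
    (hy : D.Between i.1 x₀ y x₃) (hy' : D.Between i.1 x₀ y' x₃) {r s : Fin D.n} {l : D.Letter}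
    (h₀ : Has i.1 x₀ x₃ (.solid r s)) (hl : Has i.1 x₀ x₃ l)
    (h1 : Has i.1 x₀ y (.solid r s)) (h2 : ¬ Has i.1 x₀ y l)
    (h1' : ¬ Has i.1 x₀ y' (.solid r s)) (h2' : Has i.1 x₀ y' l)
    (hnc : ¬ Commute (ddiff r s) (opL i.1 l))
    (hex : ∀ r s A M B f, D.Exceptional i.1 r s A M B f → ¬ D.Reversed x₀ x₃ A M B) :
    ∃ F, ∀ x₁ x₂, TriPath i x₀ x₁ x₂ x₃ → ops i x₀ x₁ x₂ x₃ = F := by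
  have hne := ne_of_passes_solid h₀.2
  replace h1 := h₀.has_iff.1 h1
  replace h2 := hl.lt_of_not gy h2
  replace h1' := h₀.lt_of_not gy' h1'
  replace h2' := hl.has_iff.1 h2'
  have hrs : i.1 r = i.1 s := h₀.1
  have o1 := h₀.2.1
  have o2 := h₀.2.2
  have o3 := hl.2.1
  have o4 := hl.2.2
  have rev := fun {S T} => reversed_of_between (S := S) (T := T) g₀ g₃ hy hy'
  cases l with
  | solid t u =>
    simp only [Letter.fst, Letter.snd, loc] at h1 h2 h1' h2' o1 o2 o3 o4
    have htu : i.1 t = i.1 u := hl.1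
    have mk : ∀ {a b : Fin D.n}, i.1 a = i.1 b → D.loc x₀ (.solid a) < D.loc x₀ (.solid b) →
        D.loc x₃ (.solid b) < D.loc x₃ (.solid a) → Has i.1 x₀ x₃ (.solid a b) :=
      fun a b c => ⟨a, b, c⟩
    -- Letters without a common string commute. Otherwise three strings are involved, and the third
    -- pair crosses as well: by transitivity, or because its order differs in `y` and `y'`. All such
    -- triangles have been treated, except for the exceptional ones, which `hex` excludes.
    by_cases e1 : r = t
    · subst e1
      rcases rev (S := .solid s) (T := .solid u) trivial trivial (lt_trans h1 h2)
        (lt_trans h2' h1') with ⟨a, b⟩ | ⟨a, b⟩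
      · exact ⟨_, fun x₁ x₂ p => p.ops_solid h₀ (mk (hrs.symm.trans htu) a b)⟩
      · exact ⟨_, fun x₁ x₂ p => p.ops_solid hl (mk (htu.symm.trans hrs) a b)⟩
    by_cases e2 : r = u
    · subst e2
      exact ⟨_, fun x₁ x₂ p => p.ops_solid hl h₀⟩
    by_cases e3 : s = t
    · subst e3
      exact ⟨_, fun x₁ x₂ p => p.ops_solid h₀ hl⟩
    by_cases e4 : s = u
    · subst e4
      rcases rev (S := .solid t) (T := .solid r) trivial trivial (lt_trans h2 h1)
        (lt_trans h1' h2') with ⟨a, b⟩ | ⟨a, b⟩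
      · exact ⟨_, fun x₁ x₂ p => p.ops_solid (mk (htu.trans hrs.symm) a b) h₀⟩
      · exact ⟨_, fun x₁ x₂ p => p.ops_solid (mk (hrs.trans htu.symm) a b) hl⟩
    exact absurd (commute_ddiff e1 e2 e3 e4) hnc
  | ghostLeft k ε u =>
    exact absurd (by rw [opL, mulL_one]; exact Commute.one_right _) hnc
  | redLeft k c =>
    exact absurd (by rw [opL, mulL_one]; exact Commute.one_right _) hnc
  | redRight k c =>
    simp only [Letter.fst, Letter.snd, loc] at h1 h2 h1' h2' o1 o2 o3 o4
    have hc : D.ρ c = i.1 k := hl.1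
    have mk : ∀ {a : Fin D.n}, D.ρ c = i.1 a → D.loc x₀ (.solid a) < D.loc x₀ (.red c) →
        D.loc x₃ (.red c) < D.loc x₃ (.solid a) → Has i.1 x₀ x₃ (.redRight a c) :=
      fun a b c => ⟨a, b, c⟩
    by_cases e1 : k = r
    · subst e1
      rcases rev (S := .solid s) (T := .red c) trivial trivial (lt_trans h1 h2)
        (lt_trans h2' h1') with ⟨a, b⟩ | ⟨a, b⟩
      · exact ⟨_, fun x₁ x₂ p => p.ops_red h₀ hl (mk (hc.trans hrs) a b)⟩
      · exact absurd ⟨o3, a, b, o4⟩ (hex _ _ _ _ _ _ (.solidRedSolid k s c hrs hc))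
    by_cases e2 : k = s
    · subst e2
      exact ⟨_, fun x₁ x₂ p => p.ops_red h₀ (mk (hc.trans hrs.symm) (lt_trans o1 o3)
        (lt_trans o4 o2)) hl⟩
    refine absurd (commute_ddiff_mulL ?_) hnc
    rw [permRat_yy, Equiv.swap_apply_of_ne_of_ne e1 e2]
  | ghostRight k ε u =>
    simp only [Letter.fst, Letter.snd, loc] at h1 h2 h1' h2' o1 o2 o3 o4
    obtain ⟨hk, hu⟩ : D.Γ.owner D.σ ε = i.1 k ∧ D.Γ.partner D.σ ε = i.1 u := hl.1
    have mk : ∀ {a b : Fin D.n}, D.Γ.owner D.σ ε = i.1 a → D.Γ.partner D.σ ε = i.1 b →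
        D.loc x₀ (.ghost a ε) < D.loc x₀ (.solid b) →
        D.loc x₃ (.solid b) < D.loc x₃ (.ghost a ε) → Has i.1 x₀ x₃ (.ghostRight a ε b) :=
      fun a b c d => ⟨⟨a, b⟩, c, d⟩
    by_cases e1 : k = r
    · subst e1
      rcases rev (S := .ghost s ε) (T := .solid u) (hk.trans hrs) trivial
        (by simp only [loc]; linarith) (by simp only [loc]; linarith) with ⟨a, b⟩ | ⟨a, b⟩
      · exact ⟨_, fun x₁ x₂ p => p.ops_ghost_ghost h₀ hl (mk (hk.trans hrs) hu a b)⟩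
      · exact absurd ⟨o3, a, b, o4⟩ (hex _ _ _ _ _ _ (.ghostSolidGhost k u s ε hrs hk hu))
    by_cases e2 : k = s
    · subst e2
      exact ⟨_, fun x₁ x₂ p => p.ops_ghost_ghost h₀ (mk (hk.trans hrs.symm) hu
        (by simp only [loc]; linarith) (by simp only [loc]; linarith)) hl⟩
    by_cases e3 : u = r
    · subst e3
      exact ⟨_, fun x₁ x₂ p => p.ops_solid_solid h₀ hl (mk hk (hu.trans hrs)
        (by simp only [loc]; linarith) (by simp only [loc]; linarith))⟩
    by_cases e4 : u = s
    · subst e4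
      rcases rev (S := .ghost k ε) (T := .solid r) hk trivial
        (by simp only [loc]; linarith) (by simp only [loc]; linarith) with ⟨a, b⟩ | ⟨a, b⟩
      · exact ⟨_, fun x₁ x₂ p => p.ops_solid_solid h₀ (mk hk (hu.trans hrs.symm) a b) hl⟩
      · exact absurd ⟨a, o3, o4, b⟩
          (hex _ _ _ _ _ _ (.solidGhostSolid r k u ε hrs hk (hu.trans hrs.symm)))
    refine absurd (commute_ddiff_mulL ?_) hnc
    rw [permRat_toRat, rename_swap_evalQ, Equiv.swap_apply_of_ne_of_ne e1 e2,
      Equiv.swap_apply_of_ne_of_ne e3 e4]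

theorem opL_cases (i : Fin D.n → I) (l : D.Letter) :
    (∃ r s, l = .solid r s) ∨ ∃ f, opL i l = mulL f := by
  cases l
  · exact Or.inl ⟨_, _, rfl⟩
  all_goals exact Or.inr ⟨_, rfl⟩

/-- Reidemeister III outside of the exceptional cases. -/
theorem ops_eq_ops (p : TriPath i x₀ x₁ x₂ x₃) {y₁ y₂ : Fin D.n → ℝ} (q : TriPath i x₀ y₁ y₂ x₃)
    (hex : ∀ r s A M B f, D.Exceptional i.1 r s A M B f → ¬ D.Reversed x₀ x₃ A M B) :
    ops i x₀ x₁ x₂ x₃ = ops i x₀ y₁ y₂ x₃ := by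
  have hpt : ∀ {z₁ z₂}, TriPath i x₀ z₁ z₂ x₃ → ∀ z, (z = z₁ ∨ z = z₂) →
      D.Generic i.1 z ∧ D.Between i.1 x₀ z x₃ := by
    rintro z₁ z₂ t z (rfl | rfl)
    · exact ⟨t.g₁, t.between₁⟩
    · exact ⟨t.g₂, t.between₂⟩
  -- Either all letters that occur in opposite orders commute, and then the two words have the same
  -- product; or two non-commuting letters occur in both orders, and then `exists_ops_eq` determines
  -- the operator of every path with these ends.
  by_cases H : ∀ a b, (Before i x₀ x₁ x₂ b a ∧ Has i.1 x₀ x₃ a ∧ Has i.1 x₀ x₃ b) →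
      (Before i x₀ y₁ y₂ a b ∧ Has i.1 x₀ x₃ b ∧ Has i.1 x₀ x₃ a) →
      Commute (opL i.1 a) (opL i.1 b)
  · have hw : ∀ {z₁ z₂}, TriPath i x₀ z₁ z₂ x₃ → (word i x₀ z₁ z₂ x₃).Pairwise fun a b =>
        Before i x₀ z₁ z₂ b a ∧ Has i.1 x₀ x₃ a ∧ Has i.1 x₀ x₃ b := fun t =>
      t.pairwise_word.imp_of_mem fun ha hb h => ⟨h, (t.mem_word _).1 ha, (t.mem_word _).1 hb⟩
    rw [ops_eq, ops_eq]
    refine prod_eq_of_commute _ _ _ H ?_ (hw p) (hw q)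
    rw [List.perm_ext_iff_of_nodup p.nodup_word q.nodup_word]
    intro l
    rw [p.mem_word, q.mem_word]
  · push Not at H
    obtain ⟨a, b, ⟨⟨y, hy, yb, ya⟩, ha, hb⟩, ⟨⟨y', hy', ya', yb'⟩, -, -⟩, hnc⟩ := H
    obtain ⟨g, h⟩ := hpt p y hy
    obtain ⟨g', h'⟩ := hpt q y' hy'
    obtain ⟨F, hF⟩ : ∃ F, ∀ x₁ x₂, TriPath i x₀ x₁ x₂ x₃ → ops i x₀ x₁ x₂ x₃ = F := by
      rcases opL_cases i.1 a with ⟨r, s, rfl⟩ | ⟨f, ef⟩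
      · exact exists_ops_eq p.g₀ p.g₃ g' g h' h ha hb ya' yb' ya yb hnc hex
      rcases opL_cases i.1 b with ⟨r, s, rfl⟩ | ⟨f', ef'⟩
      · exact exists_ops_eq p.g₀ p.g₃ g g' h h' hb ha yb ya yb' ya' (fun hc => hnc hc.symm) hex
      · refine absurd ?_ hnc
        rw [ef, ef', Commute, SemiconjBy, mulL_mul, mulL_mul, mul_comm]
    rw [hF _ _ p, hF _ _ q]

theorem ddiff_mulL_sub (r s : Fin D.n) (f : Rat R D.n) :
    ddiff r s * mulL f = mulL f * ddiff r s + mulL (ddiff r s f) * permL (Equiv.swap r s) := by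
  refine LinearMap.ext fun z => ?_
  simp [ddiff_mul]

/-- The quotient `diffQ` has the denominator `y_s - y_r`, whereas `ddiff r s` has `y_r - y_s`; hence
the sign. -/
theorem neg_diffQ_eq (Q : MvPolynomial (Fin 2) R) {r u s : Fin D.n} (hne : r ≠ s) (hur : u ≠ r)
    (hus : u ≠ s) : toRat (-diffQ Q r u s) = ddiff r s (toRat (evalQ Q r u)) := by
  have e := congrArg toRat (sub_mul_diffQ Q r u s)
  rw [ddiff_apply, eq_div_iff (yy_sub_ne_zero hne), permRat_toRat, rename_swap_evalQ,
    Equiv.swap_apply_left, Equiv.swap_apply_of_ne_of_ne hur hus, ← map_sub, ← e]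
  simp only [yy, ← map_sub, ← map_mul]
  congr 1
  ring

theorem permL_mul_mulL (w : Equiv.Perm (Fin D.n)) (f : Rat R D.n) :
    permL w * mulL f = mulL (permRat w f) * permL w := by
  refine LinearMap.ext fun z => ?_
  simp

/-- The exceptional cases of Reidemeister III. -/
theorem ops_exceptional (p : TriPath i x₀ x₁ x₂ x₃) {y₁ y₂ : Fin D.n → ℝ}
    (q : TriPath i x₀ y₁ y₂ x₃) {r s : Fin D.n} {A M B : D.Str} {f : MvPolynomial (Fin D.n) R}
    (hex : D.Exceptional i.1 r s A M B f) (hrev : D.Reversed x₀ x₃ A M B)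
    (hleft : D.loc x₁ M < D.loc x₁ A) (hright : D.loc y₁ B < D.loc y₁ M) :
    ops i x₀ x₁ x₂ x₃ = ops i x₀ y₁ y₂ x₃ + permL (Equiv.swap r s) * mulL (toRat f) := by
  have hne := hex.ne_of_reversed hrev
  -- The side on which `M` passes determines the first crossing, so `p` has the order `A M`, `A B`,
  -- `M B` and `q` the reverse one. What remains is an operator identity, in which the error is the
  -- second term of the twisted Leibniz rule.
  have key : ∀ {am mb : D.Letter} {f' g' : Rat R D.n}, am.fst = A → am.snd = M → mb.fst = M →
      mb.snd = B → am.Sig i.1 → mb.Sig i.1 → (am ≠ mb) → (am ≠ .solid r s) → (mb ≠ .solid r s) →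
      i.1 r = i.1 s → A.off = B.off → A.base = some r → B.base = some s → opL i.1 am = mulL f' →
      opL i.1 mb = mulL g' →
      (mulL g' * (ddiff r s * mulL f') : Module.End R (Rat R D.n)) =
      mulL f' * (ddiff r s * mulL g') + permL (Equiv.swap r s) * mulL (toRat f) →
      ops i x₀ x₁ x₂ x₃ = ops i x₀ y₁ y₂ x₃ + permL (Equiv.swap r s) * mulL (toRat f) := by
    intro am mb f' g' e1 e2 e3 e4 s1 s2 n1 n2 n3 hrs hoff hA hB o1 o2 hop
    have h1 : Has i.1 x₀ x₃ am := ⟨s1, by rw [e1, e2]; exact ⟨hrev.1, hrev.2.2.2⟩⟩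
    have h2 : Has i.1 x₀ x₃ mb := ⟨s2, by rw [e3, e4]; exact ⟨hrev.2.1, hrev.2.2.1⟩⟩
    have lA : ∀ z, D.loc z A = z r + A.off := fun z => by rw [loc_eq, hA]; rfl
    have lB : ∀ z, D.loc z B = z s + A.off := fun z => by rw [loc_eq, hB, hoff]; rfl
    obtain ⟨r1, r2, r3, r4⟩ := hrev
    rw [lA] at r1 r4 hleft
    rw [lB] at r2 r3 hright
    have h3 : Has i.1 x₀ x₃ (.solid r s) := ⟨hrs, by
      simp only [Passes, Letter.fst, Letter.snd, loc]; constructor <;> linarith⟩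
    have E1 := p.ops_of_first h1 h3 h2 n2 n1 n3.symm
      (h1.has_iff.2 (by rw [e1, e2, lA]; exact hleft)) (fun y => by
        rw [e1, e2, e3, e4, lA, lB]; simp only [Letter.fst, Letter.snd, loc]; intros; linarith)
    have E2 := q.ops_of_first h2 h3 h1 n3 n1.symm n2.symm
      (h2.has_iff.2 (by rw [e3, e4, lB]; exact hright)) (fun y => by
        rw [e1, e2, e3, e4, lA, lB]; simp only [Letter.fst, Letter.snd, loc]; intros; linarith)
    rw [E1, E2, o1, o2]
    exact hop
  cases hex with
  | ghostSolidGhost u s ε hrs ho hp =>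
    have hur : u ≠ r := by rintro rfl; exact owner_ne_partner ε (ho.trans hp.symm)
    have hus : u ≠ s := by
      rintro rfl; exact owner_ne_partner ε (ho.trans (hrs.trans hp.symm))
    refine key (am := .ghostRight r ε u) (mb := .ghostLeft s ε u) rfl rfl rfl rfl ⟨ho, hp⟩
      ⟨ho.trans hrs, hp⟩ (by simp) (by simp) (by simp) hrs rfl rfl rfl rfl rfl ?_
    rw [permL_mul_mulL, neg_diffQ_eq _ hne hur hus, permRat_swap_ddiff, ddiff_mulL_sub, mulL_one,
      one_mul, mul_one]
  | solidGhostSolid u s ε hrs ho hp =>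
    have hur : u ≠ r := by rintro rfl; exact owner_ne_partner ε (ho.trans hp.symm)
    have hus : u ≠ s := by
      rintro rfl; exact owner_ne_partner ε (ho.trans (hrs.symm.trans hp.symm))
    refine key (am := .ghostLeft u ε r) (mb := .ghostRight u ε s) rfl rfl rfl rfl ⟨ho, hp⟩
      ⟨ho, hp.trans hrs⟩ (by simp) (by simp) (by simp) hrs rfl rfl rfl rfl rfl ?_
    rw [permL_mul_mulL, neg_diffQ_eq _ hne hur hus, permRat_swap_ddiff, evalQ_symm, ← hrs,
      ddiff_mulL_sub r s (toRat (evalQ _ s u))]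
    have e : ddiff r s (toRat (evalQ (D.Q (i.1 r) (i.1 u)) s u)) =
        - ddiff r s (toRat (evalQ (D.Q (i.1 r) (i.1 u)) r u)) := by
      rw [ddiff_apply, ddiff_apply, permRat_toRat, permRat_toRat, rename_swap_evalQ,
        rename_swap_evalQ, Equiv.swap_apply_left, Equiv.swap_apply_right,
        Equiv.swap_apply_of_ne_of_ne hur hus, ← neg_div, neg_sub]
    rw [e]
    refine LinearMap.ext fun z => ?_
    simp
  | solidRedSolid s c hrs hc =>
    refine key (am := .redRight r c) (mb := .redLeft s c) rfl rfl rfl rfl hc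
      (hc.trans hrs) (by simp) (by simp) (by simp) hrs rfl rfl rfl rfl rfl ?_
    rw [ddiff_mulL_sub, ddiff_yy_left hne]
    refine LinearMap.ext fun z => ?_
    simp

end TriPath

end Datum

end WKLRW

end

/-! ### The action of diagrams on rational functions -/

noncomputable section


namespace WKLRW

/-- The value of a linear map on polynomials that is compatible with the variables. -/
theorem eq_sum_of_mul_X {R B : Type*} [CommRing R] [Ring B] [Algebra R B] {n : ℕ}
    (ψ : MvPolynomial (Fin n) R →ₗ[R] B) (d : Fin n → B)
    (h : ∀ k f, ψ (MvPolynomial.X k * f) = d k * ψ f) (f : MvPolynomial (Fin n) R) :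
    ∑ m ∈ f.support, f.coeff m • ((List.ofFn fun k => d k ^ m k).prod * ψ 1) = ψ f := by
  have h1 : ∀ k j f, ψ (MvPolynomial.X k ^ j * f) = d k ^ j * ψ f := by
    intro k j
    induction j with
    | zero => simp
    | succ j ih => intro f; rw [pow_succ, pow_succ, mul_assoc, mul_assoc, ih, h]
  have h2 : ∀ (m : Fin n → ℕ) (L : List (Fin n)) f,
      ψ ((L.map fun k => MvPolynomial.X k ^ m k).prod * f) =
        (L.map fun k => d k ^ m k).prod * ψ f := by
    intro m L
    induction L with
    | nil => simp
    | cons a L ih => intro f; simp only [List.map_cons, List.prod_cons, mul_assoc, h1, ih]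
  conv_rhs => rw [f.as_sum]
  rw [map_sum]
  refine Finset.sum_congr rfl fun m _ => ?_
  have e : (List.ofFn fun k => d k ^ m k) = (List.finRange n).map fun k => d k ^ m k :=
    List.ofFn_eq_map
  rw [e, ← h2, ← List.ofFn_eq_map, List.prod_ofFn, mul_one, ← map_smul]
  congr 1
  rw [MvPolynomial.monomial_eq, Finsupp.prod_fintype _ _ (by simp), MvPolynomial.smul_eq_C_mul]

namespace Datum

open Wall Str MvPolynomial

variable {R I : Type*} [CommRing R] {D : Datum R I}

namespace Letter

/-- Renumbering the solid strings. -/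
def perm (w : Equiv.Perm (Fin D.n)) : D.Letter → D.Letter
  | .solid r s => .solid (w r) (w s)
  | .ghostRight k ε s => .ghostRight (w k) ε (w s)
  | .ghostLeft k ε s => .ghostLeft (w k) ε (w s)
  | .redRight k c => .redRight (w k) c
  | .redLeft k c => .redLeft (w k) c

theorem fst_perm (w : Equiv.Perm (Fin D.n)) (l : D.Letter) : (l.perm w).fst = l.fst.perm w := by
  cases l <;> rfl

theorem snd_perm (w : Equiv.Perm (Fin D.n)) (l : D.Letter) : (l.perm w).snd = l.snd.perm w := by
  cases l <;> rfl

theorem sig_perm {w : Equiv.Perm (Fin D.n)} {i i' : Fin D.n → I} (h : ∀ k, i' (w k) = i k)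
    (l : D.Letter) : (l.perm w).Sig i' ↔ l.Sig i := by
  cases l <;> simp [perm, Sig, h]

theorem perm_symm_perm (w : Equiv.Perm (Fin D.n)) (l : D.Letter) :
    (l.perm w.symm).perm w = l := by
  cases l <;> simp [perm]

theorem has_perm {w : Equiv.Perm (Fin D.n)} {i i' : Fin D.n → I} (h : ∀ k, i' (w k) = i k)
    (x y : Fin D.n → ℝ) (l : D.Letter) : Has i' x y (l.perm w) ↔ Has i (x ∘ w) (y ∘ w) l := by
  rw [Has, Has, sig_perm h, Passes, Passes, fst_perm, snd_perm, loc_perm, loc_perm, loc_perm,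
    loc_perm]

/-- The crossing that is read from top to bottom. -/
def rev : D.Letter → D.Letter
  | .solid r s => .solid s r
  | .ghostRight k ε s => .ghostLeft k ε s
  | .ghostLeft k ε s => .ghostRight k ε s
  | .redRight k c => .redLeft k c
  | .redLeft k c => .redRight k c

theorem has_rev {i : Fin D.n → I} {x y : Fin D.n → ℝ} {l : D.Letter} (h : Has i x y l) :
    Has i y x l.rev := by
  obtain ⟨h1, h2, h3⟩ := h
  cases l
  · exact ⟨Eq.symm h1, h3, h2⟩
  all_goals exact ⟨h1, h3, h2⟩

end Letter

namespace Move

theorem generic_end (m : D.Move) : D.Generic m.bot.res.1 m.endPos :=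
  generic_perm m.res_comp m.top.generic

theorem card_le (m : D.Move) : (sp m.bot.res m.bot.pos m.endPos).card ≤ 1 :=
  card_sp_le_one_iff.2 m.elementary

theorem solidCross_iff (m : D.Move) (r s : Fin D.n) :
    m.SolidCross r s ↔ Has m.bot.res.1 m.bot.pos m.endPos (.solid r s) := Iff.rfl

theorem ghostCross_iff (m : D.Move) (k : Fin D.n) (ε : D.Γ.Edge) (s : Fin D.n) :
    m.GhostCross k ε s ↔ Has m.bot.res.1 m.bot.pos m.endPos (.ghostRight k ε s) ∨
      Has m.bot.res.1 m.bot.pos m.endPos (.ghostLeft k ε s) := by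
  simp only [GhostCross, Has, Letter.Sig, Letter.fst, Letter.snd]
  tauto

theorem redCross_iff (m : D.Move) (k : Fin D.n) (c : Fin D.ℓ) :
    m.RedCross k c ↔ Has m.bot.res.1 m.bot.pos m.endPos (.redRight k c) ∨
      Has m.bot.res.1 m.bot.pos m.endPos (.redLeft k c) := by
  simp only [RedCross, Has, Letter.Sig, Letter.fst, Letter.snd]
  tauto

theorem endPos_of_hw {m m₀ : D.Move} {v : Equiv.Perm (Fin D.n)} (htop : m₀.top = m.top)
    (hw : m₀.w = m.w * v) : m₀.endPos = m.endPos ∘ v := by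
  funext k
  simp [endPos, htop, hw]

end Move

variable [IsDomain R]

theorem permL_mul {n : ℕ} (v w : Equiv.Perm (Fin n)) :
    (permL v * permL w : Module.End R (Rat R n)) = permL (v * w) :=
  LinearMap.ext fun z => (permRat_mul_apply v w z).symm

theorem permL_one {n : ℕ} : (permL 1 : Module.End R (Rat R n)) = 1 :=
  LinearMap.ext fun z => by simp

theorem opL_perm {w : Equiv.Perm (Fin D.n)} {i i' : Fin D.n → I} (h : ∀ k, i' (w k) = i k)
    (l : D.Letter) : opL i' (l.perm w) * permL w = permL w * opL i l := by
  have hm : ∀ f : Rat R D.n, permL w * mulL f = mulL (permRat w f) * permL w :=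
    TriPath.permL_mul_mulL w
  cases l with
  | solid r s =>
    refine LinearMap.ext fun z => ?_
    simp only [Letter.perm, opL, Module.End.mul_apply, AlgHom.toLinearMap_apply]
    exact (permRat_ddiff w r s z).symm
  | ghostRight k ε s =>
    simp only [Letter.perm, opL, hm, permRat_toRat, rename_swap_evalQ, h]
  | ghostLeft k ε s => simp only [Letter.perm, opL, hm, map_one]
  | redRight k c => simp only [Letter.perm, opL, hm, permRat_yy]
  | redLeft k c => simp only [Letter.perm, opL, hm, map_one]

/-- Renumbering the solid strings in the operator of an elementary piece. -/
theorem opS_perm {w : Equiv.Perm (Fin D.n)} {i i' : D.ResSeq} (h : ∀ k, i'.1 (w k) = i.1 k)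
    {x y : Fin D.n → ℝ} (hx : D.Generic i'.1 x) (hc : (sp i' x y).card ≤ 1) :
    opS i'.1 x y * permL w = permL w * opS i.1 (x ∘ w) (y ∘ w) := by
  have hx' : D.Generic i.1 (x ∘ w) := generic_perm h hx
  have hc' : (sp i (x ∘ w) (y ∘ w)).card ≤ 1 := by rwa [← card_sp_perm h]
  by_cases H : ∃ l : D.Letter, Has i.1 (x ∘ w) (y ∘ w) l
  · obtain ⟨l, hl⟩ := H
    rw [opS_of_has hx' hc' hl, opS_of_has hx hc ((Letter.has_perm h x y l).2 hl), opL_perm h]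
  · push Not at H
    rw [opS_of_not H, opS_of_not, mul_one, one_mul]
    intro l hl
    refine H (l.perm w.symm) ((Letter.has_perm h x y _).1 ?_)
    rwa [Letter.perm_symm_perm]

open Classical in
/-- The operator with a single non-zero block. -/
def blk (s t : D.Slice) (f : Module.End R (Rat R D.n)) : Module.End R (D.Slice → Rat R D.n) :=
  LinearMap.single R (fun _ : D.Slice => Rat R D.n) t ∘ₗ f ∘ₗ LinearMap.proj s

theorem blk_mul (s t u : D.Slice) (f g : Module.End R (Rat R D.n)) :
    blk t u g * blk s t f = blk s u (g * f) := by
  classical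
  refine LinearMap.ext fun v => ?_
  simp [blk, Module.End.mul_apply]

theorem blk_mul_of_ne {s t t' u : D.Slice} (h : t ≠ t') (f g : Module.End R (Rat R D.n)) :
    blk t' u g * blk s t f = 0 := by
  classical
  refine LinearMap.ext fun v => ?_
  simp [blk, Module.End.mul_apply, Pi.single_eq_of_ne h.symm]

theorem blk_add (s t : D.Slice) (f g : Module.End R (Rat R D.n)) :
    blk s t (f + g) = blk s t f + blk s t g := by
  simp [blk, LinearMap.add_comp, LinearMap.comp_add]

theorem blk_sub (s t : D.Slice) (f g : Module.End R (Rat R D.n)) :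
    blk s t (f - g) = blk s t f - blk s t g := by
  simp [blk, LinearMap.sub_comp, LinearMap.comp_sub]

theorem blk_smul (s t : D.Slice) (c : R) (f : Module.End R (Rat R D.n)) :
    blk s t (c • f) = c • blk s t f := by
  simp [blk, LinearMap.smul_comp, LinearMap.comp_smul]

theorem blk_zero (s t : D.Slice) : blk s t (0 : Module.End R (Rat R D.n)) = 0 := by
  simp [blk]

theorem blk_inj {s t : D.Slice} {f g : Module.End R (Rat R D.n)} (h : blk s t f = blk s t g) :
    f = g := by
  classical
  refine LinearMap.ext fun z => ?_
  have := congrFun (LinearMap.congr_fun h (fun _ => z)) t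
  simpa [blk] using this

/-- The operator of an elementary piece. -/
def opM (m : D.Move) : Module.End R (Rat R D.n) :=
  permL m.w * opS m.bot.res.1 m.bot.pos m.endPos

/-- The action of the generators on rational functions. -/
def repGen : D.Gen → Module.End R (D.Slice → Rat R D.n)
  | .idem s => blk s s 1
  | .dot s k => blk s s (mulL (yy k))
  | .move m => blk m.bot m.top (opM m)

/-- The action of linear combinations of diagrams on rational functions. -/
def repFree : D.Free →ₐ[R] Module.End R (D.Slice → Rat R D.n) := FreeAlgebra.lift R repGen

@[simp] theorem repFree_idem (s : D.Slice) : repFree (D.idem s) = blk s s 1 := by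
  simp [repFree, idem, repGen]

@[simp] theorem repFree_dot (s : D.Slice) (k : Fin D.n) :
    repFree (D.dot s k) = blk s s (mulL (yy k)) := by
  simp [repFree, dot, repGen]

@[simp] theorem repFree_mv (m : D.Move) : repFree (D.mv m) = blk m.bot m.top (opM m) := by
  simp [repFree, mv, repGen]

theorem repFree_poly (s : D.Slice) (f : MvPolynomial (Fin D.n) R) :
    repFree (D.poly s f) = blk s s (mulL (toRat f)) := by
  let ψ : MvPolynomial (Fin D.n) R →ₗ[R] Module.End R (D.Slice → Rat R D.n) :=
    { toFun := fun f => blk s s (mulL (toRat f))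
      map_add' := fun f g => by
        rw [← blk_add]; congr 1; refine LinearMap.ext fun z => ?_; simp [add_mul]
      map_smul' := fun c f => by
        rw [RingHom.id_apply, ← blk_smul]; congr 1; refine LinearMap.ext fun z => ?_; simp }
  have h1 : ψ 1 = repFree (D.idem s) := by
    rw [repFree_idem, ← mulL_one, ← map_one toRat]; rfl
  rw [poly, map_sum]
  refine Eq.trans ?_ (eq_sum_of_mul_X ψ (fun k => repFree (D.dot s k)) ?_ f)
  · refine Finset.sum_congr rfl fun m _ => ?_
    rw [map_smul, map_mul, h1, map_list_prod, List.map_ofFn]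
    simp only [Function.comp_def, map_pow]
  · intro k f
    change blk s s _ = _ * blk s s _
    rw [repFree_dot, blk_mul, mulL_mul, map_mul]; rfl

namespace Path3

/-- The positions in a reduced path. -/
theorem triPath (p : D.Path3) (hp : p.Reduced) :
    TriPath p.a.bot.res p.x0 p.x1 p.x2 p.x3 := by
  have hb : ∀ k, p.b.bot.res.1 (p.a.w k) = p.a.bot.res.1 k := by
    rw [p.hab]; exact p.a.res_comp
  have hb' : ∀ k, p.b.top.res.1 ((p.b.w * p.a.w) k) = p.a.bot.res.1 k := fun k =>
    (p.b.res_comp _).trans (hb k)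
  have hc : ∀ k, p.c.bot.res.1 ((p.b.w * p.a.w) k) = p.a.bot.res.1 k := by
    rw [p.hbc]; exact hb'
  have hc' : ∀ k, p.c.top.res.1 ((p.c.w * p.b.w * p.a.w) k) = p.a.bot.res.1 k := fun k =>
    (p.c.res_comp _).trans (hc k)
  have g₀ : D.Generic p.a.bot.res.1 p.x0 := p.a.bot.generic
  have g₁ : D.Generic p.a.bot.res.1 p.x1 := p.a.generic_end
  have g₂ : D.Generic p.a.bot.res.1 p.x2 := generic_perm hb' p.b.top.generic
  have g₃ : D.Generic p.a.bot.res.1 p.x3 := generic_perm hc' p.c.top.generic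
  refine ⟨g₀, g₁, g₂, g₃, p.a.card_le, ?_, ?_, (between_iff_red g₀ g₁ g₃).1 hp.1,
    (between_iff_red g₀ g₂ g₃).1 hp.2.1, (between_iff_red g₀ g₁ g₂).1 hp.2.2⟩
  · have := p.b.card_le
    rw [card_sp_perm hb] at this
    convert this using 3
    · rw [p.hab]; rfl
    · rfl
  · have := p.c.card_le
    rw [card_sp_perm hc] at this
    convert this using 3
    · rw [p.hbc]; rfl
    · rfl

/-- By `opS_perm` the renumberings of the three pieces are collected on the left, so that all
crossing operators refer to the numbering at the bottom, where `ops` compares different paths. -/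
theorem repFree_diagram (p : D.Path3) : repFree p.diagram = blk p.a.bot p.c.top
    (permL (p.c.w * p.b.w * p.a.w) * TriPath.ops p.a.bot.res p.x0 p.x1 p.x2 p.x3) := by
  have hb : ∀ k, p.b.bot.res.1 (p.a.w k) = p.a.bot.res.1 k := by
    rw [p.hab]; exact p.a.res_comp
  have hc : ∀ k, p.c.bot.res.1 ((p.b.w * p.a.w) k) = p.a.bot.res.1 k := by
    rw [p.hbc]; exact fun k => (p.b.res_comp _).trans (hb k)
  have e1 : p.b.bot.pos ∘ p.a.w = p.x1 := by rw [p.hab]; rfl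
  have e2 : p.c.bot.pos ∘ (p.b.w * p.a.w) = p.x2 := by rw [p.hbc]; rfl
  have e3 := opS_perm hb p.b.bot.generic p.b.card_le
  have e4 := opS_perm hc p.c.bot.generic p.c.card_le
  rw [e1] at e3
  rw [e2] at e4
  have e5 : p.b.endPos ∘ p.a.w = p.x2 := rfl
  have e6 : p.c.endPos ∘ (p.b.w * p.a.w) = p.x3 := rfl
  rw [e5] at e3
  rw [e6] at e4
  rw [diagram, map_mul, map_mul, repFree_mv, repFree_mv, repFree_mv, show p.c.bot = p.b.top from
    p.hbc, blk_mul, show p.b.bot = p.a.top from p.hab, blk_mul]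
  congr 1
  rw [TriPath.ops, opM, opM, opM, mul_assoc (permL p.c.w) _, mul_assoc (permL p.c.w) _,
    mul_assoc p.c.w, ← permL_mul, mul_assoc (permL p.c.w)]
  congr 1
  have e7 : (permL p.b.w * opS p.b.bot.res.1 p.b.bot.pos p.b.endPos) *
      (permL p.a.w * opS p.a.bot.res.1 p.a.bot.pos p.a.endPos) = permL (p.b.w * p.a.w) *
      (opS p.a.bot.res.1 p.x1 p.x2 * opS p.a.bot.res.1 p.x0 p.x1) := by
    rw [mul_assoc, ← mul_assoc _ (permL p.a.w), e3, ← permL_mul]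
    simp only [mul_assoc]; rfl
  rw [mul_assoc, e7, ← mul_assoc, e4, mul_assoc]

end Path3

theorem opL_of_not_solid {i : Fin D.n → I} {k : Fin D.n} {l : D.Letter}
    (h : ∀ s, l ≠ .solid k s ∧ l ≠ .solid s k) : Commute (opL i l) (mulL (yy k)) := by
  rcases TriPath.opL_cases i l with ⟨r, s, rfl⟩ | ⟨f, hf⟩
  · refine commute_ddiff_mulL ?_
    rw [permRat_yy, Equiv.swap_apply_of_ne_of_ne]
    · rintro rfl; exact (h s).1 rfl
    · rintro rfl; exact (h r).2 rfl
  · rw [hf, Commute, SemiconjBy, mulL_mul, mulL_mul, mul_comm]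

theorem opM_of_swap {m m₀ : D.Move} {r s : Fin D.n} (h : m.SolidCross r s)
    (hbot : m₀.bot = m.bot) (htop : m₀.top = m.top) (hw : m₀.w = m.w * Equiv.swap r s) :
    opM m₀ = permL m.w * permL (Equiv.swap r s) := by
  rw [opM, Move.endPos_of_hw htop hw, hw, hbot, opS_of_empty
    (sp_swap_of_single m.generic_end.gen m.card_le h), mul_one, permL_mul]

theorem repFree_double {m m' : D.Move} (hbot : m'.bot = m.top) (htop : m'.top = m.bot)
    (hw : m'.w = m.w⁻¹) : repFree (D.mv m' * D.mv m) = blk m.bot m.bot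
      (opS m.bot.res.1 m.endPos m.bot.pos * opS m.bot.res.1 m.bot.pos m.endPos) := by
  have h : ∀ k, m'.bot.res.1 (m.w k) = m.bot.res.1 k := by rw [hbot]; exact m.res_comp
  have e := opS_perm h m'.bot.generic m'.card_le
  have e1 : m'.bot.pos ∘ m.w = m.endPos := by rw [hbot]; rfl
  have e2 : m'.endPos ∘ m.w = m.bot.pos := by
    funext k; simp [Move.endPos, htop, hw]
  rw [e1, e2] at e
  rw [map_mul, repFree_mv, repFree_mv, hbot, blk_mul, htop, opM, opM, mul_assoc,
    ← mul_assoc _ (permL m.w), e, hw, mul_assoc, ← mul_assoc (permL _), permL_mul, inv_mul_cancel,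
    permL_one, one_mul]

theorem repFree_double_of_has {m m' : D.Move} (hbot : m'.bot = m.top) (htop : m'.top = m.bot)
    (hw : m'.w = m.w⁻¹) {l : D.Letter} (h : Has m.bot.res.1 m.bot.pos m.endPos l) :
    repFree (D.mv m' * D.mv m) =
      blk m.bot m.bot (opL m.bot.res.1 l.rev * opL m.bot.res.1 l) := by
  rw [repFree_double hbot htop hw, opS_of_has m.bot.generic m.card_le h,
    opS_of_has m.generic_end (by rw [card_sep_comm (isArr_walls _)]; exact m.card_le)
      (Letter.has_rev h)]

/-- Dots and solid crossings obey the twisted Leibniz rule, and a repeated divided difference is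
zero. In a double crossing with a ghost one passage gives `Q` and the other `1`, so the product is
`Q` whichever comes first; likewise for red strings. Reidemeister III is `ops_eq_ops` and
`ops_exceptional`. -/
theorem repFree_rel {a b : D.Free} (h : D.Rel a b) : repFree a = repFree b := by
  have cm : ∀ m : D.Move, (opM m : Module.End R (Rat R D.n)) =
    permL m.w * opS m.bot.res.1 m.bot.pos m.endPos := fun m => rfl
  have hm : ∀ (w : Equiv.Perm (Fin D.n)) k, mulL (yy (w k) : Rat R D.n) * permL w =
      permL w * mulL (yy k) := fun w k => by
    rw [TriPath.permL_mul_mulL, permRat_yy]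
  cases h with
  | idem_mul_self s => simp [blk_mul]
  | idem_mul_of_ne s t h => simp [blk_mul_of_ne h.symm]
  | idem_dot s k => simp [blk_mul]
  | dot_idem s k => simp [blk_mul]
  | idem_move m => simp [blk_mul]
  | move_idem m => simp [blk_mul]
  | move_refl m h hw =>
    rw [repFree_mv, repFree_idem, ← h, opM, hw, permL_one, one_mul, opS_of_empty]
    have : m.endPos = m.bot.pos := by funext k; simp [Move.endPos, ← h, hw]
    rw [this, sp, sep_self]
  | dot_comm s k l =>
    simp only [map_mul, repFree_dot, blk_mul, mulL_mul, mul_comm]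
  | dot_slide m k h =>
    rw [map_mul, map_mul, repFree_mv, repFree_dot, repFree_dot, blk_mul, blk_mul, cm, ← mul_assoc,
      hm, mul_assoc, mul_assoc]
    congr 2
    by_cases H : ∃ l : D.Letter, Has m.bot.res.1 m.bot.pos m.endPos l
    · obtain ⟨l, hl⟩ := H
      rw [opS_of_has m.bot.generic m.card_le hl]
      refine (opL_of_not_solid fun s => ⟨?_, ?_⟩).eq.symm
      · rintro rfl; exact (h s).1 hl
      · rintro rfl; exact (h s).2 hl
    · push Not at H
      rw [opS_of_not H, one_mul, mul_one]
  | dot_cross_left m m₀ r s h hbot htop hw =>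
    have hne := ne_of_passes_solid h.2
    rw [map_sub, map_mul, map_mul, repFree_mv, repFree_mv, repFree_dot, repFree_dot, blk_mul,
      blk_mul, ← blk_sub, opM_of_swap h hbot htop hw, hbot, htop, cm, ← mul_assoc (mulL _), hm,
      mul_assoc, mul_assoc, ← mul_sub, opS_of_has m.bot.generic m.card_le
      ((m.solidCross_iff r s).1 h), opL, TriPath.ddiff_mulL_sub, ddiff_yy_left hne, add_sub_cancel_left, mulL_one, one_mul]
  | dot_cross_right m m₀ r s h hbot htop hw =>
    have hne := ne_of_passes_solid h.2
    rw [map_sub, map_mul, map_mul, repFree_mv, repFree_mv, repFree_dot, repFree_dot, blk_mul,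
      blk_mul, ← blk_sub, opM_of_swap h hbot htop hw, hbot, htop, cm, ← mul_assoc (mulL _), hm,
      mul_assoc, mul_assoc, ← mul_sub, opS_of_has m.bot.generic m.card_le
      ((m.solidCross_iff r s).1 h), opL, TriPath.ddiff_mulL_sub, ddiff_yy_right hne, sub_add_cancel_left]
    congr 2
    refine LinearMap.ext fun z => ?_
    simp
  | double_solid m m' hbot htop hw r s h =>
    rw [repFree_double_of_has hbot htop hw ((m.solidCross_iff r s).1 h), map_zero, ← blk_zero m.bot m.bot]
    congr 1
    exact LinearMap.ext fun z => ddiff_ddiff_swap r s z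
  | double_ghost m m' hbot htop hw k ε s h =>
    rw [repFree_poly]
    rcases (m.ghostCross_iff k ε s).1 h with h | h <;>
      rw [repFree_double_of_has hbot htop hw h] <;> simp only [Letter.rev, opL, mulL_mul, one_mul,
        mul_one]
  | double_red m m' hbot htop hw k c h =>
    rw [repFree_dot]
    rcases (m.redCross_iff k c).1 h with h | h <;>
      rw [repFree_double_of_has hbot htop hw h] <;> simp only [Letter.rev, opL, mulL_mul, one_mul,
        mul_one]
  | double_other m m' hbot htop hw hs hg hr =>
    have hno : ∀ l : D.Letter, ¬ Has m.bot.res.1 m.bot.pos m.endPos l := by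
      intro l hl
      cases l with
      | solid r s => exact hs r s hl
      | ghostRight k ε s => exact hg k ε s ((m.ghostCross_iff k ε s).2 (Or.inl hl))
      | ghostLeft k ε s => exact hg k ε s ((m.ghostCross_iff k ε s).2 (Or.inr hl))
      | redRight k c => exact hr k c ((m.redCross_iff k c).2 (Or.inl hl))
      | redLeft k c => exact hr k c ((m.redCross_iff k c).2 (Or.inr hl))
    rw [repFree_double hbot htop hw, opS_of_not hno, opS_of_not, one_mul, repFree_idem]
    intro l hl
    have := Letter.has_rev hl
    exact hno _ this
  | braid p q h hp hq hex =>
    have tp := p.triPath hp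
    have tq := q.triPath hq
    rw [p.repFree_diagram, q.repFree_diagram, h.2.2, h.1, h.2.1]
    have e0 : p.x0 = q.x0 := by rw [Path3.x0, h.1]; rfl
    have e3 : p.x3 = q.x3 := funext fun k =>
      (congrArg (fun t : D.Slice => t.pos ((p.c.w * p.b.w * p.a.w) k)) h.2.1).trans
        (congrArg (fun v : Equiv.Perm (Fin D.n) => q.c.top.pos (v k)) h.2.2)
    rw [h.1, e0, e3] at tp hex
    rw [e0, e3, tp.ops_eq_ops tq hex]
  | braid_exceptional p q h hp hq r s A M B f hex hrev hleft hright m₀ hbot htop hw =>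
    have tp := p.triPath hp
    have tq := q.triPath hq
    have e0 : p.x0 = q.x0 := by rw [Path3.x0, h.1]; rfl
    have e3 : p.x3 = q.x3 := funext fun k =>
      (congrArg (fun t : D.Slice => t.pos ((p.c.w * p.b.w * p.a.w) k)) h.2.1).trans
        (congrArg (fun v : Equiv.Perm (Fin D.n) => q.c.top.pos (v k)) h.2.2)
    have hP := hex.parallel (hex.ne_of_reversed hrev)
    have e5 : m₀.endPos = p.x3 ∘ Equiv.swap r s := by
      funext k; simp [Move.endPos, Path3.x3, htop, hw]
    have hm₀ : opM m₀ = permL (p.c.w * p.b.w * p.a.w) * permL (Equiv.swap r s) := by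
      rw [opM, e5, hw, permL_mul, hbot, opS_of_empty, mul_one]
      exact sp_swap_of_reversed tp.g₃.gen hP hrev tp.card_le
    rw [map_add, map_mul, repFree_poly, repFree_mv, hm₀, hbot, htop, blk_mul,
      p.repFree_diagram, q.repFree_diagram, ← h.2.2, ← h.1, ← h.2.1, ← blk_add, mul_assoc (permL _)
      (permL _), ← mul_add]
    rw [← e0, ← h.1, ← e3] at tq
    rw [← e0, ← e3, tp.ops_exceptional tq hex hrev hleft hright]

/-- The action of the algebra of all diagrams on rational functions. -/
def rep : D.Big →ₐ[R] Module.End R (D.Slice → Rat R D.n) :=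
  RingQuot.liftAlgHom R ⟨repFree, fun _ _ h => repFree_rel h⟩

@[simp] theorem rep_cls (a : D.Free) : rep (D.cls a) = repFree a := by
  rw [rep, cls, RingQuot.liftAlgHom_mkAlgHom_apply]

end Datum

end WKLRW

end

noncomputable section


namespace WKLRW

namespace Datum

open Wall Str MvPolynomial

variable {R I : Type*} [CommRing R] [IsDomain R] {D : Datum R I}

/-! ### Generators of the algebra of all diagrams -/

theorem cls_rel {a b : D.Free} (h : D.Rel a b) : D.cls a = D.cls b := RingQuot.mkAlgHom_rel R h

/-- The idempotent diagram. -/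
def ee (s : D.Slice) : D.Big := D.cls (D.idem s)

/-- The dot. -/
def dd (s : D.Slice) (k : Fin D.n) : D.Big := D.cls (D.dot s k)

/-- The elementary piece. -/
def mm (m : D.Move) : D.Big := D.cls (D.mv m)

theorem ee_mul_ee (s : D.Slice) : ee s * ee s = ee s := by
  rw [ee, ← map_mul, cls_rel (.idem_mul_self s)]

theorem ee_mul_of_ne {s t : D.Slice} (h : s ≠ t) : ee s * ee t = 0 := by
  rw [ee, ee, ← map_mul, cls_rel (.idem_mul_of_ne s t h), map_zero]

theorem ee_dd (s : D.Slice) (k : Fin D.n) : ee s * dd s k = dd s k := by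
  rw [ee, dd, ← map_mul, cls_rel (.idem_dot s k)]

theorem dd_ee (s : D.Slice) (k : Fin D.n) : dd s k * ee s = dd s k := by
  rw [ee, dd, ← map_mul, cls_rel (.dot_idem s k)]

theorem ee_mm (m : D.Move) : ee m.top * mm m = mm m := by
  rw [ee, mm, ← map_mul, cls_rel (.idem_move m)]

theorem mm_ee (m : D.Move) : mm m * ee m.bot = mm m := by
  rw [ee, mm, ← map_mul, cls_rel (.move_idem m)]

theorem dd_comm (s : D.Slice) (k l : Fin D.n) : dd s k * dd s l = dd s l * dd s k := by
  rw [dd, dd, ← map_mul, cls_rel (.dot_comm s k l), map_mul]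

theorem elementary_of_eq {s : D.Slice} {x : Fin D.n → ℝ} (h : x = s.pos) :
    ∀ S T S' T' : D.Str, D.Present s.res.1 S → D.Present s.res.1 T → D.Present s.res.1 S' →
      D.Present s.res.1 T' → D.Passes s.pos x S T → D.Passes s.pos x S' T' →
      ∀ z : Fin D.n → ℝ, D.loc z S = D.loc z T ↔ D.loc z S' = D.loc z T' := by
  subst h
  exact fun S T _ _ _ _ _ _ h => absurd h (not_passes_self _ S T)

/-- Vertical strings. -/
def idm (s : D.Slice) : D.Move := ⟨s, s, 1, fun _ => rfl, elementary_of_eq rfl⟩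

theorem mm_idm (s : D.Slice) : mm (idm s) = ee s := cls_rel (.move_refl _ rfl rfl)

/-- An exceptional triple needs three different walls, so no exception can occur on a path with at
most two crossings. -/
theorem three_walls_of_reversed {i : D.ResSeq} {x y : Fin D.n → ℝ} {r s : Fin D.n} {A M B : D.Str}
    (hP : Parallel i.1 r s A M B) (hrev : D.Reversed x y A M B) :
    ({wall A M, wall M B, wall A B} : Finset (Wall D.n)) ⊆ sp i x y ∧
      ({wall A M, wall M B, wall A B} : Finset (Wall D.n)).card = 3 := by
  obtain ⟨h1, h2, h3, h4⟩ := hrev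
  have m1 : wall A M ∈ sp i x y := (wall_mem_sp hP.presA hP.presM).2 ⟨h1, h4⟩
  have m2 : wall M B ∈ sp i x y := (wall_mem_sp hP.presM hP.presB).2 ⟨h2, h3⟩
  have m3 : wall A B ∈ sp i x y :=
    (wall_mem_sp hP.presA hP.presB).2 ⟨h1.trans h2, h3.trans h4⟩
  constructor
  · intro G; simp only [Finset.mem_insert, Finset.mem_singleton]
    rintro (rfl | rfl | rfl) <;> assumption
  · refine Finset.card_eq_three.2 ⟨_, _, _, ?_, ?_, ?_, rfl⟩
    · intro h; exact hP.baseMA ((congrArg Prod.fst h).symm.trans hP.baseA)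
    · intro h; exact hP.baseMB ((congrArg (fun H => H.2.1) h).trans hP.baseB)
    · intro h; exact hP.baseMA ((congrArg Prod.fst h).trans hP.baseA)

theorem not_reversed_of_card {i : D.ResSeq} {x y : Fin D.n → ℝ} (h : (sp i x y).card ≤ 2)
    {r s : Fin D.n} {A M B : D.Str} {f : MvPolynomial (Fin D.n) R}
    (hex : D.Exceptional i.1 r s A M B f) : ¬ D.Reversed x y A M B := by
  intro hrev
  obtain ⟨h1, h2⟩ := three_walls_of_reversed (hex.parallel (hex.ne_of_reversed hrev)) hrev
  have := Finset.card_le_card h1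
  omega

theorem red_left (A : Finset (Wall D.n)) (x z : Fin D.n → ℝ) : Red A x x z := by
  simp [Red, sep_self]

theorem red_right (A : Finset (Wall D.n)) (x z : Fin D.n → ℝ) : Red A x z z := by
  simp [Red, sep_self]

/-- Two successive pieces that can be replaced by one. -/
theorem mm_comp {a b m : D.Move} (hab : b.bot = a.top) (hbot : m.bot = a.bot)
    (htop : m.top = b.top) (hw : m.w = b.w * a.w)
    (hred : Red (walls a.bot.res) a.bot.pos a.endPos m.endPos) : mm b * mm a = mm m := by
  -- The braid relation compares paths of three pieces, so both sides are padded with vertical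
  -- strings. With at most one wall between the ends no triple is exceptional.
  let p : D.Path3 := ⟨a, b, idm b.top, hab, rfl⟩
  let q : D.Path3 := ⟨idm a.bot, idm a.bot, m, rfl, hbot⟩
  have e : m.endPos = fun k => b.top.pos (b.w (a.w k)) := by
    funext k; simp [Move.endPos, htop, hw]
  have hm := m.generic_end
  rw [hbot] at hm
  have hcard := m.card_le
  rw [hbot] at hcard
  have hb := (between_iff_red a.bot.generic a.generic_end hm).2 hred
  have hself : ∀ x z, D.Between a.bot.res.1 x z z ∧ D.Between a.bot.res.1 x x z := fun x z =>
    ⟨fun S T _ _ _ h => h, fun S T _ _ h _ => h⟩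
  have p2 : p.x2 = m.endPos := e.symm
  have p3 : p.x3 = m.endPos := e.symm
  have q3 : q.x3 = m.endPos := rfl
  have key := cls_rel (.braid p q ⟨rfl, htop.symm, by
    change 1 * b.w * a.w = m.w * 1 * 1
    rw [hw]; simp⟩ ?_ ?_ ?_)
  · have ep : D.cls p.diagram = mm (idm b.top) * mm b * mm a := by
      simp only [Path3.diagram, map_mul]; rfl
    have eq : D.cls q.diagram = mm m * mm (idm a.bot) * mm (idm a.bot) := by
      simp only [Path3.diagram, map_mul]; rfl
    rw [ep, eq, mm_idm, mm_idm, ← hbot, mm_ee, mm_ee, ee_mm] at key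
    exact key
  · refine ⟨?_, ?_, ?_⟩
    · rw [p3]; exact hb
    · rw [p2, p3]; exact (hself _ _).1
    · rw [p2]; exact hb
  · refine ⟨(hself _ _).2, ?_, (hself _ _).2⟩
    exact (hself _ _).2
  · intro r s A M B f hE
    rw [p3]
    exact not_reversed_of_card (hcard.trans one_le_two) hE

/-! ### Elementary pieces without permutation -/

/-- The slice of a generic position. -/
abbrev sl (i : D.ResSeq) (y : Fin D.n → ℝ) (hy : D.Generic i.1 y) : D.Slice := ⟨y, i, hy⟩

/-- The elementary piece that joins two positions, with strings numbered as at the bottom. -/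
abbrev em {i : D.ResSeq} {y z : Fin D.n → ℝ} (hy : D.Generic i.1 y) (hz : D.Generic i.1 z)
    (hc : (sp i y z).card ≤ 1) : D.Move :=
  ⟨sl i y hy, sl i z hz, 1, fun _ => rfl, card_sp_le_one_iff.1 hc⟩

open Classical in
/-- The elementary piece that joins two positions, as an element of the algebra. -/
def E (i : D.ResSeq) (y z : Fin D.n → ℝ) : D.Big :=
  -- The default value is not met in a `Gal`; it makes `E` a function of positions alone, free of
  -- proofs.
  if h : D.Generic i.1 y ∧ D.Generic i.1 z ∧ (sp i y z).card ≤ 1 then mm (em h.1 h.2.1 h.2.2) else 0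

theorem E_eq {i : D.ResSeq} {y z : Fin D.n → ℝ} (hy : D.Generic i.1 y) (hz : D.Generic i.1 z)
    (hc : (sp i y z).card ≤ 1) : E i y z = mm (em hy hz hc) := dif_pos ⟨hy, hz, hc⟩

theorem E_self {i : D.ResSeq} {y : Fin D.n → ℝ} (hy : D.Generic i.1 y) :
    E i y y = ee (sl i y hy) := by
  rw [E_eq hy hy (by simp [sep_self]), ← mm_idm]; rfl

theorem E_comp {i : D.ResSeq} {x y z : Fin D.n → ℝ} (hx : D.Generic i.1 x) (hy : D.Generic i.1 y)
    (hz : D.Generic i.1 z) (h1 : (sp i x y).card ≤ 1) (h2 : (sp i y z).card ≤ 1)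
    (h3 : (sp i x z).card ≤ 1) (hr : Red (walls i) x y z) : E i y z * E i x y = E i x z := by
  rw [E_eq hx hy h1, E_eq hy hz h2, E_eq hx hz h3]
  exact mm_comp rfl rfl rfl rfl hr

theorem ee_E {i : D.ResSeq} {y z : Fin D.n → ℝ} (hz : D.Generic i.1 z) :
    ee (sl i z hz) * E i y z = E i y z := by
  unfold E
  split_ifs with h
  · exact ee_mm (em h.1 h.2.1 h.2.2)
  · exact mul_zero _

theorem E_ee {i : D.ResSeq} {y z : Fin D.n → ℝ} (hy : D.Generic i.1 y) :
    E i y z * ee (sl i y hy) = E i y z := by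
  unfold E
  split_ifs with h
  · exact mm_ee (em h.1 h.2.1 h.2.2)
  · exact zero_mul _

/-- Three elementary pieces. -/
abbrev ePath {i : D.ResSeq} {x₀ x₁ x₂ x₃ : Fin D.n → ℝ} (p : TriPath i x₀ x₁ x₂ x₃) : D.Path3 :=
  ⟨em p.g₀ p.g₁ p.c₁, em p.g₁ p.g₂ p.c₂, em p.g₂ p.g₃ p.c₃, rfl, rfl⟩

theorem reduced_ePath {i : D.ResSeq} {x₀ x₁ x₂ x₃ : Fin D.n → ℝ} (p : TriPath i x₀ x₁ x₂ x₃) :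
    (ePath p).Reduced :=
  ⟨(between_iff_red p.g₀ p.g₁ p.g₃).2 p.r₁, (between_iff_red p.g₀ p.g₂ p.g₃).2 p.r₂,
    (between_iff_red p.g₀ p.g₁ p.g₂).2 p.r₁₂⟩

theorem cls_ePath {i : D.ResSeq} {x₀ x₁ x₂ x₃ : Fin D.n → ℝ} (p : TriPath i x₀ x₁ x₂ x₃) :
    D.cls (ePath p).diagram = E i x₂ x₃ * E i x₁ x₂ * E i x₀ x₁ := by
  rw [E_eq p.g₀ p.g₁ p.c₁, E_eq p.g₁ p.g₂ p.c₂, E_eq p.g₂ p.g₃ p.c₃, Path3.diagram, map_mul, map_mul]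
  rfl

theorem E_braid {i : D.ResSeq} {x₀ x₁ x₂ x₃ y₁ y₂ : Fin D.n → ℝ} (p : TriPath i x₀ x₁ x₂ x₃)
    (q : TriPath i x₀ y₁ y₂ x₃)
    (hex : ∀ r s A M B f, D.Exceptional i.1 r s A M B f → ¬ D.Reversed x₀ x₃ A M B) :
    E i x₂ x₃ * E i x₁ x₂ * E i x₀ x₁ = E i y₂ x₃ * E i y₁ y₂ * E i x₀ y₁ := by
  rw [← cls_ePath p, ← cls_ePath q]
  exact cls_rel (.braid (ePath p) (ePath q) ⟨rfl, rfl, rfl⟩ (reduced_ePath p) (reduced_ePath q) hex)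

theorem E_braid_exceptional {i : D.ResSeq} {x₀ x₁ x₂ x₃ y₁ y₂ : Fin D.n → ℝ}
    (p : TriPath i x₀ x₁ x₂ x₃) (q : TriPath i x₀ y₁ y₂ x₃) {r s : Fin D.n} {A M B : D.Str}
    {f : MvPolynomial (Fin D.n) R} (hex : D.Exceptional i.1 r s A M B f)
    (hrev : D.Reversed x₀ x₃ A M B)
    (hleft : D.loc x₁ M < D.loc x₁ A) (hright : D.loc y₁ B < D.loc y₁ M) :
    ∃ m₀ : D.Move, sp m₀.bot.res m₀.bot.pos m₀.endPos = ∅ ∧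
      E i x₂ x₃ * E i x₁ x₂ * E i x₀ x₁ = E i y₂ x₃ * E i y₁ y₂ * E i x₀ y₁ +
        mm m₀ * D.cls (D.poly (sl i x₀ p.g₀) f) := by
  have hP := hex.parallel (hex.ne_of_reversed hrev)
  have h0 : sp i x₀ (x₃ ∘ Equiv.swap r s) = ∅ :=
    sp_swap_of_reversed p.g₃.gen hP hrev p.card_le
  have hw : ∀ k, i.1 (Equiv.swap r s k) = i.1 k := by
    intro k
    by_cases h1 : k = r
    · rw [h1, Equiv.swap_apply_left, hP.res]
    by_cases h2 : k = s
    · rw [h2, Equiv.swap_apply_right, hP.res]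
    · rw [Equiv.swap_apply_of_ne_of_ne h1 h2]
  refine ⟨⟨sl i x₀ p.g₀, sl i x₃ p.g₃, Equiv.swap r s, hw,
    card_sp_le_one_iff.1 (by rw [show (fun k => (sl i x₃ p.g₃).pos (Equiv.swap r s k)) =
      x₃ ∘ Equiv.swap r s from rfl, h0]; simp)⟩, h0, ?_⟩
  rw [← cls_ePath p, ← cls_ePath q, mm, ← map_mul, ← map_add]
  exact cls_rel (.braid_exceptional (ePath p) (ePath q) ⟨rfl, rfl, rfl⟩ (reduced_ePath p)
    (reduced_ePath q) r s A M B f hex hrev hleft hright _ rfl rfl (one_mul _).symm)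

/-! ### Renumbering the strings -/

/-- The elementary piece with vertical strings, which only changes the numbers of the strings. -/
abbrev pm (t : D.Slice) (w : Equiv.Perm (Fin D.n)) (i : D.ResSeq)
    (h : ∀ k, t.res.1 (w k) = i.1 k) : D.Move :=
  ⟨sl i (t.pos ∘ w) (generic_perm h t.generic), t, w, h, elementary_of_eq rfl⟩

/-- A piece is split into its motion, numbered as at the bottom, and a pure renumbering. All
crossings are in the motion. -/
theorem mm_eq (m : D.Move) :
    mm m = mm (pm m.top m.w m.bot.res m.res_comp) * E m.bot.res m.bot.pos m.endPos := by
  rw [E_eq m.bot.generic m.generic_end m.card_le]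
  exact (mm_comp (a := em m.bot.generic m.generic_end m.card_le)
    (b := pm m.top m.w m.bot.res m.res_comp) (m := m) rfl rfl rfl (mul_one _).symm (red_right _ _ _)).symm

theorem E_pm {i i' : D.ResSeq} {w : Equiv.Perm (Fin D.n)} (h : ∀ k, i'.1 (w k) = i.1 k)
    {y z : Fin D.n → ℝ} (hy : D.Generic i'.1 y) (hz : D.Generic i'.1 z)
    (hc : (sp i' y z).card ≤ 1) :
    E i' y z * mm (pm (sl i' y hy) w i h) = mm (pm (sl i' z hz) w i h) * E i (y ∘ w) (z ∘ w) := by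
  have hc' : (sp i (y ∘ w) (z ∘ w)).card ≤ 1 := by rwa [← card_sp_perm h]
  have hy' := generic_perm h hy
  have hz' := generic_perm h hz
  let m : D.Move := ⟨sl i (y ∘ w) hy', sl i' z hz, w, h, card_sp_le_one_iff.1 hc'⟩
  rw [E_eq hy hz hc, E_eq hy' hz' hc']
  exact (mm_comp (a := pm (sl i' y hy) w i h) (b := em hy hz hc) (m := m) rfl rfl rfl
    (one_mul _).symm (red_left _ _ _)).trans (mm_comp (a := em hy' hz' hc')
    (b := pm (sl i' z hz) w i h) (m := m) rfl rfl rfl (mul_one _).symm (red_right _ _ _)).symm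

theorem pm_pm {t : D.Slice} {v w : Equiv.Perm (Fin D.n)} {i i' : D.ResSeq}
    (h : ∀ k, t.res.1 (v k) = i'.1 k) (h' : ∀ k, i'.1 (w k) = i.1 k) :
    mm (pm t v i' h) * mm (pm (sl i' (t.pos ∘ v) (generic_perm h t.generic)) w i h') =
      mm (pm t (v * w) i fun k => (h (w k)).trans (h' k)) :=
  mm_comp rfl rfl rfl rfl (red_left _ _ _)

theorem pm_one (t : D.Slice) : mm (pm t 1 t.res fun _ => rfl) = ee t :=
  mm_idm t

theorem mm_mul_pm {m : D.Move} {w : Equiv.Perm (Fin D.n)} {i : D.ResSeq}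
    (h : ∀ k, m.bot.res.1 (w k) = i.1 k) :
    mm m * mm (pm m.bot w i h) =
      mm (pm m.top (m.w * w) i fun k => (m.res_comp (w k)).trans (h k)) *
        E i (m.bot.pos ∘ w) (m.endPos ∘ w) := by
  rw [mm_eq m, mul_assoc]
  have := E_pm h m.bot.generic m.generic_end m.card_le
  rw [this, ← mul_assoc]
  congr 1
  exact pm_pm m.res_comp h

/-! ### The filtration by the number of crossings -/

/-- The number of crossings. -/
def Gen.count : D.Gen → ℕ
  | .idem _ => 0
  | .dot _ _ => 0
  | .move m => (sp m.bot.res m.bot.pos m.endPos).card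

/-- The span of the diagrams with fewer than `N` crossings. -/
def fil (D : Datum R I) (N : ℕ) : Submodule R D.Big :=
  Submodule.span R {b | ∃ l : List D.Gen, (l.map Gen.count).sum < N ∧
    b = D.cls (l.map (FreeAlgebra.ι R)).prod}

theorem fil_mono {M N : ℕ} (h : M ≤ N) : D.fil M ≤ D.fil N :=
  Submodule.span_mono fun _ ⟨l, hl, e⟩ => ⟨l, hl.trans_le h, e⟩

/-- The bound in `fil` is strict. A factor with at most `c` crossings lies in `fil (c + 1)` and
raises the index by `c` only. -/
theorem fil_mul {c N K : ℕ} {a b : D.Big} (ha : a ∈ D.fil (c + 1)) (hb : b ∈ D.fil N)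
    (h : c + N ≤ K) : a * b ∈ D.fil K := by
  have key := Submodule.mul_mem_mul ha hb
  rw [fil, fil, Submodule.span_mul_span] at key
  refine Submodule.span_le.2 ?_ key
  rintro _ ⟨_, ⟨l, hl, rfl⟩, _, ⟨l', hl', rfl⟩, rfl⟩
  refine Submodule.subset_span ⟨l ++ l', ?_, ?_⟩
  · rw [List.map_append, List.sum_append]; omega
  · simp

theorem fil_mul' {c N K : ℕ} {a b : D.Big} (ha : a ∈ D.fil N) (hb : b ∈ D.fil (c + 1))
    (h : N + c ≤ K) : a * b ∈ D.fil K := by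
  have key := Submodule.mul_mem_mul ha hb
  rw [fil, fil, Submodule.span_mul_span] at key
  refine Submodule.span_le.2 ?_ key
  rintro _ ⟨_, ⟨l, hl, rfl⟩, _, ⟨l', hl', rfl⟩, rfl⟩
  refine Submodule.subset_span ⟨l ++ l', ?_, ?_⟩
  · rw [List.map_append, List.sum_append]; omega
  · simp

theorem ι_mem_fil (g : D.Gen) : D.cls (FreeAlgebra.ι R g) ∈ D.fil (g.count + 1) :=
  Submodule.subset_span ⟨[g], by simp, by simp⟩

theorem ee_mem_fil (s : D.Slice) : ee s ∈ D.fil 1 := ι_mem_fil (.idem s)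

theorem dd_mem_fil (s : D.Slice) (k : Fin D.n) : dd s k ∈ D.fil 1 := ι_mem_fil (.dot s k)

theorem mm_mem_fil (m : D.Move) :
    mm m ∈ D.fil ((sp m.bot.res m.bot.pos m.endPos).card + 1) := ι_mem_fil (.move m)

theorem mm_mem_fil_of_empty {m : D.Move} (h : sp m.bot.res m.bot.pos m.endPos = ∅) :
    mm m ∈ D.fil 1 := by
  have := mm_mem_fil m
  rwa [h] at this

theorem pm_mem_fil (t : D.Slice) (w : Equiv.Perm (Fin D.n)) (i : D.ResSeq)
    (h : ∀ k, t.res.1 (w k) = i.1 k) : mm (pm t w i h) ∈ D.fil 1 :=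
  mm_mem_fil_of_empty (sep_self _)

theorem E_mem_fil (i : D.ResSeq) (y z : Fin D.n → ℝ) : E i y z ∈ D.fil ((sp i y z).card + 1) := by
  unfold E
  split_ifs with h
  · have e : (em h.1 h.2.1 h.2.2).endPos = z := rfl
    have := mm_mem_fil (em h.1 h.2.1 h.2.2)
    rw [e] at this
    exact this
  · exact zero_mem _

theorem one_mem_fil : (1 : D.Big) ∈ D.fil 1 := Submodule.subset_span ⟨[], by simp, by simp⟩

theorem prod_mem_fil {L : List D.Big} (h : ∀ b ∈ L, b ∈ D.fil 1) : L.prod ∈ D.fil 1 := by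
  induction L with
  | nil => exact one_mem_fil
  | cons a L ih =>
    rw [List.prod_cons]
    exact fil_mul (c := 0) (h a List.mem_cons_self)
      (ih fun b hb => h b (List.mem_cons_of_mem _ hb)) le_rfl

theorem pow_mem_fil {b : D.Big} (h : b ∈ D.fil 1) (j : ℕ) : b ^ j ∈ D.fil 1 := by
  induction j with
  | zero => rw [pow_zero]; exact one_mem_fil
  | succ j ih => rw [pow_succ]; exact fil_mul (c := 0) ih h le_rfl

theorem poly_mem_fil (s : D.Slice) (f : MvPolynomial (Fin D.n) R) :
    D.cls (D.poly s f) ∈ D.fil 1 := by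
  rw [poly, map_sum]
  refine Submodule.sum_mem _ fun m _ => ?_
  rw [map_smul, map_mul, map_list_prod]
  refine Submodule.smul_mem _ _ (fil_mul (c := 0) (prod_mem_fil ?_) (ee_mem_fil s) le_rfl)
  intro b hb
  rw [List.map_ofFn, List.mem_ofFn'] at hb
  obtain ⟨k, rfl⟩ := hb
  simp only [Function.comp_apply, map_pow]
  exact pow_mem_fil (dd_mem_fil s k) _

/-- Reduced paths. -/
inductive Gal (i : D.ResSeq) (x : Fin D.n → ℝ) : (Fin D.n → ℝ) → D.Big → Prop
  | nil (hx : D.Generic i.1 x) : Gal i x x (ee (sl i x hx))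
  | cons {y z : Fin D.n → ℝ} {b : D.Big} (h : Gal i x y b) (hz : D.Generic i.1 z)
      (hc : (sp i y z).card ≤ 1) (hr : Red (walls i) x y z) : Gal i x z (E i y z * b)

namespace Gal

variable {i : D.ResSeq} {x y z : Fin D.n → ℝ} {b : D.Big}

theorem generic_left (h : Gal i x y b) : D.Generic i.1 x := by
  induction h with
  | nil hx => exact hx
  | cons _ _ _ _ ih => exact ih

theorem generic (h : Gal i x y b) : D.Generic i.1 y := by
  cases h with
  | nil hx => exact hx
  | cons _ hz _ _ => exact hz

theorem mem_fil (h : Gal i x y b) : b ∈ D.fil ((sp i x y).card + 1) := by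
  induction h with
  | nil hx => rw [sp, sep_self]; exact ee_mem_fil _
  | cons h hz hc hr ih =>
    refine fil_mul (E_mem_fil i _ _) ih ?_
    have := hr.card h.generic.gen
    simp only [sp] at *
    omega

theorem mul_ee (h : Gal i x y b) : b * ee (sl i x h.generic_left) = b := by
  induction h with
  | nil hx => exact ee_mul_ee _
  | cons h hz hc hr ih => rw [mul_assoc, ih]

theorem E_mul (hx : D.Generic i.1 x) (hy : D.Generic i.1 y) (h : (sp i x y).card ≤ 1) :
    Gal i x y (E i x y) := by
  have := (Gal.nil hx).cons hy h (red_left _ _ _)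
  rwa [E_ee] at this

/-- There are reduced paths. -/
theorem exists_gal (hx : D.Generic i.1 x) (hy : D.Generic i.1 y) : ∃ b, Gal i x y b := by
  induction h : (sp i x y).card using Nat.strong_induction_on generalizing y with
  | _ N ih =>
    by_cases he : sp i x y = ∅
    · exact ⟨_, E_mul hx hy (by simp [he])⟩
    -- A last wall towards `y` leads back to a chamber that is closer to `x` by one wall.
    · obtain ⟨K, hK, k, hk, hky⟩ := exists_last_step (isArr_walls i) hx.gen hy.gen
        (Finset.nonempty_iff_ne_empty.2 he)
      have hk' := hx.of_gen hk
      obtain ⟨hr, he'⟩ := sep_erase (isArr_walls i) hy.gen hk hky hK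
      obtain ⟨b, hb⟩ := ih _ (by rw [sp, he', ← h]; exact Finset.card_erase_lt_of_mem hK) hk' rfl
      exact ⟨_, hb.cons hy (by rw [sp, hky]; simp) hr⟩

end Gal

end Datum

end WKLRW

end

/-! ### Reduced paths with the same ends agree up to fewer crossings -/

noncomputable section


namespace WKLRW

section

variable {n : ℕ} {A : Finset (Wall n)}

open Wall

theorem mem_of_eq_singleton {α : Type*} {s : Finset α} {a : α} (h : s = {a}) : a ∈ s := by
  rw [h]; exact Finset.mem_singleton_self a

/-- A wall crossed from `x` to `z` that does not separate `x` from `y` is crossed back between `z`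
and `y`. Its opposite then separates `x` from `y`, but `x` is on the wrong side of it. -/
theorem red_of_subset (hA : IsArr A) {x y z : Fin n → ℝ} (hy : OffWalls A y)
    (h : sep A z y ⊆ sep A x y) : Red A x z y := by
  refine ⟨fun H hH => ?_, h⟩
  obtain ⟨h1, h2, h3⟩ := mem_sep.1 hH
  refine mem_sep.2 ⟨h1, h2, ?_⟩
  by_contra h4
  have h5 : L H y < 0 := lt_of_le_of_ne (not_lt.1 h4) (hy H h1)
  have : H.opp ∈ sep A z y := mem_sep.2 ⟨hA.opp_mem H h1, by rw [L_opp]; linarith,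
    by rw [L_opp]; linarith⟩
  have := (mem_sep.1 (h this)).2.1
  rw [L_opp] at this
  linarith

/-- Distances are additive at `z` and at `k`; the triangle inequalities leave no room on the shorter
paths. -/
theorem Red.trans {x z k y : Fin n → ℝ} (hz : OffWalls A z) (hk : OffWalls A k)
    (h1 : Red A x z y) (h2 : Red A z k y) : Red A x z k ∧ Red A x k y := by
  rw [red_iff hz] at h1 ⊢
  rw [red_iff hk] at h2 ⊢
  have := card_sep_triangle (A := A) (x := x) (z := k) hz
  have := card_sep_triangle (A := A) (x := x) (z := y) hk
  omega

/-- A wall between `k` and `k'` would separate one of them from `y`, so it would be `K` up to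
orientation; but both points are on the negative side of `K`. -/
theorem sep_eq_empty_of_sep_eq (hA : IsArr A) {k k' y : Fin n → ℝ} {K : Wall n}
    (hy : OffWalls A y) (h : sep A k y = {K}) (h' : sep A k' y = {K}) : sep A k k' = ∅ := by
  rw [Finset.eq_empty_iff_forall_notMem]
  intro H hH
  obtain ⟨h1, h2, h3⟩ := mem_sep.1 hH
  have hK := mem_sep.1 (h ▸ Finset.mem_singleton_self K : K ∈ sep A k y)
  have hK' := mem_sep.1 (h' ▸ Finset.mem_singleton_self K : K ∈ sep A k' y)
  rcases lt_or_gt_of_ne (hy H h1) with h4 | h4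
  · have : H.opp ∈ sep A k' y := mem_sep.2 ⟨hA.opp_mem H h1, by rw [L_opp]; linarith,
      by rw [L_opp]; linarith⟩
    rw [h', Finset.mem_singleton] at this
    rw [← this, L_opp] at hK
    linarith [hK.2.1]
  · have : H ∈ sep A k y := mem_sep.2 ⟨h1, h2, h4⟩
    rw [h, Finset.mem_singleton] at this
    rw [← this] at hK'
    linarith [hK'.2.1]

end

namespace Datum

open Wall Str MvPolynomial

variable {R I : Type*} [CommRing R] [IsDomain R] {D : Datum R I}

namespace Gal

variable {i : D.ResSeq} {x y z : Fin D.n → ℝ} {b : D.Big}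

/-- The last crossing of a reduced path. -/
theorem last (h : Gal i x y b) : (sp i x y = ∅ ∧ b = E i x y) ∨
    ∃ k K b₀, sp i k y = {K} ∧ K ∈ sp i x y ∧ Gal i x k b₀ ∧ b = E i k y * b₀ := by
  induction h with
  | nil hx => exact Or.inl ⟨sep_self x, (E_self hx).symm⟩
  | @cons y z b h hz hc hr ih =>
    have hx := h.generic_left
    have hy := h.generic
    -- A piece without crossings is absorbed into the last crossing before it.
    by_cases he : sp i y z = ∅
    · have hs := same_of_sep_eq_empty (isArr_walls i) hy.gen hz.gen he
      rcases ih with ⟨h1, rfl⟩ | ⟨k, K, b₀, h1, h2, h3, rfl⟩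
      · left
        have e : sp i x z = ∅ := (hs.sep_eq (z := x)).symm.trans h1
        exact ⟨e, E_comp hx hy hz (by simp [h1]) hc (by simp [e]) hr⟩
      · right
        have e : sp i k z = {K} := (hs.sep_eq (z := k)).symm.trans h1
        refine ⟨k, K, b₀, e, (hs.sep_eq (z := x)).subset h2, h3, ?_⟩
        rw [← mul_assoc, E_comp h3.generic hy hz (by simp [h1]) hc (by simp [e])]
        rw [Red, ← hs.sep_eq (z := k), show sep (walls i) y z = ∅ from he]
        exact ⟨subset_rfl, Finset.empty_subset _⟩
    · right
      obtain ⟨K, hK⟩ := Finset.card_eq_one.1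
        (le_antisymm hc (Finset.card_pos.2 (Finset.nonempty_iff_ne_empty.2 he)))
      exact ⟨y, K, b, hK, hr.2 (mem_of_eq_singleton hK), h, rfl⟩

/-- Reduced paths with the same last crossing. -/
theorem sub_mem_of_last {k k' : Fin D.n → ℝ} {b b' : D.Big} {K : Wall D.n}
    (ih : ∀ {z b b'}, (sp i x z).card < (sp i x y).card → Gal i x z b → Gal i x z b' →
      b - b' ∈ D.fil (sp i x z).card)
    (hy : D.Generic i.1 y) (hK : K ∈ sp i x y) (h : Gal i x k b) (h' : Gal i x k' b')
    (hk : sp i k y = {K}) (hk' : sp i k' y = {K}) :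
    E i k y * b - E i k' y * b' ∈ D.fil (sp i x y).card := by
  have gk := h.generic
  have gk' := h'.generic
  have e := sep_eq_empty_of_sep_eq (isArr_walls i) hy.gen hk hk'
  have hs := same_of_sep_eq_empty (isArr_walls i) gk.gen gk'.gen e
  obtain ⟨hr, he⟩ := sep_erase (isArr_walls i) hy.gen gk'.gen hk' hK
  have hcard : (sp i x k').card + 1 = (sp i x y).card := by
    rw [sp, he, Finset.card_erase_add_one hK]
  -- `k` and `k'` are in one chamber, so the first path can visit `k'` before it crosses `K`. Then
  -- both paths end with the same piece, and the induction applies to what precedes it.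
  have e1 : E i k y = E i k' y * E i k k' := by
    refine (E_comp gk gk' hy (by simp [sp, e]) (by simp [hk']) (by simp [hk]) ?_).symm
    rw [Red, e, show sep (walls i) k' y = {K} from hk', show sep (walls i) k y = {K} from hk]
    exact ⟨Finset.empty_subset _, subset_rfl⟩
  have g : Gal i x k' (E i k k' * b) := by
    refine h.cons gk' (by simp [sp, e]) ?_
    rw [Red, e, hs.sep_eq]
    exact ⟨subset_rfl, Finset.empty_subset _⟩
  rw [e1, mul_assoc, ← mul_sub]
  refine fil_mul (c := 1) ?_ (ih (by omega) g h') (by omega)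
  have := E_mem_fil i k' y
  rwa [hk', Finset.card_singleton] at this

/-- If an exceptional triple is reversed, its three walls are all the walls between `z` and `y`. The
paths then pass on different sides, and their difference is, up to sign, an error term without
crossings. -/
theorem braid_three {u k u' k' : Fin D.n → ℝ} {K K' K₃ : Wall D.n}
    (hz : D.Generic i.1 z) (hu : D.Generic i.1 u) (hk : D.Generic i.1 k) (hu' : D.Generic i.1 u')
    (hk' : D.Generic i.1 k') (hy : D.Generic i.1 y) (hzy : (sp i z y).card = 3)
    (h1 : sp i z u = {K'}) (h2 : sp i u k = {K₃}) (h3 : sp i k y = {K})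
    (h1' : sp i z u' = {K}) (h2' : sp i u' k' = {K₃}) (h3' : sp i k' y = {K'}) :
    E i k y * E i u k * E i z u - E i k' y * E i u' k' * E i z u' ∈ D.fil 1 := by
  have tri : ∀ {u k : Fin D.n → ℝ}, D.Generic i.1 u → D.Generic i.1 k → (sp i z u).card = 1 →
      (sp i u k).card = 1 → (sp i k y).card = 1 → TriPath i z u k y := by
    intro u k hu hk h1 h2 h3
    have t1 := card_sep_triangle (A := walls i) (x := z) (z := y) hu.gen
    have t2 := card_sep_triangle (A := walls i) (x := u) (z := y) hk.gen
    have t3 := card_sep_triangle (A := walls i) (x := z) (z := y) hk.gen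
    have t4 := card_sep_triangle (A := walls i) (x := z) (z := k) hu.gen
    simp only [sp] at h1 h2 h3 hzy
    refine ⟨hz, hu, hk, hy, h1.le, h2.le, h3.le, (red_iff hu.gen).2 ?_, (red_iff hk.gen).2 ?_,
      (red_iff hu.gen).2 ?_⟩ <;> omega
  have p := tri hu hk (by simp [h1]) (by simp [h2]) (by simp [h3])
  have q := tri hu' hk' (by simp [h1']) (by simp [h2']) (by simp [h3'])
  by_cases hex : ∀ r s A M B f, D.Exceptional i.1 r s A M B f → ¬ D.Reversed z y A M B
  · rw [E_braid p q hex, sub_self]; exact zero_mem _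
  · push Not at hex
    obtain ⟨r, s, A, M, B, f, hE, hrev⟩ := hex
    have hP := hE.parallel (hE.ne_of_reversed hrev)
    obtain ⟨hsub, hc⟩ := three_walls_of_reversed hP hrev
    have heq := Finset.eq_of_subset_of_card_le hsub (by rw [hc, hzy])
    have hne : K ≠ K' := by
      rintro rfl
      have m1 := p.r₁₂.1 (show K ∈ sep (walls i) z u from mem_of_eq_singleton h1)
      have m2 : K ∈ sep (walls i) k y := mem_of_eq_singleton h3
      exact lt_asymm (mem_sep.1 m1).2.2 (mem_sep.1 m2).2.1
    -- The wall of `A` and `B` cannot come first: `M` starts between these strings, so one of them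
    -- would have crossed `M` as well.
    have first : ∀ {v : Fin D.n → ℝ} {J : Wall D.n}, D.Generic i.1 v → sp i z v = {J} →
        J ∈ sp i z y → (J = wall A M ∧ D.loc v M < D.loc v A) ∨
          (J = wall M B ∧ D.loc v B < D.loc v M) := by
      intro v J hv hJ hJy
      rw [← heq, Finset.mem_insert, Finset.mem_insert, Finset.mem_singleton] at hJy
      have hJm : J ∈ sp i z v := mem_of_eq_singleton hJ
      rcases hJy with rfl | rfl | rfl
      · exact Or.inl ⟨rfl, ((wall_mem_sp hP.presA hP.presM).1 hJm).2⟩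
      · exact Or.inr ⟨rfl, ((wall_mem_sp hP.presM hP.presB).1 hJm).2⟩
      · exfalso
        have hAB := ((wall_mem_sp hP.presA hP.presB).1 hJm).2
        rcases lt_or_lt hv hP.presM hP.presA (fun e => hP.baseMA (e ▸ hP.baseA)) with h | h
        · have : wall A M ∈ sp i z v := (wall_mem_sp hP.presA hP.presM).2 ⟨hrev.1, h⟩
          rw [hJ, Finset.mem_singleton] at this
          exact hP.baseMB ((congrArg (fun H => H.2.1) this).trans hP.baseB)
        · have : wall M B ∈ sp i z v :=
            (wall_mem_sp hP.presM hP.presB).2 ⟨hrev.2.1, hAB.trans h⟩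
          rw [hJ, Finset.mem_singleton] at this
          exact hP.baseMA ((congrArg Prod.fst this).trans hP.baseA)
    have hKy : K ∈ sp i z y := q.r₁.1 (show K ∈ sep (walls i) z u' from
      mem_of_eq_singleton h1')
    have hKy' : K' ∈ sp i z y := p.r₁.1 (show K' ∈ sep (walls i) z u from
      mem_of_eq_singleton h1)
    have hmem : ∀ {m₀ : D.Move}, sp m₀.bot.res m₀.bot.pos m₀.endPos = ∅ →
        mm m₀ * D.cls (D.poly (sl i z hz) f) ∈ D.fil 1 := fun h =>
      fil_mul (c := 0) (mm_mem_fil_of_empty h) (poly_mem_fil _ _) le_rfl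
    rcases first hu h1 hKy' with ⟨e, o⟩ | ⟨e, o⟩ <;> rcases first hu' h1' hKy with ⟨e', o'⟩ | ⟨e', o'⟩
    · exact absurd (e'.trans e.symm) hne
    · obtain ⟨m₀, h0, eq⟩ := E_braid_exceptional p q hE hrev o o'
      rw [eq, add_sub_cancel_left]
      exact hmem h0
    · obtain ⟨m₀, h0, eq⟩ := E_braid_exceptional q p hE hrev o' o
      rw [eq, sub_add_cancel_left]
      exact neg_mem (hmem h0)
    · exact absurd (e'.trans e.symm) hne

/-- A vertical third piece makes the braid relation applicable, and two walls leave no room for an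
exceptional triple. -/
theorem braid_two {k k' : Fin D.n → ℝ} (hz : D.Generic i.1 z) (hk : D.Generic i.1 k)
    (hk' : D.Generic i.1 k') (hy : D.Generic i.1 y) (hzy : (sp i z y).card = 2)
    (h1 : (sp i z k).card = 1) (h2 : (sp i k y).card = 1) (h1' : (sp i z k').card = 1)
    (h2' : (sp i k' y).card = 1) : E i k y * E i z k = E i k' y * E i z k' := by
  have tri : ∀ {k : Fin D.n → ℝ}, D.Generic i.1 k → (sp i z k).card = 1 →
      (sp i k y).card = 1 → TriPath i z k y y := by
    intro k hk h1 h2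
    have hr : Red (walls i) z k y := (red_iff hk.gen).2 (by simp only [sp] at *; omega)
    exact ⟨hz, hk, hy, hy, h1.le, h2.le, by simp [sep_self], hr, red_right _ _ _, hr⟩
  have := E_braid (tri hk h1 h2) (tri hk' h1' h2') fun r s A M B f hE =>
    not_reversed_of_card hzy.le hE
  rwa [E_self hy, ee_E, ee_E] at this

/-- The two reduced paths of a flip. -/
theorem exists_of_flip {K K' : Wall D.n} (hx : D.Generic i.1 x) (hy : D.Generic i.1 y)
    (h : Flip (walls i) x y K K') :
    K ∈ sp i x y ∧ K' ∈ sp i x y ∧ ∃ k b k' b', Gal i x k b ∧ sp i k y = {K} ∧ Gal i x k' b' ∧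
      sp i k' y = {K'} ∧ E i k y * b - E i k' y * b' ∈ D.fil (sp i x y).card := by
  have hA := isArr_walls i
  cases h with
  | two z k k' hz hk hk' hxy hzy h1 h2 h1' h2' =>
    have gz := hx.of_gen hz
    have gk := hx.of_gen hk
    have gk' := hx.of_gen hk'
    have c1 : (sep (walls i) z k).card = 1 := by simp [h1]
    have c2 : (sep (walls i) k y).card = 1 := by simp [h2]
    have c1' : (sep (walls i) z k').card = 1 := by simp [h1']
    have c2' : (sep (walls i) k' y).card = 1 := by simp [h2']
    have r1 : Red (walls i) z k y := (red_iff hk).2 (by omega)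
    have r1' : Red (walls i) z k' y := (red_iff hk').2 (by omega)
    have r0 := red_of_subset hA hy.gen hxy
    obtain ⟨c, hc⟩ := exists_gal hx gz
    refine ⟨hxy (r1.2 (mem_of_eq_singleton h2)),
      hxy (r1'.2 (mem_of_eq_singleton h2')), k, _, k', _,
      hc.cons gk c1.le (r0.trans hz hk r1).1, h2, hc.cons gk' c1'.le (r0.trans hz hk' r1').1, h2', ?_⟩
    rw [← mul_assoc, ← mul_assoc, braid_two gz gk gk' hy hzy c1 c2 c1' c2', sub_self]
    exact zero_mem _
  | three K₃ z u k u' k' hz hu hk hu' hk' hxy hzy h1 h2 h3 h1' h2' h3' =>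
    have gz := hx.of_gen hz
    have gu := hx.of_gen hu
    have gk := hx.of_gen hk
    have gu' := hx.of_gen hu'
    have gk' := hx.of_gen hk'
    have r0 := red_of_subset hA hy.gen hxy
    obtain ⟨c, hc⟩ := exists_gal hx gz
    have key : ∀ {u k : Fin D.n → ℝ} {K K' : Wall D.n}, OffWalls (walls i) u →
        OffWalls (walls i) k → sep (walls i) z u = {K'} →
        sep (walls i) u k = {K₃} → sep (walls i) k y = {K} →
        K ∈ sep (walls i) z y ∧ Gal i x k (E i u k * (E i z u * c)) := by
      intro u k K K' hu hk h1 h2 h3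
      have gu := hx.of_gen hu
      have gk := hx.of_gen hk
      have c1 : (sep (walls i) z u).card = 1 := by simp [h1]
      have c2 : (sep (walls i) u k).card = 1 := by simp [h2]
      have c3 : (sep (walls i) k y).card = 1 := by simp [h3]
      have t1 := card_sep_triangle (A := walls i) (x := z) (z := y) hu
      have t2 := card_sep_triangle (A := walls i) (x := u) (z := y) hk
      have ru : Red (walls i) z u y := (red_iff hu).2 (by omega)
      have rk : Red (walls i) u k y := (red_iff hk).2 (by omega)
      obtain ⟨s1, s2⟩ := r0.trans hz hu ru
      obtain ⟨s3, s4⟩ := s2.trans hu hk rk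
      exact ⟨ru.2 (rk.2 (mem_of_eq_singleton h3)),
        (hc.cons gu c1.le s1).cons gk c2.le s3⟩
    obtain ⟨m, g⟩ := key hu hk h1 h2 h3
    obtain ⟨m', g'⟩ := key hu' hk' h1' h2' h3'
    refine ⟨hxy m, hxy m', k, _, k', _, g, h3, g', h3', ?_⟩
    have := braid_three gz gu gk gu' gk' hy hzy h1 h2 h3 h1' h2' h3'
    simp only [← mul_assoc]
    rw [← sub_mul]
    refine fil_mul (c := 0) this hc.mem_fil ?_
    have e := r0.card hz
    simp only [sp] at *
    omega

/-- Reduced paths with the same ends agree up to diagrams with fewer crossings. -/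
theorem sub_mem_fil (h : Gal i x y b) {b' : D.Big} (h' : Gal i x y b') :
    b - b' ∈ D.fil (sp i x y).card := by
  induction hN : (sp i x y).card using Nat.strong_induction_on generalizing y b b' with
  | _ N ih =>
    have hx := h.generic_left
    have hy := h.generic
    have ih' : ∀ {z b b'}, (sp i x z).card < (sp i x y).card → Gal i x z b → Gal i x z b' →
        b - b' ∈ D.fil (sp i x z).card := fun hz g g' => ih _ (hN ▸ hz) g g' rfl
    rw [← hN]
    rcases h.last with ⟨he, rfl⟩ | ⟨k, K, b₀, hk, hK, g, rfl⟩ <;>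
      rcases h'.last with ⟨he', rfl⟩ | ⟨k', K', b₀', hk', hK', g', rfl⟩
    · rw [sub_self]; exact zero_mem _
    · rw [he] at hK'
      simp at hK'
    · rw [he'] at hK; simp at hK
    -- The last walls are joined by a chain of flips. Paths with the same last wall agree up to
    -- lower terms by induction, and every flip provides two paths with its two last walls that
    -- agree up to lower terms; the differences telescope.
    · have hT : Relation.ReflTransGen (Flip (walls i) x y) K K' :=
        connected_flips (isArr_walls i) hx.gen hy.gen hK hK' ⟨k, g.generic.gen, hk⟩
          ⟨k', g'.generic.gen, hk'⟩
      clear h h'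
      induction hT generalizing k' b₀' with
      | refl => exact sub_mem_of_last ih' hy hK g g' hk hk'
      | @tail J K' _ hflip ihT =>
        obtain ⟨hJ, -, l, c, l', c', gl, hl, gl', hl', hd⟩ := exists_of_flip hx hy hflip
        have a1 := ihT l c hl hJ gl
        have a2 := sub_mem_of_last ih' hy hK' gl' g' hl' hk'
        have := add_mem (add_mem a1 hd) a2
        convert this using 1
        abel

end Gal

end Datum

end WKLRW

end

noncomputable section


namespace WKLRW

namespace Datum

open Wall Str MvPolynomial

variable {R I : Type*} [CommRing R] [IsDomain R] {D : Datum R I}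

/-! ### Polynomials in the dots -/

-- The dots of a slice generate a commutative subalgebra, which receives the polynomial ring. The
-- homomorphism is unital, so constants go to multiples of `1`; multiplying by the idempotent is
-- left to `pB`.
open scoped IsMulCommutative in
theorem exists_dotHom (s : D.Slice) :
    ∃ φ : MvPolynomial (Fin D.n) R →ₐ[R] D.Big, ∀ k, φ (X k) = dd s k := by
  have hc : ∀ a ∈ Set.range (dd s), ∀ b ∈ Set.range (dd s), a * b = b * a := by
    rintro _ ⟨k, rfl⟩ _ ⟨l, rfl⟩
    exact dd_comm s k l
  have := Algebra.isMulCommutative_adjoin R hc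
  refine ⟨(Algebra.adjoin R (Set.range (dd s))).val.comp
    (aeval fun k => (⟨dd s k, Algebra.subset_adjoin ⟨k, rfl⟩⟩ :
      Algebra.adjoin R (Set.range (dd s)))), fun k => ?_⟩
  rw [AlgHom.comp_apply, aeval_X]
  rfl

/-- Polynomials in the dots. -/
def dotHom (s : D.Slice) : MvPolynomial (Fin D.n) R →ₐ[R] D.Big := (exists_dotHom s).choose

@[simp] theorem dotHom_X (s : D.Slice) (k : Fin D.n) : dotHom s (X k) = dd s k :=
  (exists_dotHom s).choose_spec k

/-- The idempotent diagram with dots. -/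
def pB (s : D.Slice) : MvPolynomial (Fin D.n) R →ₗ[R] D.Big :=
  (LinearMap.mulRight R (ee s)) ∘ₗ (dotHom s).toLinearMap

theorem pB_apply (s : D.Slice) (f : MvPolynomial (Fin D.n) R) : pB s f = dotHom s f * ee s := rfl

@[simp] theorem pB_one (s : D.Slice) : pB s 1 = ee s := by rw [pB_apply, map_one, one_mul]

theorem dotHom_mul_pB (s : D.Slice) (f g : MvPolynomial (Fin D.n) R) :
    dotHom s f * pB s g = pB s (f * g) := by
  rw [pB_apply, pB_apply, map_mul, mul_assoc]

theorem dd_mul_pB (s : D.Slice) (k : Fin D.n) (f : MvPolynomial (Fin D.n) R) :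
    dd s k * pB s f = pB s (X k * f) := by
  rw [← dotHom_mul_pB, dotHom_X]

theorem commute_ee_dotHom (s : D.Slice) (f : MvPolynomial (Fin D.n) R) :
    Commute (ee s) (dotHom s f) := by
  induction f using MvPolynomial.induction_on with
  | C c => rw [← MvPolynomial.algebraMap_eq, AlgHom.commutes]; exact Algebra.commute_algebraMap_right c _
  | add f g hf hg => rw [map_add]; exact hf.add_right hg
  | mul_X f k hf =>
    rw [map_mul, dotHom_X]
    refine hf.mul_right ?_
    rw [Commute, SemiconjBy, ee_dd, dd_ee]

theorem pB_mul (s : D.Slice) (f g : MvPolynomial (Fin D.n) R) : pB s f * pB s g = pB s (f * g) := by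
  rw [pB_apply s f, mul_assoc, pB_apply s g, ← mul_assoc (ee s), (commute_ee_dotHom s g).eq,
    mul_assoc, ee_mul_ee, ← pB_apply, dotHom_mul_pB]

theorem ee_pB (s : D.Slice) (f : MvPolynomial (Fin D.n) R) : ee s * pB s f = pB s f := by
  rw [← pB_one, pB_mul, one_mul]

theorem pB_ee (s : D.Slice) (f : MvPolynomial (Fin D.n) R) : pB s f * ee s = pB s f := by
  rw [← pB_one, pB_mul, mul_one]

theorem cls_poly (s : D.Slice) (f : MvPolynomial (Fin D.n) R) : D.cls (D.poly s f) = pB s f := by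
  rw [poly, map_sum]
  refine Eq.trans ?_ (eq_sum_of_mul_X (pB s) (dd s) (fun k f => (dd_mul_pB s k f).symm) f)
  refine Finset.sum_congr rfl fun m _ => ?_
  rw [map_smul, map_mul, pB_one, map_list_prod, List.map_ofFn]
  simp only [Function.comp_def, map_pow]
  rfl

theorem pB_mem_fil (s : D.Slice) (f : MvPolynomial (Fin D.n) R) : pB s f ∈ D.fil 1 := by
  rw [← cls_poly]; exact poly_mem_fil s f

theorem rep_ee (s : D.Slice) : rep (ee s) = blk s s 1 := by rw [ee, rep_cls, repFree_idem]

theorem rep_pB (s : D.Slice) (f : MvPolynomial (Fin D.n) R) :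
    rep (pB s f) = blk s s (mulL (toRat f)) := by
  rw [← cls_poly, rep_cls, repFree_poly]

/-! ### Dots and crossings -/

/-- The dot slides freely, or the error is the diagram with interchanged ends. The latter has no
crossing, while the piece has one. -/
theorem dd_E {i : D.ResSeq} {y z : Fin D.n → ℝ} (hy : D.Generic i.1 y) (hz : D.Generic i.1 z)
    (hc : (sp i y z).card ≤ 1) (k : Fin D.n) :
    dd (sl i z hz) k * E i y z - E i y z * dd (sl i y hy) k ∈ D.fil (sp i y z).card := by
  rw [E_eq hy hz hc]
  set m := em hy hz hc with hm
  by_cases h : ∀ s, ¬ m.SolidCross k s ∧ ¬ m.SolidCross s k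
  · have := cls_rel (.dot_slide m k h)
    rw [map_mul, map_mul] at this
    have e : dd (sl i z hz) k * mm m - mm m * dd (sl i y hy) k = 0 := sub_eq_zero.2 this
    rw [e]
    exact zero_mem _
  · have key : ∀ r s, m.SolidCross r s → ∃ m₀ : D.Move, m₀.bot = m.bot ∧ m₀.top = m.top ∧
        m₀.w = m.w * Equiv.swap r s ∧ mm m₀ ∈ D.fil (sp i y z).card := by
      intro r s hs
      have h0 : sp i y (z ∘ Equiv.swap r s) = ∅ := sp_swap_of_single hz.gen hc hs
      have hw : ∀ k, i.1 (Equiv.swap r s k) = i.1 k := by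
        have hrs : i.1 r = i.1 s := hs.1
        intro k
        by_cases h1 : k = r
        · rw [h1, Equiv.swap_apply_left, hrs]
        by_cases h2 : k = s
        · rw [h2, Equiv.swap_apply_right, hrs]
        · rw [Equiv.swap_apply_of_ne_of_ne h1 h2]
      refine ⟨⟨sl i y hy, sl i z hz, Equiv.swap r s, hw,
        card_sp_le_one_iff.1 (by rw [show (fun k => (sl i z hz).pos (Equiv.swap r s k)) =
          z ∘ Equiv.swap r s from rfl, h0]; simp)⟩, rfl, rfl, (one_mul _).symm, ?_⟩
      refine fil_mono ?_ (mm_mem_fil_of_empty h0)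
      exact Finset.card_pos.2 ⟨_, Has.mem_sp ((m.solidCross_iff r s).1 hs)⟩
    push Not at h
    obtain ⟨s, hs⟩ := h
    by_cases hks : m.SolidCross k s
    · obtain ⟨m₀, h1, h2, h3, h4⟩ := key k s hks
      have := cls_rel (.dot_cross_left m m₀ k s hks h1 h2 h3)
      rw [map_sub, map_mul, map_mul] at this
      have e : dd (sl i z hz) k * mm m - mm m * dd (sl i y hy) k = - mm m₀ := by
        rw [← neg_sub]; exact congrArg Neg.neg this
      rw [e]
      exact neg_mem h4
    · have hsk := hs hks
      obtain ⟨m₀, h1, h2, h3, h4⟩ := key s k hsk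
      have := cls_rel (.dot_cross_right m m₀ s k hsk h1 h2 h3)
      rw [map_sub, map_mul, map_mul] at this
      have e : dd (sl i z hz) k * mm m - mm m * dd (sl i y hy) k = mm m₀ := this
      rw [e]
      exact h4

theorem Gal.dd_sub_mem {i : D.ResSeq} {x y : Fin D.n → ℝ} {b : D.Big} (h : Gal i x y b)
    (k : Fin D.n) :
    dd (sl i y h.generic) k * b - b * dd (sl i x h.generic_left) k ∈ D.fil (sp i x y).card := by
  induction h with
  | nil hx => rw [dd_ee, ee_dd, sub_self]; exact zero_mem _
  | @cons y z b h hz hc hr ih =>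
    have e := hr.card h.generic.gen
    have h1 := fil_mul' (K := (sp i x z).card) (dd_E h.generic hz hc k) h.mem_fil
      (by simp only [sp] at *; omega)
    have h2 := fil_mul (K := (sp i x z).card) (E_mem_fil i y z) ih (by simp only [sp] at *; omega)
    convert add_mem h1 h2 using 1
    simp only [sub_mul, mul_sub, mul_assoc]
    abel

theorem dd_pm {t : D.Slice} {w : Equiv.Perm (Fin D.n)} {i : D.ResSeq}
    (h : ∀ k, t.res.1 (w k) = i.1 k) (k : Fin D.n) :
    dd t (w k) * mm (pm t w i h) =
      mm (pm t w i h) * dd (sl i (t.pos ∘ w) (generic_perm h t.generic)) k := by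
  have := cls_rel (.dot_slide (pm t w i h) k fun s =>
    ⟨fun hs => not_passes_self _ _ _ hs.2, fun hs => not_passes_self _ _ _ hs.2⟩)
  rwa [map_mul, map_mul] at this

/-- Every Reidemeister II relation turns a double crossing into a polynomial in the dots, possibly
zero or one. -/
theorem E_double {i : D.ResSeq} {y z : Fin D.n → ℝ} (hy : D.Generic i.1 y) (hz : D.Generic i.1 z)
    (hc : (sp i y z).card ≤ 1) : E i z y * E i y z ∈ D.fil 1 := by
  have hc' : (sp i z y).card ≤ 1 := by rwa [sp, card_sep_comm (isArr_walls i)]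
  rw [E_eq hy hz hc, E_eq hz hy hc', mm, mm, ← map_mul]
  set m := em hy hz hc with hm
  by_cases h1 : ∃ r s, m.SolidCross r s
  · obtain ⟨r, s, h⟩ := h1
    rw [cls_rel (.double_solid m (em hz hy hc') rfl rfl inv_one.symm r s h), map_zero]
    exact zero_mem _
  by_cases h2 : ∃ k ε s, m.GhostCross k ε s
  · obtain ⟨k, ε, s, h⟩ := h2
    rw [cls_rel (.double_ghost m (em hz hy hc') rfl rfl inv_one.symm k ε s h)]
    exact poly_mem_fil _ _
  by_cases h3 : ∃ k c, m.RedCross k c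
  · obtain ⟨k, c, h⟩ := h3
    rw [cls_rel (.double_red m (em hz hy hc') rfl rfl inv_one.symm k c h)]
    exact dd_mem_fil _ _
  push Not at h1 h2 h3
  rw [cls_rel (.double_other m (em hz hy hc') rfl rfl inv_one.symm h1 h2 h3)]
  exact ee_mem_fil _

/-! ### The spanning set -/

/-- The ways to join the strings of two slices. -/
def Conn (s t : D.Slice) : Type := {w : Equiv.Perm (Fin D.n) // ∀ k, t.res.1 (w k) = s.res.1 k}

instance (s t : D.Slice) : Fintype (Conn s t) := Fintype.ofFinite (Subtype _)

namespace Conn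

variable {s t : D.Slice}

/-- The final positions, with strings numbered as at the bottom. -/
def fin (w : Conn s t) : Fin D.n → ℝ := t.pos ∘ w.1

theorem generic_fin (w : Conn s t) : D.Generic s.res.1 w.fin := generic_perm w.2 t.generic

/-- The number of crossings. -/
def len (w : Conn s t) : ℕ := (sp s.res s.pos w.fin).card

theorem exists_gal (w : Conn s t) : ∃ b, Gal s.res s.pos w.fin b :=
  Gal.exists_gal s.generic w.generic_fin

/-- A diagram without dots in which no strings cross twice. -/
def diag (w : Conn s t) : D.Big := mm (pm t w.1 s.res w.2) * w.exists_gal.choose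

theorem gal (w : Conn s t) : Gal s.res s.pos w.fin w.exists_gal.choose := w.exists_gal.choose_spec

theorem ee_diag (w : Conn s t) : ee t * w.diag = w.diag := by
  rw [diag, ← mul_assoc, ee_mm (pm t w.1 s.res w.2)]

theorem diag_ee (w : Conn s t) : w.diag * ee s = w.diag := by
  rw [diag, mul_assoc, w.gal.mul_ee]

end Conn

/-- The span of the diagrams with fewer than `N` crossings in which no strings cross twice and all
dots are at the bottom. -/
def spn (s : D.Slice) (N : ℕ) : Submodule R D.Big :=
  Submodule.span R {b | ∃ (t : D.Slice) (w : Conn s t) (f : MvPolynomial (Fin D.n) R),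
    w.len < N ∧ b = w.diag * pB s f}

theorem spn_mono {s : D.Slice} {M N : ℕ} (h : M ≤ N) : spn s M ≤ spn s N :=
  Submodule.span_mono fun _ ⟨t, w, f, hl, e⟩ => ⟨t, w, f, hl.trans_le h, e⟩

theorem diag_mem_spn {s t : D.Slice} (w : Conn s t) (f : MvPolynomial (Fin D.n) R) {N : ℕ}
    (h : w.len < N) : w.diag * pB s f ∈ spn s N := Submodule.subset_span ⟨t, w, f, h, rfl⟩

theorem fil_zero : D.fil 0 = ⊥ := by
  rw [eq_bot_iff, fil, Submodule.span_le]
  rintro _ ⟨l, hl, -⟩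
  exact absurd hl (Nat.not_lt_zero _)

/-- The product of a generator with an element of the spanning set. -/
theorem gen_mul_mem_spn {s : D.Slice} {N : ℕ}
    (ih : ∀ M ≤ N, ∀ a ∈ D.fil M, a * ee s ∈ spn s M) (g : D.Gen) {t : D.Slice} (w : Conn s t)
    (f : MvPolynomial (Fin D.n) R) (h : w.len + g.count ≤ N) :
    D.cls (FreeAlgebra.ι R g) * (w.diag * pB s f) ∈ spn s (N + 1) := by
  -- The error terms have fewer crossings and are covered by the induction hypothesis.
  have low : ∀ {M a}, a ∈ D.fil M → M ≤ N → a * pB s f ∈ spn s (N + 1) := by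
    intro M a ha hM
    rw [← pB_ee, ← mul_assoc]
    exact spn_mono (hM.trans N.le_succ) (ih M hM _ (fil_mul' (c := 0) ha (pB_mem_fil s f) le_rfl))
  rw [← mul_assoc]
  cases g with
  | idem u =>
    change ee u * _ * _ ∈ _
    by_cases hu : u = t
    · subst hu
      rw [w.ee_diag]
      exact diag_mem_spn w f (by omega)
    · rw [← w.ee_diag, ← mul_assoc, ee_mul_of_ne hu, zero_mul, zero_mul]
      exact zero_mem _
  | dot u k =>
    change dd u k * _ * _ ∈ _
    by_cases hu : u = t
    · subst hu
      have e := w.gal.dd_sub_mem (w.1.symm k)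
      have e1 : dd u k * w.diag = w.diag * dd s (w.1.symm k) + mm (pm u w.1 s.res w.2) *
          (dd (sl s.res w.fin w.generic_fin) (w.1.symm k) * w.exists_gal.choose -
            w.exists_gal.choose * dd s (w.1.symm k)) := by
        have := dd_pm w.2 (w.1.symm k)
        rw [Equiv.apply_symm_apply] at this
        rw [Conn.diag, ← mul_assoc, this, mul_sub, ← mul_assoc, ← mul_assoc]
        exact (add_sub_cancel _ _).symm
      rw [e1, add_mul, mul_assoc, dd_mul_pB]
      refine add_mem (diag_mem_spn w _ (by omega)) (low (M := w.len) ?_ (by omega))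
      exact fil_mul (c := 0) (pm_mem_fil _ _ _ _) e (by rw [zero_add]; exact le_rfl)
    · rw [← w.ee_diag, ← mul_assoc, ← dd_ee, mul_assoc (dd u k), ee_mul_of_ne hu, mul_zero, zero_mul,
        zero_mul]
      exact zero_mem _
  | move m =>
    change mm m * _ * _ ∈ _
    by_cases hu : m.bot = t
    · subst hu
      let w' : Conn s m.top := ⟨m.w * w.1, fun k => (m.res_comp (w.1 k)).trans (w.2 k)⟩
      have hcount : (sp s.res w.fin w'.fin).card = Gen.count (.move m) := by
        have f0 : w.fin = m.bot.pos ∘ w.1 := rfl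
        have f1 : w'.fin = m.endPos ∘ w.1 := rfl
        rw [f0, f1, ← card_sp_perm w.2]
        rfl
      have hc : (sp s.res w.fin w'.fin).card ≤ 1 := by rw [hcount]; exact m.card_le
      have e1 : mm m * w.diag = mm (pm m.top w'.1 s.res w'.2) *
          (E s.res w.fin w'.fin * w.exists_gal.choose) := by
        rw [Conn.diag, ← mul_assoc, mm_mul_pm w.2, mul_assoc]
        rfl
      have hlen : w.len = (sp s.res s.pos w.fin).card := rfl
      rw [e1]
      -- If no wall is crossed twice, the extended path is reduced and may be replaced by the chosen
      -- path of `w'`.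
      by_cases hr : Red (walls s.res) s.pos w.fin w'.fin
      · have hl : w'.len = w.len + Gen.count (.move m) := by
          rw [← hcount]; exact hr.card w.generic_fin.gen
        have hd := (w.gal.cons w'.generic_fin hc hr).sub_mem_fil w'.gal
        have e2 : mm (pm m.top w'.1 s.res w'.2) * (E s.res w.fin w'.fin * w.exists_gal.choose) =
            w'.diag + mm (pm m.top w'.1 s.res w'.2) *
              (E s.res w.fin w'.fin * w.exists_gal.choose - w'.exists_gal.choose) := by
          rw [mul_sub]; exact (add_sub_cancel _ _).symm
        rw [e2, add_mul]
        refine add_mem (diag_mem_spn w' f (by omega)) (low (M := w'.len) ?_ (by omega))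
        exact fil_mul (c := 0) (pm_mem_fil _ _ _ _) hd (by rw [zero_add]; exact le_rfl)
      -- Otherwise the new piece crosses back a wall `H` of the path. Up to lower terms the path can
      -- be replaced by one that crosses `H` last, and the resulting double crossing turns into
      -- dots.
      · obtain ⟨H, h1, h2⟩ := exists_passes_not_red s.generic w'.generic_fin hr
        have h3 : H ∈ sp s.res w'.fin w.fin := by
          rw [← opp_opp H]; exact (opp_mem_sep (isArr_walls _)).2 (by simpa using h2)
        have hcomm : (sp s.res w'.fin w.fin).card = (sp s.res w.fin w'.fin).card :=
          card_sep_comm (isArr_walls _) _ _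
        have h4 : sp s.res w'.fin w.fin = {H} :=
          Finset.card_eq_one.1 (le_antisymm (hcomm.trans_le hc) (Finset.card_pos.2 ⟨H, h3⟩)) |>.elim
            fun K hK => by rw [hK] at h3 ⊢; rw [Finset.mem_singleton.1 h3]
        obtain ⟨hr', he⟩ := sep_erase (isArr_walls s.res) w.generic_fin.gen w'.generic_fin.gen h4 h1
        have hl : (sp s.res s.pos w'.fin).card + 1 = w.len := by
          rw [sp, he, Finset.card_erase_add_one h1]; rfl
        have hl' : w'.len + 1 = w.len := hl
        have hc1 : (sp s.res w.fin w'.fin).card = 1 := by rw [← hcomm, h4, Finset.card_singleton]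
        have hd := w.gal.sub_mem_fil (w'.gal.cons w.generic_fin (hcomm.trans_le hc) hr')
        have e2 : E s.res w.fin w'.fin * w.exists_gal.choose =
            E s.res w.fin w'.fin * E s.res w'.fin w.fin * w'.exists_gal.choose +
            E s.res w.fin w'.fin *
              (w.exists_gal.choose - E s.res w'.fin w.fin * w'.exists_gal.choose) := by
          rw [mul_sub, mul_assoc]
          exact (add_sub_cancel _ _).symm
        rw [e2, mul_add, add_mul]
        refine add_mem (low (M := w'.len + 1) ?_ (by omega)) (low (M := w.len + 1) ?_ (by omega))
        · refine fil_mul (c := 0) (pm_mem_fil _ _ _ _) (fil_mul (c := 0)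
            (E_double w'.generic_fin w.generic_fin (hcomm.trans_le hc)) w'.gal.mem_fil le_rfl) ?_
          rw [zero_add, zero_add]; exact le_rfl
        · refine fil_mul (c := 0) (pm_mem_fil _ _ _ _) (fil_mul (c := 1) (N := w.len) ?_ hd le_rfl) ?_
          · have := E_mem_fil s.res w.fin w'.fin
            rwa [hc1] at this
          · omega
    · rw [← w.ee_diag, ← mul_assoc, ← mm_ee, mul_assoc (mm m), ee_mul_of_ne hu, mul_zero, zero_mul,
        zero_mul]
      exact zero_mem _

/-- The identity permutation. -/
def Conn.one (s : D.Slice) : Conn s s := ⟨1, fun _ => rfl⟩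

theorem Conn.len_one (s : D.Slice) : (Conn.one s).len = 0 := by
  have hw : (Conn.one s).fin = s.pos := rfl
  rw [Conn.len, hw, sp, sep_self]; rfl

/-- The chosen path of length zero agrees with the trivial one modulo `fil 0`, which is zero, so the
equality is exact. -/
theorem Conn.diag_one (s : D.Slice) : (Conn.one s).diag = ee s := by
  have hg := (Conn.one s).gal.sub_mem_fil (Gal.nil s.generic)
  rw [show (sp s.res s.pos (Conn.one s).fin).card = 0 from Conn.len_one s, fil_zero,
    Submodule.mem_bot, sub_eq_zero] at hg
  rw [Conn.diag, hg]
  exact (congrArg (· * ee s) (pm_one s)).trans (ee_mul_ee s)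

theorem ee_mem_spn (s : D.Slice) (N : ℕ) : ee s ∈ spn s (N + 1) := by
  have := diag_mem_spn (Conn.one s) 1 (N := N + 1) (by rw [Conn.len_one]; omega)
  rwa [Conn.diag_one, pB_one, ee_mul_ee] at this

/-- Outer induction on the number of crossings, inner induction on the length of a word, which is
built up from the bottom by `gen_mul_mem_spn`. -/
theorem fil_mul_ee {s : D.Slice} (N : ℕ) : ∀ a ∈ D.fil N, a * ee s ∈ spn s N := by
  induction N using Nat.strong_induction_on with
  | _ N IH =>
    cases N with
    | zero =>
      intro a ha
      rw [fil_zero, Submodule.mem_bot] at ha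
      rw [ha, zero_mul]; exact zero_mem _
    | succ N =>
      have ih : ∀ M ≤ N, ∀ a ∈ D.fil M, a * ee s ∈ spn s M := fun M hM => IH M (by omega)
      have word : ∀ l : List D.Gen, (l.map Gen.count).sum < N + 1 →
          D.cls (l.map (FreeAlgebra.ι R)).prod * ee s ∈ spn s (N + 1) := by
        intro l
        induction l with
        | nil => intro _; simpa using ee_mem_spn s N
        | cons g l ihl =>
          intro hl
          rw [List.map_cons, List.sum_cons] at hl
          have h1 : D.cls (l.map (FreeAlgebra.ι R)).prod * ee s ∈
              spn s ((l.map Gen.count).sum + 1) := by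
            -- Either the remaining word has fewer crossings, or the generator on top has none and
            -- the induction on the length applies without loss.
            by_cases h : (l.map Gen.count).sum + 1 ≤ N
            · exact ih _ h _ (Submodule.subset_span ⟨l, Nat.lt_succ_self _, rfl⟩)
            · have : (l.map Gen.count).sum = N := by omega
              rw [this]
              exact ihl (by omega)
          rw [List.map_cons, List.prod_cons, map_mul, mul_assoc]
          generalize D.cls (l.map (FreeAlgebra.ι R)).prod * ee s = v at h1
          induction h1 using Submodule.span_induction with
          | mem v hv =>
            obtain ⟨t, w, f, hw, rfl⟩ := hv
            exact gen_mul_mem_spn ih g w f (by omega)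
          | zero => rw [mul_zero]; exact zero_mem _
          | add a b _ _ ha hb => rw [mul_add]; exact add_mem ha hb
          | smul c a _ ha => rw [mul_smul_comm]; exact Submodule.smul_mem _ _ ha
      intro a ha
      induction ha using Submodule.span_induction with
      | mem v hv =>
        obtain ⟨l, hl, rfl⟩ := hv
        exact word l hl
      | zero => rw [zero_mul]; exact zero_mem _
      | add a b _ _ ha hb => rw [add_mul]; exact add_mem ha hb
      | smul c a _ ha => rw [smul_mul_assoc]; exact Submodule.smul_mem _ _ ha

/-- The words span the algebra. -/
theorem span_words : Submodule.span R (Set.range fun l : List D.Gen =>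
    D.cls (l.map (FreeAlgebra.ι R)).prod) = ⊤ := by
  rw [eq_top_iff]
  rintro a -
  obtain ⟨a, rfl⟩ := RingQuot.mkAlgHom_surjective R D.Rel a
  change D.cls a ∈ _
  induction a using FreeAlgebra.induction with
  | grade0 r =>
    rw [AlgHom.commutes, Algebra.algebraMap_eq_smul_one]
    exact Submodule.smul_mem _ _ (Submodule.subset_span ⟨[], by simp⟩)
  | grade1 g => exact Submodule.subset_span ⟨[g], by simp⟩
  | mul a b ha hb =>
    rw [map_mul]
    have := Submodule.mul_mem_mul ha hb
    rw [Submodule.span_mul_span] at this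
    refine Submodule.span_mono ?_ this
    rintro _ ⟨_, ⟨l, rfl⟩, _, ⟨l', rfl⟩, rfl⟩
    exact ⟨l ++ l', by simp⟩
  | add a b ha hb => rw [map_add]; exact add_mem ha hb

theorem exists_mem_fil (a : D.Big) : ∃ N, a ∈ D.fil N := by
  have ha : a ∈ Submodule.span R (Set.range fun l : List D.Gen =>
    D.cls (l.map (FreeAlgebra.ι R)).prod) := by
    rw [span_words]; exact Submodule.mem_top
  induction ha using Submodule.span_induction with
  | mem v hv =>
    obtain ⟨l, rfl⟩ := hv
    exact ⟨_, Submodule.subset_span ⟨l, Nat.lt_succ_self _, rfl⟩⟩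
  | zero => exact ⟨0, zero_mem _⟩
  | add a b _ _ ha hb =>
    obtain ⟨M, hM⟩ := ha
    obtain ⟨N, hN⟩ := hb
    exact ⟨max M N, add_mem (fil_mono (le_max_left _ _) hM) (fil_mono (le_max_right _ _) hN)⟩
  | smul c a _ ha =>
    obtain ⟨M, hM⟩ := ha
    exact ⟨M, Submodule.smul_mem _ _ hM⟩

/-- The linear combinations of the diagrams that join two slices. -/
def lc (s t : D.Slice) : (Conn s t → MvPolynomial (Fin D.n) R) →ₗ[R] D.Big :=
  ∑ w : Conn s t, LinearMap.mulLeft R w.diag ∘ₗ pB s ∘ₗ LinearMap.proj w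

theorem lc_apply {s t : D.Slice} (f : Conn s t → MvPolynomial (Fin D.n) R) :
    lc s t f = ∑ w, w.diag * pB s (f w) := by simp [lc]

theorem exists_lc (s t : D.Slice) (a : D.Big) : ∃ f, ee t * a * ee s = lc s t f := by
  classical
  obtain ⟨N, hN⟩ := exists_mem_fil a
  have h := fil_mul_ee (s := s) N a hN
  rw [mul_assoc]
  generalize a * ee s = v at h
  suffices ee t * v ∈ LinearMap.range (lc s t) by
    obtain ⟨f, hf⟩ := this
    exact ⟨f, hf.symm⟩
  induction h using Submodule.span_induction with
  | mem v hv =>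
    obtain ⟨u, w, f, -, rfl⟩ := hv
    by_cases hu : t = u
    · subst hu
      refine ⟨Pi.single w f, ?_⟩
      rw [lc_apply, Finset.sum_eq_single w, Pi.single_eq_same, ← mul_assoc, w.ee_diag]
      · intro v _ hv
        rw [Pi.single_eq_of_ne hv, map_zero, mul_zero]
      · exact fun h => absurd (Finset.mem_univ _) h
    · rw [← w.ee_diag, ← mul_assoc, ← mul_assoc, ee_mul_of_ne hu, zero_mul, zero_mul]
      exact zero_mem _
  | zero => rw [mul_zero]; exact zero_mem _
  | add a b _ _ ha hb => rw [mul_add]; exact add_mem ha hb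
  | smul c a _ ha => rw [mul_smul_comm]; exact Submodule.smul_mem _ _ ha

end Datum

end WKLRW

end

/-! ### Triangular operators, the basis of diagrams and faithfulness -/

noncomputable section


namespace WKLRW

open MvPolynomial

section

variable {R : Type*} [CommRing R] [IsDomain R] {n : ℕ}

/-- A linear combination of permutations. -/
def tri (c : Equiv.Perm (Fin n) → Rat R n) : Module.End R (Rat R n) := ∑ g, mulL (c g) * permL g

theorem tri_apply (c : Equiv.Perm (Fin n) → Rat R n) (z : Rat R n) :
    tri c z = ∑ g, c g * permRat g z := by simp [tri]

theorem permRat_injective : Function.Injective fun g : Equiv.Perm (Fin n) =>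
    ((permRat g : Rat R n →ₐ[R] Rat R n) : Rat R n →* Rat R n) := by
  intro g h e
  refine Equiv.ext fun k => ?_
  have := DFunLike.congr_fun e (yy k)
  exact yy_inj.1 (by simpa using this)

/-- Permutations are linearly independent over the rational functions. -/
theorem tri_injective : Function.Injective (tri : (Equiv.Perm (Fin n) → Rat R n) → _) := by
  intro c c' h
  -- Dedekind's independence of characters, applied to the different automorphisms given by
  -- permutations.
  have hli := (linearIndependent_monoidHom (Rat R n) (Rat R n)).comp _
    (permRat_injective (R := R) (n := n))
  rw [Fintype.linearIndependent_iff] at hli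
  funext g
  refine sub_eq_zero.1 (hli (fun g => c g - c' g) ?_ g)
  funext z
  have := LinearMap.congr_fun h z
  rw [tri_apply, tri_apply] at this
  simp only [Finset.sum_apply, Pi.smul_apply, Function.comp_apply, smul_eq_mul, sub_mul,
    Finset.sum_sub_distrib, Pi.zero_apply]
  exact sub_eq_zero.2 this

theorem mulL_mul_tri (z : Rat R n) (c : Equiv.Perm (Fin n) → Rat R n) :
    mulL z * tri c = tri fun g => z * c g := by
  refine LinearMap.ext fun x => ?_
  simp [tri_apply, mul_assoc]

theorem tri_mul_mulL (z : Rat R n) (c : Equiv.Perm (Fin n) → Rat R n) :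
    tri c * mulL z = tri fun g => c g * permRat g z := by
  refine LinearMap.ext fun x => ?_
  simp [tri_apply, mul_assoc]

theorem permL_mul_tri (w : Equiv.Perm (Fin n)) (c : Equiv.Perm (Fin n) → Rat R n) :
    permL w * tri c = tri fun g => permRat w (c (w⁻¹ * g)) := by
  refine LinearMap.ext fun x => ?_
  simp only [Module.End.mul_apply, tri_apply, AlgHom.toLinearMap_apply, map_sum, map_mul]
  rw [← Equiv.sum_comp (Equiv.mulLeft w : Equiv.Perm (Fin n) ≃ Equiv.Perm (Fin n))
    fun g => permRat w (c (w⁻¹ * g)) * permRat g x]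
  refine Finset.sum_congr rfl fun g _ => ?_
  simp [permRat_mul_apply]

theorem tri_single_one : tri (Pi.single 1 1) = (1 : Module.End R (Rat R n)) := by
  refine LinearMap.ext fun x => ?_
  rw [tri_apply, Finset.sum_eq_single 1]
  · simp
  · intro g _ hg; rw [Pi.single_eq_of_ne hg, zero_mul]
  · exact fun h => absurd (Finset.mem_univ _) h

theorem tri_sub (c c' : Equiv.Perm (Fin n) → Rat R n) : tri c - tri c' = tri (c - c') := by
  refine LinearMap.ext fun x => ?_
  simp [tri_apply, sub_mul]

theorem tri_sum {ι : Type*} (s : Finset ι) (c : ι → Equiv.Perm (Fin n) → Rat R n) :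
    ∑ k ∈ s, tri (c k) = tri fun g => ∑ k ∈ s, c k g := by
  refine LinearMap.ext fun x => ?_
  simp only [LinearMap.sum_apply, tri_apply, Finset.sum_mul]
  exact Finset.sum_comm

theorem evalQ_ne_zero {Q : MvPolynomial (Fin 2) R} (hQ : Q ≠ 0) {r s : Fin n} (h : r ≠ s) :
    evalQ Q r s ≠ 0 := by
  have e : evalQ Q r s = rename ![r, s] Q := by
    rw [evalQ]
    congr 1
    refine MvPolynomial.algHom_ext fun k => ?_
    fin_cases k <;> simp
  have hinj : Function.Injective ![r, s] := by
    intro a b hab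
    fin_cases a <;> fin_cases b <;> simp_all
  rw [e, Ne, ← map_zero (rename ![r, s] : _ →ₐ[R] MvPolynomial (Fin n) R)]
  exact fun h => hQ (rename_injective _ hinj h)

end

namespace Datum

open Wall Str

variable {R I : Type*} [CommRing R] [IsDomain R] {D : Datum R I}

theorem res_swap {i : Fin D.n → I} {r s : Fin D.n} (h : i r = i s) (k : Fin D.n) :
    i (Equiv.swap r s k) = i k := by
  by_cases h1 : k = r
  · rw [h1, Equiv.swap_apply_left, h]
  by_cases h2 : k = s
  · rw [h2, Equiv.swap_apply_right, h]
  · rw [Equiv.swap_apply_of_ne_of_ne h1 h2]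

theorem rep_E {i : D.ResSeq} {y z : Fin D.n → ℝ} (hy : D.Generic i.1 y) (hz : D.Generic i.1 z)
    (hc : (sp i y z).card ≤ 1) :
    rep (E i y z) = blk (sl i y hy) (sl i z hz) (opS i.1 y z) := by
  have e : (em hy hz hc).endPos = z := rfl
  rw [E_eq hy hz hc, mm, rep_cls, repFree_mv, opM, e]
  congr 1
  exact (congrArg (· * _) permL_one).trans (one_mul _)

theorem opL_of_ne_solid {i : Fin D.n → I} {l : D.Letter} (h : l.Sig i) :
    (∃ r s, l = .solid r s) ∨ ∃ f, f ≠ 0 ∧ opL i l = mulL f := by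
  cases l with
  | solid r s => exact Or.inl ⟨r, s, rfl⟩
  | ghostRight k ε s =>
    have hks : i k ≠ i s := by rw [← h.1, ← h.2]; exact owner_ne_partner ε
    refine Or.inr ⟨_, ?_, rfl⟩
    rw [Ne, ← map_zero toRat, toRat_inj]
    exact evalQ_ne_zero (D.Q_ne_zero _ _ hks) fun e => hks (congrArg i e)
  | ghostLeft k ε s => exact Or.inr ⟨_, one_ne_zero, rfl⟩
  | redRight k c =>
    refine Or.inr ⟨_, ?_, rfl⟩
    rw [Ne, yy, ← map_zero toRat, toRat_inj]
    exact X_ne_zero k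
  | redLeft k c => exact Or.inr ⟨_, one_ne_zero, rfl⟩

/-- The operator of a reduced path is triangular. -/
theorem Gal.exists_tri {i : D.ResSeq} {x y : Fin D.n → ℝ} {b : D.Big} (h : Gal i x y b) :
    ∃ c : Equiv.Perm (Fin D.n) → Rat R D.n,
      rep b = blk (sl i x h.generic_left) (sl i y h.generic) (tri c) ∧ c 1 ≠ 0 ∧
      ∀ g, c g ≠ 0 → g = 1 ∨ ((∀ k, i.1 (g k) = i.1 k) ∧
        (sp i x (y ∘ g)).card < (sp i x y).card) := by
  induction h with
  | nil hx =>
    refine ⟨Pi.single 1 1, by rw [rep_ee, tri_single_one], by simp, fun g hg => Or.inl ?_⟩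
    by_contra h
    exact hg (Pi.single_eq_of_ne h _)
  | @cons y z b h hz hc hr ih =>
    obtain ⟨c, h1, h2, h3⟩ := ih
    have hy := h.generic
    have hcard := hr.card hy.gen
    -- The leg from `y ∘ g` to `z ∘ g` is as long as that from `y` to `z`, by which the reduced path
    -- grows. So a permutation that shortens the way to `y` also shortens the way to `z`.
    have same : ∀ g : Equiv.Perm (Fin D.n), (∀ k, i.1 (g k) = i.1 k) →
        (sp i x (y ∘ g)).card < (sp i x y).card → (sp i x (z ∘ g)).card < (sp i x z).card := by
      intro g hg hlt
      have e1 := card_sep_triangle (A := walls i) (x := x) (z := z ∘ g) (generic_perm hg hy).gen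
      have e2 := card_sp_perm hg y z
      simp only [sp] at *
      omega
    have same' : ∀ g, c g ≠ 0 → g = 1 ∨ ((∀ k, i.1 (g k) = i.1 k) ∧
        (sp i x (z ∘ g)).card < (sp i x z).card) := fun g hg =>
      (h3 g hg).imp_right fun h => ⟨h.1, same g h.1 h.2⟩
    have hrep : rep (E i y z * b) = blk (sl i x h.generic_left) (sl i z hz)
        (opS i.1 y z * tri c) := by
      rw [map_mul, rep_E hy hz hc, h1, blk_mul]
    by_cases hl : ∃ l : D.Letter, Has i.1 y z l
    · obtain ⟨l, hl⟩ := hl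
      rw [opS_of_has hy hc hl] at hrep
      rcases opL_of_ne_solid hl.1 with ⟨r, s, rfl⟩ | ⟨f, hf, ef⟩
      · have hrs : i.1 r = i.1 s := hl.1
        have hne := ne_of_passes_solid hl.2
        have hsw := res_swap hrs
        have h0 : sp i y (z ∘ Equiv.swap r s) = ∅ := sp_swap_of_single hz.gen hc hl
        have hpos : 0 < (sp i y z).card := Finset.card_pos.2 ⟨_, hl.mem_sp⟩
        have hss : (Equiv.swap r s)⁻¹ = Equiv.swap r s := Equiv.swap_inv r s
        refine ⟨fun g => (yy r - yy s)⁻¹ * (c g - permRat (Equiv.swap r s) (c (Equiv.swap r s * g))),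
          ?_, ?_, ?_⟩
        · rw [hrep]
          congr 1
          rw [opL, ddiff, mul_assoc, sub_mul, one_mul, permL_mul_tri, tri_sub, mulL_mul_tri, hss]
          rfl
        · change _ * (c 1 - permRat _ (c (Equiv.swap r s * 1))) ≠ 0
          rw [mul_one]
          -- Otherwise the swapped point `y ∘ swap` would be closer to `x` than `y`. It lies in the
          -- chamber of `z`, since no strings cross once the ends are interchanged, whereas `z` is
          -- farther than `y`.
          have hcs : c (Equiv.swap r s) = 0 := by
            by_contra hcs
            rcases h3 _ hcs with e | ⟨-, e⟩
            · exact hne (Equiv.swap_eq_one_iff.1 e)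
            · have e1 := card_sep_triangle (A := walls i) (x := x) (z := z)
                (generic_perm hsw hy).gen
              have e2 := card_sp_perm hsw (y ∘ Equiv.swap r s) z
              have e3 : (y ∘ Equiv.swap r s) ∘ Equiv.swap r s = y := by
                funext k; simp
              rw [e3, h0, Finset.card_empty] at e2
              simp only [sp] at *
              omega
          rw [hcs, map_zero, sub_zero]
          exact mul_ne_zero (inv_ne_zero (yy_sub_ne_zero hne)) h2
        · intro g hg
          beta_reduce at hg
          by_cases hcg : c g = 0
          · right
            have hcs : c (Equiv.swap r s * g) ≠ 0 := by
              intro e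
              rw [hcg, e, map_zero, sub_zero, mul_zero] at hg
              exact hg rfl
            set h' := Equiv.swap r s * g with hh
            have hg' : g = Equiv.swap r s * h' := by rw [hh, ← mul_assoc]; simp
            have hle : (∀ k, i.1 (h' k) = i.1 k) ∧ (sp i x (y ∘ h')).card ≤ (sp i x y).card := by
              rcases h3 h' hcs with e | ⟨e, e'⟩
              · rw [e]; exact ⟨fun _ => rfl, le_rfl⟩
              · exact ⟨e, e'.le⟩
            refine ⟨fun k => ?_, ?_⟩
            · rw [hg', Equiv.Perm.mul_apply, hsw, hle.1]
            -- `z ∘ g` is in the chamber of `y ∘ h'`, which is not farther from `x` than `y`, hence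
            -- closer than `z`.
            · have e1 := card_sep_triangle (A := walls i) (x := x) (z := z ∘ g)
                (generic_perm hle.1 hy).gen
              have e2 := card_sp_perm hle.1 y (z ∘ Equiv.swap r s)
              have e3 : (z ∘ Equiv.swap r s) ∘ h' = z ∘ g := by
                rw [hg']; rfl
              rw [e3, h0, Finset.card_empty] at e2
              have := hle.2
              simp only [sp] at *
              omega
          · exact same' g hcg
      · refine ⟨fun g => f * c g, ?_, mul_ne_zero hf h2, fun g hg => same' g (right_ne_zero_of_mul hg)⟩
        rw [hrep, ef, mulL_mul_tri]
    · push Not at hl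
      rw [opS_of_not hl, one_mul] at hrep
      exact ⟨c, hrep, h2, same'⟩

namespace Conn

variable {s t : D.Slice}

/-- The renumbering by `w` translates the support of the operator of the gallery, so the identity
becomes `w`. -/
theorem exists_tri (w : Conn s t) : ∃ a : Equiv.Perm (Fin D.n) → Rat R D.n,
    rep w.diag = blk s t (tri a) ∧ a w.1 ≠ 0 ∧
    ∀ v, a v ≠ 0 → v = w.1 ∨ ∃ w' : Conn s t, w'.1 = v ∧ w'.len < w.len := by
  obtain ⟨c, h1, h2, h3⟩ := w.gal.exists_tri
  refine ⟨fun g => permRat w.1 (c (w.1⁻¹ * g)), ?_, ?_, ?_⟩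
  · have e : (pm t w.1 s.res w.2).endPos = w.fin := rfl
    have e' : opM (pm t w.1 s.res w.2) = permL w.1 := by
      rw [opM, opS_of_empty, mul_one]
      exact sep_self _
    rw [diag, map_mul, h1, mm, rep_cls, repFree_mv, e', ← permL_mul_tri]
    exact blk_mul _ _ _ _ _
  · change permRat w.1 (c (w.1⁻¹ * w.1)) ≠ 0
    rw [inv_mul_cancel]
    exact (map_ne_zero _).2 h2
  · intro v hv
    beta_reduce at hv
    have hv' := (map_ne_zero _).1 hv
    rcases h3 _ hv' with e | ⟨e, e'⟩
    · exact Or.inl (by rw [inv_mul_eq_one] at e; exact e.symm)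
    · refine Or.inr ⟨⟨v, fun k => ?_⟩, rfl, ?_⟩
      · have := w.2 ((w.1⁻¹ * v) k)
        rw [e] at this
        simpa using this
      · have e4 : w.fin ∘ (w.1⁻¹ * v) = t.pos ∘ v := by
          funext k; simp [fin]
        rw [e4] at e'
        exact e'

/-- The coefficients of the operator of a diagram. -/
def coef (w : Conn s t) : Equiv.Perm (Fin D.n) → Rat R D.n := w.exists_tri.choose

theorem rep_diag (w : Conn s t) : rep w.diag = blk s t (tri w.coef) := w.exists_tri.choose_spec.1

theorem coef_self (w : Conn s t) : w.coef w.1 ≠ 0 := w.exists_tri.choose_spec.2.1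

theorem coef_ne_zero (w : Conn s t) {v : Equiv.Perm (Fin D.n)} (h : w.coef v ≠ 0) :
    v = w.1 ∨ ∃ w' : Conn s t, w'.1 = v ∧ w'.len < w.len := w.exists_tri.choose_spec.2.2 v h

theorem conn_of_coef (w : Conn s t) {v : Equiv.Perm (Fin D.n)} (h : w.coef v ≠ 0) :
    ∃ w' : Conn s t, w'.1 = v := by
  rcases w.coef_ne_zero h with rfl | ⟨w', h, -⟩
  · exact ⟨w, rfl⟩
  · exact ⟨w', h⟩

end Conn

variable {s t : D.Slice}

theorem rep_lc (f : Conn s t → MvPolynomial (Fin D.n) R) :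
    rep (lc s t f) = blk s t (tri fun v => ∑ w, w.coef v * permRat v (toRat (f w))) := by
  have hb : ∀ (S : Finset (Conn s t)) (a : Conn s t → Module.End R (Rat R D.n)),
      ∑ w ∈ S, blk s t (a w) = blk s t (∑ w ∈ S, a w) := by
    classical
    intro S a
    induction S using Finset.induction_on with
    | empty => simp [blk_zero]
    | insert w S hw ih => rw [Finset.sum_insert hw, Finset.sum_insert hw, ih, blk_add]
  rw [lc_apply, map_sum, ← tri_sum, ← hb]
  refine Finset.sum_congr rfl fun w _ => ?_
  rw [map_mul, w.rep_diag, rep_pB, blk_mul, tri_mul_mulL]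

/-- If the coefficients of an operator vanish, so do the corresponding polynomials. -/
theorem eq_zero_of_coef (f : Conn s t → MvPolynomial (Fin D.n) R) (P : Conn s t → Prop)
    (hP : ∀ w w', P w → w.len < w'.len → P w')
    (h : ∀ w, P w → ∑ w' : Conn s t, w'.coef w.1 * permRat w.1 (toRat (f w')) = 0)
    (w : Conn s t) (hw : P w) : f w = 0 := by
  classical
  by_contra hf
  -- For a longest `v` with non-zero polynomial no other diagram contributes to the coefficient of
  -- `v`, and the leading coefficient is invertible. `P` is closed under increasing the length, so
  -- it suffices to know the coefficients in `P`.
  obtain ⟨v, hv, hmax⟩ := Finset.exists_max_image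
    (Finset.univ.filter fun w : Conn s t => P w ∧ f w ≠ 0) Conn.len ⟨w, by simp [hw, hf]⟩
  rw [Finset.mem_filter] at hv
  have := h v hv.2.1
  rw [Finset.sum_eq_single v] at this
  · rcases mul_eq_zero.1 this with e | e
    · exact v.coef_self e
    · rw [map_eq_zero, ← map_zero toRat, toRat_inj] at e
      exact hv.2.2 e
  · intro w' _ hne
    by_contra h0
    obtain ⟨h1, h2⟩ := mul_ne_zero_iff.1 h0
    rcases w'.coef_ne_zero h1 with e | ⟨w'', e, hlt⟩
    · exact hne (Subtype.ext e.symm)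
    · have e' : w'' = v := Subtype.ext e
      rw [e'] at hlt
      have hf' : f w' ≠ 0 := by
        rintro hf'; rw [hf', map_zero, map_zero] at h2; exact h2 rfl
      exact absurd (hmax w' (by simp [hf', hP v w' hv.2.1 hlt])) (not_le.2 hlt)
  · exact fun h => absurd (Finset.mem_univ _) h

theorem lc_eq_zero {f : Conn s t → MvPolynomial (Fin D.n) R} (h : rep (lc s t f) = 0) : f = 0 := by
  rw [rep_lc, ← blk_zero s t] at h
  have h0 : tri (fun _ => 0) = (0 : Module.End R (Rat R D.n)) :=
    LinearMap.ext fun z => by simp [tri_apply]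
  have h1 := tri_injective ((blk_inj h).trans h0.symm)
  funext w
  exact eq_zero_of_coef f (fun _ => True) (fun _ _ _ _ => trivial)
    (fun w _ => congrFun h1 w.1) w trivial

theorem lc_injective : Function.Injective (lc s t) := by
  rw [← LinearMap.ker_eq_bot, LinearMap.ker_eq_bot']
  intro f hf
  exact lc_eq_zero (by rw [hf, map_zero])

/-- The action on rational functions is faithful. -/
theorem eq_of_rep_eq {a b : D.Big} (h : rep (ee t * a * ee s) = rep (ee t * b * ee s)) :
    ee t * a * ee s = ee t * b * ee s := by
  obtain ⟨f, hf⟩ := exists_lc s t (a - b)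
  have e : ee t * (a - b) * ee s = ee t * a * ee s - ee t * b * ee s := by
    rw [mul_sub, sub_mul]
  have h0 : rep (lc s t f) = 0 := by rw [← hf, e, map_sub, h, sub_self]
  rw [← sub_eq_zero, ← e, hf, lc_eq_zero h0, map_zero]

theorem pB_injective (s : D.Slice) : Function.Injective (pB s) := by
  intro f g h
  have := congrArg rep h
  rw [rep_pB, rep_pB] at this
  have := LinearMap.congr_fun (blk_inj this) 1
  simpa [toRat_inj] using this

/-- Polynomials that are moved along the strings commute with the diagrams. -/
theorem pB_mul_diag (w : Conn s t) {f g : MvPolynomial (Fin D.n) R}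
    (h : ∀ v : Conn s t, g = rename v.1 f) : pB t g * w.diag = w.diag * pB s f := by
  have e1 : pB t g * w.diag = ee t * (pB t g * w.diag) * ee s := by
    rw [← mul_assoc, ee_pB, mul_assoc, w.diag_ee]
  have e2 : w.diag * pB s f = ee t * (w.diag * pB s f) * ee s := by
    rw [← mul_assoc, w.ee_diag, mul_assoc, pB_ee]
  rw [e1, e2]
  refine eq_of_rep_eq ?_
  rw [← e1, ← e2, map_mul, map_mul, w.rep_diag, rep_pB, rep_pB, blk_mul, blk_mul, mulL_mul_tri,
    tri_mul_mulL]
  congr 2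
  -- Only permutations that connect the two slices have non-zero coefficients, and all of them carry
  -- `f` to `g`.
  funext v
  by_cases hv : w.coef v = 0
  · rw [hv, mul_zero, zero_mul]
  · obtain ⟨w', rfl⟩ := w.conn_of_coef hv
    rw [permRat_toRat, ← h w', mul_comm]

theorem eq_rename_of_mul_diag (w : Conn s t) {f g : MvPolynomial (Fin D.n) R}
    (h : pB t g * w.diag = w.diag * pB s f) : g = rename w.1 f := by
  have := congrArg rep h
  rw [map_mul, map_mul, w.rep_diag, rep_pB, rep_pB, blk_mul, blk_mul, mulL_mul_tri,
    tri_mul_mulL] at this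
  have := congrFun (tri_injective (blk_inj this)) w.1
  rw [mul_comm, permRat_toRat] at this
  exact toRat_inj.1 (mul_left_cancel₀ w.coef_self this)

/-- The elements that commute with the dots are polynomials in the dots. -/
theorem exists_eq_pB {a : D.Big} (h : ∀ k, dd s k * (ee s * a * ee s) = ee s * a * ee s * dd s k) :
    ∃ f, ee s * a * ee s = pB s f := by
  classical
  obtain ⟨f, hf⟩ := exists_lc s s a
  rw [hf] at h ⊢
  have hX : ∀ k, rep (dd s k) = blk s s (mulL (yy k)) := fun k => by
    rw [dd, rep_cls, repFree_dot]
  have hone : ∀ w : Conn s s, w.1 = 1 → w = Conn.one s := fun w e => Subtype.ext e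
  have key : ∀ w : Conn s s, w.1 ≠ 1 → f w = 0 := by
    -- The identity has length zero, so being different from it persists for longer elements. For
    -- these, comparing coefficients gives the factor `y_k - y_{w k}`, which is non-zero if `w`
    -- moves `k`.
    refine eq_zero_of_coef f _ ?_ ?_
    · intro w w' _ hlt e
      rw [hone w' e, Conn.len_one] at hlt
      exact Nat.not_lt_zero _ hlt
    · intro w hw
      obtain ⟨k, hk⟩ : ∃ k, w.1 k ≠ k := by
        by_contra hall
        push Not at hall
        exact hw (Equiv.ext hall)
      have := congrArg rep (h k)
      rw [map_mul, map_mul, hX, rep_lc, blk_mul, blk_mul, mulL_mul_tri, tri_mul_mulL] at this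
      have := congrFun (tri_injective (blk_inj this)) w.1
      rw [permRat_yy, mul_comm, ← sub_eq_zero, ← mul_sub] at this
      exact (mul_eq_zero.1 this).resolve_right (yy_sub_ne_zero hk.symm)
  refine ⟨f (Conn.one s), ?_⟩
  rw [lc_apply, Finset.sum_eq_single (Conn.one s), Conn.diag_one, ee_pB]
  · intro w _ hw
    rw [key w fun e => hw (hone w e), map_zero, mul_zero]
  · exact fun h => absurd (Finset.mem_univ _) h

end Datum

end WKLRW

end

noncomputable section


namespace WKLRW

namespace Datum

open Wall Str MvPolynomial

variable {R I : Type*} [CommRing R] {D : Datum R I}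

/-! ### Degrees of crossings -/

/-- The degree of a crossing. -/
def degL (i : Fin D.n → I) : D.Letter → ℤ
  | .solid r _ => -(2 * (D.Γ.d (i r) : ℤ))
  | .ghostRight k _ s => -((D.Γ.d (i k) : ℤ) * D.Γ.a (i k) (i s))
  | .ghostLeft k _ s => -((D.Γ.d (i k) : ℤ) * D.Γ.a (i k) (i s))
  | .redRight k _ => D.Γ.d (i k)
  | .redLeft k _ => D.Γ.d (i k)

theorem degL_perm {w : Equiv.Perm (Fin D.n)} {i i' : Fin D.n → I} (h : ∀ k, i' (w k) = i k)
    (l : D.Letter) : degL i' (l.perm w) = degL i l := by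
  cases l <;> simp [degL, Letter.perm, h]

theorem degL_rev {i : Fin D.n → I} {l : D.Letter} (h : l.Sig i) :
    degL i l.rev = degL i l := by
  cases l <;> simp only [degL, Letter.rev]
  rw [show i _ = i _ from h]

section

variable [IsDomain R]

/-- The degree of an elementary piece. -/
def degS (i : Fin D.n → I) (x y : Fin D.n → ℝ) : ℤ := ((step (D := D) i x y).map (degL i)).sum

theorem degS_of_not {i : Fin D.n → I} {x y : Fin D.n → ℝ} (h : ∀ l : D.Letter, ¬ Has i x y l) :
    degS (D := D) i x y = 0 := by rw [degS, step_of_not h]; rfl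

theorem degS_of_has {i : D.ResSeq} {x y : Fin D.n → ℝ} (hx : D.Generic i.1 x)
    (hc : (sp i x y).card ≤ 1) {l : D.Letter} (h : Has i.1 x y l) :
    degS i.1 x y = degL i.1 l := by rw [degS, step_of_has hx hc h]; simp

theorem degS_of_empty {i : D.ResSeq} {x y : Fin D.n → ℝ} (h : sp i x y = ∅) :
    degS i.1 x y = 0 := degS_of_not fun l hl => by
  have := hl.mem_sp
  simp [h] at this

theorem degS_perm {w : Equiv.Perm (Fin D.n)} {i i' : D.ResSeq} (h : ∀ k, i'.1 (w k) = i.1 k)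
    {x y : Fin D.n → ℝ} (hx : D.Generic i'.1 x) (hc : (sp i' x y).card ≤ 1) :
    degS i'.1 x y = degS i.1 (x ∘ w) (y ∘ w) := by
  have hx' : D.Generic i.1 (x ∘ w) := generic_perm h hx
  have hc' : (sp i (x ∘ w) (y ∘ w)).card ≤ 1 := by rwa [← card_sp_perm h]
  by_cases H : ∃ l : D.Letter, Has i.1 (x ∘ w) (y ∘ w) l
  · obtain ⟨l, hl⟩ := H
    rw [degS_of_has hx' hc' hl, degS_of_has hx hc ((Letter.has_perm h x y l).2 hl), degL_perm h]
  · push Not at H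
    rw [degS_of_not H, degS_of_not]
    intro l hl
    refine H (l.perm w.symm) ((Letter.has_perm h x y _).1 ?_)
    rwa [Letter.perm_symm_perm]

-- At most one letter occurs in an elementary piece, so at most one term in all three sums is
-- non-zero. In particular the `finsum` over the edges has finite support.
open Classical in
theorem Move.degree_eq (m : D.Move) : m.degree = degS m.bot.res.1 m.bot.pos m.endPos := by
  unfold Move.degree
  simp only [Move.solidCross_iff, Move.ghostCross_iff, Move.redCross_iff]
  by_cases H : ∃ l : D.Letter, Has m.bot.res.1 m.bot.pos m.endPos l
  · obtain ⟨l, hl⟩ := H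
    rw [degS_of_has m.bot.generic m.card_le hl]
    have e : ∀ l', Has m.bot.res.1 m.bot.pos m.endPos l' ↔ l' = l := fun l' =>
      ⟨fun h => has_unique m.bot.generic m.card_le h hl, fun h => h ▸ hl⟩
    simp only [e]
    have hg : ∀ (k₀ s₀ : Fin D.n) (ε₀ : D.Γ.Edge) (c : Fin D.n → Fin D.n → ℤ),
        (∑ k, ∑ s, ∑ᶠ ε : D.Γ.Edge, if k = k₀ ∧ ε = ε₀ ∧ s = s₀ then c k s else 0) = c k₀ s₀ := by
      intro k₀ s₀ ε₀ c
      have h1 : ∀ k s, (∑ᶠ ε : D.Γ.Edge, if k = k₀ ∧ ε = ε₀ ∧ s = s₀ then c k s else 0) =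
          if k = k₀ then (if s = s₀ then c k s else 0) else 0 := by
        intro k s
        rw [finsum_eq_single _ ε₀ (by intro ε hε; simp [hε])]
        split_ifs <;> simp_all
      simp [h1]
    cases l with
    | solid r s =>
      simp only [Letter.solid.injEq, reduceCtorEq, or_self, if_false, finsum_zero,
        Finset.sum_const_zero, add_zero, degL]
      simp [ite_and]
    | ghostRight k ε s => simp [hg, degL]
    | ghostLeft k ε s => simp [hg, degL]
    | redRight k c => simp [ite_and, degL]
    | redLeft k c => simp [ite_and, degL]
  · push Not at H
    rw [degS_of_not H]
    simp [H]

/-- Both words consist of the letters that occur between the ends, each exactly once. -/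
theorem TriPath.sum_degS {i : D.ResSeq} {x₀ x₁ x₂ x₃ y₁ y₂ : Fin D.n → ℝ}
    (p : TriPath i x₀ x₁ x₂ x₃) (q : TriPath i x₀ y₁ y₂ x₃) :
    degS i.1 x₂ x₃ + (degS i.1 x₁ x₂ + degS i.1 x₀ x₁) =
      degS i.1 y₂ x₃ + (degS i.1 y₁ y₂ + degS i.1 x₀ y₁) := by
  have h : (word i x₀ x₁ x₂ x₃).Perm (word i x₀ y₁ y₂ x₃) :=
    (List.perm_ext_iff_of_nodup p.nodup_word q.nodup_word).2 fun l => by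
      rw [p.mem_word, q.mem_word]
  have := (h.map (degL i.1)).sum_eq
  simpa [word, degS] using this

theorem TriPath.sum_degS_of_has {i : D.ResSeq} {x₀ x₁ x₂ x₃ : Fin D.n → ℝ}
    (p : TriPath i x₀ x₁ x₂ x₃) {l₁ l₂ l₃ : D.Letter} (h₁ : Has i.1 x₀ x₃ l₁)
    (h₂ : Has i.1 x₀ x₃ l₂) (h₃ : Has i.1 x₀ x₃ l₃) (h₁₂ : l₁ ≠ l₂) (h₁₃ : l₁ ≠ l₃)
    (h₂₃ : l₂ ≠ l₃) : degS i.1 x₂ x₃ + (degS i.1 x₁ x₂ + degS i.1 x₀ x₁) =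
      degL i.1 l₁ + (degL i.1 l₂ + degL i.1 l₃) := by
  have hsub : [l₁, l₂, l₃].Subperm (word i x₀ x₁ x₂ x₃) := by
    refine List.subperm_of_subset (by simp [h₁₂, h₁₃, h₂₃]) ?_
    intro l hl
    simp only [List.mem_cons, List.not_mem_nil, or_false] at hl
    rw [p.mem_word]
    rcases hl with rfl | rfl | rfl <;> assumption
  have h := hsub.perm_of_length_le (by simpa using length_word)
  have := (h.map (degL i.1)).sum_eq
  simpa [word, degS] using this.symm

theorem Path3.sum_degree (p : D.Path3) : p.c.degree + p.b.degree + p.a.degree =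
    degS p.a.bot.res.1 p.x2 p.x3 + (degS p.a.bot.res.1 p.x1 p.x2 + degS p.a.bot.res.1 p.x0 p.x1) := by
  have hb : ∀ k, p.b.bot.res.1 (p.a.w k) = p.a.bot.res.1 k := by
    rw [p.hab]; exact p.a.res_comp
  have hc : ∀ k, p.c.bot.res.1 ((p.b.w * p.a.w) k) = p.a.bot.res.1 k := by
    rw [p.hbc]; exact fun k => (p.b.res_comp _).trans (hb k)
  have e1 : p.b.bot.pos ∘ p.a.w = p.x1 := by rw [p.hab]; rfl
  have e2 : p.c.bot.pos ∘ (p.b.w * p.a.w) = p.x2 := by rw [p.hbc]; rfl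
  have e5 : p.b.endPos ∘ p.a.w = p.x2 := rfl
  have e6 : p.c.endPos ∘ (p.b.w * p.a.w) = p.x3 := rfl
  rw [Move.degree_eq, Move.degree_eq, Move.degree_eq, degS_perm hb p.b.bot.generic p.b.card_le,
    degS_perm hc p.c.bot.generic p.c.card_le, e1, e2, e5, e6, add_assoc]
  rfl

/-! ### Degrees of polynomials -/

/-- The degrees of the dots. -/
def wt (i : Fin D.n → I) : Fin D.n → ℤ := fun k => 2 * (D.Γ.d (i k) : ℤ)

theorem weight_two (a b : ℤ) (m : Fin 2 →₀ ℕ) : Finsupp.weight ![a, b] m = m 0 * a + m 1 * b := by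
  rw [Finsupp.weight_apply, Finsupp.sum_fintype _ _ (by simp)]
  simp [Fin.sum_univ_two]

theorem isWeightedHomogeneous_evalQ {i : Fin D.n → I} {r s : Fin D.n} (h : i r ≠ i s) :
    (evalQ (D.Q (i r) (i s)) r s).IsWeightedHomogeneous (wt i)
      (-(2 * (D.Γ.d (i r) * D.Γ.a (i r) (i s)))) := by
  rw [evalQ, aeval_def, eval₂_eq']
  refine IsWeightedHomogeneous.sum _ _ _ fun m hm => ?_
  have h1 := D.Q_homogeneous _ _ h (mem_support_iff.1 hm)
  rw [weight_two] at h1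
  rw [← h1, Fin.prod_univ_two, ← zero_add (_ + _)]
  refine (isWeightedHomogeneous_C _ _).mul (.mul ?_ ?_)
  · have := (isWeightedHomogeneous_X R (wt i) r).pow (m 0)
    simpa [wt] using this
  · have := (isWeightedHomogeneous_X R (wt i) s).pow (m 1)
    simpa [wt] using this

theorem isWeightedHomogeneous_diffQ {i : Fin D.n → I} {r u s : Fin D.n} (h : i r ≠ i u)
    (hrs : i r = i s) :
    (-diffQ (D.Q (i r) (i u)) r u s).IsWeightedHomogeneous (wt i)
      (-(2 * (D.Γ.d (i r) * D.Γ.a (i r) (i u))) - 2 * D.Γ.d (i r)) := by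
  rw [diffQ, neg_neg]
  refine IsWeightedHomogeneous.sum _ _ _ fun m hm => ?_
  have h1 := D.Q_homogeneous _ _ h (mem_support_iff.1 hm)
  rw [weight_two] at h1
  rw [← h1]
  -- The geometric sum has the integer degree `m 0 - 1`, in units of the weight of `r`. For `m 0 =
  -- 0` this is negative, but then the sum is empty.
  have e : (m 0 * (2 * (D.Γ.d (i r) : ℤ)) + m 1 * (2 * (D.Γ.d (i u) : ℤ)) - 2 * D.Γ.d (i r)) =
      (0 + m 1 • wt i u) + ((m 0 : ℤ) - 1) * wt i r := by simp [wt]; ring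
  rw [e]
  refine ((isWeightedHomogeneous_C _ _).mul ((isWeightedHomogeneous_X R (wt i) u).pow _)).mul ?_
  refine IsWeightedHomogeneous.sum _ _ _ fun k hk => ?_
  have hk := Finset.mem_range.1 hk
  have := ((isWeightedHomogeneous_X R (wt i) s).pow k).mul
    ((isWeightedHomogeneous_X R (wt i) r).pow (m 0 - 1 - k))
  convert this using 1
  have e2 : wt i s = wt (D := D) i r := by simp [wt, hrs]
  rw [e2, ← add_smul, nsmul_eq_mul]
  congr 1
  push_cast [show k + (m 0 - 1 - k) = m 0 - 1 by omega, show 1 ≤ m 0 by omega]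
  omega

/-! ### The grading of the algebra of all diagrams -/

/-- The algebra of all diagrams, with a formal variable that records degrees. -/
abbrev BigZ (D : Datum R I) : Type _ := AddMonoidAlgebra D.Big ℤ

/-- A linear combination of diagrams, decomposed according to degrees. -/
def gradFree : D.Free →ₐ[R] D.BigZ :=
  FreeAlgebra.lift R fun g => AddMonoidAlgebra.single g.degree (D.cls (FreeAlgebra.ι R g))

theorem bigDeg_mul {δ ε : ℤ} {a b : D.Big} (ha : a ∈ D.bigDeg δ) (hb : b ∈ D.bigDeg ε) :
    a * b ∈ D.bigDeg (δ + ε) := by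
  have h : D.bigDeg δ * D.bigDeg ε ≤ D.bigDeg (δ + ε) := by
    rw [bigDeg, bigDeg, Submodule.span_mul_span, Submodule.span_le]
    rintro _ ⟨_, ⟨l, hl, rfl⟩, _, ⟨l', hl', rfl⟩, rfl⟩
    exact Submodule.subset_span ⟨l ++ l', by simp [hl, hl'], by simp⟩
  exact h (Submodule.mul_mem_mul ha hb)

theorem bigDeg_word (l : List D.Gen) :
    D.cls (l.map (FreeAlgebra.ι R)).prod ∈ D.bigDeg (l.map Gen.degree).sum :=
  Submodule.subset_span ⟨l, rfl, rfl⟩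

theorem bigDeg_one : (1 : D.Big) ∈ D.bigDeg 0 := by simpa using bigDeg_word ([] : List D.Gen)

/-- The linear combination `a` of diagrams is homogeneous of degree `δ`. -/
def Homog (δ : ℤ) (a : D.Free) : Prop :=
  gradFree a = AddMonoidAlgebra.single δ (D.cls a) ∧ D.cls a ∈ D.bigDeg δ

theorem homog_gen (g : D.Gen) : Homog g.degree (FreeAlgebra.ι R g : D.Free) :=
  ⟨by simp [gradFree], by simpa using bigDeg_word [g]⟩

theorem Homog.mul {δ ε : ℤ} {a b : D.Free} (ha : Homog δ a) (hb : Homog ε b) :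
    Homog (δ + ε) (a * b) := by
  refine ⟨?_, by rw [map_mul]; exact bigDeg_mul ha.2 hb.2⟩
  rw [map_mul, ha.1, hb.1, AddMonoidAlgebra.single_mul_single, map_mul]

theorem Homog.add {δ : ℤ} {a b : D.Free} (ha : Homog δ a) (hb : Homog δ b) :
    Homog δ (a + b) := by
  refine ⟨?_, by rw [map_add]; exact add_mem ha.2 hb.2⟩
  rw [map_add, ha.1, hb.1, ← AddMonoidAlgebra.single_add, map_add]

theorem Homog.sub {δ : ℤ} {a b : D.Free} (ha : Homog δ a) (hb : Homog δ b) :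
    Homog δ (a - b) := by
  refine ⟨?_, by rw [map_sub]; exact sub_mem ha.2 hb.2⟩
  rw [map_sub, ha.1, hb.1, ← AddMonoidAlgebra.single_sub, map_sub]

theorem Homog.smul {δ : ℤ} {a : D.Free} (c : R) (ha : Homog δ a) : Homog δ (c • a) := by
  refine ⟨?_, by rw [map_smul]; exact Submodule.smul_mem _ _ ha.2⟩
  rw [map_smul, ha.1, AddMonoidAlgebra.smul_single, map_smul]

theorem homog_zero (δ : ℤ) : Homog δ (0 : D.Free) := by
  refine ⟨?_, by simp⟩
  rw [map_zero, map_zero, AddMonoidAlgebra.single_zero]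

theorem homog_one : Homog 0 (1 : D.Free) := by
  refine ⟨?_, by rw [map_one]; exact bigDeg_one⟩
  rw [map_one, map_one, AddMonoidAlgebra.one_def]

theorem Homog.sum {ι : Type*} {s : Finset ι} {δ : ℤ} {f : ι → D.Free} (h : ∀ k ∈ s, Homog δ (f k)) :
    Homog δ (∑ k ∈ s, f k) := by
  classical
  induction s using Finset.induction_on with
  | empty => exact homog_zero δ
  | insert a s ha ih =>
    rw [Finset.sum_insert ha]
    exact (h a (by simp)).add (ih fun k hk => h k (by simp [hk]))

theorem Homog.pow {δ : ℤ} {a : D.Free} (h : Homog δ a) (m : ℕ) : Homog (m * δ) (a ^ m) := by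
  induction m with
  | zero => simpa using homog_one
  | succ m ih => rw [pow_succ]; convert ih.mul h using 1; push_cast; ring

theorem homog_list {α : Type*} {l : List α} {f : α → D.Free} {e : α → ℤ}
    (h : ∀ k, Homog (e k) (f k)) : Homog (l.map e).sum (l.map f).prod := by
  induction l with
  | nil => simpa using homog_one
  | cons a l ih => simpa using (h a).mul ih

theorem homog_idem (s : D.Slice) : Homog 0 (D.idem s) := homog_gen (Gen.idem s)

theorem homog_dot (s : D.Slice) (k : Fin D.n) : Homog (wt s.res.1 k) (D.dot s k) :=
  homog_gen (Gen.dot s k)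

theorem homog_mv (m : D.Move) : Homog m.degree (D.mv m) := homog_gen (Gen.move m)

theorem homog_poly {s : D.Slice} {f : MvPolynomial (Fin D.n) R} {δ : ℤ}
    (h : f.IsWeightedHomogeneous (wt s.res.1) δ) : Homog δ (D.poly s f) := by
  refine Homog.sum fun m hm => .smul _ ?_
  rw [← h (mem_support_iff.1 hm), ← add_zero (Finsupp.weight _ _), Finsupp.weight_apply,
    Finsupp.sum_fintype _ _ (by simp), ← List.sum_ofFn, List.ofFn_eq_map, List.ofFn_eq_map]
  refine .mul (homog_list fun k => ?_) (homog_idem s)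
  rw [nsmul_eq_mul]
  exact (homog_dot s k).pow _

theorem Path3.homog_diagram (p : D.Path3) :
    Homog (degS p.a.bot.res.1 p.x2 p.x3 +
      (degS p.a.bot.res.1 p.x1 p.x2 + degS p.a.bot.res.1 p.x0 p.x1)) p.diagram := by
  rw [← p.sum_degree]
  exact ((homog_mv _).mul (homog_mv _)).mul (homog_mv _)

theorem homog_double {m m' : D.Move} (hbot : m'.bot = m.top) (htop : m'.top = m.bot)
    (hw : m'.w = m.w⁻¹) : Homog (degS m.bot.res.1 m.endPos m.bot.pos +
      degS m.bot.res.1 m.bot.pos m.endPos) (D.mv m' * D.mv m) := by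
  have h : ∀ k, m'.bot.res.1 (m.w k) = m.bot.res.1 k := by rw [hbot]; exact m.res_comp
  have e := degS_perm h m'.bot.generic m'.card_le
  have e1 : m'.bot.pos ∘ m.w = m.endPos := by rw [hbot]; rfl
  have e2 : m'.endPos ∘ m.w = m.bot.pos := by
    funext k; simp [Move.endPos, htop, hw]
  rw [e1, e2] at e
  rw [← e, ← m.degree_eq, ← m'.degree_eq]
  exact (homog_mv _).mul (homog_mv _)

theorem homog_double_of_has {m m' : D.Move} (hbot : m'.bot = m.top) (htop : m'.top = m.bot)
    (hw : m'.w = m.w⁻¹) {l : D.Letter} (h : Has m.bot.res.1 m.bot.pos m.endPos l) :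
    Homog (2 * degL m.bot.res.1 l) (D.mv m' * D.mv m) := by
  have := homog_double hbot htop hw
  rwa [degS_of_has m.bot.generic m.card_le h,
    degS_of_has m.generic_end (by rw [card_sep_comm (isArr_walls _)]; exact m.card_le)
      (Letter.has_rev h), degL_rev h.1, ← two_mul] at this

theorem Move.homog_of_swap {m m₀ : D.Move} {r s : Fin D.n} (h : m.SolidCross r s)
    (hbot : m₀.bot = m.bot) (htop : m₀.top = m.top) (hw : m₀.w = m.w * Equiv.swap r s) :
    Homog 0 (D.mv m₀) := by
  have := homog_mv m₀
  rwa [Move.degree_eq, Move.endPos_of_hw htop hw, hbot, degS_of_empty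
    (sp_swap_of_single m.generic_end.gen m.card_le h)] at this

/-- The error term has no crossings, so the polynomial has to carry the degree of the three
crossings. For `Q` the two ghost crossings give its degree, and the solid crossing takes away the
degree of one dot, as does the divided difference. -/
theorem Exceptional.degree {i : D.ResSeq} {x₀ x₁ x₂ x₃ : Fin D.n → ℝ}
    (p : TriPath i x₀ x₁ x₂ x₃) {r s : Fin D.n} {A M B : D.Str} {f : MvPolynomial (Fin D.n) R}
    (hex : D.Exceptional i.1 r s A M B f) (hrev : D.Reversed x₀ x₃ A M B) :
    f.IsWeightedHomogeneous (wt i.1)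
      (degS i.1 x₂ x₃ + (degS i.1 x₁ x₂ + degS i.1 x₀ x₁)) := by
  have key : ∀ {am mb : D.Letter}, am.fst = A → am.snd = M → mb.fst = M →
      mb.snd = B → am.Sig i.1 → mb.Sig i.1 → (am ≠ mb) → (am ≠ .solid r s) → (mb ≠ .solid r s) →
      i.1 r = i.1 s → A.off = B.off → A.base = some r → B.base = some s →
      f.IsWeightedHomogeneous (wt i.1) (degL i.1 am + (degL i.1 mb + degL i.1 (.solid r s))) →
      f.IsWeightedHomogeneous (wt i.1)
        (degS i.1 x₂ x₃ + (degS i.1 x₁ x₂ + degS i.1 x₀ x₁)) := by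
    intro am mb e1 e2 e3 e4 s1 s2 n1 n2 n3 hrs hoff hA hB hf
    have h1 : Has i.1 x₀ x₃ am := ⟨s1, by rw [e1, e2]; exact ⟨hrev.1, hrev.2.2.2⟩⟩
    have h2 : Has i.1 x₀ x₃ mb := ⟨s2, by rw [e3, e4]; exact ⟨hrev.2.1, hrev.2.2.1⟩⟩
    have lA : ∀ z, D.loc z A = z r + A.off := fun z => by rw [loc_eq, hA]; rfl
    have lB : ∀ z, D.loc z B = z s + A.off := fun z => by rw [loc_eq, hB, hoff]; rfl
    obtain ⟨r1, r2, r3, r4⟩ := hrev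
    rw [lA] at r1 r4
    rw [lB] at r2 r3
    have h3 : Has i.1 x₀ x₃ (.solid r s) := ⟨hrs, by
      simp only [Passes, Letter.fst, Letter.snd, loc]; constructor <;> linarith⟩
    rwa [p.sum_degS_of_has h1 h2 h3 n1 n2 n3]
  cases hex with
  | ghostSolidGhost u s ε hrs ho hp =>
    have hru : i.1 r ≠ i.1 u := by rw [← ho, ← hp]; exact owner_ne_partner ε
    refine key (am := .ghostRight r ε u) (mb := .ghostLeft s ε u) rfl rfl rfl rfl ⟨ho, hp⟩
      ⟨ho.trans hrs, hp⟩ (by simp) (by simp) (by simp) hrs rfl rfl rfl ?_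
    convert isWeightedHomogeneous_diffQ hru hrs using 1
    simp only [degL, ← hrs]
    ring
  | solidGhostSolid u s ε hrs ho hp =>
    have hru : i.1 r ≠ i.1 u := by rw [← ho, ← hp]; exact (owner_ne_partner ε).symm
    refine key (am := .ghostLeft u ε r) (mb := .ghostRight u ε s) rfl rfl rfl rfl ⟨ho, hp⟩
      ⟨ho, hp.trans hrs⟩ (by simp) (by simp) (by simp) hrs rfl rfl rfl ?_
    convert isWeightedHomogeneous_diffQ hru hrs using 1
    simp only [degL, ← hrs]
    rw [D.Γ.symm (i.1 u) (i.1 r)]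
    ring
  | solidRedSolid s c hrs hc =>
    refine key (am := .redRight r c) (mb := .redLeft s c) rfl rfl rfl rfl hc
      (hc.trans hrs) (by simp) (by simp) (by simp) hrs rfl rfl rfl ?_
    convert isWeightedHomogeneous_one R (wt i.1) using 1
    simp only [degL, ← hrs]
    ring

/-- The two sides have the same class by the relation itself, so only their degrees have to agree.
-/
theorem gradFree_eq_of_homog {a b : D.Free} (h : D.Rel a b) {δ : ℤ} (ha : Homog δ a)
    (hb : Homog δ b) : gradFree a = gradFree b := by
  rw [ha.1, hb.1, cls_rel h]

theorem gradFree_rel {a b : D.Free} (h : D.Rel a b) : gradFree a = gradFree b := by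
  have hab := h
  cases h with
  | idem_mul_self s =>
    exact gradFree_eq_of_homog hab (.mul (homog_idem s) (homog_idem s)) (homog_idem s)
  | idem_mul_of_ne s t h =>
    exact gradFree_eq_of_homog hab ((homog_idem s).mul (homog_idem t)) (homog_zero _)
  | idem_dot s k =>
    refine gradFree_eq_of_homog hab ((homog_idem s).mul (homog_dot s k)) ?_
    rw [zero_add]; exact homog_dot s k
  | dot_idem s k =>
    refine gradFree_eq_of_homog hab ((homog_dot s k).mul (homog_idem s)) ?_
    rw [add_zero]; exact homog_dot s k
  | idem_move m =>
    refine gradFree_eq_of_homog hab ((homog_idem _).mul (homog_mv m)) ?_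
    rw [zero_add]; exact homog_mv m
  | move_idem m =>
    refine gradFree_eq_of_homog hab ((homog_mv m).mul (homog_idem _)) ?_
    rw [add_zero]; exact homog_mv m
  | move_refl m h hw =>
    refine gradFree_eq_of_homog hab (homog_mv m) ?_
    rw [m.degree_eq, degS_of_empty]
    · exact homog_idem _
    · have : m.endPos = m.bot.pos := by funext k; simp [Move.endPos, ← h, hw]
      rw [this, sp, sep_self]
  | dot_comm s k l =>
    refine gradFree_eq_of_homog hab ((homog_dot s k).mul (homog_dot s l)) ?_
    rw [add_comm]
    exact (homog_dot s l).mul (homog_dot s k)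
  | dot_slide m k h =>
    refine gradFree_eq_of_homog hab ((homog_dot _ _).mul (homog_mv m)) ?_
    have e : wt m.top.res.1 (m.w k) = wt m.bot.res.1 k := by rw [wt, wt, m.res_comp]
    rw [add_comm, e]
    exact (homog_mv m).mul (homog_dot _ _)
  | dot_cross_left m m₀ r s h hbot htop hw =>
    refine gradFree_eq_of_homog hab ?_ (Move.homog_of_swap h hbot htop hw)
    have hd : m.degree = - wt m.bot.res.1 r := by
      rw [m.degree_eq, degS_of_has m.bot.generic m.card_le ((m.solidCross_iff r s).1 h)]; rfl
    have e : wt m.top.res.1 (m.w r) = wt m.bot.res.1 r := by rw [wt, wt, m.res_comp]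
    refine .sub ?_ ?_
    · convert (homog_mv m).mul (homog_dot m.bot r) using 1
      rw [hd]; ring
    · convert (homog_dot m.top (m.w r)).mul (homog_mv m) using 1
      rw [hd, e]; ring
  | dot_cross_right m m₀ r s h hbot htop hw =>
    refine gradFree_eq_of_homog hab ?_ (Move.homog_of_swap h hbot htop hw)
    have hd : m.degree = - wt m.bot.res.1 s := by
      rw [m.degree_eq, degS_of_has m.bot.generic m.card_le ((m.solidCross_iff r s).1 h), wt,
        ← h.1]; rfl
    have e : wt m.top.res.1 (m.w s) = wt m.bot.res.1 s := by rw [wt, wt, m.res_comp]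
    refine .sub ?_ ?_
    · convert (homog_dot m.top (m.w s)).mul (homog_mv m) using 1
      rw [hd, e]; ring
    · convert (homog_mv m).mul (homog_dot m.bot s) using 1
      rw [hd]; ring
  | double_solid m m' hbot htop hw r s h =>
    exact gradFree_eq_of_homog hab (homog_double hbot htop hw) (homog_zero _)
  | double_ghost m m' hbot htop hw k ε s h =>
    have hne : m.bot.res.1 k ≠ m.bot.res.1 s := by
      rw [← h.1, ← h.2.1]; exact owner_ne_partner ε
    have hp := homog_poly (isWeightedHomogeneous_evalQ hne)
    refine gradFree_eq_of_homog hab ?_ hp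
    rcases (m.ghostCross_iff k ε s).1 h with h | h
    all_goals
      convert homog_double_of_has hbot htop hw h using 1
      simp only [degL]
      ring
  | double_red m m' hbot htop hw k c h =>
    refine gradFree_eq_of_homog hab ?_ (homog_dot m.bot k)
    rcases (m.redCross_iff k c).1 h with h | h <;>
      exact homog_double_of_has hbot htop hw h
  | double_other m m' hbot htop hw hs hg hr =>
    have hno : ∀ l : D.Letter, ¬ Has m.bot.res.1 m.bot.pos m.endPos l := by
      intro l hl
      cases l with
      | solid r s => exact hs r s hl
      | ghostRight k ε s => exact hg k ε s ((m.ghostCross_iff k ε s).2 (Or.inl hl))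
      | ghostLeft k ε s => exact hg k ε s ((m.ghostCross_iff k ε s).2 (Or.inr hl))
      | redRight k c => exact hr k c ((m.redCross_iff k c).2 (Or.inl hl))
      | redLeft k c => exact hr k c ((m.redCross_iff k c).2 (Or.inr hl))
    refine gradFree_eq_of_homog hab (homog_double hbot htop hw) ?_
    rw [degS_of_not hno, degS_of_not fun l hl => hno _ (Letter.has_rev hl)]
    exact homog_idem _
  | braid p q h hp hq hex =>
    have tp := p.triPath hp
    have tq := q.triPath hq
    have e0 : p.x0 = q.x0 := by rw [Path3.x0, h.1]; rfl
    have e3 : p.x3 = q.x3 := funext fun k =>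
      (congrArg (fun t : D.Slice => t.pos ((p.c.w * p.b.w * p.a.w) k)) h.2.1).trans
        (congrArg (fun v : Equiv.Perm (Fin D.n) => q.c.top.pos (v k)) h.2.2)
    refine gradFree_eq_of_homog hab p.homog_diagram ?_
    rw [← e0, ← h.1, ← e3] at tq
    rw [tp.sum_degS tq]
    have := q.homog_diagram
    rwa [← e0, ← h.1, ← e3] at this
  | braid_exceptional p q h hp hq r s A M B f hex hrev hleft hright m₀ hbot htop hw =>
    have tp := p.triPath hp
    have tq := q.triPath hq
    have e0 : p.x0 = q.x0 := by rw [Path3.x0, h.1]; rfl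
    have e3 : p.x3 = q.x3 := funext fun k =>
      (congrArg (fun t : D.Slice => t.pos ((p.c.w * p.b.w * p.a.w) k)) h.2.1).trans
        (congrArg (fun v : Equiv.Perm (Fin D.n) => q.c.top.pos (v k)) h.2.2)
    have hP := hex.parallel (hex.ne_of_reversed hrev)
    have e5 : m₀.endPos = p.x3 ∘ Equiv.swap r s := by
      funext k; simp [Move.endPos, Path3.x3, htop, hw]
    have hm₀ : Homog 0 (D.mv m₀) := by
      have := homog_mv m₀
      have hz : degS p.a.bot.res.1 p.a.bot.pos (p.x3 ∘ Equiv.swap r s) = 0 :=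
        degS_of_empty (sp_swap_of_reversed tp.g₃.gen hP hrev tp.card_le)
      rwa [m₀.degree_eq, e5, hbot, hz] at this
    refine gradFree_eq_of_homog hab p.homog_diagram (.add ?_ ?_)
    · rw [← e0, ← h.1, ← e3] at tq
      rw [tp.sum_degS tq]
      have := q.homog_diagram
      rwa [← e0, ← h.1, ← e3] at this
    · have := hm₀.mul (homog_poly (s := p.a.bot) (hex.degree tp hrev))
      rwa [zero_add] at this

/-- The decomposition according to degrees. -/
def grad : D.Big →ₐ[R] D.BigZ :=
  RingQuot.liftAlgHom R ⟨gradFree, fun _ _ h => gradFree_rel h⟩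

@[simp] theorem grad_cls (a : D.Free) : grad (D.cls a) = gradFree a := by
  rw [grad, cls, RingQuot.liftAlgHom_mkAlgHom_apply]

theorem grad_of_mem {δ : ℤ} {b : D.Big} (h : b ∈ D.bigDeg δ) :
    grad b = AddMonoidAlgebra.single δ b := by
  refine Submodule.span_induction (p := fun b _ => grad b = AddMonoidAlgebra.single δ b)
    ?_ ?_ ?_ ?_ h
  · rintro _ ⟨l, hl, rfl⟩
    have : Homog (l.map Gen.degree).sum (l.map (FreeAlgebra.ι R)).prod :=
      homog_list fun g => homog_gen g
    rw [grad_cls, this.1, hl]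
  · simp
  · intro a b _ _ ha hb
    rw [map_add, ha, hb, AddMonoidAlgebra.single_add]
  · intro c a _ ha
    rw [map_smul, ha, AddMonoidAlgebra.smul_single]


theorem ee_mem_bigDeg (s : D.Slice) : ee s ∈ D.bigDeg 0 := (homog_idem s).2

theorem pB_mem_bigDeg {s : D.Slice} {f : MvPolynomial (Fin D.n) R} {δ : ℤ}
    (h : f.IsWeightedHomogeneous (wt s.res.1) δ) : pB s f ∈ D.bigDeg δ := by
  rw [← cls_poly]
  exact (homog_poly h).2

/-! ### The grading of the weighted KLRW algebra -/

theorem unit_mem_bigDeg (X : Finset D.Loading) : D.unit X ∈ D.bigDeg 0 :=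
  sum_mem fun _ _ => sum_mem fun _ _ => ee_mem_bigDeg _

variable {X : Finset D.Loading}

theorem W.val_injective : Function.Injective (W.val : D.W X → D.Big) := Subtype.val_injective

theorem W.val_add (v w : D.W X) : (v + w).val = v.val + w.val := rfl

theorem W.val_mul (v w : D.W X) : (v * w).val = v.val * w.val := rfl

theorem W.val_zero : (0 : D.W X).val = 0 := rfl

theorem W.val_smul (c : R) (v : D.W X) : (c • v).val = c • v.val := rfl

theorem toW_val (b : D.Big) : (D.toW X b).val = D.unit X * b * D.unit X := rfl

theorem W.unit_mul (v : D.W X) : D.unit X * v.val = v.val :=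
  ((Subsemigroup.mem_corner_iff (D.unit_idem X)).mp v.2).1

theorem W.mul_unit (v : D.W X) : v.val * D.unit X = v.val :=
  ((Subsemigroup.mem_corner_iff (D.unit_idem X)).mp v.2).2

theorem W.toW_val_self (v : D.W X) : D.toW X v.val = v :=
  W.val_injective (by rw [toW_val, v.unit_mul, v.mul_unit])

/-- The inclusion as a linear map. -/
def W.valL (X : Finset D.Loading) : D.W X →ₗ[R] D.Big where
  toFun := W.val
  map_add' := W.val_add
  map_smul' := W.val_smul

/-- The projection as a linear map. -/
def toWL (X : Finset D.Loading) : D.Big →ₗ[R] D.W X where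
  toFun := D.toW X
  map_add' a b := W.val_injective (by simp only [toW_val, W.val_add, mul_add, add_mul])
  map_smul' c a := W.val_injective (by
    simp only [toW_val, W.val_smul, RingHom.id_apply, mul_smul_comm, smul_mul_assoc])

theorem toW_mem_deg {δ : ℤ} {b : D.Big} (h : b ∈ D.bigDeg δ) : D.toW X b ∈ D.deg X δ := by
  have := bigDeg_mul (bigDeg_mul (unit_mem_bigDeg X) h) (unit_mem_bigDeg X)
  rwa [zero_add, add_zero] at this

/-- Words are homogeneous and span, and cutting down by the unit, which has degree zero, preserves
degrees. -/
theorem iSup_deg : ⨆ δ, D.deg X δ = ⊤ := by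
  refine eq_top_iff.2 fun v _ => ?_
  have h : ∀ b : D.Big, toWL X b ∈ ⨆ δ, D.deg X δ := by
    intro b
    have hb : b ∈ Submodule.span R
      (Set.range fun l : List D.Gen => D.cls (l.map (FreeAlgebra.ι R)).prod) := by
      rw [span_words]; trivial
    induction hb using Submodule.span_induction with
    | mem x hx =>
      obtain ⟨l, rfl⟩ := hx
      exact Submodule.mem_iSup_of_mem _ (toW_mem_deg (bigDeg_word l))
    | zero => rw [map_zero]; exact zero_mem _
    | add x y _ _ hx hy => rw [map_add]; exact add_mem hx hy
    | smul c x _ hx => rw [map_smul]; exact Submodule.smul_mem _ _ hx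
  rw [← v.toW_val_self]
  exact h _

/-- `grad` puts the terms of a vanishing sum at different exponents, where each of them is read off
as a coefficient. -/
theorem iSupIndep_deg : iSupIndep (D.deg X) := by
  rw [iSupIndep_iff_finsetSum_eq_zero_imp_eq_zero]
  intro s v hv hs i hi
  have h1 := congrArg (fun u => grad (W.valL X u)) hs
  simp only [map_sum, map_zero] at h1
  rw [Finset.sum_congr rfl fun j hj => (grad_of_mem (hv j hj) :
    grad (W.valL X (v j)) = AddMonoidAlgebra.single j (v j).val)] at h1
  have h2 := congrArg (fun u : D.BigZ => u.coeff i) h1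
  simp only [AddMonoidAlgebra.coeff_sum, AddMonoidAlgebra.coeff_single, AddMonoidAlgebra.coeff_zero,
    Finsupp.finsetSum_apply, Finsupp.coe_zero, Pi.zero_apply] at h2
  rw [Finset.sum_eq_single i (fun j _ hj => Finsupp.single_eq_of_ne hj.symm)
    (fun h => absurd hi h), Finsupp.single_eq_same] at h2
  exact W.val_injective h2

theorem nonempty_gradedAlgebra (X : Finset D.Loading) : Nonempty (GradedAlgebra (D.deg X)) := by
  have h := DirectSum.isInternal_submodule_of_iSupIndep_of_iSup_eq_top iSupIndep_deg (iSup_deg (X := X))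
  exact ⟨{ one_mem := unit_mem_bigDeg X
           mul_mem := fun _ _ _ _ ha hb => bigDeg_mul ha hb
           toDecomposition := h.chooseDecomposition }⟩

end

end Datum

end WKLRW

end

noncomputable section


namespace WKLRW

open MvPolynomial

section

variable {R I : Type*} [CommRing R] {n : ℕ}

/-! ### Polynomials that are symmetric in the variables of each colour -/

/-- The permutations of the variables that preserve colours. -/
def colPerm (i : Fin n → I) : Subgroup (Equiv.Perm (Fin n)) where
  carrier := {w | ∀ k, i (w k) = i k}
  one_mem' := fun _ => rfl
  mul_mem' := fun {v w} hv hw k => by rw [Equiv.Perm.mul_apply, hv, hw]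
  inv_mem' := fun {w} hw k => by
    have := hw (w⁻¹ k)
    rwa [← Equiv.Perm.mul_apply, mul_inv_cancel, Equiv.Perm.one_apply, eq_comm] at this

theorem mem_colPerm {i : Fin n → I} {w : Equiv.Perm (Fin n)} :
    w ∈ colPerm i ↔ ∀ k, i (w k) = i k := Iff.rfl

variable (R) in
/-- The polynomials that are symmetric in the variables of each colour. -/
def colSymm (i : Fin n → I) : Subalgebra R (MvPolynomial (Fin n) R) where
  carrier := {f | ∀ w ∈ colPerm i, rename w f = f}
  mul_mem' := fun {f g} hf hg w hw => by rw [map_mul, hf w hw, hg w hw]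
  add_mem' := fun {f g} hf hg w hw => by rw [map_add, hf w hw, hg w hw]
  algebraMap_mem' := fun r w _ => by simp

/-- The monic polynomial with given roots among the variables. -/
def rootPoly {σ : Type*} (s : Finset σ) : Polynomial (MvPolynomial σ R) :=
  ∏ k ∈ s, (Polynomial.X - Polynomial.C (X k))

theorem monic_rootPoly {σ : Type*} (s : Finset σ) :
    (rootPoly s : Polynomial (MvPolynomial σ R)).Monic :=
  Polynomial.monic_prod_X_sub_C _ _

theorem map_rootPoly {σ τ : Type*} (s : Finset σ) (e : σ ↪ τ) :
    (rootPoly s : Polynomial (MvPolynomial σ R)).map (rename (R := R) e).toRingHom =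
      rootPoly (s.map e) := by
  rw [rootPoly, rootPoly, Polynomial.map_prod, Finset.prod_map]
  refine Finset.prod_congr rfl fun k _ => ?_
  simp

theorem coeff_rootPoly_map {σ τ : Type*} (s : Finset σ) (e : σ ↪ τ) (m : ℕ) :
    rename e ((rootPoly s : Polynomial (MvPolynomial σ R)).coeff m) =
      (rootPoly (s.map e)).coeff m := by
  rw [← map_rootPoly, Polynomial.coeff_map]; rfl

open Classical in
/-- The variables of a given colour. -/
def colour (i : Fin n → I) (b : I) : Finset (Fin n) := Finset.univ.filter fun k => i k = b

theorem mem_colour {i : Fin n → I} {b : I} {k : Fin n} : k ∈ colour i b ↔ i k = b := by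
  simp [colour]

variable (R) in
/-- The elementary symmetric polynomials in the variables of one colour. -/
def elemSymm (i : Fin n → I) : Set (MvPolynomial (Fin n) R) :=
  {c | ∃ b m, c = (rootPoly (colour i b)).coeff m}

theorem elemSymm_subset (i : Fin n → I) : elemSymm R i ⊆ colSymm R i := by
  rintro _ ⟨b, m, rfl⟩ w hw
  have h : (colour i b).map w.toEmbedding = colour i b := by
    ext k
    simp only [Finset.mem_map_equiv, mem_colour]
    have := hw (w.symm k)
    rw [Equiv.apply_symm_apply] at this
    rw [this]
  have := coeff_rootPoly_map (R := R) (colour i b) w.toEmbedding m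
  rwa [h] at this

/-- The variables of the colour of `k` that are not before `k`. -/
def tailColour (i : Fin n → I) (k : Fin n) : Finset (Fin n) :=
  (colour i (i k)).filter fun l => k ≤ l

/-- Monomials with bounded exponents in the first `j` variables. -/
def boundedMonomials (R : Type*) [CommRing R] (i : Fin n → I) (j : ℕ) :
    Set (MvPolynomial (Fin n) R) :=
  {g | ∃ m : Fin n → ℕ, (∀ k, m k < (tailColour i k).card) ∧ (∀ k : Fin n, j ≤ k → m k = 0) ∧
    g = ∏ k, X k ^ m k}

theorem tailColour_card_pos (i : Fin n → I) (k : Fin n) : 0 < (tailColour i k).card :=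
  Finset.card_pos.2 ⟨k, by simp [tailColour, mem_colour]⟩

variable (R) in
/-- The algebra generated by the elementary symmetric polynomials and the first `j` variables. -/
def stage (i : Fin n → I) (j : ℕ) : Subalgebra R (MvPolynomial (Fin n) R) :=
  Algebra.adjoin R (elemSymm R i ∪ X '' {l : Fin n | (l : ℕ) < j})

theorem X_mem_stage {i : Fin n → I} {j : ℕ} {l : Fin n} (h : (l : ℕ) < j) :
    (X l : MvPolynomial (Fin n) R) ∈ stage R i j :=
  Algebra.subset_adjoin (Or.inr ⟨l, h, rfl⟩)

variable [IsDomain R]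

/-- The next variable is a root of a monic polynomial. -/
theorem exists_monic (i : Fin n → I) (k : Fin n) : ∃ p : Polynomial (stage R i k),
    p.Monic ∧ p.natDegree = (tailColour i k).card ∧
    Polynomial.aeval (X k : MvPolynomial (Fin n) R) p = 0 := by
  classical
  let A := stage R i k
  have hinj : Function.Injective (algebraMap A (MvPolynomial (Fin n) R)) := Subtype.val_injective
  let L := (colour i (i k)).filter fun l => l < k
  obtain ⟨P, hP⟩ : ∃ P : Polynomial A, P.map (algebraMap A _) =
      (rootPoly (colour i (i k)) : Polynomial (MvPolynomial (Fin n) R)) := by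
    rw [← Polynomial.mem_lifts, Polynomial.lifts_iff_coeff_lifts]
    exact fun m => ⟨⟨_, Algebra.subset_adjoin (Or.inl ⟨i k, m, rfl⟩)⟩, rfl⟩
  let q : Polynomial A := ∏ l ∈ L, (Polynomial.X - Polynomial.C
    (if h : l < k then (⟨X l, X_mem_stage h⟩ : A) else 0))
  have hqm : q.Monic :=
    Polynomial.monic_prod_of_monic _ _ fun l _ => Polynomial.monic_X_sub_C _
  have hq : q.map (algebraMap A _) =
      (rootPoly L : Polynomial (MvPolynomial (Fin n) R)) := by
    rw [rootPoly, Polynomial.map_prod]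
    refine Finset.prod_congr rfl fun l hl => ?_
    rw [Polynomial.map_sub, Polynomial.map_X, Polynomial.map_C,
      dif_pos (Finset.mem_filter.1 hl).2]
    rfl
  -- The polynomial of the whole colour factors into the part of the variables before `k` and the
  -- tail, which has the root `X k`. The first two are monic with coefficients in `stage R i k`,
  -- hence so is their quotient.
  have hsplit : (rootPoly (colour i (i k)) : Polynomial (MvPolynomial (Fin n) R)) =
      rootPoly L * rootPoly (tailColour i k) := by
    have e : tailColour i k = (colour i (i k)).filter fun l => ¬ l < k := by
      simp [tailColour]
    rw [e]
    exact (Finset.prod_filter_mul_prod_filter_not _ _ _).symm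
  have hp : (P /ₘ q).map (algebraMap A _) =
      (rootPoly (tailColour i k) : Polynomial (MvPolynomial (Fin n) R)) := by
    rw [Polynomial.map_divByMonic _ hqm, hP, hq, hsplit,
      Polynomial.mul_divByMonic_cancel_left _ (monic_rootPoly L)]
  refine ⟨P /ₘ q, (hinj.monic_map_iff).2 (by rw [hp]; exact monic_rootPoly _), ?_, ?_⟩
  · rw [← Polynomial.natDegree_map_eq_of_injective hinj, hp, rootPoly,
      Polynomial.natDegree_prod_of_monic _ _ fun l _ => Polynomial.monic_X_sub_C _]
    simp
  · rw [Polynomial.aeval_def, ← Polynomial.eval_map, hp, rootPoly, Polynomial.eval_prod]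
    exact Finset.prod_eq_zero (i := k) (by simp [tailColour, mem_colour]) (by simp)

/-- The new stage consists of polynomials in `X k` over the previous one. Division with remainder by
the monic polynomial with the root `X k` bounds the exponents. -/
theorem stage_succ {i : Fin n → I} {k : Fin n} {f : MvPolynomial (Fin n) R}
    (hf : f ∈ stage R i (k + 1)) : ∃ c : ℕ → MvPolynomial (Fin n) R, (∀ p, c p ∈ stage R i k) ∧
      f = ∑ p ∈ Finset.range (tailColour i k).card, c p * X k ^ p := by
  obtain ⟨P, hP, hd, hr⟩ := exists_monic (R := R) i k
  have hle : stage R i (k + 1) ≤ ((Polynomial.aeval (X k : MvPolynomial (Fin n) R) :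
      Polynomial (stage R i k) →ₐ[stage R i k] _).range.restrictScalars R) := by
    refine Algebra.adjoin_le ?_
    rintro g (hg | ⟨l, hl, rfl⟩)
    · exact ⟨Polynomial.C ⟨g, Algebra.subset_adjoin (Or.inl hg)⟩, by simp⟩
    · rcases lt_or_eq_of_le (Nat.lt_succ_iff.1 hl) with h | h
      · exact ⟨Polynomial.C ⟨X l, X_mem_stage h⟩, by simp⟩
      · exact ⟨Polynomial.X, by simp [Fin.ext h]⟩
  obtain ⟨q, rfl⟩ := hle hf
  refine ⟨fun p => ((q %ₘ P).coeff p : MvPolynomial (Fin n) R), fun p => Subtype.coe_prop _, ?_⟩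
  have hne : P ≠ 1 := by
    rintro rfl
    rw [Polynomial.natDegree_one] at hd
    exact (tailColour_card_pos i k).ne hd
  have h1 := Polynomial.natDegree_modByMonic_lt q hP hne
  rw [hd] at h1
  change Polynomial.aeval (X k : MvPolynomial (Fin n) R) q = _
  rw [← Polynomial.aeval_modByMonic_eq_self_of_root hr, Polynomial.aeval_eq_sum_range' h1]
  rfl

theorem stage_le_span (i : Fin n → I) (j : ℕ) (hj : j ≤ n) {f : MvPolynomial (Fin n) R}
    (hf : f ∈ stage R i j) : f ∈ Submodule.span (stage R i 0) (boundedMonomials R i j) := by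
  induction j generalizing f with
  | zero =>
    have h1 : (1 : MvPolynomial (Fin n) R) ∈ boundedMonomials R i 0 :=
      ⟨fun _ => 0, fun k => tailColour_card_pos i k, fun _ _ => rfl, by simp⟩
    have := Submodule.smul_mem _ (⟨f, hf⟩ : stage R i 0) (Submodule.subset_span h1)
    rwa [Subalgebra.smul_def, smul_eq_mul, mul_one] at this
  | succ j ih =>
    obtain ⟨c, hc, rfl⟩ := stage_succ (k := ⟨j, hj⟩) hf
    refine Submodule.sum_mem _ fun p hp => ?_
    have h1 := Submodule.mem_map_of_mem
      (f := LinearMap.mulRight (stage R i 0) (X ⟨j, hj⟩ ^ p : MvPolynomial (Fin n) R))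
      (ih (Nat.le_of_succ_le hj) (hc p))
    refine (Submodule.map_span_le _ _ _).2 ?_ h1
    rintro _ ⟨m, hm, hm0, rfl⟩
    refine Submodule.subset_span ⟨m + Pi.single ⟨j, hj⟩ p, fun k => ?_, fun k hk => ?_, ?_⟩
    · rcases eq_or_ne k ⟨j, hj⟩ with rfl | h
      · simpa [hm0 ⟨j, hj⟩ le_rfl] using hp
      · simpa [h] using hm k
    · have h : k ≠ ⟨j, hj⟩ := by rintro rfl; simp at hk
      simpa [h] using hm0 k (Nat.le_of_succ_le hk)
    · simp only [LinearMap.mulRight_apply, Pi.add_apply, pow_add, Finset.prod_mul_distrib]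
      congr 1
      rw [Finset.prod_eq_single ⟨j, hj⟩] <;> simp +contextual

theorem prod_card_filter_le {α : Type*} [LinearOrder α] (s : Finset α) :
    ∏ k ∈ s, (s.filter fun l => k ≤ l).card = s.card.factorial := by
  induction s using Finset.induction_on_min with
  | empty => simp
  | insert a s ha ih =>
    have has : a ∉ s := fun h => lt_irrefl _ (ha a h)
    rw [Finset.prod_insert has, Finset.card_insert_of_notMem has, Nat.factorial_succ, ← ih]
    congr 1
    · rw [Finset.filter_true_of_mem, Finset.card_insert_of_notMem has]
      intro l hl
      rcases Finset.mem_insert.1 hl with rfl | h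
      · exact le_rfl
      · exact (ha l h).le
    · refine Finset.prod_congr rfl fun k hk => ?_
      rw [Finset.filter_insert, if_neg (not_le.2 (ha k hk))]

-- The group is a product of symmetric groups, one for each colour, and the tails of a colour have
-- the sizes from `1` up to the number of its variables.
open Classical in
theorem prod_tailColour (i : Fin n → I) :
    ∏ k, (tailColour i k).card = Fintype.card (colPerm i) := by
  have h1 : Fintype.card (colPerm i) = Fintype.card {g : Equiv.Perm (Fin n) // i ∘ g = i} :=
    Fintype.card_congr (Equiv.subtypeEquivRight fun g => by
      rw [mem_colPerm, funext_iff]; rfl)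
  rw [h1, DomMulAct.stabilizer_card', ← Finset.prod_fiberwise_of_maps_to
    (g := i) (t := Finset.univ.image i) fun k _ => Finset.mem_image_of_mem i (Finset.mem_univ k)]
  refine Finset.prod_congr rfl fun b _ => ?_
  rw [Fintype.card_subtype, ← prod_card_filter_le]
  refine Finset.prod_congr rfl fun k hk => ?_
  rw [tailColour, (Finset.mem_filter.1 hk).2, colour]

/-- The action of permutations on rational functions. -/
@[reducible] def ratAction : MulSemiringAction (Equiv.Perm (Fin n)) (Rat R n) where
  smul w z := permRat w z
  one_smul z := by change permRat 1 z = z; simp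
  mul_smul v w z := permRat_mul_apply v w z
  smul_zero w := map_zero (permRat w)
  smul_add w := map_add (permRat w)
  smul_one w := map_one (permRat w)
  smul_mul w := map_mul (permRat w)

/-- The indices of the basis of the polynomials over the symmetric ones. -/
abbrev ColIdx (i : Fin n → I) : Type := (k : Fin n) → Fin (tailColour i k).card

/-- The basis of the polynomials over the symmetric ones. -/
def colMon (i : Fin n → I) (m : ColIdx i) : MvPolynomial (Fin n) R := ∏ k, X k ^ (m k : ℕ)

/-- The index of the constant polynomial. -/
def colZero (i : Fin n → I) : ColIdx i := fun k => ⟨0, tailColour_card_pos i k⟩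

theorem colMon_zero (i : Fin n → I) : (colMon i (colZero i) : MvPolynomial (Fin n) R) = 1 := by
  simp [colMon, colZero]

theorem stage_zero (i : Fin n → I) : stage R i 0 = Algebra.adjoin R (elemSymm R i) := by
  rw [stage]
  congr 1
  simp

theorem exists_colMon (i : Fin n → I) (f : MvPolynomial (Fin n) R) :
    ∃ c : ColIdx i → MvPolynomial (Fin n) R,
      (∀ m, c m ∈ Algebra.adjoin R (elemSymm R i)) ∧ f = ∑ m, c m * colMon i m := by
  have htop : f ∈ stage R i n := by
    have h : (⊤ : Subalgebra R (MvPolynomial (Fin n) R)) ≤ stage R i n := by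
      rw [← adjoin_range_X]
      refine Algebra.adjoin_mono ?_
      rintro _ ⟨l, rfl⟩
      exact Or.inr ⟨l, l.2, rfl⟩
    exact h trivial
  have h1 := stage_le_span i n le_rfl htop
  have h2 : boundedMonomials R i n ⊆ Set.range (colMon i) := by
    rintro _ ⟨m, hm, -, rfl⟩
    exact ⟨fun k => ⟨m k, hm k⟩, rfl⟩
  obtain ⟨c, hc⟩ := (Submodule.mem_span_range_iff_exists_fun _).1 (Submodule.span_mono h2 h1)
  refine ⟨fun m => c m, fun m => by rw [← stage_zero]; exact (c m).2, ?_⟩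
  rw [← hc]; rfl

/-- By Artin's theorem the degree of the rational functions over the fixed field is the order of the
group, which is the number of these monomials. They span over the fixed field, hence they are
linearly independent. -/
theorem colMon_unique (i : Fin n → I) {c c' : ColIdx i → MvPolynomial (Fin n) R}
    (hc : ∀ m, c m ∈ colSymm R i) (hc' : ∀ m, c' m ∈ colSymm R i)
    (h : ∑ m, c m * colMon i m = ∑ m, c' m * colMon i m) : c = c' := by
  classical
  let _ : MulSemiringAction (Equiv.Perm (Fin n)) (Rat R n) := ratAction
  have hsmul : ∀ (w : colPerm i) (z : Rat R n), w • z = permRat w.1 z := fun _ _ => rfl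
  have : FaithfulSMul (colPerm i) (Rat R n) := ⟨fun {v w} hvw => by
    refine Subtype.ext (Equiv.ext fun k => ?_)
    have := hvw (yy k)
    rw [hsmul, hsmul, permRat_yy, permRat_yy] at this
    exact yy_inj.1 this⟩
  let F := FixedPoints.subfield (colPerm i) (Rat R n)
  have hF : ∀ {f : MvPolynomial (Fin n) R}, f ∈ colSymm R i → toRat f ∈ F := by
    intro f hf w
    rw [hsmul, permRat_toRat, hf _ w.2]
  have hspan : (⊤ : Submodule F (Rat R n)) ≤
      Submodule.span F (Set.range fun m : ColIdx i => toRat (R := R) (colMon i m)) := by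
    intro z _
    obtain ⟨f, g, hg, rfl⟩ := Rat.exists_div z
    -- The norm of the denominator is symmetric. Extending the fraction by the other conjugates
    -- moves the denominator into the fixed field, and the new numerator is expanded in monomials.
    let N : MvPolynomial (Fin n) R := ∏ w : colPerm i, rename w.1 g
    have hN : N ∈ colSymm R i := by
      intro v hv
      rw [map_prod]
      refine Fintype.prod_equiv (Equiv.mulLeft (⟨v, hv⟩ : colPerm i)) _ _ fun w => ?_
      rw [rename_rename]; rfl
    have hN0 : N ≠ 0 := Finset.prod_ne_zero_iff.2 fun w _ => by
      rw [Ne, ← map_zero (rename (R := R) w.1), (rename_injective _ w.1.injective).eq_iff]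
      exact hg
    obtain ⟨c, hc, hf⟩ := exists_colMon i (f * ∏ w ∈ Finset.univ.erase (1 : colPerm i),
      rename w.1 g)
    have hcF : ∀ m, toRat (c m) ∈ F := fun m =>
      hF (Algebra.adjoin_le (elemSymm_subset i) (hc m))
    have e : toRat f / toRat g = ∑ m, ((⟨toRat (c m), hcF m⟩ / ⟨toRat N, hF hN⟩ : F) •
        toRat (R := R) (colMon i m)) := by
      have hg' : toRat (R := R) g ≠ 0 := fun h0 => hg (toRat_injective (by rw [h0, map_zero]))
      have hN' : toRat (R := R) N ≠ 0 := fun h0 => hN0 (toRat_injective (by rw [h0, map_zero]))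
      have hNg : N = g * ∏ w ∈ Finset.univ.erase (1 : colPerm i), rename w.1 g := by
        change ∏ w : colPerm i, rename w.1 g = _
        rw [← Finset.mul_prod_erase _ _ (Finset.mem_univ (1 : colPerm i))]
        simp
      have e1 : ∀ m, ((⟨toRat (c m), hcF m⟩ / ⟨toRat N, hF hN⟩ : F) •
          toRat (R := R) (colMon i m)) = toRat (c m * colMon i m) / toRat N := by
        intro m
        rw [map_mul]
        change toRat (c m) / toRat N * toRat (colMon i m) = _
        ring
      rw [Finset.sum_congr rfl fun m _ => e1 m, ← Finset.sum_div, ← map_sum, ← hf, map_mul,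
        div_eq_div_iff hg' hN', hNg, map_mul]
      ring
    rw [e]
    exact Submodule.sum_mem _ fun m _ => Submodule.smul_mem _ _ (Submodule.subset_span ⟨m, rfl⟩)
  have hli := linearIndependent_of_top_le_span_of_card_le_finrank hspan (by
    rw [FixedPoints.finrank_eq_card (colPerm i) (Rat R n), ← prod_tailColour i,
      Fintype.card_pi]
    simp)
  rw [Fintype.linearIndependent_iff] at hli
  funext m
  have h3 := hli (fun m => (⟨toRat (c m - c' m), hF (sub_mem (hc m) (hc' m))⟩ : F)) (by
    have : ∑ m, toRat (R := R) ((c m - c' m) * colMon i m) = 0 := by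
      rw [← map_sum, ← map_zero toRat]
      congr 1
      simp only [sub_mul, Finset.sum_sub_distrib, h, sub_self]
    rw [← this]
    refine Finset.sum_congr rfl fun m _ => ?_
    rw [map_mul]; rfl) m
  have h4 : toRat (R := R) (c m - c' m) = 0 := congrArg Subtype.val h3
  rw [← map_zero toRat, toRat_inj, sub_eq_zero] at h4
  exact h4

/-- The fundamental theorem on symmetric polynomials. -/
theorem colSymm_eq_adjoin (i : Fin n → I) :
    colSymm R i = Algebra.adjoin R (elemSymm R i) := by
  classical
  refine le_antisymm (fun f hf => ?_) (Algebra.adjoin_le (elemSymm_subset i))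
  obtain ⟨c, hc, h⟩ := exists_colMon i f
  -- Two expansions of `f` with symmetric coefficients: `f` times the monomial `1`, and one with
  -- coefficients in the subalgebra. By uniqueness `f` is the constant coefficient of the latter.
  have hz : ∑ m, (Pi.single (colZero i) f : ColIdx i → MvPolynomial (Fin n) R) m * colMon i m = f := by
    rw [Finset.sum_eq_single (colZero i)]
    · rw [Pi.single_eq_same, colMon_zero, mul_one]
    · intro m _ hm
      rw [Pi.single_eq_of_ne hm, zero_mul]
    · exact fun h => absurd (Finset.mem_univ _) h
  have := colMon_unique i (fun m => ?_) (fun m => Algebra.adjoin_le (elemSymm_subset i) (hc m))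
    (hz.trans h)
  · rw [← Pi.single_eq_same (M := fun _ => MvPolynomial (Fin n) R) (colZero i) f, this]
    exact hc _
  · by_cases hm : m = colZero i
    · rw [hm, Pi.single_eq_same]; exact hf
    · rw [Pi.single_eq_of_ne hm]; exact zero_mem _

theorem exists_colMon' (i : Fin n → I) (f : MvPolynomial (Fin n) R) :
    ∃ c : ColIdx i → MvPolynomial (Fin n) R,
      (∀ m, c m ∈ colSymm R i) ∧ f = ∑ m, c m * colMon i m := by
  rw [colSymm_eq_adjoin]
  exact exists_colMon i f

/-- There is a linear projection from polynomials onto symmetric polynomials. -/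
theorem exists_retraction (i : Fin n → I) :
    ∃ r : MvPolynomial (Fin n) R →ₗ[R] colSymm R i, ∀ f : colSymm R i, r f = f := by
  classical
  choose c hc h using exists_colMon' (R := R) i
  -- The projection takes the coefficient of the monomial `1`, and it is linear because coefficients
  -- are unique.
  refine ⟨{ toFun := fun f => ⟨c f (colZero i), hc f _⟩, map_add' := fun f g => ?_,
            map_smul' := fun a f => ?_ }, fun f => ?_⟩
  · refine Subtype.ext ?_
    have := colMon_unique i (hc (f + g)) (c' := c f + c g)
      (fun m => add_mem (hc f m) (hc g m)) (by
        simp only [Pi.add_apply, add_mul, Finset.sum_add_distrib, ← h])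
    exact congrFun this _
  · refine Subtype.ext ?_
    have := colMon_unique i (hc (a • f)) (c' := a • c f)
      (fun m => Subalgebra.smul_mem _ (hc f m) a) (by
        simp only [Pi.smul_apply, smul_mul_assoc, ← Finset.smul_sum, ← h])
    exact congrFun this _
  · refine Subtype.ext ?_
    have := colMon_unique i (hc f.1) (c' := Pi.single (colZero i) f.1) (fun m => ?_) (by
      rw [← h, Finset.sum_eq_single (colZero i)]
      · rw [Pi.single_eq_same, colMon_zero, mul_one]
      · intro m _ hm
        rw [Pi.single_eq_of_ne hm, zero_mul]
      · exact fun h => absurd (Finset.mem_univ _) h)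
    · change c f.1 (colZero i) = f.1
      rw [this, Pi.single_eq_same]
    · by_cases hm : m = colZero i
      · rw [hm, Pi.single_eq_same]; exact f.2
      · rw [Pi.single_eq_of_ne hm]; exact zero_mem _

end

end WKLRW

end

/-! ### The tensor product of symmetric polynomials as a ring of polynomials on the strings -/

noncomputable section


namespace WKLRW

open MvPolynomial

/-- Symmetric polynomials do not depend on the numbering of the variables. -/
theorem rename_eq_of_range_eq {R σ τ : Type*} [CommRing R] [Finite τ] {f : MvPolynomial τ R}
    (hf : f.IsSymmetric) {g h : τ → σ} (hg : Function.Injective g) (hh : Function.Injective h)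
    (hr : Set.range g = Set.range h) : rename g f = rename h f := by
  let e : Equiv.Perm τ := (Equiv.ofInjective g hg).trans
    ((Equiv.setCongr hr).trans (Equiv.ofInjective h hh).symm)
  have he : h ∘ e = g := by
    funext k
    have := Equiv.apply_ofInjective_symm hh (Equiv.setCongr hr (Equiv.ofInjective g hg k))
    exact this
  conv_rhs => rw [← hf e, rename_rename, he]

theorem IsHomogeneous.rename_weighted {R σ τ : Type*} [CommRing R] {f : MvPolynomial τ R} {m : ℕ}
    (hf : f.IsHomogeneous m) (g : τ → σ) (w : σ → ℤ) (c : ℤ) (hw : ∀ k, w (g k) = c) :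
    (rename g f).IsWeightedHomogeneous w (c * m) := by
  rw [f.as_sum, map_sum]
  refine IsWeightedHomogeneous.sum _ _ _ fun d hd => ?_
  rw [rename_monomial]
  refine isWeightedHomogeneous_monomial _ _ _ ?_
  have h1 := hf (mem_support_iff.1 hd)
  rw [← h1, Finsupp.weight_apply, Finsupp.weight_apply, Finsupp.sum_mapDomain_index (by simp)
    (by intros; rw [add_smul]), Finsupp.sum, Finsupp.sum]
  simp only [hw, Pi.one_apply, smul_eq_mul, mul_one, nsmul_eq_mul]
  push_cast
  rw [Finset.mul_sum]
  exact Finset.sum_congr rfl fun _ _ => mul_comm _ _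

namespace Datum

variable {R I : Type*} [CommRing R] {D : Datum R I}

theorem enum_injective (i : D.ResSeq) (b : I) : Function.Injective (D.enum i b) :=
  RelEmbedding.injective _

theorem range_enum (i : D.ResSeq) (b : I) : Set.range (D.enum i b) = {k | i.1 k = b} := by
  classical
  ext k
  simp [enum]

theorem res_enum (i : D.ResSeq) (b : I) (j : Fin (D.β b)) : i.1 (D.enum i b j) = b := by
  have : D.enum i b j ∈ Set.range (D.enum i b) := ⟨j, rfl⟩
  rwa [range_enum] at this

theorem toPoly_tprod (i : D.ResSeq)
    (f : (b : D.β.support) → MvPolynomial.symmetricSubalgebra (Fin (D.β b)) R) :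
    D.toPoly i (PiTensorProduct.tprod R f) = ∏ b : D.β.support, rename (D.enum i b) (f b).1 := by
  simp [toPoly]

/-- The polynomials on the strings, for tensors of polynomials that need not be symmetric. -/
def tensorPoly (i : D.ResSeq) :
    (PiTensorProduct R fun b : D.β.support => MvPolynomial (Fin (D.β b)) R) →ₗ[R]
      MvPolynomial (Fin D.n) R :=
  PiTensorProduct.lift ((MultilinearMap.mkPiAlgebra R D.β.support
    (MvPolynomial (Fin D.n) R)).compLinearMap fun b => (rename (D.enum i b)).toLinearMap)

/-- The strings of different residues are disjoint, so tensors of monomials go to different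
monomials, which are linearly independent. -/
theorem tensorPoly_injective (i : D.ResSeq) :
    Function.Injective (tensorPoly i : _ →ₗ[R] MvPolynomial (Fin D.n) R) := by
  classical
  let B := Basis.piTensorProduct fun b : D.β.support => basisMonomials (Fin (D.β b)) R
  let p' : ((b : D.β.support) → (Fin (D.β b) →₀ ℕ)) → (Fin D.n →₀ ℕ) := fun p =>
    ∑ b, (p b).mapDomain (D.enum i b)
  have hB : ∀ p, tensorPoly i (B p) = basisMonomials (Fin D.n) R (p' p) := by
    intro p
    rw [Basis.piTensorProduct_apply, tensorPoly, PiTensorProduct.lift.tprod]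
    simp only [MultilinearMap.compLinearMap_apply, MultilinearMap.mkPiAlgebra_apply,
      AlgHom.toLinearMap_apply, coe_basisMonomials, rename_monomial, p']
    rw [monomial_sum_one]
  have hp' : Function.Injective p' := by
    intro p q h
    funext b
    ext j
    have key : ∀ p : (b : D.β.support) → (Fin (D.β b) →₀ ℕ), p' p (D.enum i b j) = p b j := by
      intro p
      rw [Finsupp.finsetSum_apply, Finset.sum_eq_single b]
      · exact Finsupp.mapDomain_apply (enum_injective i b) _ _
      · intro b' _ hb'
        refine Finsupp.mapDomain_of_notMem_range _ _ ?_
        rw [range_enum]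
        intro h1
        exact hb' (Subtype.ext (h1.symm.trans (res_enum i b j)))
      · exact fun h => absurd (Finset.mem_univ _) h
    rw [← key p, ← key q, h]
  have hli : LinearIndependent R fun p => tensorPoly i (B p) := by
    rw [funext hB]
    exact (basisMonomials (Fin D.n) R).linearIndependent.comp _ hp'
  intro x y hxy
  have e : ∀ x, tensorPoly i x = Finsupp.linearCombination R (fun p => tensorPoly i (B p))
      (B.repr x) := by
    intro x
    conv_lhs => rw [← B.linearCombination_repr x, Finsupp.apply_linearCombination]
    rfl
  rw [e, e] at hxy
  exact B.repr.injective (hli hxy)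

/-- The polynomials on the strings of different residue sequences. -/
theorem rename_toPoly {i j : D.ResSeq} {w : Equiv.Perm (Fin D.n)} (h : ∀ k, j.1 (w k) = i.1 k)
    (f : D.SymTensor) : rename w (D.toPoly i f) = D.toPoly j f := by
  have : ((rename w).comp (D.toPoly i)).toLinearMap = (D.toPoly j).toLinearMap := by
    refine PiTensorProduct.ext (MultilinearMap.ext fun f => ?_)
    simp only [LinearMap.compMultilinearMap_apply, AlgHom.toLinearMap_apply, AlgHom.comp_apply,
      toPoly_tprod, map_prod, rename_rename]
    refine Finset.prod_congr rfl fun b _ => ?_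
    refine rename_eq_of_range_eq (f b).2 (w.injective.comp (enum_injective i b))
      (enum_injective j b) ?_
    rw [Set.range_comp, range_enum, range_enum]
    ext k
    rw [Equiv.image_eq_preimage_symm]
    have := h (w.symm k)
    rw [Equiv.apply_symm_apply] at this
    simp [this]
  exact LinearMap.congr_fun this f

theorem toPoly_mem (i : D.ResSeq) (f : D.SymTensor) : D.toPoly i f ∈ colSymm R i.1 :=
  fun _ hw => rename_toPoly hw f

theorem toPoly_isWeightedHomogeneous (i : D.ResSeq) {δ : ℤ} {f : D.SymTensor}
    (hf : f ∈ D.symDeg δ) : (D.toPoly i f).IsWeightedHomogeneous (wt i.1) δ := by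
  have : D.symDeg δ ≤ (weightedHomogeneousSubmodule R (wt i.1) δ).comap
      (D.toPoly i).toLinearMap := by
    refine Submodule.span_le.2 ?_
    rintro _ ⟨f, m, hm, rfl, rfl⟩
    change (D.toPoly i _).IsWeightedHomogeneous _ _
    rw [toPoly_tprod]
    refine IsWeightedHomogeneous.prod _ _ _ fun b _ => ?_
    exact IsHomogeneous.rename_weighted (hm b) _ _ _ fun k => by rw [wt, res_enum]
  exact this hf

/-- The homogeneous components of a symmetric polynomial are symmetric; a pure tensor is expanded
multilinearly into these. -/
theorem iSup_symDeg : ⨆ δ, D.symDeg δ = ⊤ := by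
  classical
  rw [eq_top_iff, ← PiTensorProduct.span_tprod_eq_top, Submodule.span_le]
  rintro _ ⟨f, rfl⟩
  let g : (b : D.β.support) → ℕ → symmetricSubalgebra (Fin (D.β b)) R := fun b m =>
    ⟨homogeneousComponent m (f b).1, fun e => by
      rw [rename_homogeneousComponent, (f b).2 e]⟩
  have hg : f = fun b => ∑ m ∈ Finset.range ((f b).1.totalDegree + 1), g b m := by
    funext b
    refine Subtype.ext ?_
    rw [AddSubmonoidClass.coe_finsetSum]
    exact (sum_homogeneousComponent _).symm
  rw [hg, MultilinearMap.map_sum_finset]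
  refine Submodule.sum_mem _ fun m _ => ?_
  exact Submodule.mem_iSup_of_mem _ (Submodule.subset_span
    ⟨fun b => g b (m b), m, fun b => homogeneousComponent_isHomogeneous _ _, rfl, rfl⟩)

variable [IsDomain R]

theorem exists_retraction_symmetric (m : ℕ) :
    ∃ r : MvPolynomial (Fin m) R →ₗ[R] symmetricSubalgebra (Fin m) R,
      ∀ f : symmetricSubalgebra (Fin m) R, r f.1 = f := by
  have h : colSymm R (fun _ : Fin m => ()) = symmetricSubalgebra (Fin m) R := by
    ext f
    exact ⟨fun h w => h w fun _ => rfl, fun h w _ => h w⟩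
  obtain ⟨r, hr⟩ := exists_retraction (R := R) fun _ : Fin m => ()
  refine ⟨(Subalgebra.inclusion h.le).toLinearMap ∘ₗ r, fun f => Subtype.ext ?_⟩
  exact congrArg (fun g : colSymm R (fun _ : Fin m => ()) => g.1) (hr ⟨f.1, h.symm.le f.2⟩)

/-- Tensor products over `R` need not preserve injectivity of arbitrary maps, but the inclusions of
the symmetric polynomials are split by `exists_retraction_symmetric`, and the tensor product of the
splittings is a left inverse. -/
theorem toPoly_injective (i : D.ResSeq) : Function.Injective (D.toPoly i) := by
  choose r hr using exists_retraction_symmetric (R := R)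
  have e : ∀ f, D.toPoly i f = tensorPoly i (PiTensorProduct.map
      (fun b : D.β.support => (symmetricSubalgebra (Fin (D.β b)) R).val.toLinearMap) f) := by
    intro f
    have : (D.toPoly i).toLinearMap = tensorPoly i ∘ₗ PiTensorProduct.map
      (fun b : D.β.support => (symmetricSubalgebra (Fin (D.β b)) R).val.toLinearMap) := by
      refine PiTensorProduct.ext (MultilinearMap.ext fun f => ?_)
      simp [toPoly_tprod, tensorPoly]
    exact LinearMap.congr_fun this f
  have hinj : Function.Injective (PiTensorProduct.map
      (fun b : D.β.support => (symmetricSubalgebra (Fin (D.β b)) R).val.toLinearMap)) := by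
    refine Function.LeftInverse.injective (g := PiTensorProduct.map fun b : D.β.support =>
      r (D.β b)) fun f => ?_
    rw [← LinearMap.comp_apply, ← PiTensorProduct.map_comp]
    have : (fun b : D.β.support => r (D.β b) ∘ₗ
        (symmetricSubalgebra (Fin (D.β b)) R).val.toLinearMap) = fun b => LinearMap.id := by
      funext b
      exact LinearMap.ext fun f => hr _ f
    rw [this, PiTensorProduct.map_id, LinearMap.id_apply]
  intro f g h
  rw [e, e] at h
  exact hinj (tensorPoly_injective i h)

/-- By the fundamental theorem it suffices to reach the elementary symmetric polynomials of one
colour, which are tensors with a single factor different from `1`. -/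
theorem exists_toPoly (i : D.ResSeq) {f : MvPolynomial (Fin D.n) R} (hf : f ∈ colSymm R i.1) :
    ∃ F : D.SymTensor, D.toPoly i F = f := by
  classical
  rw [colSymm_eq_adjoin] at hf
  have : Algebra.adjoin R (elemSymm R i.1) ≤ (D.toPoly i).range := by
    refine Algebra.adjoin_le ?_
    rintro _ ⟨b, m, rfl⟩
    by_cases hb : b ∈ D.β.support
    · let b₀ : D.β.support := ⟨b, hb⟩
      have hs : ((rootPoly Finset.univ : Polynomial (MvPolynomial (Fin (D.β b₀)) R)).coeff m)
          ∈ symmetricSubalgebra (Fin (D.β b₀)) R := fun e => by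
        have := coeff_rootPoly_map (R := R) (Finset.univ : Finset (Fin (D.β b₀))) e.toEmbedding m
        rwa [Finset.map_univ_equiv] at this
      refine ⟨PiTensorProduct.tprod R (Pi.mulSingle b₀ ⟨_, hs⟩), ?_⟩
      change D.toPoly i _ = _
      rw [toPoly_tprod, Finset.prod_eq_single b₀]
      · rw [Pi.mulSingle_eq_same]
        have := coeff_rootPoly_map (R := R) (Finset.univ : Finset (Fin (D.β b₀)))
          ⟨D.enum i b₀, enum_injective i b₀⟩ m
        refine this.trans ?_
        congr 2
        ext k
        rw [mem_colour]
        have := Set.ext_iff.1 (range_enum i b) k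
        simpa using this
      · intro b' _ hb'
        rw [Pi.mulSingle_eq_of_ne hb']
        simp
      · exact fun h => absurd (Finset.mem_univ _) h
    -- A residue outside of the support has no variables; its polynomial is `1`, with the
    -- coefficients `0` and `1`.
    · have : colour i.1 b = ∅ := by
        refine Finset.eq_empty_of_forall_notMem fun k hk => ?_
        rw [mem_colour] at hk
        exact hb (by rw [← hk]; exact Finsupp.mem_support_iff.2 (i.β_ne_zero k))
      rw [this, rootPoly, Finset.prod_empty, Polynomial.coeff_one]
      split_ifs
      · exact one_mem _
      · exact zero_mem _
  exact this hf

end Datum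

end WKLRW

end

noncomputable section


namespace WKLRW

namespace Datum

open MvPolynomial

variable {R I : Type*} [CommRing R] {D : Datum R I}

/-! ### Residue sequences -/

/-- The positions in a residue sequence, sorted by residues. -/
def enumEquiv (i : D.ResSeq) : (Σ b : D.β.support, Fin (D.β b)) ≃ Fin D.n :=
  Equiv.ofBijective (fun p => D.enum i p.1 p.2) <| by
    constructor
    · rintro ⟨⟨b, hb⟩, k⟩ ⟨⟨b', hb'⟩, k'⟩ h
      have e : b = b' := by
        rw [← res_enum i b k, ← res_enum i b' k']
        exact congrArg i.1 h
      subst e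
      have h' : k = k' := enum_injective i b h
      rw [h']
    · intro k
      have hk : k ∈ Set.range (D.enum i (i.1 k)) := by rw [range_enum]; rfl
      obtain ⟨j, hj⟩ := hk
      exact ⟨⟨⟨i.1 k, Finsupp.mem_support_iff.2 (i.β_ne_zero k)⟩, j⟩, hj⟩

theorem res_enumEquiv (i : D.ResSeq) (p : Σ b : D.β.support, Fin (D.β b)) :
    i.1 (enumEquiv i p) = p.1 := res_enum i _ _

/-- Two residue sequences differ by a permutation. -/
theorem exists_perm (i j : D.ResSeq) : ∃ w : Equiv.Perm (Fin D.n), ∀ k, j.1 (w k) = i.1 k :=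
  ⟨(enumEquiv i).symm.trans (enumEquiv j), fun k => by
    rw [Equiv.trans_apply, res_enumEquiv, ← res_enumEquiv i, Equiv.apply_symm_apply]⟩

/-- The height of `β` is `n`, so the strings can be labelled by any bijection with the pairs of a
residue and one of its copies. -/
theorem nonempty_resSeq (D : Datum R I) : Nonempty D.ResSeq := by
  have hc : Fintype.card (Σ b : D.β.support, Fin (D.β b)) = Fintype.card (Fin D.n) := by
    rw [Fintype.card_sigma, Fintype.card_fin]
    simp only [Fintype.card_fin]
    rw [← D.height, Finsupp.degree_apply, Finset.univ_eq_attach,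
      Finset.sum_attach D.β.support fun b => D.β b]
  let e := Fintype.equivOfCardEq hc
  refine ⟨⟨fun k => (e.symm k).1, ?_⟩⟩
  rw [Equiv.sum_comp e.symm fun p : (Σ b : D.β.support, Fin (D.β b)) =>
    Finsupp.single (p.1 : I) 1, Fintype.sum_sigma]
  simp only [Finset.sum_const, Finset.card_univ, Fintype.card_fin, Finsupp.smul_single,
    smul_eq_mul, mul_one]
  rw [Finset.univ_eq_attach, Finset.sum_attach D.β.support fun b => Finsupp.single b (D.β b)]
  exact Finsupp.sum_single D.β

/-! ### The slices of the weighted KLRW algebra -/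

section

variable [IsDomain R] {X : Finset D.Loading}

/-- The indices of the idempotent diagrams. -/
abbrev Idx (X : Finset D.Loading) : Type _ := {x // x ∈ X} × D.ResSeq

/-- The slice of an idempotent diagram. -/
def Idx.sl (a : Idx X) : D.Slice := a.1.1.slice a.2

theorem Idx.sl_injective : Function.Injective (Idx.sl : Idx X → D.Slice) := by
  rintro ⟨⟨x, hx⟩, i⟩ ⟨⟨y, hy⟩, j⟩ h
  have h1 : x = y := Subtype.ext (congrArg Slice.pos h)
  have h2 : i = j := congrArg Slice.res h
  subst h1 h2
  rfl

theorem sum_idx {M : Type*} [AddCommMonoid M] (f : D.Loading → D.ResSeq → M) :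
    ∑ x ∈ X, ∑ i, f x i = ∑ a : Idx X, f a.1.1 a.2 := by
  rw [Fintype.sum_prod_type, ← Finset.sum_attach X]
  rfl

theorem unit_eq : D.unit X = ∑ a : Idx X, ee a.sl :=
  sum_idx fun x i => D.cls (D.idem (x.slice i))

theorem ee_mul_sum (a : Idx X) (f : Idx X → D.Big) (hf : ∀ b, ee b.sl * f b = f b) :
    ee a.sl * ∑ b, f b = f a := by
  rw [Finset.mul_sum, Finset.sum_eq_single a]
  · exact hf a
  · intro b _ hb
    rw [← hf b, ← mul_assoc, ee_mul_of_ne fun h => hb (Idx.sl_injective h).symm, zero_mul]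
  · exact fun h => absurd (Finset.mem_univ _) h

theorem sum_mul_ee (a : Idx X) (f : Idx X → D.Big) (hf : ∀ b, f b * ee b.sl = f b) :
    (∑ b, f b) * ee a.sl = f a := by
  rw [Finset.sum_mul, Finset.sum_eq_single a]
  · exact hf a
  · intro b _ hb
    rw [← hf b, mul_assoc, ee_mul_of_ne fun h => hb (Idx.sl_injective h), mul_zero]
  · exact fun h => absurd (Finset.mem_univ _) h

theorem ee_unit (a : Idx X) : ee a.sl * D.unit X = ee a.sl := by
  rw [unit_eq]
  exact ee_mul_sum a _ fun b => ee_mul_ee _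

theorem unit_ee (a : Idx X) : D.unit X * ee a.sl = ee a.sl := by
  rw [unit_eq]
  exact sum_mul_ee a _ fun b => ee_mul_ee _

/-- A diagram between slices with positions in `X`, as an element of the weighted KLRW algebra. -/
theorem toW_val_of {a b : Idx X} {v : D.Big} (h1 : ee b.sl * v = v) (h2 : v * ee a.sl = v) :
    (D.toW X v).val = v := by
  rw [toW_val, ← h1, ← mul_assoc, unit_ee, h1, ← h2, mul_assoc, ee_unit]

theorem W.val_sum {ι : Type*} (s : Finset ι) (f : ι → D.W X) :
    (∑ k ∈ s, f k).val = ∑ k ∈ s, (f k).val := map_sum (W.valL X) f s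

theorem W.val_eq_sum (v : D.W X) :
    v.val = ∑ b : Idx X, ∑ a : Idx X, ee b.sl * v.val * ee a.sl := by
  conv_lhs => rw [← v.mul_unit, ← v.unit_mul, unit_eq, Finset.sum_mul, Finset.sum_mul]
  refine Finset.sum_congr rfl fun b _ => ?_
  rw [Finset.mul_sum]

theorem polyOne_val (f : D.SymTensor) :
    (D.polyOne X f).val = ∑ a : Idx X, pB a.sl (D.toPoly a.2 f) := by
  rw [polyOne, toW_val, sum_idx (X := X) fun x i => D.cls (D.poly (x.slice i) (D.toPoly i f))]
  simp only [cls_poly]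
  rw [Finset.mul_sum, Finset.sum_mul]
  refine Finset.sum_congr rfl fun a _ => ?_
  change D.unit X * pB a.sl _ * D.unit X = _
  rw [← ee_pB, ← mul_assoc, unit_ee, mul_assoc, ← pB_ee, mul_assoc, ee_unit, pB_ee, ee_pB]

theorem ee_mul_polyOne (a : Idx X) (f : D.SymTensor) :
    ee a.sl * (D.polyOne X f).val = pB a.sl (D.toPoly a.2 f) := by
  rw [polyOne_val]
  exact ee_mul_sum a (fun a => pB a.sl (D.toPoly a.2 f)) fun b => ee_pB _ _

theorem polyOne_mul_ee (a : Idx X) (f : D.SymTensor) :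
    (D.polyOne X f).val * ee a.sl = pB a.sl (D.toPoly a.2 f) := by
  rw [polyOne_val]
  exact sum_mul_ee a (fun a => pB a.sl (D.toPoly a.2 f)) fun b => pB_ee _ _

/-- `f ↦ f · 1` as a homomorphism. -/
def polyHom (X : Finset D.Loading) : D.SymTensor →ₐ[R] D.W X :=
  AlgHom.ofLinearMap
    { toFun := D.polyOne X
      map_add' := fun f g => W.val_injective (by
        simp only [W.val_add, polyOne_val, map_add, Finset.sum_add_distrib])
      map_smul' := fun c f => W.val_injective (by
        simp only [W.val_smul, polyOne_val, map_smul, RingHom.id_apply, Finset.smul_sum]) }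
    (W.val_injective (by
      change (D.polyOne X 1).val = _
      simp only [polyOne_val, map_one, pB_one]
      exact unit_eq.symm))
    (fun f g => W.val_injective (by
      change (D.polyOne X (f * g)).val = (D.polyOne X f).val * (D.polyOne X g).val
      rw [polyOne_val (f * g), polyOne_val g, Finset.mul_sum]
      refine Finset.sum_congr rfl fun a _ => ?_
      rw [← ee_pB a.sl (D.toPoly a.2 g), ← mul_assoc, polyOne_mul_ee, pB_mul, map_mul]))

/-- Symmetric polynomials commute with diagrams without dots. -/
theorem polyOne_mul_diag {a b : Idx X} (w : Conn a.sl b.sl) (f : D.SymTensor) :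
    (D.polyOne X f).val * w.diag = w.diag * pB a.sl (D.toPoly a.2 f) := by
  rw [← w.ee_diag, ← mul_assoc, polyOne_mul_ee, w.ee_diag]
  exact pB_mul_diag w fun v => (rename_toPoly v.2 f).symm

theorem polyOne_mul_diag_pB {a b : Idx X} (w : Conn a.sl b.sl) (f : D.SymTensor)
    (g : MvPolynomial (Fin D.n) R) : (D.polyOne X f).val * (w.diag * pB a.sl g) =
      w.diag * pB a.sl (D.toPoly a.2 f * g) := by
  rw [← mul_assoc, polyOne_mul_diag, mul_assoc, pB_mul]

/-- By the spanning set it suffices to move the polynomial through a diagram without dots, which is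
`polyOne_mul_diag`. Polynomials in the dots commute. -/
theorem polyOne_mem_center (f : D.SymTensor) : D.polyOne X f ∈ Subalgebra.center R (D.W X) := by
  rw [Subalgebra.mem_center_iff]
  intro v
  refine W.val_injective ?_
  rw [W.val_mul, W.val_mul, v.val_eq_sum, Finset.sum_mul, Finset.mul_sum]
  refine Finset.sum_congr rfl fun b _ => ?_
  rw [Finset.sum_mul, Finset.mul_sum]
  refine Finset.sum_congr rfl fun a _ => ?_
  obtain ⟨g, hg⟩ := exists_lc a.sl b.sl v.val
  have e : ee b.sl * v.val * ee a.sl * (D.polyOne X f).val =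
      ee b.sl * v.val * ee a.sl * pB a.sl (D.toPoly a.2 f) := by
    rw [mul_assoc _ (ee a.sl), ee_mul_polyOne, mul_assoc _ (ee a.sl), ee_pB]
  rw [e, hg, lc_apply, Finset.sum_mul, Finset.mul_sum]
  refine Finset.sum_congr rfl fun w _ => ?_
  rw [polyOne_mul_diag_pB, mul_assoc, pB_mul, mul_comm (g w)]

theorem nonempty_idx (hX : X.Nonempty) : Nonempty (Idx X) := by
  obtain ⟨x, hx⟩ := hX
  obtain ⟨i⟩ := nonempty_resSeq D
  exact ⟨⟨⟨x, hx⟩, i⟩⟩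

/-- A single idempotent detects `f`; one exists because `X` is non-empty. -/
theorem polyOne_injective (hX : X.Nonempty) : Function.Injective (D.polyOne X) := by
  intro f g h
  obtain ⟨a⟩ := nonempty_idx hX
  have := congrArg (fun v : D.W X => ee a.sl * v.val) h
  simp only [ee_mul_polyOne] at this
  exact toPoly_injective a.2 (pB_injective _ this)

theorem commute_of_mem_center {v : D.W X} (hv : v ∈ Subalgebra.center R (D.W X)) {a b : Idx X}
    {u : D.Big} (h1 : ee b.sl * u = u) (h2 : u * ee a.sl = u) : u * v.val = v.val * u := by
  have := congrArg W.val ((Subalgebra.mem_center_iff.1 hv) (D.toW X u))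
  rwa [W.val_mul, W.val_mul, toW_val_of h1 h2] at this

/-- On every idempotent a central element is a polynomial `g a`. Diagrams from `a` to itself make it
symmetric, so it comes from a tensor `F`, and diagrams from `a` to `b` transport it to the
polynomial of the same tensor. -/
theorem exists_polyOne (hX : X.Nonempty) {v : D.W X} (hv : v ∈ Subalgebra.center R (D.W X)) :
    ∃ f, D.polyOne X f = v := by
  have hee : ∀ a : Idx X, ee a.sl * v.val * ee a.sl = v.val * ee a.sl := fun a => by
    rw [commute_of_mem_center hv (ee_mul_ee a.sl) (ee_mul_ee a.sl), mul_assoc, ee_mul_ee]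
  have hee' : ∀ a : Idx X, ee a.sl * v.val * ee a.sl = ee a.sl * v.val := fun a => by
    rw [hee, commute_of_mem_center hv (ee_mul_ee a.sl) (ee_mul_ee a.sl)]
  have hdot : ∀ a : Idx X, ∃ g, ee a.sl * v.val * ee a.sl = pB a.sl g := by
    refine fun a => exists_eq_pB fun k => ?_
    have hc := commute_of_mem_center hv (ee_dd a.sl k) (dd_ee a.sl k)
    rw [hee, ← mul_assoc, hc, mul_assoc, dd_ee, mul_assoc, ee_dd]
  choose g hg using hdot
  have hconn : ∀ (a b : Idx X) (w : Conn a.sl b.sl), g b = rename w.1 (g a) := by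
    intro a b w
    refine eq_rename_of_mul_diag w ?_
    have hc := commute_of_mem_center hv w.ee_diag w.diag_ee
    rw [← hg, ← hg, hee b, hee' a, mul_assoc, w.ee_diag, ← hc, ← mul_assoc, w.diag_ee]
  obtain ⟨a⟩ := nonempty_idx hX
  obtain ⟨F, hF⟩ := exists_toPoly a.2 (f := g a) fun w hw => (hconn a a ⟨w, hw⟩).symm
  refine ⟨F, W.val_injective ?_⟩
  rw [polyOne_val, ← v.unit_mul, unit_eq, Finset.sum_mul]
  refine Finset.sum_congr rfl fun b _ => ?_
  obtain ⟨w, hw⟩ := exists_perm a.2 b.2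
  rw [← hee', hg, hconn a b ⟨w, hw⟩, ← hF, rename_toPoly hw]

/-- The isomorphism from symmetric polynomials to the center. -/
def centerEquiv (hX : X.Nonempty) : D.SymTensor ≃ₐ[R] Subalgebra.center R (D.W X) :=
  AlgEquiv.ofBijective ((polyHom X).codRestrict _ polyOne_mem_center)
    ⟨fun _ _ h => polyOne_injective hX (congrArg Subtype.val h), fun v => by
      obtain ⟨f, hf⟩ := exists_polyOne hX v.2
      exact ⟨f, Subtype.ext hf⟩⟩

theorem centerEquiv_apply (hX : X.Nonempty) (f : D.SymTensor) :
    (centerEquiv hX f : D.W X) = D.polyOne X f := rfl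

theorem polyOne_mem_deg {δ : ℤ} {f : D.SymTensor} (h : f ∈ D.symDeg δ) :
    D.polyOne X f ∈ D.deg X δ := by
  change (D.polyOne X f).val ∈ D.bigDeg δ
  rw [polyOne_val]
  exact sum_mem fun a _ => pB_mem_bigDeg (toPoly_isWeightedHomogeneous a.2 h)

theorem polyOne_mem_deg_iff (hX : X.Nonempty) {δ : ℤ} {f : D.SymTensor} :
    f ∈ D.symDeg δ ↔ D.polyOne X f ∈ D.deg X δ := by
  classical
  refine ⟨polyOne_mem_deg, fun h => ?_⟩
  have hf : f ∈ ⨆ δ, D.symDeg δ := by rw [iSup_symDeg]; trivial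
  obtain ⟨g, hg, rfl⟩ := (Submodule.mem_iSup_iff_exists_finsupp _ _).1 hf
  have hinj : Function.Injective (polyHom X) := polyOne_injective hX
  -- Subtract the whole element `f · 1`, homogeneous of degree `δ`, from the term at `δ` of its
  -- decomposition. The sum is then zero, so `g δ · 1 = f · 1` by independence. The index `δ` is
  -- inserted because it need not be in the support.
  have h1 := (iSupIndep_iff_finsetSum_eq_zero_imp_eq_zero _).1 (iSupIndep_deg (X := X))
    (insert δ g.support) (fun ε => polyHom X (g ε) -
      if ε = δ then polyHom X (g.sum fun _ x => x) else 0) (fun ε _ => by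
        refine sub_mem (polyOne_mem_deg (hg ε)) ?_
        split_ifs with he
        · rw [he]; exact h
        · exact zero_mem _) (by
        rw [Finset.sum_sub_distrib, Finset.sum_ite_eq', if_pos (Finset.mem_insert_self _ _),
          ← map_sum, sub_eq_zero]
        rw [Finsupp.sum_of_support_subset g (Finset.subset_insert δ _) (fun _ x => x)
          fun _ _ => rfl])
    δ (Finset.mem_insert_self _ _)
  rw [if_pos rfl, sub_eq_zero] at h1
  rw [← hinj h1]
  exact hg δ

end

end Datum

end WKLRW

end

noncomputable section


namespace WKLRW

namespace Datum

open MvPolynomial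

variable {R I : Type*} [CommRing R] [IsDomain R] {D : Datum R I} {X : Finset D.Loading}

/-! ### The weighted KLRW algebra is free over its center -/

/-- The indices of the basis over the center. -/
abbrev BasisIdx (X : Finset D.Loading) : Type _ :=
  Σ b : Idx X, Σ a : Idx X, Conn a.sl b.sl × ColIdx a.2.1

/-- The basis over the center. -/
def basisElt (p : BasisIdx X) : D.W X := D.toW X (p.2.2.1.diag * pB p.2.1.sl (colMon p.2.1.2.1 p.2.2.2))

theorem basisElt_val {a b : Idx X} (w : Conn a.sl b.sl) (m : ColIdx a.2.1) :
    (basisElt ⟨b, a, w, m⟩ : D.W X).val = w.diag * pB a.sl (colMon a.2.1 m) :=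
  toW_val_of (a := a) (b := b) (by rw [← mul_assoc, w.ee_diag]) (by rw [mul_assoc, pB_ee])

/-- A central scalar moves through the diagram to its bottom, where it becomes a symmetric
coefficient of the monomial. -/
theorem sum_polyOne_mul_basisElt (F : BasisIdx X → D.SymTensor) :
    (∑ p, D.polyOne X (F p) * basisElt p).val = ∑ b : Idx X, ∑ a : Idx X,
      lc a.sl b.sl fun w => ∑ m, D.toPoly a.2 (F ⟨b, a, w, m⟩) * colMon a.2.1 m := by
  rw [W.val_sum, Fintype.sum_sigma]
  refine Finset.sum_congr rfl fun b _ => ?_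
  rw [Fintype.sum_sigma]
  refine Finset.sum_congr rfl fun a _ => ?_
  rw [Fintype.sum_prod_type, lc_apply]
  refine Finset.sum_congr rfl fun w _ => ?_
  rw [map_sum, Finset.mul_sum]
  refine Finset.sum_congr rfl fun m _ => ?_
  rw [W.val_mul, basisElt_val, polyOne_mul_diag_pB]

theorem ee_mul_lc {s t : D.Slice} (f : Conn s t → MvPolynomial (Fin D.n) R) :
    ee t * lc s t f = lc s t f := by
  rw [lc_apply, Finset.mul_sum]
  refine Finset.sum_congr rfl fun w _ => ?_
  rw [← mul_assoc, w.ee_diag]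

theorem lc_mul_ee {s t : D.Slice} (f : Conn s t → MvPolynomial (Fin D.n) R) :
    lc s t f * ee s = lc s t f := by
  rw [lc_apply, Finset.sum_mul]
  refine Finset.sum_congr rfl fun w _ => ?_
  rw [mul_assoc, pB_ee]

/-- Idempotents separate the pairs of slices, `lc_injective` the diagrams between them, and
`colMon_unique` the monomials. -/
theorem sum_polyOne_mul_basisElt_eq_zero {F : BasisIdx X → D.SymTensor}
    (h : ∑ p, D.polyOne X (F p) * basisElt p = 0) : F = 0 := by
  have h1 := congrArg W.val h
  rw [sum_polyOne_mul_basisElt, W.val_zero] at h1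
  funext ⟨b, a, w, m⟩
  have h2 : lc a.sl b.sl (fun w => ∑ m, D.toPoly a.2 (F ⟨b, a, w, m⟩) * colMon a.2.1 m) = 0 := by
    have h3 := congrArg (fun v => ee b.sl * v * ee a.sl) h1
    simp only [mul_zero, zero_mul] at h3
    rw [ee_mul_sum b (fun b => ∑ a : Idx X, lc a.sl b.sl
      fun w => ∑ m, D.toPoly a.2 (F ⟨b, a, w, m⟩) * colMon a.2.1 m) fun b => by
        rw [Finset.mul_sum]; exact Finset.sum_congr rfl fun a _ => ee_mul_lc _,
      sum_mul_ee a (fun a => lc a.sl b.sl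
        fun w => ∑ m, D.toPoly a.2 (F ⟨b, a, w, m⟩) * colMon a.2.1 m) fun a => lc_mul_ee _] at h3
    exact h3
  have h4 := congrFun (lc_injective (h2.trans (map_zero _).symm)) w
  have h5 := colMon_unique a.2.1 (c := fun m => D.toPoly a.2 (F ⟨b, a, w, m⟩)) (c' := 0)
    (fun m => toPoly_mem _ _) (fun m => zero_mem _) (by
      refine h4.trans ?_
      simp)
  exact toPoly_injective a.2 ((congrFun h5 m).trans (map_zero _).symm)

/-- Expand in diagrams with polynomial coefficients, expand these coefficients over the symmetric
polynomials, and lift the latter to tensors. -/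
theorem exists_sum_basisElt (v : D.W X) :
    ∃ F : BasisIdx X → D.SymTensor, ∑ p, D.polyOne X (F p) * basisElt p = v := by
  choose f hf using fun b a : Idx X => exists_lc a.sl b.sl v.val
  choose c hc hfc using fun (b a : Idx X) (w : Conn a.sl b.sl) => exists_colMon' a.2.1 (f b a w)
  choose F hF using fun (b a : Idx X) (w : Conn a.sl b.sl) (m : ColIdx a.2.1) =>
    exists_toPoly a.2 (hc b a w m)
  refine ⟨fun p => F p.1 p.2.1 p.2.2.1 p.2.2.2, W.val_injective ?_⟩
  rw [sum_polyOne_mul_basisElt, v.val_eq_sum]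
  refine Finset.sum_congr rfl fun b _ => Finset.sum_congr rfl fun a _ => ?_
  rw [hf b a]
  congr 1
  funext w
  rw [hfc b a w]
  exact Finset.sum_congr rfl fun m _ => by rw [hF]

/-- The basis of the weighted KLRW algebra over its center. -/
def centerBasis (hX : X.Nonempty) :
    Module.Basis (BasisIdx X) (Subalgebra.center R (D.W X)) (D.W X) := by
  refine Module.Basis.mk (v := basisElt) ?_ ?_
  · rw [Fintype.linearIndependent_iff]
    intro c hc p
    have h := sum_polyOne_mul_basisElt_eq_zero (F := fun p => (centerEquiv hX).symm (c p)) (by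
      rw [← hc]
      refine Finset.sum_congr rfl fun p _ => ?_
      rw [← centerEquiv_apply hX, AlgEquiv.apply_symm_apply]
      rfl)
    exact (map_eq_zero_iff _ (centerEquiv hX).symm.injective).1 (congrFun h p)
  · intro v _
    obtain ⟨F, rfl⟩ := exists_sum_basisElt v
    refine Submodule.sum_mem _ fun p _ => ?_
    exact Submodule.smul_mem _ (centerEquiv hX (F p)) (Submodule.subset_span ⟨p, rfl⟩)

end Datum

end WKLRW

end

theorem mainTheorem12 {R I : Type*} [CommRing R] [IsDomain R] (D : WKLRW.Datum R I)
    (X : Finset D.Loading) (hX : X.Nonempty) :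
    Nonempty (GradedAlgebra (D.deg X)) ∧
    ∃ ν : D.SymTensor ≃ₐ[R] Subalgebra.center R (D.W X),
      (∀ f, (ν f : D.W X) = D.polyOne X f) ∧
      (∀ (δ : ℤ) (f : D.SymTensor), f ∈ D.symDeg δ ↔ (ν f : D.W X) ∈ D.deg X δ) ∧
      Module.Free (Subalgebra.center R (D.W X)) (D.W X) ∧
      Module.Finite (Subalgebra.center R (D.W X)) (D.W X) := by
  refine ⟨WKLRW.Datum.nonempty_gradedAlgebra X, WKLRW.Datum.centerEquiv hX, fun f => rfl,
    fun δ f => WKLRW.Datum.polyOne_mem_deg_iff hX,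
    Module.Free.of_basis (WKLRW.Datum.centerBasis hX),
    Module.Finite.of_basis (WKLRW.Datum.centerBasis hX)⟩
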